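/- **Conventions.** Let $K$ be a field of characteristic different from $2$. Graded vector spaces are $\mathbb Z$-graded $K$-vector spaces, with degree-zero maps, the tensor product, and the symmetry $x\otimes y\mapsto(-1)^{|x||y|}\,y\otimes x$. Write $V^{\odot 2}$ and $V^{\wedge 2}$ for the subspaces of $V\otimes V$ spanned by the elements $x\otimes y+(-1)^{|x||y|}y\otimes x$ and $x\otimes y-(-1)^{|x||y|}y\otimes x$ respectively, and, for graded spaces $V$ and $W$, write $[V,W]_\pm\subseteq (V\oplus W)^{\otimes 2}$ for the span of the elements $v\otimes w\pm(-1)^{|v||w|}w\otimes v$ with $v\in V$, $w\in W$. A contravariant functor $F:\mathsf C\to\mathsf D$ between symmetric monoidal categories is called strong symmetric monoidal if the covariant functor $\mathsf C^{\mathrm{op}}\to\mathsf D$ is so, that is, if it admits natural isomorphisms $1_{\mathsf D}\cong F(1_{\mathsf C})$ and $F(A)\otimes_{\mathsf D}F(B)\cong F(A\otimes_{\mathsf C}B)$ that are coherent with associators, unitors and braidings. **Quadratic data.** $\mathbf{QD}$ is the category of pairs $(V,R)$ with $V$ a finite dimensional graded vector space and $R\subseteq V^{\otimes 2}$ a graded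 subspace; a morphism $(V,R)\to(W,S)$ is a degree-zero map $f:V\to W$ with $(f\otimes f)(R)\subseteq S$. $\mathbf{QD}^+$ and $\mathbf{QD}^-$ are the full subcategories given by $R\subseteq V^{\odot 2}$ and $R\subseteq V^{\wedge 2}$. The symmetric monoidal products, with unit $(0,0)$, are: * on $\mathbf{QD}$: $(V,R)\otimes(W,S)=(V\oplus W,R\oplus[V,W]_-\oplus S)$ and $(V,R)\,\underline\otimes\,(W,S)=(V\oplus W,R\oplus[V,W]_+\oplus S)$; * on $\mathbf{QD}^-$: $(V,R)\oplus(W,S)=(V\oplus W,R\oplus[V,W]_-\oplus S)$; * on $\mathbf{QD}^+$: $(V,R)\,\underline\otimes\,(W,S)=(V\oplus W,R\oplus[V,W]_+\oplus S)$ and $(V,R)\vee(W,S)=(V\oplus W,R\oplus S)$. **Algebras and coalgebras.** $\mathbf{Ass}$, $\mathbf{Com}$, $\mathbf{AssCo}$ and $\mathbf{ComCo}$ are the categories of graded unital associative algebras, unital (graded) commutative algebras, counital coassociative coalgebras, and counital (graded) cocommutative coalgebras, with the tensor product $\otimes$ (with Koszul signs); $\mathbf{Lie}$ is the category of graded Lie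 algebras with the direct sum $\oplus$, where $[x+y,x'+y']=[x,x']+[y,y']$. The categories $\mathbf{wgAss}$, $\mathbf{wgCom}$, $\mathbf{wgAssCo}$, $\mathbf{wgComCo}$, $\mathbf{wgLie}$ are the analogous categories of objects with an additional weight grading by $\mathbb N$ preserved by the structure maps, with all weight components finite dimensional, and with the same products. **Theorem.** Each of the following functors is strong symmetric monoidal. 1. The Koszul dual functors $(V,R)^{¡}=(sV,s^2R)$, from $(\mathbf{QD},\otimes)$ to $(\mathbf{QD},\underline\otimes)$ and from $(\mathbf{QD}^-,\oplus)$ to $(\mathbf{QD}^+,\underline\otimes)$. Here $(sV)_{n+1}=V_n$ and $s^2(x\otimes y)=(-1)^{|x|}sx\otimes sy$. 2. The contravariant linear dual functors $(V,R)^*=(V^*,R^\perp)$, from $(\mathbf{QD},\underline\otimes)$ to $(\mathbf{QD},\otimes)$ (with $R^\perp\subseteq(V^*)^{\otimes2}$) and from $(\mathbf{QD}^+,\underline\otimes)$ to $(\mathbf{QD}^+,\vee)$ (with $R^\perp$ taken in $(V^*)^{\odot2}$). Here $(V^*)^{\otimes 2}$ and $V^{\otimes 2}$ are paired by $\langle f\otimes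 g,x\otimes y\rangle=(-1)^{|g||x|}f(x)g(y)$. 3. The contravariant second Koszul dual functors $(V,R)^!=((V,R)^{¡})^*$, from $(\mathbf{QD},\otimes)$ to $(\mathbf{QD},\otimes)$ and from $(\mathbf{QD}^-,\oplus)$ to $(\mathbf{QD}^+,\vee)$. 4. The lifts $\Lambda:(\mathbf{QD}^-,\oplus)\to(\mathbf{QD},\otimes)$, $(V,R)\mapsto(V,R)$; $\Sigma:(\mathbf{QD}^+,\underline\otimes)\to(\mathbf{QD},\underline\otimes)$, $(V,R)\mapsto(V,R)$; and $\mathcal S:(\mathbf{QD}^+,\vee)\to(\mathbf{QD},\otimes)$, $(V,R)\mapsto(V,R\oplus V^{\wedge 2})$. 5. The realisation functors, where $V$ is placed in weight $1$: * $\mathrm A:(\mathbf{QD},\otimes)\to(\mathbf{wgAss},\otimes)$, $\mathrm A(V,R)=T(V)/(R)$; * $\mathrm S:(\mathbf{QD}^+,\vee)\to(\mathbf{wgCom},\otimes)$, $\mathrm S(V,R)=S(V)/(R)$, where $S(V)=T(V)/(V^{\wedge 2})$; * $\mathrm L:(\mathbf{QD}^-,\oplus)\to(\mathbf{wgLie},\oplus)$,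 the quotient $\mathrm L(V,R)=\mathrm{Lie}(V)/(R)$ of the free Lie algebra on $V$ by the ideal generated by the image of $R$ under $x\otimes y\mapsto[x,y]$; * $\mathrm A^c:(\mathbf{QD},\underline\otimes)\to(\mathbf{wgAssCo},\otimes)$, where $\mathrm A^c(V,R)$ is the largest subcoalgebra $C$ of the tensor coalgebra $T^c(V)$ (with the deconcatenation coproduct) such that the composite $C\hookrightarrow T^c(V)\twoheadrightarrow V^{\otimes2}\twoheadrightarrow V^{\otimes 2}/R$ vanishes; * $\mathrm S^c:(\mathbf{QD}^+,\underline\otimes)\to(\mathbf{wgComCo},\otimes)$, where $\mathrm S^c(V,R)$ is the largest cocommutative subcoalgebra $C$ of $T^c(V)$ such that this composite vanishes. 6. The contravariant weight-wise linear duality functors $*:(\mathbf{wgAssCo},\otimes)\to(\mathbf{wgAss},\otimes)$ and $*:(\mathbf{wgComCo},\otimes)\to(\mathbf{wgCom},\otimes)$. 7. The inclusions $\mathbf{wgCom}\hookrightarrow\mathbf{wgAss}$, $\mathbf{wgComCo}\hookrightarrow\mathbf{wgAssCo}$, $\mathbf{Com}\hookrightarrow\mathbf{Ass}$, $\mathbf{ComCo}\hookrightarrow\mathbf{AssCo}$.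 8. The functors that forget the weight grading, $\mathbf{wgAss}\to\mathbf{Ass}$, $\mathbf{wgAssCo}\to\mathbf{AssCo}$, $\mathbf{wgLie}\to\mathbf{Lie}$, $\mathbf{wgCom}\to\mathbf{Com}$, $\mathbf{wgComCo}\to\mathbf{ComCo}$. 9. The universal enveloping algebra functor $\mathrm U:(\mathbf{Lie},\oplus)\to(\mathbf{Ass},\otimes)$, $\mathrm U(\mathfrak g)=T(\mathfrak g)/(x\otimes y-(-1)^{|x||y|}y\otimes x-[x,y])$. In particular there are natural isomorphisms such as $\mathrm U(\mathfrak g\oplus\mathfrak h)\cong\mathrm U(\mathfrak g)\otimes\mathrm U(\mathfrak h)$ and $\mathrm S^c(V,R)\otimes\mathrm S^c(W,S)\cong\mathrm S^c\big((V,R)\,\underline\otimes\,(W,S)\big)$. -/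

import Mathlib

open CategoryTheory MonoidalCategory TensorProduct

universe u

set_option linter.unusedSectionVars false

noncomputable section

namespace QuadraticData

/-! ### Graded vector spaces -/

/-- A `Γ`-graded `K`-vector space: a vector space which is the internal direct sum of a family of
subspaces indexed by `Γ`. -/
structure GrVect (K : Type u) [Field K] (Γ : Type) [DecidableEq Γ] : Type (u + 1) where
  carrier : Type u
  [addCommGroup : AddCommGroup carrier]
  [module : Module K carrier]
  /-- the homogeneous component of a given degree -/
  gr : Γ → Submodule K carrier
  isInternal : DirectSum.IsInternal gr

attribute [instance] GrVect.addCommGroup GrVect.module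

/-- Bookkeeping for the index monoids `ℤ` (degree) and `ℕ × ℤ` (weight, degree): the `ℤ`-degree that
governs the Koszul signs, and the index in which the dual of the component of a given index
sits. -/
class DegreeIndex (Γ : Type) [AddCommMonoid Γ] where
  deg : Γ →+ ℤ
  dual : Γ →+ Γ
  dual_dual : ∀ γ, dual (dual γ) = γ
  deg_dual : ∀ γ, deg (dual γ) = -deg γ

instance : DegreeIndex ℤ where
  deg := AddMonoidHom.id ℤ
  dual := -AddMonoidHom.id ℤ
  dual_dual := by simp
  deg_dual := by simp

instance : DegreeIndex (ℕ × ℤ) where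
  deg := AddMonoidHom.snd ℕ ℤ
  dual := (AddMonoidHom.fst ℕ ℤ).prod (-AddMonoidHom.snd ℕ ℤ)
  dual_dual := by simp
  deg_dual := by simp

section GradedBasics

variable {K : Type u} [Field K] {Γ : Type} [DecidableEq Γ]

theorem isInternal_of {M M' : Type*} [AddCommGroup M] [Module K M] [AddCommGroup M'] [Module K M']
    (gr : Γ → Submodule K M) (φ : M →ₗ[K] (Γ → M')) (j : M →ₗ[K] M') (hj : Function.Injective j)
    (h : ∀ γ, ∀ x ∈ gr γ, φ x = Pi.single γ (j x)) (htop : ⨆ γ, gr γ = ⊤) :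
    DirectSum.IsInternal gr := by
  refine DirectSum.isInternal_submodule_of_iSupIndep_of_iSup_eq_top ?_ htop
  intro γ
  rw [Submodule.disjoint_def]
  intro x hx hx'
  have key : (⨆ δ, ⨆ (_ : δ ≠ γ), gr δ) ≤ LinearMap.ker (LinearMap.proj γ ∘ₗ φ) := by
    refine iSup₂_le fun δ hδ y hy => ?_
    simp [h δ y hy, hδ.symm]
  have h1 := key hx'
  rw [LinearMap.mem_ker, LinearMap.comp_apply, h γ x hx] at h1
  apply hj
  simpa using h1

namespace GrVect

instance : CoeSort (GrVect K Γ) (Type u) := ⟨GrVect.carrier⟩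

/-- The decomposition of a vector into its homogeneous components. -/
def coact (V : GrVect K Γ) : V →ₗ[K] Γ →₀ V :=
  (DirectSum.toModule K Γ _ fun γ => Finsupp.lsingle γ ∘ₗ (V.gr γ).subtype) ∘ₗ
    (LinearEquiv.ofBijective (DirectSum.coeLinearMap V.gr) V.isInternal).symm.toLinearMap

theorem coact_of_mem (V : GrVect K Γ) {γ : Γ} {x : V} (hx : x ∈ V.gr γ) :
    V.coact x = Finsupp.single γ x := by
  have : (LinearEquiv.ofBijective (DirectSum.coeLinearMap V.gr) V.isInternal).symm x =
      DirectSum.lof K Γ (fun γ => V.gr γ) γ ⟨x, hx⟩ := by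
    rw [LinearEquiv.symm_apply_eq]
    exact (DirectSum.coeLinearMap_lof V.gr γ ⟨x, hx⟩).symm
  rw [coact, LinearMap.comp_apply, LinearEquiv.coe_coe, this, DirectSum.toModule_lof]
  rfl

theorem iSup_gr (V : GrVect K Γ) : ⨆ γ, V.gr γ = ⊤ :=
  V.isInternal.submodule_iSup_eq_top

theorem induction (V : GrVect K Γ) {p : V → Prop} (x : V) (h : ∀ γ, ∀ x ∈ V.gr γ, p x)
    (h0 : p 0) (hadd : ∀ x y, p x → p y → p (x + y)) : p x :=
  Submodule.iSup_induction V.gr (motive := p) (by rw [V.iSup_gr]; trivial) h h0 hadd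

theorem lin_ext (V : GrVect K Γ) {M : Type*} [AddCommMonoid M] [Module K M] {f g : V →ₗ[K] M}
    (h : ∀ γ, ∀ x ∈ V.gr γ, f x = g x) : f = g := by
  ext x
  refine V.induction (p := fun x => f x = g x) x h (by simp) fun x y hx hy => by simp [hx, hy]

theorem tensor_ext (V W : GrVect K Γ) {M : Type*} [AddCommMonoid M] [Module K M]
    {f g : V ⊗[K] W →ₗ[K] M}
    (h : ∀ γ, ∀ x ∈ V.gr γ, ∀ δ, ∀ y ∈ W.gr δ, f (x ⊗ₜ y) = g (x ⊗ₜ y)) : f = g := by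
  apply TensorProduct.ext
  refine V.lin_ext fun γ x hx => W.lin_ext fun δ y hy => ?_
  simpa using h γ x hx δ y hy

theorem coact_mem (V : GrVect K Γ) (x : V) (γ : Γ) : V.coact x γ ∈ V.gr γ := by
  refine V.induction (p := fun x => V.coact x γ ∈ V.gr γ) x ?_ (by simp)
    fun x y hx hy => by simpa using add_mem hx hy
  intro δ y hy
  rw [V.coact_of_mem hy, Finsupp.single_apply]
  split_ifs with h
  · exact h ▸ hy
  · exact zero_mem _

theorem coact_sum (V : GrVect K Γ) (x : V) :
    Finsupp.lsum K (fun _ : Γ => (LinearMap.id : V →ₗ[K] V)) (V.coact x) = x := by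
  refine V.induction (p := fun x => Finsupp.lsum K (fun _ : Γ => (LinearMap.id : V →ₗ[K] V))
    (V.coact x) = x) x ?_ (by simp) fun x y hx hy => by rw [map_add, map_add, hx, hy]
  intro δ y hy
  simp [V.coact_of_mem hy]

theorem mem_iff (V : GrVect K Γ) {x : V} {γ : Γ} :
    x ∈ V.gr γ ↔ V.coact x = Finsupp.single γ x := by
  refine ⟨V.coact_of_mem, fun h => ?_⟩
  have := V.coact_mem x γ
  rwa [h, Finsupp.single_eq_same] at this

/-- Graded (homogeneous) subspaces. -/
def IsHomogeneous (V : GrVect K Γ) (N : Submodule K V) : Prop :=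
  ∀ x ∈ N, ∀ γ, V.coact x γ ∈ N

/-- Degree-zero linear maps. -/
@[ext]
structure Hom (V W : GrVect K Γ) where
  lin : V →ₗ[K] W
  map_mem : ∀ γ, ∀ x ∈ V.gr γ, lin x ∈ W.gr γ

theorem Hom.coact_lin {V W : GrVect K Γ} (f : Hom V W) (x : V) (γ : Γ) :
    W.coact (f.lin x) γ = f.lin (V.coact x γ) := by
  refine V.induction (p := fun x => W.coact (f.lin x) γ = f.lin (V.coact x γ)) x ?_ (by simp)
    fun x y hx hy => by simp [hx, hy]
  intro δ y hy
  rw [V.coact_of_mem hy, W.coact_of_mem (f.map_mem δ y hy)]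
  by_cases h : δ = γ <;> simp [h]

instance : Category (GrVect K Γ) where
  Hom V W := Hom V W
  id V := ⟨LinearMap.id, fun _ _ h => h⟩
  comp f g := ⟨g.lin ∘ₗ f.lin, fun γ x h => g.map_mem γ _ (f.map_mem γ x h)⟩

@[ext] theorem hom_ext {V W : GrVect K Γ} {f g : V ⟶ W} (h : f.lin = g.lin) : f = g := Hom.ext h

@[simp] theorem id_lin (V : GrVect K Γ) : Hom.lin (𝟙 V) = LinearMap.id := rfl

@[simp] theorem comp_lin {U V W : GrVect K Γ} (f : U ⟶ V) (g : V ⟶ W) :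
    Hom.lin (f ≫ g) = g.lin ∘ₗ f.lin := rfl

/-- Isomorphisms from linear equivalences preserving degrees in both directions. -/
def mkIso {V W : GrVect K Γ} (e : V ≃ₗ[K] W) (h : ∀ γ, ∀ x ∈ V.gr γ, e x ∈ W.gr γ)
    (h' : ∀ γ, ∀ x ∈ W.gr γ, e.symm x ∈ V.gr γ) : V ≅ W where
  hom := ⟨e.toLinearMap, h⟩
  inv := ⟨e.symm.toLinearMap, h'⟩
  hom_inv_id := by ext x; simp
  inv_hom_id := by ext x; simp

/-- It is enough to check one direction. -/
theorem symm_mem {V W : GrVect K Γ} (e : V ≃ₗ[K] W) (h : ∀ γ, ∀ x ∈ V.gr γ, e x ∈ W.gr γ) (γ : Γ)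
    (x : W) (hx : x ∈ W.gr γ) : e.symm x ∈ V.gr γ := by
  rw [mem_iff]
  ext δ
  apply e.injective
  have := Hom.coact_lin ⟨e.toLinearMap, h⟩ (e.symm x) δ
  simp only [LinearEquiv.coe_coe, LinearEquiv.apply_symm_apply, W.coact_of_mem hx] at this
  rw [← this]
  by_cases h : γ = δ <;> simp [h]

theorem tensor_induction (V W : GrVect K Γ) {N : Submodule K (V ⊗[K] W)}
    (h : ∀ i j, ∀ x ∈ V.gr i, ∀ y ∈ W.gr j, x ⊗ₜ[K] y ∈ N) (z : V ⊗[K] W) : z ∈ N := by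
  have : N.mkQ = 0 := tensor_ext V W fun i x hx j y hy => by
    simpa using h i j x hx y hy
  rw [← Submodule.ker_mkQ N, this]
  trivial

/-! ### Tensor product -/

section Tensor

variable [AddCommMonoid Γ]

/-- `(V ⊗ W)_n = ⨁_{i + j = n} V_i ⊗ W_j`. -/
def tensorGr (V W : GrVect K Γ) (n : Γ) : Submodule K (V ⊗[K] W) :=
  ⨆ (i : Γ) (j : Γ) (_ : i + j = n), Submodule.map₂ (TensorProduct.mk K V W) (V.gr i) (W.gr j)

theorem tmul_mem (V W : GrVect K Γ) {i j n : Γ} (h : i + j = n) {x : V} (hx : x ∈ V.gr i) {y : W}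
    (hy : y ∈ W.gr j) : x ⊗ₜ[K] y ∈ tensorGr V W n :=
  Submodule.mem_iSup_of_mem i <| Submodule.mem_iSup_of_mem j <| Submodule.mem_iSup_of_mem h <|
    Submodule.apply_mem_map₂ _ hx hy

theorem tensorGr_le (V W : GrVect K Γ) {n : Γ} {N : Submodule K (V ⊗[K] W)}
    (h : ∀ i j, i + j = n → ∀ x ∈ V.gr i, ∀ y ∈ W.gr j, x ⊗ₜ[K] y ∈ N) : tensorGr V W n ≤ N :=
  iSup_le fun i => iSup_le fun j => iSup_le fun hij => Submodule.map₂_le.2 fun x hx y hy =>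
    h i j hij x hx y hy

/-- The decomposition map of a tensor product. -/
def tensorCoact (V W : GrVect K Γ) : V ⊗[K] W →ₗ[K] Γ →₀ (V ⊗[K] W) :=
  Finsupp.lmapDomain _ K (fun p : Γ × Γ => p.1 + p.2) ∘ₗ
    (finsuppTensorFinsupp K K V W Γ Γ).toLinearMap ∘ₗ TensorProduct.map V.coact W.coact

theorem tensorCoact_tmul (V W : GrVect K Γ) {i j : Γ} {x : V} (hx : x ∈ V.gr i) {y : W}
    (hy : y ∈ W.gr j) : tensorCoact V W (x ⊗ₜ y) = Finsupp.single (i + j) (x ⊗ₜ y) := by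
  simp [tensorCoact, V.coact_of_mem hx, W.coact_of_mem hy]

theorem tensor_isInternal (V W : GrVect K Γ) : DirectSum.IsInternal (tensorGr V W) := by
  refine isInternal_of _ (Finsupp.lcoeFun ∘ₗ tensorCoact V W) LinearMap.id
    Function.injective_id ?_ ?_
  · intro n x hx
    have : tensorGr V W n ≤ LinearMap.eqLocus (tensorCoact V W) (Finsupp.lsingle n) := by
      refine tensorGr_le V W fun i j hij x hx y hy => ?_
      simp [tensorCoact_tmul V W hx hy, hij]
    have h1 : tensorCoact V W x = Finsupp.single n x := this hx
    ext m
    simp [h1, Finsupp.single_apply, Pi.single_apply, eq_comm]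
  · rw [eq_top_iff]
    rintro z -
    refine tensor_induction V W (fun i j x hx y hy => ?_) z
    exact Submodule.mem_iSup_of_mem (i + j) (tmul_mem V W rfl hx hy)

/-- The tensor product of graded vector spaces. -/
abbrev tensorObj' (V W : GrVect K Γ) : GrVect K Γ where
  carrier := V ⊗[K] W
  gr := tensorGr V W
  isInternal := tensor_isInternal V W

/-- The unit: `K` in degree `0`. -/
abbrev unitObj (K : Type u) [Field K] (Γ : Type) [DecidableEq Γ] [AddCommMonoid Γ] : GrVect K Γ where
  carrier := K
  gr γ := if γ = 0 then ⊤ else ⊥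
  isInternal := by
    refine isInternal_of _ (LinearMap.single K (fun _ => K) 0) LinearMap.id
      Function.injective_id ?_ ?_
    · intro γ x hx
      by_cases h : γ = 0
      · simp [h]
      · simp only [h, if_false, Submodule.mem_bot] at hx
        simp [hx]
    · rw [eq_top_iff]
      rintro x -
      exact Submodule.mem_iSup_of_mem 0 (by simp)

theorem mem_unit_gr {γ : Γ} {x : K} (hx : x ∈ (unitObj K Γ).gr γ) : γ = 0 ∨ x = 0 := by
  by_cases h : γ = 0
  · exact .inl h
  · simp only [unitObj, h, if_false] at hx
    exact .inr hx

theorem mem_unit_gr_zero (x : K) : x ∈ (unitObj K Γ).gr 0 := by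
  change x ∈ (if (0 : Γ) = 0 then ⊤ else ⊥ : Submodule K K)
  simp

/-- The tensor product of two degree-zero maps. -/
def tensorHom' {V V' W W' : GrVect K Γ} (f : V ⟶ V') (g : W ⟶ W') :
    tensorObj' V W ⟶ tensorObj' V' W' where
  lin := TensorProduct.map f.lin g.lin
  map_mem n x hx := by
    have : tensorGr V W n ≤ (tensorGr V' W' n).comap (TensorProduct.map f.lin g.lin) :=
      tensorGr_le V W fun i j hij x hx y hy =>
        tmul_mem V' W' hij (f.map_mem i x hx) (g.map_mem j y hy)
    exact this hx

theorem tensorGr_le_comap {V W : GrVect K Γ} {X : GrVect K Γ} {f : V ⊗[K] W →ₗ[K] X}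
    (h : ∀ i j, ∀ x ∈ V.gr i, ∀ y ∈ W.gr j, f (x ⊗ₜ[K] y) ∈ X.gr (i + j)) (n : Γ)
    (z : V ⊗[K] W) (hz : z ∈ (tensorObj' V W).gr n) : f z ∈ X.gr n := by
  have : tensorGr V W n ≤ (X.gr n).comap f := tensorGr_le V W fun i j hij x hx y hy => by
    subst hij; exact h i j x hx y hy
  exact this hz

/-- Associativity of the tensor product. -/
def assoc' (U V W : GrVect K Γ) :
    tensorObj' (tensorObj' U V) W ≅ tensorObj' U (tensorObj' V W) :=
  have h : ∀ γ, ∀ x ∈ (tensorObj' (tensorObj' U V) W).gr γ,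
      TensorProduct.assoc K U V W x ∈ (tensorObj' U (tensorObj' V W)).gr γ := by
    refine tensorGr_le_comap (V := tensorObj' U V) (W := W) (X := tensorObj' U (tensorObj' V W))
      (f := (TensorProduct.assoc K U V W).toLinearMap) ?_
    intro i j x hx y hy
    have : tensorGr U V i ≤ ((tensorObj' U (tensorObj' V W)).gr (i + j)).comap
        ((TensorProduct.assoc K U V W).toLinearMap ∘ₗ (TensorProduct.mk K _ _).flip y) := by
      refine tensorGr_le U V fun k l hkl u hu v hv => ?_
      refine tmul_mem U (tensorObj' V W) (by rw [← hkl, add_assoc]) hu ?_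
      exact tmul_mem V W rfl hv hy
    exact this hx
  mkIso (TensorProduct.assoc K U V W) h (symm_mem (V := tensorObj' (tensorObj' U V) W)
    (W := tensorObj' U (tensorObj' V W)) _ h)

/-- Left unitality of the tensor product. -/
def lid' (V : GrVect K Γ) : tensorObj' (unitObj K Γ) V ≅ V :=
  have h : ∀ γ, ∀ x ∈ (tensorObj' (unitObj K Γ) V).gr γ, TensorProduct.lid K V x ∈ V.gr γ := by
    refine tensorGr_le_comap (V := unitObj K Γ) (W := V) (X := V) (f := (TensorProduct.lid K V).toLinearMap) ?_
    intro i j x hx y hy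
    rcases mem_unit_gr hx with rfl | rfl
    · rw [zero_add]
      exact (V.gr j).smul_mem x hy
    · erw [TensorProduct.zero_tmul, map_zero]
      exact zero_mem _
  mkIso (TensorProduct.lid K V) h (symm_mem (V := tensorObj' (unitObj K Γ) V) _ h)

/-- Right unitality of the tensor product. -/
def rid' (V : GrVect K Γ) : tensorObj' V (unitObj K Γ) ≅ V :=
  have h : ∀ γ, ∀ x ∈ (tensorObj' V (unitObj K Γ)).gr γ, TensorProduct.rid K V x ∈ V.gr γ := by
    refine tensorGr_le_comap (V := V) (W := unitObj K Γ) (X := V) (f := (TensorProduct.rid K V).toLinearMap) ?_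
    intro i j x hx y hy
    rcases mem_unit_gr hy with rfl | rfl
    · rw [add_zero]
      exact (V.gr i).smul_mem y hx
    · erw [TensorProduct.tmul_zero, map_zero]
      exact zero_mem _
  mkIso (TensorProduct.rid K V) h (symm_mem (V := tensorObj' V (unitObj K Γ)) _ h)

instance : MonoidalCategoryStruct (GrVect K Γ) where
  tensorObj := tensorObj'
  tensorUnit := unitObj K Γ
  whiskerLeft V _ _ f := tensorHom' (𝟙 V) f
  whiskerRight f W := tensorHom' f (𝟙 W)
  tensorHom := tensorHom'
  associator := assoc'
  leftUnitor := lid'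
  rightUnitor := rid'

instance : MonoidalCategory (GrVect K Γ) :=
  .ofTensorHom
    (id_tensorHom_id := fun V W => hom_ext (TensorProduct.map_id))
    (tensorHom_comp_tensorHom := fun f₁ f₂ g₁ g₂ => hom_ext (TensorProduct.map_comp _ _ _ _).symm)
    (associator_naturality := fun f g h => hom_ext <| TensorProduct.ext_threefold fun _ _ _ => rfl)
    (leftUnitor_naturality := fun {V W} f => hom_ext <| TensorProduct.ext' fun (a : K) x =>
      (f.lin.map_smul a x).symm)
    (rightUnitor_naturality := fun {V W} f => hom_ext <| TensorProduct.ext' fun x (a : K) =>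
      (f.lin.map_smul a x).symm)
    (pentagon := fun W X Y Z => hom_ext <| TensorProduct.ext_fourfold fun _ _ _ _ => rfl)
    (triangle := fun X Y => hom_ext <| TensorProduct.ext_threefold fun x (a : K) y =>
      TensorProduct.tmul_smul a x y)

end Tensor
end GrVect

namespace GrVect

/-! ### Koszul signs and the symmetry of the tensor product -/

section Koszul

variable [AddCommMonoid Γ] [DegreeIndex Γ]

/-- The Koszul sign `(-1)^{|x||y|}` for `|x| = deg i`, `|y| = deg j`. -/
def koszul (K : Type u) [Field K] {Γ : Type} [AddCommMonoid Γ] [DegreeIndex Γ] (i j : Γ) : K :=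
  ((Int.negOnePow (DegreeIndex.deg i * DegreeIndex.deg j) : ℤˣ) : ℤ)

theorem koszul_comm (i j : Γ) : koszul K i j = koszul K j i := by
  rw [koszul, koszul, mul_comm]

theorem koszul_add_left (i j k : Γ) : koszul K (i + j) k = koszul K i k * koszul K j k := by
  simp [koszul, add_mul, Int.negOnePow_add]

theorem koszul_add_right (i j k : Γ) : koszul K i (j + k) = koszul K i j * koszul K i k := by
  simp [koszul, mul_add, Int.negOnePow_add]

theorem koszul_zero_left (i : Γ) : koszul K 0 i = 1 := by simp [koszul]

theorem koszul_zero_right (i : Γ) : koszul K i 0 = 1 := by simp [koszul]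

theorem koszul_mul_self (i j : Γ) : koszul K i j * koszul K i j = 1 := by
  rw [koszul, ← Int.cast_mul, ← Units.val_mul]
  simp

/-- The linear map `x ⊗ y ↦ (-1)^{|x||y|} x ⊗ y`. -/
def signTwist (V W : GrVect K Γ) : V ⊗[K] W →ₗ[K] V ⊗[K] W :=
  Finsupp.lsum K (fun p : Γ × Γ => koszul K p.1 p.2 • (LinearMap.id : V ⊗[K] W →ₗ[K] V ⊗[K] W)) ∘ₗ
    (finsuppTensorFinsupp K K V W Γ Γ).toLinearMap ∘ₗ TensorProduct.map V.coact W.coact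

theorem signTwist_tmul (V W : GrVect K Γ) {i j : Γ} {x : V} (hx : x ∈ V.gr i) {y : W}
    (hy : y ∈ W.gr j) : signTwist V W (x ⊗ₜ y) = koszul K i j • (x ⊗ₜ y) := by
  simp [signTwist, V.coact_of_mem hx, W.coact_of_mem hy]

theorem signTwist_signTwist (V W : GrVect K Γ) (z : V ⊗[K] W) :
    signTwist V W (signTwist V W z) = z := by
  have : signTwist V W ∘ₗ signTwist V W = LinearMap.id := tensor_ext V W fun i x hx j y hy => by
    simp [signTwist_tmul V W hx hy, smul_smul, koszul_mul_self]
  exact LinearMap.congr_fun this z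

/-- The Koszul symmetry `x ⊗ y ↦ (-1)^{|x||y|} y ⊗ x`. -/
def swapLin (V W : GrVect K Γ) : V ⊗[K] W →ₗ[K] W ⊗[K] V :=
  (TensorProduct.comm K V W).toLinearMap ∘ₗ signTwist V W

theorem swapLin_tmul (V W : GrVect K Γ) {i j : Γ} {x : V} (hx : x ∈ V.gr i) {y : W}
    (hy : y ∈ W.gr j) : swapLin V W (x ⊗ₜ y) = koszul K i j • (y ⊗ₜ x) := by
  simp [swapLin, signTwist_tmul V W hx hy]

theorem swapLin_swapLin (V W : GrVect K Γ) : swapLin W V ∘ₗ swapLin V W = LinearMap.id :=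
  tensor_ext V W fun i x hx j y hy => by
    simp [swapLin_tmul V W hx hy, swapLin_tmul W V hy hx, smul_smul, koszul_comm j i,
      koszul_mul_self]

theorem swapLin_mem (V W : GrVect K Γ) (n : Γ) (z : V ⊗[K] W) (hz : z ∈ (tensorObj' V W).gr n) :
    swapLin V W z ∈ (tensorObj' W V).gr n := by
  refine tensorGr_le_comap (X := tensorObj' W V) (f := swapLin V W) ?_ n z hz
  intro i j x hx y hy
  rw [swapLin_tmul V W hx hy]
  exact Submodule.smul_mem _ _ (tmul_mem W V (add_comm _ _) hy hx)

/-- The symmetry isomorphism of the tensor product of graded vector spaces. -/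
def braid (V W : GrVect K Γ) : tensorObj' V W ≅ tensorObj' W V where
  hom := ⟨swapLin V W, swapLin_mem V W⟩
  inv := ⟨swapLin W V, swapLin_mem W V⟩
  hom_inv_id := hom_ext (swapLin_swapLin V W)
  inv_hom_id := hom_ext (swapLin_swapLin W V)

theorem swapLin_natural {V V' W W' : GrVect K Γ} (f : V ⟶ V') (g : W ⟶ W') :
    swapLin V' W' ∘ₗ TensorProduct.map f.lin g.lin =
      TensorProduct.map g.lin f.lin ∘ₗ swapLin V W :=
  tensor_ext V W fun i x hx j y hy => by
    simp [swapLin_tmul V W hx hy, swapLin_tmul V' W' (f.map_mem i x hx) (g.map_mem j y hy)]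

theorem tensor_ext_threefold (U V W : GrVect K Γ) {M : Type*} [AddCommMonoid M] [Module K M]
    {f g : (U ⊗[K] V) ⊗[K] W →ₗ[K] M}
    (h : ∀ i, ∀ x ∈ U.gr i, ∀ j, ∀ y ∈ V.gr j, ∀ k, ∀ z ∈ W.gr k,
      f ((x ⊗ₜ y) ⊗ₜ z) = g ((x ⊗ₜ y) ⊗ₜ z)) : f = g := by
  apply TensorProduct.ext
  refine tensor_ext U V fun i x hx j y hy => W.lin_ext fun k z hz => ?_
  simpa using h i x hx j y hy k z hz

theorem tensor_ext_threefold' (U V W : GrVect K Γ) {M : Type*} [AddCommMonoid M] [Module K M]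
    {f g : U ⊗[K] (V ⊗[K] W) →ₗ[K] M}
    (h : ∀ i, ∀ x ∈ U.gr i, ∀ j, ∀ y ∈ V.gr j, ∀ k, ∀ z ∈ W.gr k,
      f (x ⊗ₜ (y ⊗ₜ z)) = g (x ⊗ₜ (y ⊗ₜ z))) : f = g := by
  apply TensorProduct.ext
  refine U.lin_ext fun i x hx => tensor_ext V W fun j y hy k z hz => ?_
  simpa using h i x hx j y hy k z hz

theorem hexagon_fwd (U V W : GrVect K Γ) :
    (TensorProduct.assoc K V W U).toLinearMap ∘ₗ swapLin U (tensorObj' V W) ∘ₗ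
        (TensorProduct.assoc K U V W).toLinearMap =
      TensorProduct.map LinearMap.id (swapLin U W) ∘ₗ
        (TensorProduct.assoc K V U W).toLinearMap ∘ₗ
        TensorProduct.map (swapLin U V) LinearMap.id :=
  tensor_ext_threefold U V W fun i x hx j y hy k z hz => by
    have h1 := swapLin_tmul U (tensorObj' V W) hx (tmul_mem V W rfl hy hz)
    simp only [LinearMap.comp_apply, LinearEquiv.coe_coe, TensorProduct.assoc_tmul,
      TensorProduct.map_tmul, swapLin_tmul U V hx hy, LinearMap.id_apply]
    erw [h1]
    rw [koszul_add_right, map_smul, ← TensorProduct.smul_tmul', map_smul, map_smul]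
    simp only [TensorProduct.assoc_tmul, TensorProduct.map_tmul, swapLin_tmul U W hx hz,
      LinearMap.id_apply, TensorProduct.tmul_smul, smul_smul]

theorem hexagon_rev (U V W : GrVect K Γ) :
    (TensorProduct.assoc K W U V).symm.toLinearMap ∘ₗ swapLin (tensorObj' U V) W ∘ₗ
        (TensorProduct.assoc K U V W).symm.toLinearMap =
      TensorProduct.map (swapLin U W) LinearMap.id ∘ₗ
        (TensorProduct.assoc K U W V).symm.toLinearMap ∘ₗ
        TensorProduct.map LinearMap.id (swapLin V W) :=
  tensor_ext_threefold' U V W fun i x hx j y hy k z hz => by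
    have h1 := swapLin_tmul (tensorObj' U V) W (tmul_mem U V rfl hx hy) hz
    simp only [LinearMap.comp_apply, LinearEquiv.coe_coe, TensorProduct.assoc_symm_tmul,
      TensorProduct.map_tmul, swapLin_tmul V W hy hz, LinearMap.id_apply]
    erw [h1]
    rw [koszul_add_left, map_smul, TensorProduct.tmul_smul, map_smul, map_smul]
    simp only [TensorProduct.assoc_symm_tmul, TensorProduct.map_tmul, swapLin_tmul U W hx hz,
      LinearMap.id_apply, ← TensorProduct.smul_tmul', smul_smul, mul_comm]

instance : SymmetricCategory (GrVect K Γ) where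
  braiding := braid
  braiding_naturality_right X _ _ f := hom_ext (swapLin_natural (𝟙 X) f)
  braiding_naturality_left f Z := hom_ext (swapLin_natural f (𝟙 Z))
  hexagon_forward X Y Z := hom_ext (hexagon_fwd X Y Z)
  hexagon_reverse X Y Z := hom_ext (hexagon_rev X Y Z)
  symmetry X Y := hom_ext (swapLin_swapLin X Y)

end Koszul

end GrVect

/-! ### Change of the grading: forgetting a weight, placing in weight one, shifting -/

namespace GrVect

section Regrade

variable {Δ : Type} [DecidableEq Δ]

/-- The same vector space, with `V_γ` placed in degree `f γ`. -/
abbrev regradeObj (f : Γ → Δ) (V : GrVect K Γ) : GrVect K Δ where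
  carrier := V
  gr δ := ⨆ (γ : Γ) (_ : f γ = δ), V.gr γ
  isInternal := by
    refine isInternal_of _ (Finsupp.lcoeFun ∘ₗ Finsupp.lmapDomain _ K f ∘ₗ V.coact) LinearMap.id
      Function.injective_id ?_ ?_
    · intro δ x hx
      have : (⨆ (γ : Γ) (_ : f γ = δ), V.gr γ) ≤
          LinearMap.eqLocus (Finsupp.lmapDomain _ K f ∘ₗ V.coact) (Finsupp.lsingle δ) :=
        iSup₂_le fun γ hγ x hx => by simp [V.coact_of_mem hx, hγ]
      have h1 : (Finsupp.lmapDomain _ K f ∘ₗ V.coact) x = Finsupp.single δ x := this hx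
      ext m
      rw [LinearMap.comp_apply, h1]
      simp [Finsupp.single_apply, Pi.single_apply, eq_comm]
    · rw [eq_top_iff, ← V.iSup_gr]
      exact iSup_le fun γ => le_iSup_of_le (f γ) (le_iSup₂_of_le γ rfl le_rfl)

theorem mem_regrade (f : Γ → Δ) (V : GrVect K Γ) {γ : Γ} {δ : Δ} (h : f γ = δ) {x : V}
    (hx : x ∈ V.gr γ) : x ∈ (regradeObj f V).gr δ :=
  Submodule.mem_iSup_of_mem γ (Submodule.mem_iSup_of_mem h hx)

theorem regrade_le (f : Γ → Δ) (V : GrVect K Γ) {δ : Δ} {N : Submodule K V}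
    (h : ∀ γ, f γ = δ → ∀ x ∈ V.gr γ, x ∈ N) : (regradeObj f V).gr δ ≤ N :=
  iSup₂_le fun γ hγ x hx => h γ hγ x hx

/-- Regrading as a functor (identity on underlying vector spaces and maps). -/
def regrade (f : Γ → Δ) : GrVect K Γ ⥤ GrVect K Δ where
  obj := regradeObj f
  map {V W} g := ⟨g.lin, fun _ x hx => regrade_le (N := Submodule.comap g.lin
    ((regradeObj f W).gr _)) f V (fun γ hγ x hx => mem_regrade f W hγ (g.map_mem γ x hx)) hx⟩

variable [AddCommMonoid Γ] [AddCommMonoid Δ]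

theorem regrade_unit_mem (f : Γ →+ Δ) (δ : Δ) (x : K) (hx : x ∈ (unitObj K Δ).gr δ) :
    x ∈ (regradeObj f (unitObj K Γ)).gr δ := by
  rcases mem_unit_gr hx with rfl | rfl
  · exact mem_regrade f (unitObj K Γ) (map_zero f) (mem_unit_gr_zero x)
  · exact zero_mem _

theorem regrade_tensor_mem (f : Γ →+ Δ) (V W : GrVect K Γ) (δ : Δ) (z : V ⊗[K] W)
    (hz : z ∈ (tensorObj' (regradeObj f V) (regradeObj f W)).gr δ) :
    z ∈ (regradeObj f (tensorObj' V W)).gr δ := by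
  refine tensorGr_le (regradeObj f V) (regradeObj f W) ?_ hz
  intro i j hij x hx y hy
  refine regrade_le (N := ((regradeObj f (tensorObj' V W)).gr δ).comap
    ((TensorProduct.mk K V W).flip y)) f V (fun a ha x hx => ?_) hx
  refine regrade_le (N := ((regradeObj f (tensorObj' V W)).gr δ).comap
    (TensorProduct.mk K V W x)) f W (fun b hb y hy => ?_) hy
  exact mem_regrade f (tensorObj' V W) (by rw [map_add, ha, hb, hij]) (tmul_mem V W rfl hx hy)

/-- Regrading along a homomorphism is strong monoidal; all structure maps are identities. -/
instance regradeMonoidal (f : Γ →+ Δ) : (regrade (K := K) f).Monoidal :=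
  Functor.CoreMonoidal.toMonoidal
    { εIso := mkIso (V := unitObj K Δ) (W := regradeObj f (unitObj K Γ)) (LinearEquiv.refl K K)
        (regrade_unit_mem f) (symm_mem (V := unitObj K Δ) (W := regradeObj f (unitObj K Γ)) _
          (regrade_unit_mem f))
      μIso := fun V W => mkIso (V := tensorObj' (regradeObj f V) (regradeObj f W))
        (W := regradeObj f (tensorObj' V W)) (LinearEquiv.refl K (V ⊗[K] W))
        (regrade_tensor_mem f V W) (symm_mem (V := tensorObj' (regradeObj f V) (regradeObj f W))
          (W := regradeObj f (tensorObj' V W)) _ (regrade_tensor_mem f V W))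
      μIso_hom_natural_left := fun _ _ => rfl
      μIso_hom_natural_right := fun _ _ => rfl
      associativity := fun _ _ _ => hom_ext <| TensorProduct.ext_threefold fun _ _ _ => rfl
      left_unitality := fun _ => hom_ext <| TensorProduct.ext' fun _ _ => rfl
      right_unitality := fun _ => hom_ext <| TensorProduct.ext' fun _ _ => rfl }

theorem regrade_swap [DegreeIndex Γ] [DegreeIndex Δ] (f : Γ →+ Δ)
    (hf : ∀ γ, DegreeIndex.deg (f γ) = DegreeIndex.deg γ) (V W : GrVect K Γ) :
    swapLin V W = swapLin (regradeObj f V) (regradeObj f W) :=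
  tensor_ext V W fun i x hx j y hy => by
    rw [swapLin_tmul V W hx hy]
    refine Eq.trans ?_
      (swapLin_tmul (regradeObj f V) (regradeObj f W) (mem_regrade f V rfl hx)
        (mem_regrade f W rfl hy)).symm
    simp [koszul, hf]

end Regrade

/-! ### Graded dual -/

section Dual

/-- The projection to the component of a given degree. -/
def component (V : GrVect K Γ) (γ : Γ) : V →ₗ[K] V := Finsupp.lapply γ ∘ₗ V.coact

theorem component_of_mem (V : GrVect K Γ) {γ δ : Γ} {x : V} (hx : x ∈ V.gr γ) :
    V.component δ x = if γ = δ then x else 0 := by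
  simp [component, V.coact_of_mem hx, Finsupp.single_apply]

variable [AddCommMonoid Γ] [DegreeIndex Γ]

/-- The functionals concentrated on the component of index `dual γ`. -/
def dualGr (V : GrVect K Γ) (γ : Γ) : Submodule K ((V →ₗ[K] K)) where
  carrier := {f | ∀ δ, δ ≠ DegreeIndex.dual γ → ∀ x ∈ V.gr δ, f x = 0}
  add_mem' hf hg δ hδ x hx := by simp [hf δ hδ x hx, hg δ hδ x hx]
  zero_mem' _ _ _ _ := rfl
  smul_mem' a f hf δ hδ x hx := by simp [hf δ hδ x hx]

theorem dualGr_component (V : GrVect K Γ) {γ : Γ} {f : (V →ₗ[K] K)} (hf : f ∈ dualGr V γ)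
    (δ : Γ) : f ∘ₗ V.component (DegreeIndex.dual δ) = if γ = δ then f else 0 := by
  refine V.lin_ext fun i x hx => ?_
  rw [LinearMap.comp_apply, V.component_of_mem hx]
  by_cases h : γ = δ
  · subst h
    by_cases h' : i = DegreeIndex.dual γ
    · simp [h']
    · simp [h', hf i h' x hx]
  · by_cases h' : i = DegreeIndex.dual δ
    · have : i ≠ DegreeIndex.dual γ := fun h'' => h <| by
        rw [← DegreeIndex.dual_dual γ, ← h'', h', DegreeIndex.dual_dual]
      simp [h, h', hf _ (h' ▸ this) _ (h' ▸ hx)]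
    · simp [h, h']

/-- The functionals supported in finitely many degrees. -/
def dualSpace (V : GrVect K Γ) : Submodule K (V →ₗ[K] K) := ⨆ γ, dualGr V γ

/-- The space of functionals supported in finitely many degrees, as a type. -/
def DualSpace (V : GrVect K Γ) : Type u := dualSpace V

instance (V : GrVect K Γ) : AddCommGroup (DualSpace V) := inferInstanceAs (AddCommGroup (dualSpace V))

instance (V : GrVect K Γ) : Module K (DualSpace V) := inferInstanceAs (Module K (dualSpace V))

/-- An element of the graded dual as a functional. -/
def toFun (V : GrVect K Γ) : DualSpace V →ₗ[K] V →ₗ[K] K := (dualSpace V).subtype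

theorem toFun_injective (V : GrVect K Γ) : Function.Injective (toFun V) :=
  Submodule.injective_subtype _

theorem toFun_mem (V : GrVect K Γ) (f : DualSpace V) : toFun V f ∈ dualSpace V := f.2

theorem range_toFun (V : GrVect K Γ) : LinearMap.range (toFun V) = dualSpace V :=
  Submodule.range_subtype _

/-- Maps into the graded dual. -/
def dualLift (V : GrVect K Γ) {M : Type u} [AddCommGroup M] [Module K M] (f : M →ₗ[K] V →ₗ[K] K)
    (h : ∀ m, f m ∈ dualSpace V) : M →ₗ[K] DualSpace V := f.codRestrict (dualSpace V) h

theorem toFun_dualLift (V : GrVect K Γ) {M : Type u} [AddCommGroup M] [Module K M]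
    (f : M →ₗ[K] V →ₗ[K] K) (h : ∀ m, f m ∈ dualSpace V) (m : M) :
    toFun V (dualLift V f h m) = f m := rfl

theorem dual_isInternal (V : GrVect K Γ) :
    DirectSum.IsInternal fun γ => (dualGr V γ).comap (toFun V) := by
  let φ : DualSpace V →ₗ[K] (Γ → (V →ₗ[K] K)) :=
    { toFun := fun f γ => toFun V f ∘ₗ V.component (DegreeIndex.dual γ)
      map_add' := fun f g => by ext; simp
      map_smul' := fun a f => by ext; simp }
  refine isInternal_of _ φ (toFun V) (toFun_injective V) ?_ ?_
  · intro γ f hf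
    ext1 δ
    refine (dualGr_component V (f := toFun V f) hf δ).trans ?_
    by_cases h : γ = δ
    · subst h
      simp
    · rw [if_neg h, Pi.single_eq_of_ne (Ne.symm h)]
  · apply Submodule.map_injective_of_injective (toFun_injective V)
    rw [Submodule.map_iSup, Submodule.map_top, range_toFun]
    refine iSup_congr fun γ => ?_
    rw [Submodule.map_comap_eq, range_toFun]
    exact inf_eq_right.2 (le_iSup (dualGr V) γ)

/-- The degreewise dual: the direct sum of the duals of the homogeneous components, as a space of
functionals on `V`, with `(V^*)_γ = Hom(V_{dual γ}, K)`. -/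
abbrev dualObj (V : GrVect K Γ) : GrVect K Γ where
  carrier := DualSpace V
  gr γ := (dualGr V γ).comap (toFun V)
  isInternal := dual_isInternal V

theorem mem_dual (V : GrVect K Γ) {γ : Γ} {f : V →ₗ[K] K} (hf : f ∈ dualGr V γ) :
    f ∈ dualSpace V := Submodule.mem_iSup_of_mem γ hf

theorem dual_coact (V : GrVect K Γ) (f : dualObj V) (γ : Γ) :
    toFun V ((dualObj V).coact f γ) = toFun V f ∘ₗ V.component (DegreeIndex.dual γ) := by
  refine (dualObj V).induction (p := fun f => toFun V ((dualObj V).coact f γ) =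
    toFun V f ∘ₗ V.component (DegreeIndex.dual γ)) f ?_ ?_ ?_
  · intro δ f hf
    rw [(dualObj V).coact_of_mem hf, dualGr_component V (f := toFun V f) hf]
    by_cases h : δ = γ <;> simp [h]
  · simp
  · intro f g hf hg
    simp only [map_add, Finsupp.add_apply, hf, hg, LinearMap.add_comp]

/-- Transpose of a degree-zero map. -/
def dualMap {V W : GrVect K Γ} (g : V ⟶ W) : dualObj W ⟶ dualObj V :=
  have h : ∀ γ, ∀ f ∈ dualGr W γ, f ∘ₗ g.lin ∈ dualGr V γ := fun _ _ hf δ hδ x hx =>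
    hf δ hδ _ (g.map_mem δ x hx)
  { lin := dualLift V (LinearMap.lcomp K K g.lin ∘ₗ toFun W) fun f => by
      have : dualSpace W ≤ (dualSpace V).comap (LinearMap.lcomp K K g.lin) :=
        iSup_le fun γ f hf => mem_dual V (h γ f hf)
      exact this (toFun_mem W f)
    map_mem := fun γ f hf => h γ _ hf }

theorem toFun_dualMap {V W : GrVect K Γ} (g : V ⟶ W) (f : DualSpace W) :
    toFun V ((dualMap g).lin f) = toFun W f ∘ₗ g.lin := rfl

/-- The pairing of `V^* ⊗ W^*` with `V ⊗ W` given by the Koszul sign rule,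
`⟨f ⊗ g, x ⊗ y⟩ = (-1)^{|g||x|} f(x) g(y)`; it can be nonzero only if `|g| = -|y|`, so that the
sign is `(-1)^{|x||y|}`. -/
def pairing (V W : GrVect K Γ) : DualSpace V ⊗[K] DualSpace W →ₗ[K] V ⊗[K] W →ₗ[K] K :=
  LinearMap.lcomp K K (signTwist V W) ∘ₗ TensorProduct.dualDistrib K V W ∘ₗ
    TensorProduct.map (toFun V) (toFun W)

theorem pairing_tmul (V W : GrVect K Γ) (f : DualSpace V) (g : DualSpace W) {i j : Γ} {x : V}
    (hx : x ∈ V.gr i) {y : W} (hy : y ∈ W.gr j) :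
    pairing V W (f ⊗ₜ g) (x ⊗ₜ y) = koszul K i j * (toFun V f x * toFun W g y) := by
  simp [pairing, signTwist_tmul V W hx hy]

theorem pairing_mem (V W : GrVect K Γ) {i j : Γ} {f : dualObj V} (hf : f ∈ (dualObj V).gr i)
    {g : dualObj W} (hg : g ∈ (dualObj W).gr j) :
    pairing V W (f ⊗ₜ g) ∈ dualGr (tensorObj' V W) (i + j) := by
  intro δ hδ z hz
  have : tensorGr V W δ ≤ LinearMap.ker (pairing V W (f ⊗ₜ g)) :=
    tensorGr_le V W fun a b hab x hx y hy => by
      rw [LinearMap.mem_ker, pairing_tmul V W f g hx hy]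
      by_cases ha : a = DegreeIndex.dual i
      · have hb : b ≠ DegreeIndex.dual j := fun hb => hδ (by rw [← hab, ha, hb, map_add])
        have : toFun W g y = 0 := hg b hb y hy
        simp [this]
      · have : toFun V f x = 0 := hf a ha x hx
        simp [this]
  exact this hz

/-- The comparison map `V^* ⊗ W^* → (V ⊗ W)^*`. -/
def dualTensor (V W : GrVect K Γ) :
    tensorObj' (dualObj V) (dualObj W) ⟶ dualObj (tensorObj' V W) where
  lin := dualLift (tensorObj' V W) (pairing V W) fun z => by
    refine tensor_induction (dualObj V) (dualObj W)
      (N := (dualSpace (tensorObj' V W)).comap (pairing V W)) (fun i j f hf g hg => ?_) z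
    exact mem_dual _ (pairing_mem V W hf hg)
  map_mem n z hz := tensorGr_le_comap (V := dualObj V) (W := dualObj W)
    (X := dualObj (tensorObj' V W)) (f := dualLift (tensorObj' V W) (pairing V W) _)
    (fun i j f hf g hg => pairing_mem V W hf hg) n z hz

theorem toFun_dualTensor (V W : GrVect K Γ) (z : DualSpace V ⊗[K] DualSpace W) :
    toFun (tensorObj' V W) ((dualTensor V W).lin z) = pairing V W z := rfl

/-- The comparison map `K → K^*`. -/
def dualUnit (K : Type u) [Field K] (Γ : Type) [DecidableEq Γ] [AddCommMonoid Γ] [DegreeIndex Γ] :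
    unitObj K Γ ⟶ dualObj (unitObj K Γ) :=
  have h : ∀ a : K, a • (LinearMap.id : K →ₗ[K] K) ∈ dualGr (unitObj K Γ) 0 := fun a δ hδ x hx => by
    rcases mem_unit_gr hx with rfl | rfl
    · exact absurd (map_zero _).symm hδ
    · simp
  { lin := dualLift (unitObj K Γ) (LinearMap.toSpanSingleton K (K →ₗ[K] K) LinearMap.id)
      fun a => mem_dual _ (h a)
    map_mem := fun γ x hx => by
      rcases mem_unit_gr hx with rfl | rfl
      · exact h x
      · erw [map_zero]
        exact zero_mem _ }

theorem toFun_dualUnit (a x : K) : toFun (unitObj K Γ) ((dualUnit K Γ).lin a) x = a * x := rfl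

theorem dual_hom_ext {X V : GrVect K Γ} {f g : X ⟶ dualObj V}
    (h : ∀ x, toFun V (f.lin x) = toFun V (g.lin x)) : f = g :=
  hom_ext <| LinearMap.ext fun x => toFun_injective V (h x)

/-- Degreewise linear duality, a contravariant functor. -/
def dual : (GrVect K Γ)ᵒᵖ ⥤ GrVect K Γ where
  obj V := dualObj V.unop
  map f := dualMap f.unop

end Dual

end GrVect

namespace GrVect

section DualMonoidal

variable [AddCommMonoid Γ] [DegreeIndex Γ]

theorem pairing_natural {V V' W W' : GrVect K Γ} (f : V' ⟶ V) (g : W' ⟶ W)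
    (z : DualSpace V ⊗[K] DualSpace W) :
    pairing V' W' (TensorProduct.map (dualMap f).lin (dualMap g).lin z) =
      pairing V W z ∘ₗ TensorProduct.map f.lin g.lin := by
  induction z with
  | zero => simp
  | add a b ha hb => simp only [map_add, ha, hb, LinearMap.add_comp]
  | tmul a b =>
    refine tensor_ext V' W' fun i x hx j y hy => ?_
    rw [TensorProduct.map_tmul, pairing_tmul V' W' _ _ hx hy, LinearMap.comp_apply,
      TensorProduct.map_tmul, pairing_tmul V W _ _ (f.map_mem i x hx) (g.map_mem j y hy)]
    rfl

theorem pairing_swap (V W : GrVect K Γ) (z : DualSpace V ⊗[K] DualSpace W) :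
    pairing W V (swapLin (dualObj V) (dualObj W) z) = pairing V W z ∘ₗ swapLin W V := by
  have : pairing W V ∘ₗ swapLin (dualObj V) (dualObj W) =
      LinearMap.lcomp K K (swapLin W V) ∘ₗ pairing V W :=
    tensor_ext (dualObj V) (dualObj W) fun i f hf j g hg => by
      refine tensor_ext W V fun b y hy a x hx => ?_
      simp only [LinearMap.comp_apply, swapLin_tmul (dualObj V) (dualObj W) hf hg, map_smul,
        LinearMap.lcomp_apply, swapLin_tmul W V hy hx, LinearMap.smul_apply,
        pairing_tmul W V g f hy hx, pairing_tmul V W f g hx hy]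
      by_cases ha : a = DegreeIndex.dual i
      · by_cases hb : b = DegreeIndex.dual j
        · have : koszul K i j = koszul K b a := by
            simp [koszul, ha, hb, DegreeIndex.deg_dual, mul_comm]
          rw [this, koszul_comm a b]
          simp [mul_comm]
        · have : toFun W g y = 0 := hg b hb y hy
          simp [this]
      · have : toFun V f x = 0 := hf a ha x hx
        simp [this]
  exact LinearMap.congr_fun this z

theorem pairing_assoc (U V W : GrVect K Γ) (f : DualSpace U) (g : DualSpace V) (h : DualSpace W) :
    pairing (tensorObj' U V) W ((dualTensor U V).lin (f ⊗ₜ g) ⊗ₜ h) ∘ₗ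
        (TensorProduct.assoc K U V W).symm.toLinearMap =
      pairing U (tensorObj' V W) (f ⊗ₜ (dualTensor V W).lin (g ⊗ₜ h)) := by
  refine tensor_ext_threefold' U V W fun i x hx j y hy k z hz => ?_
  have h1 := pairing_tmul (tensorObj' U V) W ((dualTensor U V).lin (f ⊗ₜ g)) h
    (tmul_mem U V rfl hx hy) hz
  have h2 := pairing_tmul U (tensorObj' V W) f ((dualTensor V W).lin (g ⊗ₜ h))
    hx (tmul_mem V W rfl hy hz)
  refine h1.trans (Eq.trans ?_ h2.symm)
  rw [toFun_dualTensor, toFun_dualTensor, pairing_tmul U V f g hx hy, pairing_tmul V W g h hy hz,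
    koszul_add_left, koszul_add_right]
  ring

/-- Duality is a lax symmetric monoidal functor through the comparison maps above. -/
instance : (dual (K := K) (Γ := Γ)).LaxBraided where
  ε := dualUnit K Γ
  μ V W := dualTensor V.unop W.unop
  μ_natural_left f W := dual_hom_ext fun z => pairing_natural f.unop (𝟙 W.unop) z
  μ_natural_right W f := dual_hom_ext fun z => pairing_natural (𝟙 W.unop) f.unop z
  associativity U V W := hom_ext <| TensorProduct.ext_threefold fun f g h =>
    toFun_injective _ (pairing_assoc U.unop V.unop W.unop f g h)
  left_unitality V := hom_ext <| TensorProduct.ext' fun (a : K) f => toFun_injective _ <|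
    V.unop.lin_ext fun i x hx => Eq.symm <| by
      refine (pairing_tmul (unitObj K Γ) V.unop ((dualUnit K Γ).lin a) f (mem_unit_gr_zero 1)
        hx).trans ?_
      rw [koszul_zero_left, toFun_dualUnit]
      simp only [mul_one, one_mul]
      exact (LinearMap.congr_fun ((toFun V.unop).map_smul a f) x).symm
  right_unitality V := hom_ext <| TensorProduct.ext' fun f (a : K) => toFun_injective _ <|
    V.unop.lin_ext fun i x hx => Eq.symm <| by
      refine (pairing_tmul V.unop (unitObj K Γ) f ((dualUnit K Γ).lin a) hx
        (mem_unit_gr_zero 1)).trans ?_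
      rw [koszul_zero_right, toFun_dualUnit]
      rw [mul_one, one_mul, mul_comm]
      exact (LinearMap.congr_fun ((toFun V.unop).map_smul a f) x).symm
  braided V W := dual_hom_ext fun z => (pairing_swap V.unop W.unop z).symm

end DualMonoidal
end GrVect

end GradedBasics

/-! ### Algebras and coalgebras in a symmetric monoidal category -/

section Monoids

universe v w

variable (C : Type w) [Category.{v} C] [MonoidalCategory C] [SymmetricCategory C]

/-- Commutative monoids, as a property of monoids. -/
def isComm : ObjectProperty (Mon C) := fun A => IsCommMonObj A.X

/-- Cocommutative comonoids, as a property of comonoids. -/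
def isCocomm : ObjectProperty (Comon C) := fun A => IsCommComonObj A.X

instance : (isComm C).IsMonoidal where
  prop_unit := inferInstanceAs (IsCommMonObj (𝟙_ C))
  prop_tensor A B hA hB := by
    have : IsCommMonObj A.X := hA
    have : IsCommMonObj B.X := hB
    exact inferInstanceAs (IsCommMonObj (A.X ⊗ B.X))

variable {C} in
theorem tensorμ_braiding' (X Y : C) :
    tensorμ X Y X Y ≫ (β_ (X ⊗ X) (Y ⊗ Y)).hom =
      ((β_ X Y).hom ⊗ₘ (β_ X Y).hom) ≫ tensorμ Y X Y X := by
  simp only [tensorμ, Category.assoc,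
    BraidedCategory.braiding_tensor_right_hom, BraidedCategory.braiding_tensor_left_hom,
    comp_whiskerRight, whisker_assoc, MonoidalCategory.whiskerLeft_comp, pentagon_assoc,
    pentagon_inv_hom_hom_hom_inv_assoc, Iso.inv_hom_id_assoc, whiskerLeft_hom_inv_assoc]
  slice_lhs 3 4 =>
    rw [← MonoidalCategory.whiskerLeft_comp, ← comp_whiskerRight, SymmetricCategory.symmetry]
  simp only [id_whiskerRight, MonoidalCategory.whiskerLeft_id, Category.id_comp, Category.assoc,
    pentagon_inv_assoc, Iso.hom_inv_id_assoc]
  slice_lhs 1 2 =>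
    rw [← associator_inv_naturality_left]
  slice_lhs 2 3 =>
    rw [Iso.inv_hom_id]
  rw [Category.id_comp]
  slice_lhs 2 3 =>
    rw [← associator_naturality_right]
  slice_lhs 1 2 =>
    rw [← MonoidalCategory.tensorHom_def]
  simp only [Category.assoc]

variable {C} in
theorem tensorδ_eq (X Y : C) : tensorδ X Y X Y = tensorμ X X Y Y := by
  simp only [tensorδ, tensorμ, SymmetricCategory.braiding_swap_eq_inv_braiding Y X]

variable {C} in
theorem tensorμ_braiding (A B : C) :
    tensorμ A A B B ≫ ((β_ A B).hom ⊗ₘ (β_ A B).hom) =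
      (β_ (A ⊗ A) (B ⊗ B)).hom ≫ tensorμ B B A A := by
  have h := tensorμ_braiding' A B
  rw [← tensorδ_eq, ← tensorδ_eq]
  have h' : (tensorδ A B A B ≫ tensorμ A B A B) ≫ (β_ (A ⊗ A) (B ⊗ B)).hom ≫ tensorδ B A B A =
      tensorδ A B A B ≫ ((β_ A B).hom ⊗ₘ (β_ A B).hom) ≫ (tensorμ B A B A ≫ tensorδ B A B A) := by
    simp only [Category.assoc]
    rw [reassoc_of% h]
  rw [tensorδ_tensorμ, tensorμ_tensorδ, Category.id_comp, Category.comp_id] at h'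
  exact h'.symm

variable {C} in
open ComonObj in
theorem comon_braiding_isHom (A B : C) [ComonObj A] [ComonObj B] :
    IsComonHom (β_ A B).hom where
  hom_counit := by
    rw [Comon.tensorObj_counit, Comon.tensorObj_counit,
      ← BraidedCategory.braiding_naturality_assoc]
    simp [← unitors_equal]
  hom_comul := by
    rw [Comon.tensorObj_comul, Comon.tensorObj_comul, Category.assoc, tensorμ_braiding,
      BraidedCategory.braiding_naturality_assoc]

instance : BraidedCategory (Comon C) :=
  .ofFaithful (Comon.forget C)
    (fun A B =>
      have : IsComonHom (M := (A ⊗ B).X) (N := (B ⊗ A).X) (β_ A.X B.X).hom :=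
        comon_braiding_isHom A.X B.X
      Comon.mkIso' (M := A ⊗ B) (N := B ⊗ A) (β_ A.X B.X))
    (fun _ _ => (Category.id_comp _).trans (Category.comp_id _).symm)

instance : (Comon.forget C).Braided where
  braided A B := (Category.id_comp _).trans (Category.comp_id (β_ A.X B.X).hom).symm

instance : SymmetricCategory (Comon C) := .ofFaithful (Comon.forget C)

instance : (isCocomm C).IsMonoidal where
  prop_unit := by
    let := ComonObj.instTensorUnit C
    exact inferInstanceAs (IsCommComonObj (𝟙_ C))
  prop_tensor A B hA hB := by
    have : IsCommComonObj A.X := hA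
    have : IsCommComonObj B.X := hB
    exact inferInstanceAs (IsCommComonObj (A.X ⊗ B.X))

end Monoids

/-! ### The categories of (weight graded) algebras and coalgebras -/

section Categories

variable (K : Type u) [Field K]

/-- The component `V^{(n)} = ⨁_z V_{(n, z)}` of weight `n` of a weight graded object. -/
def weightPart {K : Type u} [Field K] (V : GrVect K (ℕ × ℤ)) (n : ℕ) : Submodule K V :=
  ⨆ z : ℤ, V.gr (n, z)

/-- Weight graded objects all of whose weight components are finite dimensional. -/
def finWeight : ObjectProperty (GrVect K (ℕ × ℤ)) := fun V =>
  ∀ n, FiniteDimensional K (weightPart V n)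

theorem gr_le_weightPart {K : Type u} [Field K] (V : GrVect K (ℕ × ℤ)) (p : ℕ × ℤ) :
    V.gr p ≤ weightPart V p.1 := le_iSup (fun z => V.gr (p.1, z)) p.2

theorem finWeight_of_le {K : Type u} [Field K] {V : GrVect K (ℕ × ℤ)} (N : ℕ → Submodule K V)
    [∀ n, FiniteDimensional K (N n)] (h : ∀ n z, V.gr (n, z) ≤ N n) : finWeight K V := fun n =>
  Submodule.finiteDimensional_of_le (iSup_le fun z => h n z)

instance : (finWeight K).IsMonoidal where
  prop_unit := finWeight_of_le (V := GrVect.unitObj K (ℕ × ℤ)) (fun _ => ⊤) fun _ _ => le_top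
  prop_tensor V W hV hW := by
    have hV' : ∀ n, FiniteDimensional K (weightPart V n) := hV
    have hW' : ∀ n, FiniteDimensional K (weightPart W n) := hW
    have hfin : ∀ n, FiniteDimensional K ↥(⨆ p : Finset.HasAntidiagonal.antidiagonal n,
        Submodule.map₂ (TensorProduct.mk K V W) (weightPart V p.1.1) (weightPart W p.1.2)) := by
      intro n
      have : ∀ p : Finset.HasAntidiagonal.antidiagonal n, FiniteDimensional K ↥(Submodule.map₂
          (TensorProduct.mk K V W) (weightPart V p.1.1) (weightPart W p.1.2)) := fun p =>
        Module.Finite.iff_fg.2 (Submodule.FG.map₂ _ (Module.Finite.iff_fg.1 (hV' _))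
          (Module.Finite.iff_fg.1 (hW' _)))
      infer_instance
    refine finWeight_of_le (V := GrVect.tensorObj' V W) (fun n => ⨆ p :
        Finset.HasAntidiagonal.antidiagonal n, Submodule.map₂ (TensorProduct.mk K V W)
          (weightPart V p.1.1) (weightPart W p.1.2)) fun n z => ?_
    refine GrVect.tensorGr_le V W fun i j hij x hx y hy => ?_
    have hp : (i.1, j.1) ∈ Finset.HasAntidiagonal.antidiagonal n := by
      rw [Finset.HasAntidiagonal.mem_antidiagonal]
      exact congrArg Prod.fst hij
    exact Submodule.mem_iSup_of_mem ⟨(i.1, j.1), hp⟩ (Submodule.apply_mem_map₂ _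
      (gr_le_weightPart V i hx) (gr_le_weightPart W j hy))

/-- Unital associative graded algebras. -/
abbrev AssAlg := Mon (GrVect K ℤ)

/-- Unital graded commutative algebras. -/
abbrev ComAlg := (isComm (GrVect K ℤ)).FullSubcategory

/-- Counital coassociative graded coalgebras. -/
abbrev AssCoalg := Comon (GrVect K ℤ)

/-- Counital cocommutative graded coalgebras. -/
abbrev ComCoalg := (isCocomm (GrVect K ℤ)).FullSubcategory

/-- Weight graded algebras with finite dimensional weight components. -/
def wgAss : ObjectProperty (Mon (GrVect K (ℕ × ℤ))) := fun A => finWeight K A.X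

/-- Commutative weight graded algebras with finite dimensional weight components. -/
def wgCom : ObjectProperty (Mon (GrVect K (ℕ × ℤ))) := fun A => wgAss K A ∧ isComm _ A

/-- Weight graded coalgebras with finite dimensional weight components. -/
def wgAssCo : ObjectProperty (Comon (GrVect K (ℕ × ℤ))) := fun A => finWeight K A.X

/-- Cocommutative weight graded coalgebras with finite dimensional weight components. -/
def wgComCo : ObjectProperty (Comon (GrVect K (ℕ × ℤ))) := fun A => wgAssCo K A ∧ isCocomm _ A

instance : (wgAss K).IsMonoidal where
  prop_unit := (finWeight K).prop_unit
  prop_tensor _ _ hA hB := ObjectProperty.prop_tensor (P₁ := finWeight K) (P₂ := finWeight K)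
    (Q := finWeight K) hA hB

instance : (wgCom K).IsMonoidal where
  prop_unit := ⟨(wgAss K).prop_unit, (isComm _).prop_unit⟩
  prop_tensor _ _ hA hB := ⟨ObjectProperty.prop_tensor (P₁ := wgAss K) (P₂ := wgAss K)
    (Q := wgAss K) hA.1 hB.1, ObjectProperty.prop_tensor (P₁ := isComm _) (P₂ := isComm _)
    (Q := isComm _) hA.2 hB.2⟩

instance : (wgAssCo K).IsMonoidal where
  prop_unit := (finWeight K).prop_unit
  prop_tensor _ _ hA hB := ObjectProperty.prop_tensor (P₁ := finWeight K) (P₂ := finWeight K)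
    (Q := finWeight K) hA hB

instance : (wgComCo K).IsMonoidal where
  prop_unit := ⟨(wgAssCo K).prop_unit, (isCocomm _).prop_unit⟩
  prop_tensor _ _ hA hB := ⟨ObjectProperty.prop_tensor (P₁ := wgAssCo K) (P₂ := wgAssCo K)
    (Q := wgAssCo K) hA.1 hB.1, ObjectProperty.prop_tensor (P₁ := isCocomm _) (P₂ := isCocomm _)
    (Q := isCocomm _) hA.2 hB.2⟩

abbrev WgAssAlg := (wgAss K).FullSubcategory

abbrev WgComAlg := (wgCom K).FullSubcategory

abbrev WgAssCoalg := (wgAssCo K).FullSubcategory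

abbrev WgComCoalg := (wgComCo K).FullSubcategory

/-- Forgetting the weight: `V ↦ ⨁_n V^{(n)}`. -/
def forgetWeight : GrVect K (ℕ × ℤ) ⥤ GrVect K ℤ := GrVect.regrade (AddMonoidHom.snd ℕ ℤ)

instance : (forgetWeight K).Monoidal := GrVect.regradeMonoidal (AddMonoidHom.snd ℕ ℤ)

instance : (forgetWeight K).Braided where
  braided V W := GrVect.hom_ext
    (GrVect.regrade_swap (AddMonoidHom.snd ℕ ℤ) (fun _ => rfl) V W)

/-! ### The inclusion functors -/

/-- The inclusion of commutative algebras into associative algebras. -/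
def comToAss : ComAlg K ⥤ AssAlg K := (isComm _).ι

def comCoToAssCo : ComCoalg K ⥤ AssCoalg K := (isCocomm _).ι

def wgComToWgAss : WgComAlg K ⥤ WgAssAlg K := ObjectProperty.ιOfLE fun _ h => h.1

def wgComCoToWgAssCo : WgComCoalg K ⥤ WgAssCoalg K := ObjectProperty.ιOfLE fun _ h => h.1

def wgAssToAss : WgAssAlg K ⥤ AssAlg K := (wgAss K).ι ⋙ (forgetWeight K).mapMon

def wgAssCoToAssCo : WgAssCoalg K ⥤ AssCoalg K := (wgAssCo K).ι ⋙ (forgetWeight K).mapComon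

def wgComToCom : WgComAlg K ⥤ ComAlg K :=
  (isComm _).lift ((wgCom K).ι ⋙ (forgetWeight K).mapMon) fun A => by
    have : IsCommMonObj A.obj.X := A.property.2
    exact Functor.isCommMonObj_obj (F := forgetWeight K) (M := A.obj.X)

/-- A braided functor preserves cocommutativity. -/
theorem mapComon_isCocomm {C D : Type*} [Category* C] [MonoidalCategory C] [SymmetricCategory C]
    [Category* D] [MonoidalCategory D] [SymmetricCategory D] (F : C ⥤ D) [F.Braided]
    (A : Comon C) (hA : isCocomm C A) : isCocomm D (F.mapComon.obj A) := by
  have : IsCommComonObj A.X := hA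
  constructor
  change (F.map ComonObj.comul ≫ Functor.OplaxMonoidal.δ F A.X A.X) ≫
    (β_ (F.obj A.X) (F.obj A.X)).hom = F.map ComonObj.comul ≫ Functor.OplaxMonoidal.δ F A.X A.X
  have h := Functor.map_braiding F A.X A.X
  rw [Category.assoc, ← cancel_mono (Functor.LaxMonoidal.μ F A.X A.X)]
  simp only [Category.assoc, ← h, Functor.Monoidal.δ_μ, Category.comp_id]
  rw [← F.map_comp, IsCommComonObj.comul_comm]

def wgComCoToComCo : WgComCoalg K ⥤ ComCoalg K :=
  (isCocomm _).lift ((wgComCo K).ι ⋙ (forgetWeight K).mapComon) fun A =>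
    mapComon_isCocomm _ _ A.property.2

/-! ### Weightwise linear duality from coalgebras to algebras -/

/-- The algebra structure on the dual of a coalgebra. -/
def dualAlg : (Comon (GrVect K (ℕ × ℤ)))ᵒᵖ ⥤ Mon (GrVect K (ℕ × ℤ)) :=
  (Comon.Comon_EquivMon_OpOp _).functor.leftOp ⋙ (GrVect.dual).mapMon

theorem finWeight_dual (V : GrVect K (ℕ × ℤ)) (hV : finWeight K V) :
    finWeight K (GrVect.dualObj V) := by
  intro n
  have hfin : FiniteDimensional K (weightPart V n) := hV n
  let r : weightPart (GrVect.dualObj V) n →ₗ[K] weightPart V n →ₗ[K] K :=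
    LinearMap.lcomp K K (weightPart V n).subtype ∘ₗ GrVect.toFun V ∘ₗ
      (weightPart (GrVect.dualObj V) n).subtype
  refine FiniteDimensional.of_injective r ?_
  rw [← LinearMap.ker_eq_bot, LinearMap.ker_eq_bot']
  intro f hf
  have h1 : weightPart (GrVect.dualObj V) n ≤
      (⨅ δ : {δ : ℕ × ℤ // δ.1 ≠ n}, (Submodule.comap (GrVect.toFun V)
        (Submodule.dualAnnihilator (V.gr δ)))) := by
    refine iSup_le fun z g hg => Submodule.mem_iInf _ |>.2 fun δ => ?_
    rw [Submodule.mem_comap, Submodule.mem_dualAnnihilator]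
    intro x hx
    exact hg δ.1 (fun h => δ.2 (congrArg Prod.fst h)) x hx
  apply Subtype.ext
  apply GrVect.toFun_injective
  rw [Submodule.coe_zero, map_zero]
  refine V.lin_ext fun δ x hx => ?_
  by_cases h : δ.1 = n
  · subst h
    exact LinearMap.congr_fun hf ⟨x, gr_le_weightPart V δ hx⟩
  · have h2 := (Submodule.mem_iInf _).1 (h1 f.2) ⟨δ, h⟩
    rw [Submodule.mem_comap, Submodule.mem_dualAnnihilator] at h2
    exact h2 x hx

def dualWgAss : (WgAssCoalg K)ᵒᵖ ⥤ WgAssAlg K :=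
  (wgAss K).lift ((wgAssCo K).ι.op ⋙ dualAlg K) fun A => finWeight_dual K _ A.unop.property

def dualWgCom : (WgComCoalg K)ᵒᵖ ⥤ WgComAlg K :=
  (wgCom K).lift ((wgComCo K).ι.op ⋙ dualAlg K) fun A =>
    ⟨finWeight_dual K _ A.unop.property.1, by
      have : IsCommComonObj A.unop.obj.X := A.unop.property.2
      let := Comon.ComonToMonOpOpObjMon A.unop.obj
      have : IsCommMonObj (Opposite.op A.unop.obj.X) := by
        constructor
        apply Quiver.Hom.unop_inj
        exact IsCommComonObj.comul_comm A.unop.obj.X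
      exact Functor.isCommMonObj_obj (F := GrVect.dual) (M := Opposite.op A.unop.obj.X)⟩

end Categories

/-! ### Direct sums and homogeneous subspaces -/

namespace GrVect

section Sum

variable {K : Type u} [Field K] {Γ : Type} [DecidableEq Γ]

/-- The direct sum of graded vector spaces. -/
abbrev sumObj (V W : GrVect K Γ) : GrVect K Γ where
  carrier := V × W
  gr γ := (V.gr γ).prod (W.gr γ)
  isInternal := by
    refine isInternal_of _ (LinearMap.pi fun γ => (V.component γ).prodMap (W.component γ))
      LinearMap.id Function.injective_id ?_ ?_
    · rintro γ ⟨x, y⟩ ⟨hx, hy⟩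
      ext1 δ
      simp only [LinearMap.pi_apply, LinearMap.prodMap_apply, V.component_of_mem hx,
        W.component_of_mem hy, LinearMap.id_apply]
      by_cases h : γ = δ
      · subst h
        simp
      · rw [if_neg h, if_neg h, Pi.single_eq_of_ne (Ne.symm h)]
        rfl
    · rw [eq_top_iff]
      rintro ⟨x, y⟩ -
      have h1 : x ∈ (⨆ γ, (V.gr γ).prod (W.gr γ)).comap (LinearMap.inl K V W) := by
        refine V.induction (p := fun x => x ∈ Submodule.comap (LinearMap.inl K V W) _) x
          (fun γ x hx => Submodule.mem_iSup_of_mem γ ⟨hx, zero_mem _⟩) (zero_mem _)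
          fun _ _ => add_mem
      have h2 : y ∈ (⨆ γ, (V.gr γ).prod (W.gr γ)).comap (LinearMap.inr K V W) := by
        refine W.induction (p := fun x => x ∈ Submodule.comap (LinearMap.inr K V W) _) y
          (fun γ x hx => Submodule.mem_iSup_of_mem γ ⟨zero_mem _, hx⟩) (zero_mem _)
          fun _ _ => add_mem
      have h3 := add_mem (Submodule.mem_comap.1 h1) (Submodule.mem_comap.1 h2)
      simpa using h3

/-- The zero graded vector space. -/
abbrev zeroObj (K : Type u) [Field K] (Γ : Type) [DecidableEq Γ] : GrVect K Γ where
  carrier := PUnit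
  gr _ := ⊤
  isInternal := by
    refine isInternal_of _ 0 LinearMap.id Function.injective_id (fun _ _ _ => ?_) ?_
    · ext
    · rw [eq_top_iff]
      exact fun _ _ => zero_mem _

def inl (V W : GrVect K Γ) : V ⟶ sumObj V W where
  lin := LinearMap.inl K V W
  map_mem _ _ hx := ⟨hx, zero_mem _⟩

def inr (V W : GrVect K Γ) : W ⟶ sumObj V W where
  lin := LinearMap.inr K V W
  map_mem _ _ hx := ⟨zero_mem _, hx⟩

def sumHom {V V' W W' : GrVect K Γ} (f : V ⟶ V') (g : W ⟶ W') : sumObj V W ⟶ sumObj V' W' where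
  lin := f.lin.prodMap g.lin
  map_mem γ _ hx := ⟨f.map_mem γ _ hx.1, g.map_mem γ _ hx.2⟩

def sumAssoc (U V W : GrVect K Γ) : sumObj (sumObj U V) W ⟶ sumObj U (sumObj V W) where
  lin := (LinearEquiv.prodAssoc K U V W).toLinearMap
  map_mem _ _ hx := ⟨hx.1.1, hx.1.2, hx.2⟩

def sumAssocInv (U V W : GrVect K Γ) : sumObj U (sumObj V W) ⟶ sumObj (sumObj U V) W where
  lin := (LinearEquiv.prodAssoc K U V W).symm.toLinearMap
  map_mem _ _ hx := ⟨⟨hx.1, hx.2.1⟩, hx.2.2⟩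

def sumFst (V W : GrVect K Γ) : sumObj V W ⟶ V where
  lin := LinearMap.fst K V W
  map_mem _ _ hx := hx.1

def sumSnd (V W : GrVect K Γ) : sumObj V W ⟶ W where
  lin := LinearMap.snd K V W
  map_mem _ _ hx := hx.2

def sumComm (V W : GrVect K Γ) : sumObj V W ⟶ sumObj W V where
  lin := (LinearEquiv.prodComm K V W).toLinearMap
  map_mem _ _ hx := ⟨hx.2, hx.1⟩

end Sum

section Homogeneous

variable {K : Type u} [Field K] {Γ Δ : Type} [DecidableEq Γ] [DecidableEq Δ]

theorem IsHomogeneous.of_span {V : GrVect K Γ} {N : Submodule K V}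
    (h : N ≤ ⨆ γ, N ⊓ V.gr γ) : IsHomogeneous V N := by
  intro x hx γ
  have : (⨆ γ, N ⊓ V.gr γ) ≤ N.comap (V.component γ) := iSup_le fun δ y hy => by
    rw [Submodule.mem_comap, V.component_of_mem hy.2]
    split_ifs
    · exact hy.1
    · exact zero_mem _
  exact this (h hx)

theorem IsHomogeneous.span {V : GrVect K Γ} {N : Submodule K V} (h : IsHomogeneous V N) :
    N ≤ ⨆ γ, N ⊓ V.gr γ := by
  intro x hx
  rw [← V.coact_sum x, Finsupp.lsum_apply]
  exact Submodule.sum_mem _ fun γ _ => Submodule.mem_iSup_of_mem γ ⟨h x hx γ, V.coact_mem x γ⟩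

theorem IsHomogeneous.map {V : GrVect K Γ} {W : GrVect K Δ} {N : Submodule K V}
    (hN : IsHomogeneous V N) (φ : Γ → Δ) (f : V →ₗ[K] W)
    (hf : ∀ γ, ∀ x ∈ V.gr γ, f x ∈ W.gr (φ γ)) : IsHomogeneous W (N.map f) := by
  apply IsHomogeneous.of_span
  refine (Submodule.map_mono hN.span).trans ?_
  rw [Submodule.map_iSup]
  refine iSup_le fun γ => ?_
  rintro _ ⟨x, hx, rfl⟩
  exact Submodule.mem_iSup_of_mem (φ γ) ⟨⟨x, hx.1, rfl⟩, hf γ x hx.2⟩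

theorem IsHomogeneous.top (V : GrVect K Γ) : IsHomogeneous V ⊤ := fun _ _ _ => trivial

theorem IsHomogeneous.bot (V : GrVect K Γ) : IsHomogeneous V ⊥ := by
  rintro x hx γ
  obtain rfl := (Submodule.mem_bot K).1 hx
  simp

theorem IsHomogeneous.range {V W : GrVect K Γ} (f : V ⟶ W) :
    IsHomogeneous W (LinearMap.range f.lin) := by
  rintro _ ⟨x, rfl⟩ γ
  exact ⟨V.coact x γ, (f.coact_lin x γ).symm⟩

theorem IsHomogeneous.sup {V : GrVect K Γ} {N P : Submodule K V} (hN : IsHomogeneous V N)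
    (hP : IsHomogeneous V P) : IsHomogeneous V (N ⊔ P) := by
  intro x hx γ
  obtain ⟨y, hy, z, hz, rfl⟩ := Submodule.mem_sup.1 hx
  rw [map_add, Finsupp.add_apply]
  exact Submodule.add_mem_sup (hN y hy γ) (hP z hz γ)

theorem IsHomogeneous.inf {V : GrVect K Γ} {N P : Submodule K V} (hN : IsHomogeneous V N)
    (hP : IsHomogeneous V P) : IsHomogeneous V (N ⊓ P) := fun x hx γ =>
  ⟨hN x hx.1 γ, hP x hx.2 γ⟩

end Homogeneous

end GrVect

/-! ### Quadratic data -/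

section QuadData

open GrVect

variable {K : Type u} [Field K]

/-- The three ways of combining relations in a product of quadratic data: adding `[V, W]_-`,
adding `[V, W]_+`, adding nothing. -/
inductive Mixing : Type
  | minus
  | plus
  | none

/-- The square `f ⊗ f` of a linear map. -/
abbrev sq {V W : GrVect K ℤ} (f : V ⟶ W) : V ⊗[K] V →ₗ[K] W ⊗[K] W :=
  TensorProduct.map f.lin f.lin

/-- `x ⊗ y ↦ x ⊗ y ± (-1)^{|x||y|} y ⊗ x`, or zero. -/
def symLin (m : Mixing) (V : GrVect K ℤ) : V ⊗[K] V →ₗ[K] V ⊗[K] V :=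
  match m with
  | .minus => LinearMap.id - swapLin V V
  | .plus => LinearMap.id + swapLin V V
  | .none => 0

theorem symLin_natural (m : Mixing) {V W : GrVect K ℤ} (f : V ⟶ W) (z : V ⊗[K] V) :
    symLin m W (sq f z) = sq f (symLin m V z) := by
  have h : swapLin W W (sq f z) = sq f (swapLin V V z) :=
    LinearMap.congr_fun (swapLin_natural f f) z
  cases m <;> simp [symLin, h]

theorem symLin_swap (m : Mixing) {V : GrVect K ℤ} (z : V ⊗[K] V) :
    symLin m V (swapLin V V z) = symLin m V z ∨ symLin m V (swapLin V V z) = -symLin m V z := by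
  have h : swapLin V V (swapLin V V z) = z := LinearMap.congr_fun (swapLin_swapLin V V) z
  cases m
  · right
    simp [symLin, h]
  · left
    simp [symLin, h, add_comm]
  · left
    simp [symLin]

theorem symLin_mem (m : Mixing) (V : GrVect K ℤ) (n : ℤ) (z : V ⊗[K] V)
    (hz : z ∈ (tensorObj' V V).gr n) : symLin m V z ∈ (tensorObj' V V).gr n := by
  have h := swapLin_mem V V n z hz
  cases m
  · exact sub_mem hz h
  · exact add_mem hz h
  · exact zero_mem _

/-- `V^{⊙2}`, spanned by the `x ⊗ y + (-1)^{|x||y|} y ⊗ x`. -/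
def symSquare (V : GrVect K ℤ) : Submodule K (V ⊗[K] V) := LinearMap.range (symLin .plus V)

/-- `V^{∧2}`, spanned by the `x ⊗ y - (-1)^{|x||y|} y ⊗ x`. -/
def extSquare (V : GrVect K ℤ) : Submodule K (V ⊗[K] V) := LinearMap.range (symLin .minus V)

theorem range_symLin_homogeneous (m : Mixing) (V : GrVect K ℤ) :
    IsHomogeneous (tensorObj' V V) (LinearMap.range (symLin m V)) :=
  IsHomogeneous.range (V := tensorObj' V V) (W := tensorObj' V V) ⟨symLin m V, symLin_mem m V⟩

/-- `[V, W]_± ⊆ (V ⊕ W) ⊗ (V ⊕ W)`, spanned by the `v ⊗ w ± (-1)^{|v||w|} w ⊗ v` with `v ∈ V`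
and `w ∈ W`; zero for `m = none`. -/
def mixed (m : Mixing) (V W : GrVect K ℤ) :
    Submodule K (sumObj V W ⊗[K] sumObj V W) :=
  LinearMap.range (symLin m (sumObj V W) ∘ₗ TensorProduct.map (inl V W).lin (inr V W).lin)

theorem mixed_homogeneous (m : Mixing) (V W : GrVect K ℤ) :
    IsHomogeneous (tensorObj' (sumObj V W) (sumObj V W)) (mixed m V W) :=
  IsHomogeneous.range (V := tensorObj' V W) (W := tensorObj' (sumObj V W) (sumObj V W))
    ((tensorHom' (inl V W) (inr V W)) ≫
      (⟨symLin m _, symLin_mem m _⟩ : tensorObj' (sumObj V W) (sumObj V W) ⟶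
        tensorObj' (sumObj V W) (sumObj V W)))

/-- Quadratic data `(V, R)`: a finite dimensional graded vector space `V` and a graded subspace `R`
of `V ⊗ V`. The parameter `m` only records which monoidal product is considered. -/
structure QD (K : Type u) [Field K] (m : Mixing) : Type (u + 1) where
  V : GrVect K ℤ
  finite : FiniteDimensional K V
  R : Submodule K (V ⊗[K] V)
  homogeneous : IsHomogeneous (tensorObj' V V) R

namespace QD

variable {m : Mixing}

/-- Degree-zero maps `f` with `(f ⊗ f)(R) ⊆ S`. -/
@[ext]
structure Hom (X Y : QD K m) where
  hom : X.V ⟶ Y.V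
  map_le : X.R ≤ Y.R.comap (sq hom)

instance : Category (QD K m) where
  Hom X Y := Hom X Y
  id X := ⟨𝟙 X.V, fun x hx => by
    rw [Submodule.mem_comap, sq, id_lin, TensorProduct.map_id]
    exact hx⟩
  comp f g := ⟨f.hom ≫ g.hom, fun x hx => by
    rw [Submodule.mem_comap, sq, comp_lin, TensorProduct.map_comp]
    exact g.map_le (f.map_le hx)⟩
  id_comp f := Hom.ext (Category.id_comp f.hom)
  comp_id f := Hom.ext (Category.comp_id f.hom)
  assoc f g h := Hom.ext (Category.assoc f.hom g.hom h.hom)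

@[ext] theorem hom_ext {X Y : QD K m} {f g : X ⟶ Y} (h : f.hom.lin = g.hom.lin) : f = g :=
  Hom.ext (GrVect.hom_ext h)

/-- The product of quadratic data, `(V ⊕ W, R ⊕ [V, W] ⊕ S)`. -/
abbrev prod (X Y : QD K m) : QD K m where
  V := sumObj X.V Y.V
  finite := by
    have := X.finite
    have := Y.finite
    exact inferInstanceAs (FiniteDimensional K (X.V × Y.V))
  R := X.R.map (sq (inl X.V Y.V)) ⊔ mixed m X.V Y.V ⊔ Y.R.map (sq (inr X.V Y.V))
  homogeneous := ((X.homogeneous.map id (W := tensorObj' (sumObj X.V Y.V) (sumObj X.V Y.V)) _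
    (tensorHom' (inl X.V Y.V) (inl X.V Y.V)).map_mem).sup (mixed_homogeneous m X.V Y.V)).sup
      (Y.homogeneous.map id (W := tensorObj' (sumObj X.V Y.V) (sumObj X.V Y.V)) _
    (tensorHom' (inr X.V Y.V) (inr X.V Y.V)).map_mem)

/-- The unit `(0, 0)`. -/
abbrev unit (K : Type u) [Field K] (m : Mixing) : QD K m where
  V := zeroObj K ℤ
  finite := inferInstanceAs (FiniteDimensional K PUnit)
  R := ⊥
  homogeneous := IsHomogeneous.bot _

theorem inl_mem (X Y : QD K m) {z : X.V ⊗[K] X.V} (hz : z ∈ X.R) :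
    sq (inl X.V Y.V) z ∈ (prod X Y).R :=
  Submodule.mem_sup_left (Submodule.mem_sup_left ⟨z, hz, rfl⟩)

theorem inr_mem (X Y : QD K m) {z : Y.V ⊗[K] Y.V} (hz : z ∈ Y.R) :
    sq (inr X.V Y.V) z ∈ (prod X Y).R :=
  Submodule.mem_sup_right ⟨z, hz, rfl⟩

theorem mixed_mem (X Y : QD K m) (x : X.V) (y : Y.V) :
    symLin m (sumObj X.V Y.V) ((inl X.V Y.V).lin x ⊗ₜ (inr X.V Y.V).lin y) ∈ (prod X Y).R :=
  Submodule.mem_sup_left (Submodule.mem_sup_right ⟨x ⊗ₜ y, rfl⟩)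

theorem mixed_mem' (X Y : QD K m) (x : X.V) (y : Y.V) :
    symLin m (sumObj X.V Y.V) ((inr X.V Y.V).lin y ⊗ₜ (inl X.V Y.V).lin x) ∈ (prod X Y).R := by
  have : LinearMap.range (symLin m (sumObj X.V Y.V) ∘ₗ
      TensorProduct.map (inr X.V Y.V).lin (inl X.V Y.V).lin) ≤ (prod X Y).R := by
    rw [LinearMap.range_le_iff_comap, eq_top_iff]
    rintro z -
    refine tensor_induction Y.V X.V (fun i j y hy x hx => ?_) z
    rw [Submodule.mem_comap, LinearMap.comp_apply, TensorProduct.map_tmul]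
    have h := swapLin_tmul (sumObj X.V Y.V) (sumObj X.V Y.V) ((inl X.V Y.V).map_mem j x hx)
      ((inr X.V Y.V).map_mem i y hy)
    have h' : (inr X.V Y.V).lin y ⊗ₜ[K] (inl X.V Y.V).lin x = koszul K j i •
        swapLin (sumObj X.V Y.V) (sumObj X.V Y.V)
          ((inl X.V Y.V).lin x ⊗ₜ[K] (inr X.V Y.V).lin y) := by
      rw [h, smul_smul, koszul_mul_self, one_smul]
    rw [h', map_smul]
    apply Submodule.smul_mem
    rcases symLin_swap m ((inl X.V Y.V).lin x ⊗ₜ[K] (inr X.V Y.V).lin y) with h | h <;> rw [h]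
    · exact mixed_mem X Y x y
    · exact neg_mem (mixed_mem X Y x y)
  exact this ⟨y ⊗ₜ x, rfl⟩

/-- The two inclusions into a product are morphisms of quadratic data. -/
def inlHom (X Y : QD K m) : X ⟶ prod X Y := ⟨inl X.V Y.V, fun _ hz => inl_mem X Y hz⟩

def inrHom (X Y : QD K m) : Y ⟶ prod X Y := ⟨inr X.V Y.V, fun _ hz => inr_mem X Y hz⟩

/-- Maps out of a product: `f` is a morphism if its restrictions `a` and `b` are and if it respects
the mixed relations. -/
def ofSum {X Y Z : QD K m} (f : sumObj X.V Y.V ⟶ Z.V) (a : X ⟶ Z) (b : Y ⟶ Z)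
    (ha : inl X.V Y.V ≫ f = a.hom) (hb : inr X.V Y.V ≫ f = b.hom)
    (hm : ∀ x y, symLin m Z.V (a.hom.lin x ⊗ₜ b.hom.lin y) ∈ Z.R) : prod X Y ⟶ Z where
  hom := f
  map_le := by
    refine sup_le (sup_le ?_ ?_) ?_
    · rintro _ ⟨x, hx, rfl⟩
      have := a.map_le hx
      rw [Submodule.mem_comap] at this ⊢
      rw [← ha, sq, comp_lin, TensorProduct.map_comp] at this
      exact this
    · rw [mixed, LinearMap.range_le_iff_comap, eq_top_iff]
      rintro z -
      refine tensor_induction X.V Y.V (fun i j x hx y hy => ?_) z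
      rw [Submodule.mem_comap, Submodule.mem_comap, LinearMap.comp_apply, ← symLin_natural]
      have := hm x y
      rw [← ha, ← hb] at this
      exact this
    · rintro _ ⟨x, hx, rfl⟩
      have := b.map_le hx
      rw [Submodule.mem_comap] at this ⊢
      rw [← hb, sq, comp_lin, TensorProduct.map_comp] at this
      exact this

/-- The product of morphisms. -/
def prodHom {X X' Y Y' : QD K m} (f : X ⟶ X') (g : Y ⟶ Y') : prod X Y ⟶ prod X' Y' :=
  ofSum (sumHom f.hom g.hom) (f ≫ inlHom X' Y') (g ≫ inrHom X' Y')
    (GrVect.hom_ext (LinearMap.ext fun _ => Prod.ext rfl (map_zero g.hom.lin)))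
    (GrVect.hom_ext (LinearMap.ext fun _ => Prod.ext (map_zero f.hom.lin) rfl))
    (fun x y => mixed_mem X' Y' (f.hom.lin x) (g.hom.lin y))

theorem symLin_add_left {Z : GrVect K ℤ} {N : Submodule K (Z ⊗[K] Z)} {a x x' y : Z}
    (e : x + x' = a) (h : symLin m Z (x ⊗ₜ y) ∈ N) (h' : symLin m Z (x' ⊗ₜ y) ∈ N) :
    symLin m Z (a ⊗ₜ y) ∈ N := by
  rw [← e, TensorProduct.add_tmul, map_add]
  exact add_mem h h'

theorem symLin_add_right {Z : GrVect K ℤ} {N : Submodule K (Z ⊗[K] Z)} {a x x' y : Z}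
    (e : x + x' = a) (h : symLin m Z (y ⊗ₜ x) ∈ N) (h' : symLin m Z (y ⊗ₜ x') ∈ N) :
    symLin m Z (y ⊗ₜ a) ∈ N := by
  rw [← e, TensorProduct.tmul_add, map_add]
  exact add_mem h h'

theorem symLin_mem_of_hom {X Y : QD K m} (f : X ⟶ Y) (x x' : X.V) (h : symLin m X.V (x ⊗ₜ x') ∈ X.R) :
    symLin m Y.V (f.hom.lin x ⊗ₜ f.hom.lin x') ∈ Y.R := by
  have := f.map_le h
  rw [Submodule.mem_comap, ← symLin_natural] at this
  exact this

/-- The associator. -/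
def assocHom (X Y Z : QD K m) : prod (prod X Y) Z ⟶ prod X (prod Y Z) :=
  ofSum (sumAssoc X.V Y.V Z.V)
    (ofSum (Z := prod X (prod Y Z)) (inl (sumObj X.V Y.V) Z.V ≫ sumAssoc X.V Y.V Z.V)
      (inlHom X (prod Y Z)) (inlHom Y Z ≫ inrHom X (prod Y Z)) rfl rfl
      fun x y => mixed_mem X (prod Y Z) x ((inl Y.V Z.V).lin y))
    (inrHom Y Z ≫ inrHom X (prod Y Z)) rfl rfl
    (fun p z => symLin_add_left
        (x := (inl X.V (sumObj Y.V Z.V)).lin p.1)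
        (x' := (inr X.V (sumObj Y.V Z.V)).lin ((inl Y.V Z.V).lin p.2))
        (Prod.ext (add_zero p.1) (Prod.ext (zero_add p.2) (add_zero (0 : Z.V))))
        (mixed_mem X (prod Y Z) p.1 ((inr Y.V Z.V).lin z))
        (symLin_mem_of_hom (inrHom X (prod Y Z)) _ _ (mixed_mem Y Z p.2 z)))

/-- The inverse of the associator. -/
def assocInv (X Y Z : QD K m) : prod X (prod Y Z) ⟶ prod (prod X Y) Z :=
  ofSum (sumAssocInv X.V Y.V Z.V) (inlHom X Y ≫ inlHom (prod X Y) Z)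
    (ofSum (Z := prod (prod X Y) Z) (inr X.V (sumObj Y.V Z.V) ≫ sumAssocInv X.V Y.V Z.V)
      (inrHom X Y ≫ inlHom (prod X Y) Z) (inrHom (prod X Y) Z) rfl rfl
      fun y z => mixed_mem (prod X Y) Z ((inr X.V Y.V).lin y) z)
    rfl rfl
    (fun x p => symLin_add_right
        (x := (inl (sumObj X.V Y.V) Z.V).lin ((inr X.V Y.V).lin p.1))
        (x' := (inr (sumObj X.V Y.V) Z.V).lin p.2)
        (Prod.ext (Prod.ext (add_zero (0 : X.V)) (add_zero p.1)) (zero_add p.2))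
        (symLin_mem_of_hom (inlHom (prod X Y) Z) _ _ (mixed_mem X Y x p.1))
        (mixed_mem (prod X Y) Z ((inl X.V Y.V).lin x) p.2))

/-- The symmetry. -/
def commHom (X Y : QD K m) : prod X Y ⟶ prod Y X :=
  ofSum (sumComm X.V Y.V) (inrHom Y X) (inlHom Y X) rfl rfl fun x y => mixed_mem' Y X y x

/-- The zero morphism out of the unit. -/
def unitHom (X : QD K m) : unit K m ⟶ X := ⟨⟨0, fun _ _ _ => zero_mem _⟩, bot_le⟩

/-- The left unitor. -/
def lidHom (X : QD K m) : prod (unit K m) X ⟶ X :=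
  ofSum (sumSnd (zeroObj K ℤ) X.V) (unitHom X) (𝟙 X) rfl rfl fun x y => by
    change symLin m X.V ((0 : X.V) ⊗ₜ y) ∈ X.R
    rw [TensorProduct.zero_tmul, map_zero]
    exact zero_mem _

/-- The right unitor. -/
def ridHom (X : QD K m) : prod X (unit K m) ⟶ X :=
  ofSum (sumFst X.V (zeroObj K ℤ)) (𝟙 X) (unitHom X) rfl rfl fun x y => by
    change symLin m X.V (x ⊗ₜ (0 : X.V)) ∈ X.R
    rw [TensorProduct.tmul_zero, map_zero]
    exact zero_mem _

instance : MonoidalCategoryStruct (QD K m) where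
  tensorObj := prod
  tensorUnit := unit K m
  whiskerLeft X _ _ f := prodHom (𝟙 X) f
  whiskerRight f Y := prodHom f (𝟙 Y)
  tensorHom := prodHom
  associator X Y Z :=
    { hom := assocHom X Y Z
      inv := assocInv X Y Z
      hom_inv_id := hom_ext (LinearMap.ext fun _ => rfl)
      inv_hom_id := hom_ext (LinearMap.ext fun _ => rfl) }
  leftUnitor X :=
    { hom := lidHom X
      inv := inrHom (unit K m) X
      hom_inv_id := hom_ext (LinearMap.ext fun _ => rfl)
      inv_hom_id := hom_ext (LinearMap.ext fun _ => rfl) }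
  rightUnitor X :=
    { hom := ridHom X
      inv := inlHom X (unit K m)
      hom_inv_id := hom_ext (LinearMap.ext fun _ => rfl)
      inv_hom_id := hom_ext (LinearMap.ext fun _ => rfl) }

instance : MonoidalCategory (QD K m) :=
  .ofTensorHom
    (id_tensorHom_id := fun _ _ => hom_ext (LinearMap.ext fun _ => rfl))
    (tensorHom_comp_tensorHom := fun _ _ _ _ => hom_ext (LinearMap.ext fun _ => rfl))
    (associator_naturality := fun _ _ _ => hom_ext (LinearMap.ext fun _ => rfl))
    (leftUnitor_naturality := fun _ => hom_ext (LinearMap.ext fun _ => rfl))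
    (rightUnitor_naturality := fun _ => hom_ext (LinearMap.ext fun _ => rfl))
    (pentagon := fun _ _ _ _ => hom_ext (LinearMap.ext fun _ => rfl))
    (triangle := fun _ _ => hom_ext (LinearMap.ext fun _ => rfl))

instance : SymmetricCategory (QD K m) where
  braiding X Y :=
    { hom := commHom X Y
      inv := commHom Y X
      hom_inv_id := hom_ext (LinearMap.ext fun _ => rfl)
      inv_hom_id := hom_ext (LinearMap.ext fun _ => rfl) }
  braiding_naturality_right _ _ _ _ := hom_ext (LinearMap.ext fun _ => rfl)
  braiding_naturality_left _ _ := hom_ext (LinearMap.ext fun _ => rfl)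
  hexagon_forward _ _ _ := hom_ext (LinearMap.ext fun _ => rfl)
  hexagon_reverse _ _ _ := hom_ext (LinearMap.ext fun _ => rfl)
  symmetry _ _ := hom_ext (LinearMap.ext fun _ => rfl)

end QD

end QuadData

/-! ### The categories of quadratic data -/

section QuadFunctors

open GrVect

variable (K : Type u) [Field K]

/-- Skew-symmetric quadratic data: `R ⊆ V^{∧2}`. -/
def isSkew (m : Mixing) : ObjectProperty (QD K m) := fun X => X.R ≤ extSquare X.V

/-- Symmetric quadratic data: `R ⊆ V^{⊙2}`. -/
def isSym (m : Mixing) : ObjectProperty (QD K m) := fun X => X.R ≤ symSquare X.V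

variable {K} in
theorem QD.prod_le_range {m : Mixing} (m' : Mixing) {X Y : QD K m}
    (hm : mixed m X.V Y.V ≤ LinearMap.range (symLin m' (sumObj X.V Y.V)))
    (hX : X.R ≤ LinearMap.range (symLin m' X.V)) (hY : Y.R ≤ LinearMap.range (symLin m' Y.V)) :
    (QD.prod X Y).R ≤ LinearMap.range (symLin m' (sumObj X.V Y.V)) := by
  refine sup_le (sup_le ?_ hm) ?_
  · rintro _ ⟨z, hz, rfl⟩
    obtain ⟨w, rfl⟩ := hX hz
    exact ⟨sq (inl X.V Y.V) w, symLin_natural _ _ _⟩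
  · rintro _ ⟨z, hz, rfl⟩
    obtain ⟨w, rfl⟩ := hY hz
    exact ⟨sq (inr X.V Y.V) w, symLin_natural _ _ _⟩

instance : (isSkew K .minus).IsMonoidal where
  prop_unit := bot_le
  prop_tensor _ _ hX hY := QD.prod_le_range .minus (LinearMap.range_comp_le_range _ _) hX hY

instance : (isSym K .plus).IsMonoidal where
  prop_unit := bot_le
  prop_tensor _ _ hX hY := QD.prod_le_range .plus (LinearMap.range_comp_le_range _ _) hX hY

instance : (isSym K .none).IsMonoidal where
  prop_unit := bot_le
  prop_tensor X Y hX hY := QD.prod_le_range .plus (by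
    rintro _ ⟨z, rfl⟩
    exact zero_mem _) hX hY

/-- `(QD, ⊗)`, with `(V, R) ⊗ (W, S) = (V ⊕ W, R ⊕ [V, W]_- ⊕ S)`. -/
abbrev QDTensor := QD K .minus

/-- `(QD, ⊗̲)`, with `(V, R) ⊗̲ (W, S) = (V ⊕ W, R ⊕ [V, W]_+ ⊕ S)`. -/
abbrev QDUTensor := QD K .plus

/-- `(QD⁻, ⊕)`, with `(V, R) ⊕ (W, S) = (V ⊕ W, R ⊕ [V, W]_- ⊕ S)`. -/
abbrev QDMinus := (isSkew K .minus).FullSubcategory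

/-- `(QD⁺, ⊗̲)`, with `(V, R) ⊗̲ (W, S) = (V ⊕ W, R ⊕ [V, W]_+ ⊕ S)`. -/
abbrev QDPlusUTensor := (isSym K .plus).FullSubcategory

/-- `(QD⁺, ∨)`, with `(V, R) ∨ (W, S) = (V ⊕ W, R ⊕ S)`. -/
abbrev QDPlusVee := (isSym K .none).FullSubcategory

/-! ### The lifts `Λ`, `Σ` and `𝒮` -/

/-- `Λ(V, R) = (V, R)`. -/
def lambda : QDMinus K ⥤ QDTensor K := (isSkew K .minus).ι

/-- `Σ(V, R) = (V, R)`. -/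
def sigma : QDPlusUTensor K ⥤ QDUTensor K := (isSym K .plus).ι

/-- `𝒮(V, R) = (V, R ⊕ V^{∧2})`. -/
def calS : QDPlusVee K ⥤ QDTensor K where
  obj X :=
    { V := X.obj.V
      finite := X.obj.finite
      R := X.obj.R ⊔ extSquare X.obj.V
      homogeneous := X.obj.homogeneous.sup (range_symLin_homogeneous _ _) }
  map f :=
    { hom := f.hom.hom
      map_le := sup_le (fun z hz => Submodule.mem_sup_left (f.hom.map_le hz)) (by
        rintro _ ⟨z, rfl⟩
        exact Submodule.mem_sup_right ⟨_, symLin_natural .minus f.hom.hom z⟩) }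

/-! ### The Koszul dual functors -/

variable {K}

/-- The suspension `(sV)_{n + 1} = V_n`. -/
abbrev shift (V : GrVect K ℤ) : GrVect K ℤ := regradeObj (· + 1) V

/-- `x ⊗ y ↦ (-1)^{|x|} sx ⊗ sy`. -/
def shiftSq (V : GrVect K ℤ) : V ⊗[K] V →ₗ[K] shift V ⊗[K] shift V :=
  TensorProduct.map
    (Finsupp.lsum K (fun i : ℤ => koszul K i (1 : ℤ) • (LinearMap.id : V →ₗ[K] V)) ∘ₗ V.coact)
    LinearMap.id

theorem shiftSq_tmul (V : GrVect K ℤ) {i : ℤ} {x : V} (hx : x ∈ V.gr i) (y : V) :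
    shiftSq V (x ⊗ₜ y) = koszul K i (1 : ℤ) • (x ⊗ₜ[K] y) := by
  simp [shiftSq, V.coact_of_mem hx]
  rfl

theorem shiftSq_mem (V : GrVect K ℤ) (n : ℤ) (z : V ⊗[K] V) (hz : z ∈ (tensorObj' V V).gr n) :
    shiftSq V z ∈ (tensorObj' (shift V) (shift V)).gr (n + 2) := by
  have : tensorGr V V n ≤ ((tensorObj' (shift V) (shift V)).gr (n + 2)).comap (shiftSq V) := by
    refine tensorGr_le V V fun i j hij x hx y hy => ?_
    rw [Submodule.mem_comap, shiftSq_tmul V hx]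
    refine Submodule.smul_mem _ _ (tmul_mem (shift V) (shift V) (i := i + 1) (j := j + 1)
      (by omega) ?_ ?_)
    · exact mem_regrade (· + 1) V rfl hx
    · exact mem_regrade (· + 1) V rfl hy
  exact this hz

/-- The suspension of a map. -/
def shiftMap {V W : GrVect K ℤ} (f : V ⟶ W) : shift V ⟶ shift W := (regrade (· + 1)).map f

theorem shiftSq_natural {V W : GrVect K ℤ} (f : V ⟶ W) (z : V ⊗[K] V) :
    shiftSq W (sq f z) = sq (shiftMap f) (shiftSq V z) := by
  have : shiftSq W ∘ₗ sq f = sq (shiftMap f) ∘ₗ shiftSq V := tensor_ext V V fun i x hx j y hy => by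
    rw [LinearMap.comp_apply, LinearMap.comp_apply, shiftSq_tmul V hx, TensorProduct.map_tmul,
      shiftSq_tmul W (f.map_mem i x hx), map_smul]
    rfl
  exact LinearMap.congr_fun this z

/-- `(V, R)^¡ = (sV, s²R)`. -/
abbrev koszulObj {m : Mixing} (m' : Mixing) (X : QD K m) : QD K m' where
  V := shift X.V
  finite := X.finite
  R := X.R.map (shiftSq X.V)
  homogeneous := X.homogeneous.map (· + 2) (W := tensorObj' (shift X.V) (shift X.V))
    (shiftSq X.V) (shiftSq_mem X.V)

variable (K) in
/-- The Koszul dual functor `¡ : (QD, ⊗) ⥤ (QD, ⊗̲)`. -/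
def koszulDual : QDTensor K ⥤ QDUTensor K where
  obj := koszulObj .plus
  map {X Y} f :=
    { hom := shiftMap f.hom
      map_le := by
        rintro _ ⟨z, hz, rfl⟩
        exact ⟨sq f.hom z, f.map_le hz, shiftSq_natural f.hom z⟩ }

theorem koszulObj_isSym (X : QD K .minus) (hX : X.R ≤ extSquare X.V) :
    (koszulObj .plus X).R ≤ symSquare (shift X.V) := by
  have : LinearMap.range (symLin .minus X.V) ≤ (symSquare (shift X.V)).comap (shiftSq X.V) := by
    rw [LinearMap.range_le_iff_comap, eq_top_iff]
    rintro z -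
    refine tensor_induction X.V X.V (fun i j x hx y hy => ?_) z
    refine ⟨koszul K i (1 : ℤ) • (x ⊗ₜ[K] y), ?_⟩
    have h1 := swapLin_tmul (shift X.V) (shift X.V) (mem_regrade (· + 1) X.V rfl hx)
      (mem_regrade (· + 1) X.V rfl hy)
    have h2 : koszul K (i + 1) (j + 1) = -(koszul K i (1 : ℤ) * koszul K i j * koszul K j (1 : ℤ))
        := by
      rw [koszul_add_left, koszul_add_right, koszul_add_right]
      have : koszul K (1 : ℤ) (1 : ℤ) = -1 := by
        simp [koszul, DegreeIndex.deg]
      rw [this, koszul_comm 1 j]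
      ring
    have h3 := shiftSq_tmul X.V hx y
    have h4 := shiftSq_tmul X.V hy x
    simp only [symLin, LinearMap.add_apply, LinearMap.sub_apply, LinearMap.id_apply, map_smul,
      map_sub, swapLin_tmul X.V X.V hx hy, h3, h4, h1, h2]
    rw [sub_eq_add_neg, ← neg_smul, smul_add, smul_smul, smul_smul]
    congr 2
    have := koszul_mul_self (K := K) i (1 : ℤ)
    linear_combination (-(koszul K i j * koszul K j (1 : ℤ))) * this
  rintro _ ⟨z, hz, rfl⟩
  exact this (hX hz)

variable (K) in
/-- The Koszul dual functor `¡ : (QD⁻, ⊕) ⥤ (QD⁺, ⊗̲)`. -/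
def koszulDualMinus : QDMinus K ⥤ QDPlusUTensor K :=
  (isSym K .plus).lift ((isSkew K .minus).ι ⋙ koszulDual K) fun X =>
    koszulObj_isSym X.obj X.property

/-! ### The linear dual functors -/

/-- The orthogonal of a subspace of `V ⊗ V` in `V^* ⊗ V^*`. -/
def perp (V : GrVect K ℤ) (R : Submodule K (V ⊗[K] V)) :
    Submodule K (dualObj V ⊗[K] dualObj V) :=
  R.dualAnnihilator.comap (pairing V V)

theorem mem_perp {V : GrVect K ℤ} {R : Submodule K (V ⊗[K] V)} {φ : dualObj V ⊗[K] dualObj V} :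
    φ ∈ perp V R ↔ ∀ r ∈ R, pairing V V φ r = 0 := by
  rw [perp, Submodule.mem_comap, Submodule.mem_dualAnnihilator]

theorem perp_homogeneous (V : GrVect K ℤ) {R : Submodule K (V ⊗[K] V)}
    (hR : IsHomogeneous (tensorObj' V V) R) :
    IsHomogeneous (tensorObj' (dualObj V) (dualObj V)) (perp V R) := by
  intro φ hφ γ
  rw [mem_perp] at hφ ⊢
  intro r hr
  have h1 := Hom.coact_lin (dualTensor V V) φ γ
  have h2 := dual_coact (tensorObj' V V) ((dualTensor V V).lin φ) γ
  rw [h1, toFun_dualTensor, toFun_dualTensor] at h2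
  rw [h2, LinearMap.comp_apply]
  exact hφ _ (hR r hr _)

theorem perp_natural {V W : GrVect K ℤ} (f : V ⟶ W) {R : Submodule K (V ⊗[K] V)}
    {S : Submodule K (W ⊗[K] W)} (h : R ≤ S.comap (sq f)) :
    perp W S ≤ (perp V R).comap (sq (dualMap f)) := by
  intro φ hφ
  rw [Submodule.mem_comap, mem_perp]
  rw [mem_perp] at hφ
  intro r hr
  rw [sq, pairing_natural]
  exact hφ _ (h hr)

theorem dualObj_finite (V : GrVect K ℤ) [FiniteDimensional K V] :
    FiniteDimensional K (dualObj V) :=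
  FiniteDimensional.of_injective (toFun V) (toFun_injective V)

variable (K)

/-- The linear dual functor `* : (QD, ⊗̲)ᵒᵖ ⥤ (QD, ⊗)`, `(V, R) ↦ (V^*, R^⊥)`. -/
def linearDual : (QDUTensor K)ᵒᵖ ⥤ QDTensor K where
  obj X :=
    { V := dualObj X.unop.V
      finite := by
        have := X.unop.finite
        exact dualObj_finite X.unop.V
      R := perp X.unop.V X.unop.R
      homogeneous := perp_homogeneous _ X.unop.homogeneous }
  map f :=
    { hom := dualMap f.unop.hom
      map_le := perp_natural f.unop.hom f.unop.map_le }

/-- The linear dual functor `* : (QD⁺, ⊗̲)ᵒᵖ ⥤ (QD⁺, ∨)`, `(V, R) ↦ (V^*, R^⊥)`, where the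
orthogonal is taken in `(V^*)^{⊙2}`. -/
def linearDualPlus : (QDPlusUTensor K)ᵒᵖ ⥤ QDPlusVee K where
  obj X :=
    { obj :=
        { V := dualObj X.unop.obj.V
          finite := by
            have := X.unop.obj.finite
            exact dualObj_finite X.unop.obj.V
          R := perp X.unop.obj.V X.unop.obj.R ⊓ symSquare (dualObj X.unop.obj.V)
          homogeneous := (perp_homogeneous _ X.unop.obj.homogeneous).inf
            (range_symLin_homogeneous _ _) }
      property := inf_le_right }
  map f := ObjectProperty.homMk
    { hom := dualMap f.unop.hom.hom
      map_le := by
        rintro _ ⟨hz, w, rfl⟩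
        exact ⟨perp_natural f.unop.hom.hom f.unop.hom.map_le hz, _, symLin_natural .plus _ _⟩ }

/-- The second Koszul dual functor `! : (QD, ⊗)ᵒᵖ ⥤ (QD, ⊗)`. -/
def secondKoszulDual : (QDTensor K)ᵒᵖ ⥤ QDTensor K := (koszulDual K).op ⋙ linearDual K

/-- The second Koszul dual functor `! : (QD⁻, ⊕)ᵒᵖ ⥤ (QD⁺, ∨)`. -/
def secondKoszulDualMinus : (QDMinus K)ᵒᵖ ⥤ QDPlusVee K :=
  (koszulDualMinus K).op ⋙ linearDualPlus K

end QuadFunctors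

/-! ### Graded algebras presented by generators and relations -/

section Presentations

open GrVect

variable {K : Type u} [Field K] {Γ : Type} [DecidableEq Γ] [AddCommMonoid Γ] [DegreeIndex Γ]

/-- A graded algebra as a monoid in graded vector spaces. -/
abbrev monOf (B : Type u) [Ring B] [Algebra K B] (gr : Γ → Submodule K B)
    (h : DirectSum.IsInternal gr) (h1 : 1 ∈ gr 0)
    (hmul : ∀ i j, ∀ x ∈ gr i, ∀ y ∈ gr j, x * y ∈ gr (i + j)) : Mon (GrVect K Γ) where
  X := { carrier := B, gr := gr, isInternal := h }
  mon :=
    { one :=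
        { lin := Algebra.linearMap K B
          map_mem := fun γ (x : K) hx => by
            rcases mem_unit_gr hx with rfl | rfl
            · change algebraMap K B x ∈ gr 0
              rw [Algebra.algebraMap_eq_smul_one]
              exact Submodule.smul_mem _ _ h1
            · change algebraMap K B 0 ∈ gr γ
              rw [map_zero]
              exact zero_mem _ }
      mul :=
        { lin := LinearMap.mul' K B
          map_mem := by
            refine tensorGr_le_comap (V := { carrier := B, gr := gr, isInternal := h })
              (W := { carrier := B, gr := gr, isInternal := h })
              (X := { carrier := B, gr := gr, isInternal := h }) ?_
            intro i j x hx y hy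
            exact hmul i j x hx y hy }
      one_mul := GrVect.hom_ext <| TensorProduct.ext' fun (a : K) (x : B) =>
        (Algebra.smul_def a x).symm
      mul_one := GrVect.hom_ext <| TensorProduct.ext' fun (x : B) (a : K) => by
        change x * algebraMap K B a = a • x
        rw [Algebra.smul_def, Algebra.commutes]
      mul_assoc := GrVect.hom_ext <| TensorProduct.ext_threefold fun (x y z : B) =>
        mul_assoc x y z }

/-- The products of homogeneous generators with prescribed total degree. -/
inductive IsWord (X : GrVect K Γ) {B : Type u} [Ring B] [Algebra K B] (ι : X →ₗ[K] B) : Γ → B → Prop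
  | one : IsWord X ι 0 1
  | cons {i γ : Γ} {x : X} {w : B} (hx : x ∈ X.gr i) (hw : IsWord X ι γ w) :
    IsWord X ι (i + γ) (ι x * w)

theorem IsWord.mul {X : GrVect K Γ} {B : Type u} [Ring B] [Algebra K B] {ι : X →ₗ[K] B} {i j : Γ}
    {v w : B} (hv : IsWord X ι i v) (hw : IsWord X ι j w) : IsWord X ι (i + j) (v * w) := by
  induction hv with
  | one => simpa using hw
  | cons hx _ ih =>
    rw [add_assoc, mul_assoc]
    exact .cons hx ih

/-- The component of an algebra generated by a graded space, spanned by the products of homogeneous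
generators whose degrees sum up to a given degree. -/
def wordGr (X : GrVect K Γ) {B : Type u} [Ring B] [Algebra K B] (ι : X →ₗ[K] B) (γ : Γ) :
    Submodule K B := Submodule.span K {w | IsWord X ι γ w}

theorem wordGr_mul (X : GrVect K Γ) {B : Type u} [Ring B] [Algebra K B] (ι : X →ₗ[K] B) (i j : Γ)
    (x : B) (hx : x ∈ wordGr X ι i) (y : B) (hy : y ∈ wordGr X ι j) :
    x * y ∈ wordGr X ι (i + j) := by
  have h := Submodule.mul_mem_mul hx hy
  rw [wordGr, wordGr, Submodule.span_mul_span] at h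
  refine Submodule.span_mono ?_ h
  rintro _ ⟨v, hv, w, hw, rfl⟩
  exact hv.mul hw

theorem ι_mem_wordGr (X : GrVect K Γ) {B : Type u} [Ring B] [Algebra K B] (ι : X →ₗ[K] B) {i : Γ}
    {x : X} (hx : x ∈ X.gr i) : ι x ∈ wordGr X ι i := by
  have h : IsWord X ι (i + 0) (ι x * 1) := .cons hx .one
  rw [add_zero, mul_one] at h
  exact Submodule.subset_span h

theorem wordGr_isInternal (X : GrVect K Γ) {B : Type u} [Ring B] [Algebra K B] (ι : X →ₗ[K] B)
    (hgen : Algebra.adjoin K (Set.range ι) = ⊤) (ρ : B →ₐ[K] AddMonoidAlgebra B Γ)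
    (hρ : ∀ i, ∀ x ∈ X.gr i, ρ (ι x) = AddMonoidAlgebra.single i (ι x)) :
    DirectSum.IsInternal (wordGr X ι) := by
  have hw : ∀ γ w, IsWord X ι γ w → ρ w = AddMonoidAlgebra.single γ w := by
    intro γ w h
    induction h with
    | one => rw [map_one, AddMonoidAlgebra.one_def]
    | cons hx _ ih => rw [map_mul, ih, hρ _ _ hx, AddMonoidAlgebra.single_mul_single]
  refine isInternal_of _ (Finsupp.lcoeFun ∘ₗ
    (AddMonoidAlgebra.coeffLinearEquiv K (S := B) (M := Γ)).toLinearMap ∘ₗ ρ.toLinearMap)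
    LinearMap.id Function.injective_id ?_ ?_
  · intro γ x hx
    have : wordGr X ι γ ≤ LinearMap.eqLocus ρ.toLinearMap (AddMonoidAlgebra.lsingle γ) :=
      Submodule.span_le.2 fun w h => hw γ w h
    have h1 : ρ x = AddMonoidAlgebra.single γ x := this hx
    ext δ
    change (ρ x).coeff δ = _
    rw [h1]
    simp [Finsupp.single_apply, Pi.single_apply, eq_comm]
  · rw [eq_top_iff]
    let N : Subalgebra K B := Submodule.toSubalgebra (⨆ γ, wordGr X ι γ)
      (Submodule.mem_iSup_of_mem 0 (Submodule.subset_span .one)) fun x y hx hy => by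
        have h := Submodule.mul_mem_mul hx hy
        rw [Submodule.iSup_mul] at h
        refine (iSup_le fun i => ?_ : _ ≤ ⨆ γ, wordGr X ι γ) h
        rw [Submodule.mul_iSup]
        refine iSup_le fun j => Submodule.mul_le.2 fun x hx y hy => ?_
        exact Submodule.mem_iSup_of_mem (i + j) (wordGr_mul X ι i j x hx y hy)
    have h : Algebra.adjoin K (Set.range ι) ≤ N := by
      refine Algebra.adjoin_le ?_
      rintro _ ⟨x, rfl⟩
      refine X.induction (p := fun x => ι x ∈ N) x
        (fun i x hx => Submodule.mem_iSup_of_mem i (ι_mem_wordGr X ι hx)) ?_ fun x y hx hy => ?_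
      · simp
      · simpa using add_mem hx hy
    rw [hgen] at h
    exact fun x _ => h (Algebra.mem_top (x := x))

/-- The decomposition of a tensor into homogeneous components. -/
def tensorAlgCoact (X : GrVect K Γ) :
    TensorAlgebra K X →ₐ[K] AddMonoidAlgebra (TensorAlgebra K X) Γ :=
  TensorAlgebra.lift K ((AddMonoidAlgebra.coeffLinearEquiv K).symm.toLinearMap ∘ₗ
    Finsupp.mapRange.linearMap (TensorAlgebra.ι K) ∘ₗ X.coact)

theorem tensorAlgCoact_ι (X : GrVect K Γ) {i : Γ} {x : X} (hx : x ∈ X.gr i) :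
    tensorAlgCoact X (TensorAlgebra.ι K x) =
      AddMonoidAlgebra.single i (TensorAlgebra.ι K x) := by
  rw [tensorAlgCoact, TensorAlgebra.lift_ι_apply, LinearMap.comp_apply, LinearMap.comp_apply,
    X.coact_of_mem hx]
  apply AddMonoidAlgebra.coeff_injective
  change Finsupp.mapRange.linearMap (TensorAlgebra.ι K) (Finsupp.single i x) = _
  simp

/-- A graded presentation of an algebra: a graded space of generators and a set of relations in
the tensor algebra, which contains the homogeneous components of its elements. -/
structure Presentation (K : Type u) [Field K] (Γ : Type) [DecidableEq Γ] [AddCommMonoid Γ] :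
    Type (u + 1) where
  X : GrVect K Γ
  rel : Set (TensorAlgebra K X)
  coact_mem : ∀ s ∈ rel, ∀ γ, (tensorAlgCoact X s).coeff γ ∈ rel

namespace Presentation

variable (P : Presentation K Γ)

/-- The relation to be quotiented out. -/
def Rel (a b : TensorAlgebra K P.X) : Prop := a ∈ P.rel ∧ b = 0

/-- The quotient of the tensor algebra by the two-sided ideal generated by the relations. -/
abbrev Alg : Type u := RingQuot P.Rel

/-- The quotient map. -/
def proj : TensorAlgebra K P.X →ₐ[K] P.Alg := RingQuot.mkAlgHom K P.Rel

/-- The generators. -/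
def ι : P.X →ₗ[K] P.Alg := P.proj.toLinearMap ∘ₗ TensorAlgebra.ι K

theorem proj_rel {s : TensorAlgebra K P.X} (hs : s ∈ P.rel) : P.proj s = 0 := by
  have : P.Rel s 0 := ⟨hs, rfl⟩
  exact (RingQuot.mkAlgHom_rel K this).trans (map_zero P.proj)

theorem proj_surjective : Function.Surjective P.proj := RingQuot.mkAlgHom_surjective K P.Rel

/-- The universal property of the quotient. -/
def lift {B : Type u} [Ring B] [Algebra K B] (f : TensorAlgebra K P.X →ₐ[K] B)
    (h : ∀ s ∈ P.rel, f s = 0) : P.Alg →ₐ[K] B :=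
  RingQuot.liftAlgHom K ⟨f, fun a b hab => by rw [h a hab.1, hab.2, map_zero]⟩

theorem lift_proj {B : Type u} [Ring B] [Algebra K B] (f : TensorAlgebra K P.X →ₐ[K] B)
    (h : ∀ s ∈ P.rel, f s = 0) (x : TensorAlgebra K P.X) : P.lift f h (P.proj x) = f x :=
  RingQuot.liftAlgHom_mkAlgHom_apply K _ _ _

theorem lift_ι {B : Type u} [Ring B] [Algebra K B] (f : TensorAlgebra K P.X →ₐ[K] B)
    (h : ∀ s ∈ P.rel, f s = 0) (x : P.X) : P.lift f h (P.ι x) = f (TensorAlgebra.ι K x) :=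
  P.lift_proj f h _

theorem algHom_ext {B : Type u} [Ring B] [Algebra K B] {f g : P.Alg →ₐ[K] B}
    (h : ∀ x, f (P.ι x) = g (P.ι x)) : f = g := by
  apply RingQuot.ringQuot_ext'
  apply TensorAlgebra.hom_ext
  exact LinearMap.ext fun x => h x

theorem adjoin_ι : Algebra.adjoin K (Set.range P.ι) = ⊤ := by
  rw [ι, LinearMap.coe_comp, Set.range_comp, AlgHom.coe_toLinearMap, ← AlgHom.map_adjoin,
    TensorAlgebra.adjoin_range_ι, Algebra.map_top, AlgHom.range_eq_top]
  exact P.proj_surjective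

/-- The decomposition into homogeneous components on the quotient. -/
def coact : P.Alg →ₐ[K] AddMonoidAlgebra P.Alg Γ :=
  RingQuot.liftAlgHom K ⟨(AddMonoidAlgebra.mapAlgHom Γ P.proj).comp (tensorAlgCoact P.X),
    fun a b hab => by
      rw [hab.2, map_zero]
      apply AddMonoidAlgebra.coeff_injective
      ext γ
      rw [AlgHom.comp_apply, AddMonoidAlgebra.coeff_mapAlgHom]
      exact P.proj_rel (P.coact_mem a hab.1 γ)⟩

theorem coact_ι {i : Γ} {x : P.X} (hx : x ∈ P.X.gr i) :
    P.coact (P.ι x) = AddMonoidAlgebra.single i (P.ι x) := by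
  have : P.coact (P.ι x) = ((AddMonoidAlgebra.mapAlgHom Γ P.proj).comp (tensorAlgCoact P.X))
    (TensorAlgebra.ι K x) := RingQuot.liftAlgHom_mkAlgHom_apply K _ _ _
  rw [this, AlgHom.comp_apply, tensorAlgCoact_ι P.X hx, AddMonoidAlgebra.mapAlgHom_single]
  rfl

/-- The presented graded algebra. -/
def mon : Mon (GrVect K Γ) :=
  monOf P.Alg (wordGr P.X P.ι) (wordGr_isInternal P.X P.ι P.adjoin_ι P.coact fun _ _ => P.coact_ι)
    (Submodule.subset_span .one) (wordGr_mul P.X P.ι)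

variable {P}

/-- Morphisms of presentations: maps of generators that preserve the relations. -/
structure Hom (P Q : Presentation K Γ) where
  hom : P.X ⟶ Q.X
  map_rel : ∀ s ∈ P.rel, TensorAlgebra.lift K (TensorAlgebra.ι K ∘ₗ hom.lin) s ∈ Q.rel

/-- The induced algebra map. -/
def Hom.algHom {P Q : Presentation K Γ} (f : Hom P Q) : P.Alg →ₐ[K] Q.Alg :=
  P.lift (Q.proj.comp (TensorAlgebra.lift K (TensorAlgebra.ι K ∘ₗ f.hom.lin)))
    fun s hs => Q.proj_rel (f.map_rel s hs)

theorem Hom.algHom_ι {P Q : Presentation K Γ} (f : Hom P Q) (x : P.X) :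
    f.algHom (P.ι x) = Q.ι (f.hom.lin x) := by
  refine (P.lift_ι _ _ x).trans ?_
  rw [AlgHom.comp_apply, TensorAlgebra.lift_ι_apply]
  rfl

theorem Hom.algHom_mem {P Q : Presentation K Γ} (f : Hom P Q) (γ : Γ) (b : P.Alg)
    (hb : b ∈ wordGr P.X P.ι γ) : f.algHom b ∈ wordGr Q.X Q.ι γ := by
  have : wordGr P.X P.ι γ ≤ (wordGr Q.X Q.ι γ).comap f.algHom.toLinearMap :=
    Submodule.span_le.2 fun w hw => Submodule.subset_span <| by
      clear hb
      change IsWord P.X P.ι γ w at hw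
      change IsWord Q.X Q.ι γ (f.algHom w)
      induction hw with
      | one => rw [map_one]; exact .one
      | cons hx _ ih => rw [map_mul, f.algHom_ι]; exact .cons (f.hom.map_mem _ _ hx) ih
  exact this hb

/-- The induced morphism of graded algebras. -/
def Hom.mon {P Q : Presentation K Γ} (f : Hom P Q) : P.mon ⟶ Q.mon :=
  Mon.Hom.mk' (M := P.mon) (N := Q.mon) ⟨f.algHom.toLinearMap, f.algHom_mem⟩
    (GrVect.hom_ext <| LinearMap.ext fun (a : K) => f.algHom.commutes a)
    (GrVect.hom_ext <| TensorProduct.ext' fun (x y : P.Alg) => map_mul f.algHom x y)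

theorem Hom.mon_eq_id {P : Presentation K Γ} (f : Hom P P) (h : ∀ x, f.hom.lin x = x) :
    f.mon = 𝟙 P.mon :=
  Mon.Hom.ext <| GrVect.hom_ext <| congrArg AlgHom.toLinearMap <|
    P.algHom_ext (f := f.algHom) (g := AlgHom.id K P.Alg) fun x => by
      rw [f.algHom_ι, h x, AlgHom.id_apply]

theorem Hom.mon_eq_comp {P Q S : Presentation K Γ} (f : Hom P Q) (g : Hom Q S) (k : Hom P S)
    (h : ∀ x, k.hom.lin x = g.hom.lin (f.hom.lin x)) : k.mon = f.mon ≫ g.mon :=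
  Mon.Hom.ext <| GrVect.hom_ext <| congrArg AlgHom.toLinearMap <|
    P.algHom_ext (f := k.algHom) (g := g.algHom.comp f.algHom) fun x => by
      rw [AlgHom.comp_apply, f.algHom_ι, g.algHom_ι, k.algHom_ι, h x]

/-- Graded commutativity can be checked on generators. -/
theorem mon_isComm (h : ∀ i j, ∀ x ∈ P.X.gr i, ∀ y ∈ P.X.gr j,
    P.ι x * P.ι y = koszul K i j • (P.ι y * P.ι x)) : isComm _ P.mon := by
  have h1 : ∀ i, ∀ x ∈ P.X.gr i, ∀ γ w, IsWord P.X P.ι γ w →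
      P.ι x * w = koszul K i γ • (w * P.ι x) := by
    intro i x hx γ w hw
    induction hw with
    | one => rw [koszul_zero_right, one_smul, one_mul, mul_one]
    | cons hy _ ih =>
      rw [← mul_assoc, h i _ x hx _ hy, smul_mul_assoc, mul_assoc, ih, mul_smul_comm, smul_smul,
        ← koszul_add_right, mul_assoc]
  have h2 : ∀ δ v, IsWord P.X P.ι δ v → ∀ γ w, IsWord P.X P.ι γ w →
      v * w = koszul K δ γ • (w * v) := by
    intro δ v hv γ w hw
    induction hv with
    | one => rw [koszul_zero_left, one_smul, one_mul, mul_one]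
    | cons hx _ ih =>
      rw [mul_assoc, ih, mul_smul_comm, ← mul_assoc, h1 _ _ hx _ _ hw, smul_mul_assoc, smul_smul,
        ← mul_assoc, koszul_add_left, mul_comm]
  have h3 : ∀ δ, ∀ x ∈ wordGr P.X P.ι δ, ∀ γ, ∀ y ∈ wordGr P.X P.ι γ,
      x * y = koszul K δ γ • (y * x) := by
    intro δ x hx γ y hy
    induction hx using Submodule.span_induction with
    | mem v hv =>
      induction hy using Submodule.span_induction with
      | mem w hw => exact h2 δ v hv γ w hw
      | zero => simp
      | add a b _ _ ha hb => rw [mul_add, add_mul, ha, hb, smul_add]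
      | smul c a _ ha => rw [mul_smul_comm, ha, smul_mul_assoc, smul_comm]
    | zero => simp
    | add a b _ _ ha hb => rw [mul_add, add_mul, ha, hb, smul_add]
    | smul c a _ ha => rw [smul_mul_assoc, ha, mul_smul_comm, smul_comm]
  constructor
  refine GrVect.hom_ext <| tensor_ext P.mon.X P.mon.X fun i x hx j y hy => ?_
  refine (congrArg (LinearMap.mul' K P.Alg) (swapLin_tmul P.mon.X P.mon.X hx hy)).trans ?_
  refine Eq.trans ?_ (h3 i x hx j y hy).symm
  exact (LinearMap.mul' K P.Alg).map_smul (koszul K i j) _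

end Presentation

/-- The map `x ⊗ y ↦ xy` to the tensor algebra, the inclusion of `X ⊗ X` in `T(X)`. -/
def quad {K : Type u} [Field K] (X : Type u) [AddCommGroup X] [Module K X] :
    X ⊗[K] X →ₗ[K] TensorAlgebra K X :=
  LinearMap.mul' K (TensorAlgebra K X) ∘ₗ
    TensorProduct.map (TensorAlgebra.ι K) (TensorAlgebra.ι K)

theorem quad_tmul {X : Type u} [AddCommGroup X] [Module K X] (x y : X) :
    quad X (x ⊗ₜ[K] y) = TensorAlgebra.ι K x * TensorAlgebra.ι K y := by
  simp [quad]

theorem tensorAlgCoact_quad (X : GrVect K Γ) (z : X ⊗[K] X) (γ : Γ) :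
    (tensorAlgCoact X (quad X z)).coeff γ = quad X ((tensorObj' X X).coact z γ) := by
  have : Finsupp.lapply γ ∘ₗ (AddMonoidAlgebra.coeffLinearEquiv K).toLinearMap ∘ₗ
      (tensorAlgCoact X).toLinearMap ∘ₗ quad (K := K) X =
      quad X ∘ₗ component (tensorObj' X X) γ := tensor_ext X X fun i x hx j y hy => by
    have h1 := component_of_mem (tensorObj' X X) (δ := γ) (tmul_mem X X rfl hx hy)
    simp only [LinearMap.comp_apply, quad_tmul, h1, AlgHom.toLinearMap_apply, map_mul,
      tensorAlgCoact_ι X hx, tensorAlgCoact_ι X hy, AddMonoidAlgebra.single_mul_single]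
    change (AddMonoidAlgebra.single (i + j) _).coeff γ = _
    rw [AddMonoidAlgebra.coeff_single, Finsupp.single_apply]
    split_ifs
    · rw [quad_tmul]
    · rw [map_zero]
  exact LinearMap.congr_fun this z

theorem lift_quad {X Y : Type u} [AddCommGroup X] [Module K X] [AddCommGroup Y] [Module K Y]
    (f : X →ₗ[K] Y) (z : X ⊗[K] X) :
    TensorAlgebra.lift K (TensorAlgebra.ι K ∘ₗ f) (quad X z) =
      quad Y (TensorProduct.map f f z) := by
  induction z with
  | zero => simp
  | add a b ha hb => simp only [map_add, ha, hb]
  | tmul a b => simp [quad_tmul]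

end Presentations

/-! ### The realisation functors `A` and `S` -/

section Realisation

open GrVect

variable {K : Type u} [Field K]

/-- A graded space placed in weight one. -/
abbrev weightOne (V : GrVect K ℤ) : GrVect K (ℕ × ℤ) := regradeObj (fun z => (1, z)) V

theorem mem_weightOne {V : GrVect K ℤ} {p : ℕ × ℤ} {x : V} (hx : x ∈ (weightOne V).gr p) :
    x = 0 ∨ p.1 = 1 ∧ x ∈ V.gr p.2 := by
  by_cases h : p.1 = 1
  · refine .inr ⟨h, ?_⟩
    refine regrade_le (N := V.gr p.2) _ V (fun z hz x hx => ?_) hx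
    rw [← hz]
    exact hx
  · refine .inl ?_
    refine (Submodule.mem_bot K).1 (regrade_le (N := ⊥) _ V (fun z hz x hx => ?_) hx)
    rw [← hz] at h
    exact absurd rfl h

theorem weightOne_homogeneous {V : GrVect K ℤ} {R : Submodule K (V ⊗[K] V)}
    (hR : IsHomogeneous (tensorObj' V V) R) :
    IsHomogeneous (tensorObj' (weightOne V) (weightOne V)) R := by
  have h := hR.map (fun z => ((2, z) : ℕ × ℤ)) (W := tensorObj' (weightOne V) (weightOne V))
    LinearMap.id fun γ z hz => by
      have : tensorGr V V γ ≤ (tensorObj' (weightOne V) (weightOne V)).gr (2, γ) :=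
        tensorGr_le V V fun i j hij x hx y hy => by
          refine tmul_mem (weightOne V) (weightOne V) (i := (1, i)) (j := (1, j)) ?_ ?_ ?_
          · rw [← hij]
            rfl
          · exact mem_regrade _ V rfl hx
          · exact mem_regrade _ V rfl hy
      exact this hz
  rwa [Submodule.map_id] at h

theorem swap_weightOne (V : GrVect K ℤ) :
    swapLin (weightOne V) (weightOne V) = swapLin V V :=
  tensor_ext V V fun i x hx j y hy => by
    have hk : koszul K ((1, i) : ℕ × ℤ) (1, j) = koszul K i j := rfl
    have h1 : x ∈ (weightOne V).gr (1, i) := mem_regrade _ V rfl hx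
    have h2 : y ∈ (weightOne V).gr (1, j) := mem_regrade _ V rfl hy
    rw [swapLin_tmul V V hx hy, ← hk]
    exact swapLin_tmul (weightOne V) (weightOne V) h1 h2

/-- The presentation with generators `V` in weight one and quadratic relations `r ∈ N`. -/
def quadPresentation (V : GrVect K ℤ) (N : Set (V ⊗[K] V))
    (hN : ∀ z ∈ N, ∀ γ, (tensorObj' (weightOne V) (weightOne V)).coact z γ ∈ N) :
    Presentation K (ℕ × ℤ) where
  X := weightOne V
  rel := quad V '' N
  coact_mem := by
    rintro _ ⟨z, hz, rfl⟩ γ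
    exact ⟨_, hN z hz γ, (tensorAlgCoact_quad (weightOne V) z γ).symm⟩

theorem isWord_weightOne (V : GrVect K ℤ) {B : Type u} [Ring B] [Algebra K B]
    (ι : weightOne V →ₗ[K] B) (γ : ℕ × ℤ) (w : B) (hw : IsWord (weightOne V) ι γ w) :
    w ∈ (LinearMap.range ι) ^ γ.1 := by
  induction hw with
  | one => exact Submodule.one_le.1 (le_of_eq (pow_zero _).symm)
  | @cons i γ x w hx _ ih =>
    rcases mem_weightOne hx with h0 | ⟨h, -⟩
    · have h1 : ι x = 0 := (congrArg ι h0).trans (map_zero _)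
      rw [h1, zero_mul]
      exact zero_mem _
    · rw [Prod.fst_add, h, pow_add, pow_one]
      exact Submodule.mul_mem_mul ⟨x, rfl⟩ ih

theorem wordGr_finWeight (V : GrVect K ℤ) [FiniteDimensional K V] {B : Type u} [Ring B]
    [Algebra K B] (ι : weightOne V →ₗ[K] B) (h : DirectSum.IsInternal (wordGr (weightOne V) ι)) :
    finWeight K { carrier := B, gr := wordGr (weightOne V) ι, isInternal := h } := by
  have hfin : ∀ n, FiniteDimensional K ↥((LinearMap.range ι) ^ n) := fun n => by
    have : Module.Finite K (weightOne V) := inferInstanceAs (FiniteDimensional K V)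
    exact Module.Finite.iff_fg.2 (Submodule.FG.pow
      (Module.Finite.iff_fg.1 (Module.Finite.range _)) n)
  refine @finWeight_of_le K _ { carrier := B, gr := wordGr (weightOne V) ι, isInternal := h }
    (fun n => (LinearMap.range ι) ^ n) hfin fun n z => ?_
  exact Submodule.span_le.2 fun w hw => isWord_weightOne V ι (n, z) w hw

theorem quadPresentation_finWeight (V : GrVect K ℤ) [FiniteDimensional K V] (N : Set (V ⊗[K] V))
    (hN : ∀ z ∈ N, ∀ γ, (tensorObj' (weightOne V) (weightOne V)).coact z γ ∈ N) :
    wgAss K (quadPresentation V N hN).mon :=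
  wordGr_finWeight V (quadPresentation V N hN).ι _

/-- A map preserving quadratic relations. -/
def quadPresentationHom {V W : GrVect K ℤ} {N : Set (V ⊗[K] V)} {P : Set (W ⊗[K] W)}
    (hN : ∀ z ∈ N, ∀ γ, (tensorObj' (weightOne V) (weightOne V)).coact z γ ∈ N)
    (hP : ∀ z ∈ P, ∀ γ, (tensorObj' (weightOne W) (weightOne W)).coact z γ ∈ P)
    (f : V ⟶ W) (h : ∀ z ∈ N, sq f z ∈ P) :
    Presentation.Hom (quadPresentation V N hN) (quadPresentation W P hP) where
  hom := (regrade (fun z => ((1, z) : ℕ × ℤ))).map f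
  map_rel := by
    rintro _ ⟨z, hz, rfl⟩
    exact ⟨_, h z hz, (lift_quad f.lin z).symm⟩

/-- `A(V, R) = T(V)/(R)`. -/
abbrev assPresentation {m : Mixing} (X : QD K m) : Presentation K (ℕ × ℤ) :=
  quadPresentation X.V (X.R : Set (X.V ⊗[K] X.V)) (weightOne_homogeneous X.homogeneous)

/-- The functor `A : (QD, ⊗) ⥤ wg-Ass-alg`. -/
def realA (K : Type u) [Field K] : QDTensor K ⥤ WgAssAlg K where
  obj X :=
    { obj := (assPresentation X).mon
      property := by
        have := X.finite
        exact quadPresentation_finWeight _ _ _ }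
  map {X Y} f := ObjectProperty.homMk (quadPresentationHom (weightOne_homogeneous X.homogeneous)
    (weightOne_homogeneous Y.homogeneous) f.hom fun _ hz => f.map_le hz).mon
  map_id X := ObjectProperty.hom_ext _ (Presentation.Hom.mon_eq_id _ fun _ => rfl)
  map_comp f g := ObjectProperty.hom_ext _ (Presentation.Hom.mon_eq_comp _ _ _ fun _ => rfl)

/-- `S(V, R) = S(V)/(R)` where `S(V) = T(V)/(V^{∧2})`. -/
abbrev comPresentation {m : Mixing} (X : QD K m) : Presentation K (ℕ × ℤ) :=
  quadPresentation X.V ((extSquare X.V : Set (X.V ⊗[K] X.V)) ∪ (X.R : Set (X.V ⊗[K] X.V)))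
    fun z hz γ => hz.imp
      (fun h => weightOne_homogeneous (range_symLin_homogeneous .minus X.V) z h γ)
      (fun h => weightOne_homogeneous X.homogeneous z h γ)

theorem comPresentation_isComm {m : Mixing} (X : QD K m) : isComm _ (comPresentation X).mon := by
  refine Presentation.mon_isComm fun i j x hx y hy => ?_
  have h1 : symLin .minus X.V (x ⊗ₜ[K] y) ∈ extSquare X.V := ⟨_, rfl⟩
  have h2 := (comPresentation X).proj_rel ⟨_, .inl h1, rfl⟩
  have h3 : swapLin X.V X.V (x ⊗ₜ[K] y) = koszul K i j • (y ⊗ₜ[K] x) := by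
    rw [← swap_weightOne]
    exact swapLin_tmul (weightOne X.V) (weightOne X.V) hx hy
  have key : ∀ (x y : X.V) (c : K), swapLin X.V X.V (x ⊗ₜ[K] y) = c • (y ⊗ₜ[K] x) →
      quad X.V (symLin .minus X.V (x ⊗ₜ[K] y)) = TensorAlgebra.ι K x * TensorAlgebra.ι K y -
        c • (TensorAlgebra.ι K y * TensorAlgebra.ι K x) := by
    intro x y c h
    rw [symLin, LinearMap.sub_apply, h, LinearMap.id_apply, map_sub, map_smul, quad_tmul,
      quad_tmul]
  have h4 : (comPresentation X).proj (TensorAlgebra.ι K x * TensorAlgebra.ι K y -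
      koszul K i j • (TensorAlgebra.ι K y * TensorAlgebra.ι K x)) = 0 :=
    (congrArg (comPresentation X).proj (key x y _ h3)).symm.trans h2
  rw [map_sub, map_smul, map_mul, map_mul, sub_eq_zero] at h4
  exact h4

/-- The functor `S : (QD⁺, ∨) ⥤ wg-Com-alg`. -/
def realS (K : Type u) [Field K] : QDPlusVee K ⥤ WgComAlg K where
  obj X :=
    { obj := (comPresentation X.obj).mon
      property := by
        have := X.obj.finite
        exact ⟨quadPresentation_finWeight _ _ _, comPresentation_isComm _⟩ }
  map {X Y} f := ObjectProperty.homMk (quadPresentationHom _ _ f.hom.hom fun z hz => by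
    rcases hz with ⟨w, rfl⟩ | hz
    · exact .inl ⟨_, symLin_natural .minus f.hom.hom w⟩
    · exact .inr (f.hom.map_le hz)).mon
  map_id X := ObjectProperty.hom_ext _ (Presentation.Hom.mon_eq_id _ fun _ => rfl)
  map_comp f g := ObjectProperty.hom_ext _ (Presentation.Hom.mon_eq_comp _ _ _ fun _ => rfl)

end Realisation

/-! ### Graded Lie algebras -/

section LieAlgebras

open GrVect

variable {K : Type u} [Field K] {Γ : Type} [DecidableEq Γ] [AddCommMonoid Γ]

/-- A graded vector space with a bilinear operation that is additive on degrees. -/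
structure GrOp (K : Type u) [Field K] (Γ : Type) [DecidableEq Γ] [AddCommMonoid Γ] :
    Type (u + 1) where
  X : GrVect K Γ
  bracket : X →ₗ[K] X →ₗ[K] X
  bracket_mem : ∀ i, ∀ x ∈ X.gr i, ∀ j, ∀ y ∈ X.gr j, bracket x y ∈ X.gr (i + j)

/-- Graded Lie algebras: graded antisymmetry and the graded Jacobi identity. -/
structure GrLie (K : Type u) [Field K] (Γ : Type) [DecidableEq Γ] [AddCommMonoid Γ]
    [DegreeIndex Γ] : Type (u + 1) extends GrOp K Γ where
  skew : ∀ i, ∀ x ∈ X.gr i, ∀ j, ∀ y ∈ X.gr j, bracket x y = -(koszul K i j • bracket y x)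
  jacobi : ∀ i, ∀ x ∈ X.gr i, ∀ j, ∀ y ∈ X.gr j, ∀ k, ∀ z ∈ X.gr k,
    bracket x (bracket y z) = bracket (bracket x y) z + koszul K i j • bracket y (bracket x z)

/-- Degree-zero maps compatible with the operations. -/
@[ext]
structure GrOp.Hom (A B : GrOp K Γ) where
  hom : A.X ⟶ B.X
  map_bracket : ∀ x y, hom.lin (A.bracket x y) = B.bracket (hom.lin x) (hom.lin y)

namespace GrOp

/-- The two-sided ideal generated by a set. -/
def idealSpan (A : GrOp K Γ) (S : Set A.X) : Submodule K A.X :=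
  sInf {N | S ⊆ N ∧ ∀ a, ∀ x ∈ N, A.bracket a x ∈ N ∧ A.bracket x a ∈ N}

theorem idealSpan_le (A : GrOp K Γ) {S : Set A.X} {N : Submodule K A.X} (h : S ⊆ N)
    (h' : ∀ a, ∀ x ∈ N, A.bracket a x ∈ N ∧ A.bracket x a ∈ N) : A.idealSpan S ≤ N :=
  sInf_le ⟨h, h'⟩

theorem subset_idealSpan (A : GrOp K Γ) {S : Set A.X} {x : A.X} (hx : x ∈ S) :
    x ∈ A.idealSpan S := Submodule.mem_sInf.2 fun _ hN => hN.1 hx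

theorem idealSpan_left (A : GrOp K Γ) {S : Set A.X} (a : A.X) {x : A.X} (hx : x ∈ A.idealSpan S) :
    A.bracket a x ∈ A.idealSpan S :=
  Submodule.mem_sInf.2 fun N hN => (hN.2 a x (Submodule.mem_sInf.1 hx N hN)).1

theorem idealSpan_right (A : GrOp K Γ) {S : Set A.X} (a : A.X) {x : A.X}
    (hx : x ∈ A.idealSpan S) : A.bracket x a ∈ A.idealSpan S :=
  Submodule.mem_sInf.2 fun N hN => (hN.2 a x (Submodule.mem_sInf.1 hx N hN)).2

theorem component_bracket_mem (A : GrOp K Γ) {N : Submodule K A.X} (f : A.X →ₗ[K] A.X) (i : Γ)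
    (hf : ∀ x ∈ N, f x ∈ N) (hi : ∀ j, ∀ x ∈ A.X.gr j, f x ∈ A.X.gr (i + j)) (x : A.X)
    (hx : ∀ γ, A.X.coact x γ ∈ N) (γ : Γ) : A.X.component γ (f x) ∈ N := by
  rw [← A.X.coact_sum x, Finsupp.lsum_apply, Finsupp.sum, map_sum, map_sum]
  refine Submodule.sum_mem _ fun j _ => ?_
  rw [LinearMap.id_apply, A.X.component_of_mem (hi j _ (A.X.coact_mem x j))]
  split_ifs
  · exact hf _ (hx j)
  · exact zero_mem _

theorem idealSpan_homogeneous (A : GrOp K Γ) {S : Set A.X}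
    (h : ∀ s ∈ S, ∀ γ, A.X.coact s γ ∈ A.idealSpan S) : IsHomogeneous A.X (A.idealSpan S) := by
  have : A.idealSpan S ≤ ⨅ γ, (A.idealSpan S).comap (A.X.component γ) := by
    refine A.idealSpan_le (fun s hs => (Submodule.mem_iInf _).2 fun γ => h s hs γ) ?_
    intro a x hx
    have hx' : ∀ γ, A.X.coact x γ ∈ A.idealSpan S := (Submodule.mem_iInf _).1 hx
    constructor
    · refine A.X.induction (p := fun a => A.bracket a x ∈ _) a (fun i a ha => ?_) ?_ ?_
      · exact (Submodule.mem_iInf _).2 fun γ => A.component_bracket_mem (A.bracket a) i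
          (fun y hy => A.idealSpan_left a hy) (fun j y hy => A.bracket_mem i a ha j y hy) x hx' γ
      · rw [map_zero, LinearMap.zero_apply]
        exact zero_mem _
      · intro a b ha hb
        rw [map_add, LinearMap.add_apply]
        exact add_mem ha hb
    · refine A.X.induction (p := fun a => A.bracket x a ∈ _) a (fun i a ha => ?_) ?_ ?_
      · exact (Submodule.mem_iInf _).2 fun γ => A.component_bracket_mem (A.bracket.flip a) i
          (fun y hy => A.idealSpan_right a hy)
          (fun j y hy => by rw [add_comm]; exact A.bracket_mem j y hy i a ha) x hx' γ
      · rw [map_zero]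
        exact zero_mem _
      · intro a b ha hb
        rw [map_add]
        exact add_mem ha hb
  exact fun x hx => (Submodule.mem_iInf _).1 (this hx)

end GrOp

/-- The quotient of a graded space by a graded subspace. -/
abbrev GrVect.quotObj (V : GrVect K Γ) (N : Submodule K V) (hN : IsHomogeneous V N) :
    GrVect K Γ where
  carrier := V.carrier ⧸ N
  gr γ := (V.gr γ).map N.mkQ
  isInternal := by
    refine isInternal_of _ (N.liftQ (LinearMap.pi fun γ => N.mkQ ∘ₗ V.component γ) fun x hx => ?_)
      LinearMap.id Function.injective_id ?_ ?_
    · rw [LinearMap.mem_ker]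
      ext γ
      exact (Submodule.Quotient.mk_eq_zero N).2 (hN x hx γ)
    · rintro γ _ ⟨x, hx, rfl⟩
      ext δ
      rw [Submodule.mkQ_apply, Submodule.liftQ_apply, LinearMap.pi_apply, LinearMap.comp_apply,
        V.component_of_mem hx, LinearMap.id_apply]
      by_cases h : γ = δ
      · subst h
        simp
      · rw [if_neg h, map_zero, Pi.single_eq_of_ne (Ne.symm h)]
    · rw [← Submodule.map_iSup, V.iSup_gr, Submodule.map_top, Submodule.range_mkQ]

namespace GrOp

/-- The quotient by the ideal generated by a set whose homogeneous components are in the ideal. -/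
abbrev quot (A : GrOp K Γ) (S : Set A.X) (h : ∀ s ∈ S, ∀ γ, A.X.coact s γ ∈ A.idealSpan S) :
    GrOp K Γ where
  X := A.X.quotObj (A.idealSpan S) (A.idealSpan_homogeneous h)
  bracket := (A.idealSpan S).liftQ
    { toFun := fun a => (A.idealSpan S).mapQ (A.idealSpan S) (A.bracket a)
        fun _ hx => A.idealSpan_left a hx
      map_add' := fun a b => by ext x; simp
      map_smul' := fun c a => by ext x; simp }
    fun x hx => by
      rw [LinearMap.mem_ker]
      ext y
      exact (Submodule.Quotient.mk_eq_zero _).2 (A.idealSpan_right y hx)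
  bracket_mem := by
    rintro i _ ⟨x, hx, rfl⟩ j _ ⟨y, hy, rfl⟩
    exact ⟨_, A.bracket_mem i x hx j y hy, rfl⟩

variable {A : GrOp K Γ} {S : Set A.X} {h : ∀ s ∈ S, ∀ γ, A.X.coact s γ ∈ A.idealSpan S}

/-- The quotient map. -/
def proj (A : GrOp K Γ) (S : Set A.X) (h : ∀ s ∈ S, ∀ γ, A.X.coact s γ ∈ A.idealSpan S) :
    A.Hom (A.quot S h) where
  hom := ⟨(A.idealSpan S).mkQ, fun _ x hx => ⟨x, hx, rfl⟩⟩
  map_bracket _ _ := rfl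

theorem proj_eq_zero {x : A.X} (hx : x ∈ S) : (A.proj S h).hom.lin x = 0 :=
  (Submodule.Quotient.mk_eq_zero _).2 (A.subset_idealSpan hx)

/-- The universal property of the quotient. -/
def lift {B : GrOp K Γ} (f : A.Hom B) (hf : ∀ s ∈ S, f.hom.lin s = 0) : (A.quot S h).Hom B where
  hom :=
    { lin := (A.idealSpan S).liftQ f.hom.lin (A.idealSpan_le hf fun a x hx => by
        rw [LinearMap.mem_ker] at hx
        rw [LinearMap.mem_ker, LinearMap.mem_ker, f.map_bracket, f.map_bracket, hx, map_zero,
          LinearMap.map_zero₂]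
        exact ⟨rfl, rfl⟩)
      map_mem := by
        rintro γ _ ⟨x, hx, rfl⟩
        exact f.hom.map_mem γ x hx }
  map_bracket x y := by
    obtain ⟨x, rfl⟩ := Submodule.mkQ_surjective _ x
    obtain ⟨y, rfl⟩ := Submodule.mkQ_surjective _ y
    exact f.map_bracket x y

theorem lift_proj {B : GrOp K Γ} (f : A.Hom B) (hf : ∀ s ∈ S, f.hom.lin s = 0) (x : A.X) :
    (lift (h := h) f hf).hom.lin ((A.proj S h).hom.lin x) = f.hom.lin x := rfl

theorem quot_hom_ext {B : GrOp K Γ} {f g : (A.quot S h).Hom B}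
    (hfg : ∀ x, f.hom.lin ((A.proj S h).hom.lin x) = g.hom.lin ((A.proj S h).hom.lin x)) :
    f = g := by
  apply Hom.ext
  apply GrVect.hom_ext
  ext x
  exact hfg x

end GrOp

/-! ### The category of graded Lie algebras and the direct sum -/

section LieCategory

variable [DegreeIndex Γ]

namespace GrLie

instance : Category (GrLie K Γ) where
  Hom g h := GrOp.Hom g.toGrOp h.toGrOp
  id g := ⟨𝟙 g.X, fun _ _ => rfl⟩
  comp f g := ⟨f.hom ≫ g.hom, fun x y => by
    rw [comp_lin, LinearMap.comp_apply, f.map_bracket, g.map_bracket]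
    rfl⟩
  id_comp f := GrOp.Hom.ext (Category.id_comp f.hom)
  comp_id f := GrOp.Hom.ext (Category.comp_id f.hom)
  assoc f g h := GrOp.Hom.ext (Category.assoc f.hom g.hom h.hom)

theorem hom_ext {g h : GrLie K Γ} {a b : g ⟶ h} (e : a.hom.lin = b.hom.lin) : a = b :=
  GrOp.Hom.ext (GrVect.hom_ext e)

/-- The direct sum of Lie algebras. -/
abbrev prod (g h : GrLie K Γ) : GrLie K Γ where
  X := sumObj g.X h.X
  bracket := LinearMap.mk₂ K (fun x y => (g.bracket x.1 y.1, h.bracket x.2 y.2))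
    (fun x x' y => by ext <;> simp) (fun c x y => by ext <;> simp)
    (fun x y y' => by ext <;> simp) (fun c x y => by ext <;> simp)
  bracket_mem i x hx j y hy :=
    ⟨g.bracket_mem i _ hx.1 j _ hy.1, h.bracket_mem i _ hx.2 j _ hy.2⟩
  skew i x hx j y hy := Prod.ext (g.skew i _ hx.1 j _ hy.1) (h.skew i _ hx.2 j _ hy.2)
  jacobi i x hx j y hy k z hz := Prod.ext (g.jacobi i _ hx.1 j _ hy.1 k _ hz.1)
    (h.jacobi i _ hx.2 j _ hy.2 k _ hz.2)

/-- The zero Lie algebra. -/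
abbrev unit (K : Type u) [Field K] (Γ : Type) [DecidableEq Γ] [AddCommMonoid Γ] [DegreeIndex Γ] :
    GrLie K Γ where
  X := zeroObj K Γ
  bracket := 0
  bracket_mem _ _ _ _ _ _ := trivial
  skew _ _ _ _ _ _ := rfl
  jacobi _ _ _ _ _ _ _ _ _ := rfl

/-- The direct sum of morphisms. -/
def prodHom {g g' h h' : GrLie K Γ} (a : g ⟶ g') (b : h ⟶ h') : prod g h ⟶ prod g' h' where
  hom := sumHom a.hom b.hom
  map_bracket x y := Prod.ext (a.map_bracket x.1 y.1) (b.map_bracket x.2 y.2)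

instance : MonoidalCategoryStruct (GrLie K Γ) where
  tensorObj := prod
  tensorUnit := unit K Γ
  whiskerLeft g _ _ f := prodHom (𝟙 g) f
  whiskerRight f g := prodHom f (𝟙 g)
  tensorHom := prodHom
  associator a b c :=
    { hom := ⟨sumAssoc a.X b.X c.X, fun _ _ => rfl⟩
      inv := ⟨sumAssocInv a.X b.X c.X, fun _ _ => rfl⟩
      hom_inv_id := hom_ext (LinearMap.ext fun _ => rfl)
      inv_hom_id := hom_ext (LinearMap.ext fun _ => rfl) }
  leftUnitor a :=
    { hom := ⟨sumSnd (zeroObj K Γ) a.X, fun _ _ => rfl⟩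
      inv := ⟨inr (zeroObj K Γ) a.X, fun _ _ => rfl⟩
      hom_inv_id := hom_ext (LinearMap.ext fun _ => rfl)
      inv_hom_id := hom_ext (LinearMap.ext fun _ => rfl) }
  rightUnitor a :=
    { hom := ⟨sumFst a.X (zeroObj K Γ), fun _ _ => rfl⟩
      inv := ⟨inl a.X (zeroObj K Γ), fun _ _ => rfl⟩
      hom_inv_id := hom_ext (LinearMap.ext fun _ => rfl)
      inv_hom_id := hom_ext (LinearMap.ext fun _ => rfl) }

instance : MonoidalCategory (GrLie K Γ) :=
  .ofTensorHom
    (id_tensorHom_id := fun _ _ => hom_ext (LinearMap.ext fun _ => rfl))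
    (tensorHom_comp_tensorHom := fun _ _ _ _ => hom_ext (LinearMap.ext fun _ => rfl))
    (associator_naturality := fun _ _ _ => hom_ext (LinearMap.ext fun _ => rfl))
    (leftUnitor_naturality := fun _ => hom_ext (LinearMap.ext fun _ => rfl))
    (rightUnitor_naturality := fun _ => hom_ext (LinearMap.ext fun _ => rfl))
    (pentagon := fun _ _ _ _ => hom_ext (LinearMap.ext fun _ => rfl))
    (triangle := fun _ _ => hom_ext (LinearMap.ext fun _ => rfl))

instance : SymmetricCategory (GrLie K Γ) where
  braiding a b :=
    { hom := ⟨sumComm a.X b.X, fun _ _ => rfl⟩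
      inv := ⟨sumComm b.X a.X, fun _ _ => rfl⟩
      hom_inv_id := hom_ext (LinearMap.ext fun _ => rfl)
      inv_hom_id := hom_ext (LinearMap.ext fun _ => rfl) }
  braiding_naturality_right _ _ _ _ := hom_ext (LinearMap.ext fun _ => rfl)
  braiding_naturality_left _ _ := hom_ext (LinearMap.ext fun _ => rfl)
  hexagon_forward _ _ _ := hom_ext (LinearMap.ext fun _ => rfl)
  hexagon_reverse _ _ _ := hom_ext (LinearMap.ext fun _ => rfl)
  symmetry _ _ := hom_ext (LinearMap.ext fun _ => rfl)

end GrLie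

end LieCategory

end LieAlgebras

section LieCategories

open GrVect

variable (K : Type u) [Field K]

/-- Graded Lie algebras. -/
abbrev LieAlg := GrLie K ℤ

/-- Weight graded Lie algebras with finite dimensional weight components. -/
def wgLie : ObjectProperty (GrLie K (ℕ × ℤ)) := fun g => finWeight K g.X

instance : (wgLie K).IsMonoidal where
  prop_unit := fun n => by
    have : FiniteDimensional K (zeroObj K (ℕ × ℤ)) := inferInstanceAs (FiniteDimensional K PUnit)
    infer_instance
  prop_tensor g h hg hh := by
    have hg' : ∀ n, FiniteDimensional K (weightPart g.X n) := hg
    have hh' : ∀ n, FiniteDimensional K (weightPart h.X n) := hh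
    have hfin : ∀ n, FiniteDimensional K
        ↥((weightPart g.X n).map (inl g.X h.X).lin ⊔ (weightPart h.X n).map (inr g.X h.X).lin) :=
      fun n => inferInstance
    refine @finWeight_of_le K _ (sumObj g.X h.X) _ hfin fun n z x hx => ?_
    have h1 := Submodule.add_mem_sup
      (Submodule.mem_map_of_mem (f := (inl g.X h.X).lin) (gr_le_weightPart g.X (n, z) hx.1))
      (Submodule.mem_map_of_mem (f := (inr g.X h.X).lin) (gr_le_weightPart h.X (n, z) hx.2))
    have h2 : (inl g.X h.X).lin x.1 + (inr g.X h.X).lin x.2 = x :=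
      Prod.ext (add_zero x.1) (zero_add x.2)
    rwa [h2] at h1

abbrev WgLieAlg := (wgLie K).FullSubcategory

/-- Forgetting the weight of a Lie algebra. -/
def forgetWeightLie : GrLie K (ℕ × ℤ) ⥤ GrLie K ℤ where
  obj g :=
    { X := regradeObj Prod.snd g.X
      bracket := g.bracket
      bracket_mem := fun i x hx j y hy => by
        refine regrade_le (N := ((regradeObj Prod.snd g.X).gr (i + j)).comap (g.bracket.flip y))
          Prod.snd g.X (fun a ha x hx => ?_) hx
        refine regrade_le (N := ((regradeObj Prod.snd g.X).gr (i + j)).comap (g.bracket x))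
          Prod.snd g.X (fun b hb y hy => ?_) hy
        exact mem_regrade Prod.snd g.X (by rw [Prod.snd_add, ha, hb]) (g.bracket_mem a x hx b y hy)
      skew := fun i x hx j y hy => by
        refine regrade_le (N := LinearMap.eqLocus (g.bracket.flip y)
          (-(koszul K i j • g.bracket y))) Prod.snd g.X (fun a ha x hx' => ?_) hx
        refine regrade_le (N := LinearMap.eqLocus (g.bracket x)
          (-(koszul K i j • g.bracket.flip x))) Prod.snd g.X (fun b hb y hy' => ?_) hy
        subst ha
        subst hb
        exact g.skew a x hx' b y hy'
      jacobi := fun i x hx j y hy k z hz => by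
        refine regrade_le (N := LinearMap.eqLocus (g.bracket.flip (g.bracket y z))
          ((g.bracket.flip z) ∘ₗ g.bracket.flip y + koszul K i j •
            (g.bracket y ∘ₗ g.bracket.flip z))) Prod.snd g.X (fun a ha x hx' => ?_) hx
        refine regrade_le (N := LinearMap.eqLocus (g.bracket x ∘ₗ g.bracket.flip z)
          ((g.bracket.flip z) ∘ₗ g.bracket x + koszul K i j •
            (g.bracket.flip (g.bracket x z)))) Prod.snd g.X (fun b hb y hy' => ?_) hy
        refine regrade_le (N := LinearMap.eqLocus (g.bracket x ∘ₗ g.bracket y)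
          (g.bracket (g.bracket x y) + koszul K i j •
            (g.bracket y ∘ₗ g.bracket x))) Prod.snd g.X (fun c hc z hz' => ?_) hz
        subst ha
        subst hb
        exact g.jacobi a x hx' b y hy' c z hz' }
  map f := ⟨(regrade Prod.snd).map f.hom, f.map_bracket⟩

/-- The inclusion of weight graded Lie algebras into Lie algebras. -/
def wgLieToLie : WgLieAlg K ⥤ LieAlg K := (wgLie K).ι ⋙ forgetWeightLie K

/-! ### The universal enveloping algebra -/

variable {K}

/-- The presentation of `U(g) = T(g)/(x ⊗ y - (-1)^{|x||y|} y ⊗ x - [x, y])`. -/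
def envPresentation (g : LieAlg K) : Presentation K ℤ where
  X := g.X
  rel := {s | ∃ i, ∃ x ∈ g.X.gr i, ∃ j, ∃ y ∈ g.X.gr j,
    s = TensorAlgebra.ι K x * TensorAlgebra.ι K y -
      koszul K i j • (TensorAlgebra.ι K y * TensorAlgebra.ι K x) -
      TensorAlgebra.ι K (g.bracket x y)}
  coact_mem := by
    rintro _ ⟨i, x, hx, j, y, hy, rfl⟩ γ
    have h : tensorAlgCoact g.X (TensorAlgebra.ι K x * TensorAlgebra.ι K y -
      koszul K i j • (TensorAlgebra.ι K y * TensorAlgebra.ι K x) -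
      TensorAlgebra.ι K (g.bracket x y)) = AddMonoidAlgebra.lsingle (R := K) (i + j)
        (TensorAlgebra.ι K x * TensorAlgebra.ι K y -
      koszul K i j • (TensorAlgebra.ι K y * TensorAlgebra.ι K x) -
      TensorAlgebra.ι K (g.bracket x y)) := by
      simp only [map_sub, map_mul, map_smul, tensorAlgCoact_ι g.X hx, tensorAlgCoact_ι g.X hy,
        tensorAlgCoact_ι g.X (g.bracket_mem i x hx j y hy), AddMonoidAlgebra.single_mul_single,
        add_comm j i, AddMonoidAlgebra.lsingle_apply]
    rw [h, AddMonoidAlgebra.lsingle_apply, AddMonoidAlgebra.coeff_single, Finsupp.single_apply]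
    split_ifs
    · exact ⟨i, x, hx, j, y, hy, rfl⟩
    · exact ⟨0, 0, zero_mem _, 0, 0, zero_mem _, by simp⟩

/-- The map of enveloping algebras. -/
def envHom {g h : LieAlg K} (f : g ⟶ h) :
    Presentation.Hom (envPresentation g) (envPresentation h) where
  hom := f.hom
  map_rel := by
    rintro _ ⟨i, x, hx, j, y, hy, rfl⟩
    refine ⟨i, f.hom.lin x, f.hom.map_mem i x hx, j, f.hom.lin y, f.hom.map_mem j y hy, ?_⟩
    have h1 := f.map_bracket x y
    rw [← h1]
    erw [map_sub, map_sub, map_smul, map_mul, map_mul, TensorAlgebra.lift_ι_apply,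
      TensorAlgebra.lift_ι_apply, TensorAlgebra.lift_ι_apply]
    rfl

variable (K) in
/-- The universal enveloping algebra functor. -/
def env : LieAlg K ⥤ AssAlg K where
  obj g := (envPresentation g).mon
  map f := (envHom f).mon
  map_id _ := Presentation.Hom.mon_eq_id _ fun _ => rfl
  map_comp _ _ := Presentation.Hom.mon_eq_comp _ _ _ fun _ => rfl

end LieCategories

/-! ### Free Lie algebras and the realisation functor `L` -/

section FreeLie

open GrVect

variable {K : Type u} [Field K] {Γ : Type} [DecidableEq Γ] [AddCommMonoid Γ]

/-- Nonassociative words in the homogeneous elements of a graded space. -/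
abbrev Words (V : GrVect K Γ) : Type u := FreeMagma (Σ γ : Γ, V.gr γ)

/-- The degree of a word. -/
def wordDeg (V : GrVect K Γ) : Words V → Γ
  | .of p => p.1
  | .mul a b => wordDeg V a + wordDeg V b

/-- The span of the words of a given degree. -/
def wordSpan (V : GrVect K Γ) (γ : Γ) : Submodule K (Words V →₀ K) :=
  Submodule.span K ((fun w => Finsupp.single w (1 : K)) '' {w | wordDeg V w = γ})

theorem wordSpan_isInternal (V : GrVect K Γ) : DirectSum.IsInternal (wordSpan V) := by
  refine isInternal_of _ (LinearMap.pi fun γ => Finsupp.linearCombination K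
    fun w : Words V => if wordDeg V w = γ then Finsupp.single w (1 : K) else 0)
    LinearMap.id Function.injective_id ?_ ?_
  · intro γ x hx
    induction hx using Submodule.span_induction with
    | mem x hx =>
      obtain ⟨w, rfl, rfl⟩ := hx
      ext1 δ
      rw [LinearMap.pi_apply, Finsupp.linearCombination_single, one_smul, LinearMap.id_apply]
      by_cases h : wordDeg V w = δ
      · subst h
        simp
      · rw [if_neg h, Pi.single_eq_of_ne (Ne.symm h)]
    | zero => simp
    | add x y _ _ hx hy => rw [map_add, hx, hy, map_add, Pi.single_add]
    | smul c x _ hx => rw [map_smul, hx, map_smul, Pi.single_smul]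
  · rw [eq_top_iff]
    intro x _
    induction x using Finsupp.induction_linear with
    | zero => exact zero_mem _
    | add x y hx hy => exact add_mem (hx trivial) (hy trivial)
    | single w a =>
      rw [← mul_one a, ← smul_eq_mul, ← Finsupp.smul_single]
      exact Submodule.smul_mem _ _ (Submodule.mem_iSup_of_mem (wordDeg V w)
        (Submodule.subset_span ⟨w, rfl, rfl⟩))

/-- The bilinear extension of the product of words. -/
def wordMul (V : GrVect K Γ) : (Words V →₀ K) →ₗ[K] (Words V →₀ K) →ₗ[K] (Words V →₀ K) :=
  Finsupp.linearCombination K fun a : Words V =>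
    Finsupp.linearCombination K fun b : Words V => Finsupp.single (FreeMagma.mul a b) (1 : K)

theorem wordMul_single (V : GrVect K Γ) (a b : Words V) :
    wordMul V (Finsupp.single a 1) (Finsupp.single b 1) =
      Finsupp.single (FreeMagma.mul a b) (1 : K) := by
  rw [wordMul, Finsupp.linearCombination_single, one_smul, Finsupp.linearCombination_single,
    one_smul]

theorem wordMul_mem (V : GrVect K Γ) (i : Γ) (x : Words V →₀ K) (hx : x ∈ wordSpan V i) (j : Γ)
    (y : Words V →₀ K) (hy : y ∈ wordSpan V j) : wordMul V x y ∈ wordSpan V (i + j) := by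
  have h1 : Submodule.map₂ (wordMul V) (wordSpan V i) (wordSpan V j) ≤ wordSpan V (i + j) := by
    rw [wordSpan, wordSpan, Submodule.map₂_span_span, Submodule.span_le]
    rintro _ ⟨_, ⟨a, rfl, rfl⟩, _, ⟨b, rfl, rfl⟩, rfl⟩
    exact Submodule.subset_span ⟨FreeMagma.mul a b, rfl, (wordMul_single V a b).symm⟩
  exact h1 (Submodule.apply_mem_map₂ _ hx hy)

/-- The free nonassociative algebra on the homogeneous elements of `V` (regarded as a set). -/
abbrev freeOp (V : GrVect K Γ) : GrOp K Γ where
  X := { carrier := Words V →₀ K, gr := wordSpan V, isInternal := wordSpan_isInternal V }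
  bracket := wordMul V
  bracket_mem := wordMul_mem V

/-- A word as an element of the free algebra. -/
def wordElt (V : GrVect K Γ) (w : Words V) : (freeOp V).X := Finsupp.single w (1 : K)

theorem wordElt_mem (V : GrVect K Γ) (w : Words V) :
    wordElt V w ∈ (freeOp V).X.gr (wordDeg V w) := Submodule.subset_span ⟨w, rfl, rfl⟩

theorem wordElt_mul (V : GrVect K Γ) (a b : Words V) :
    wordElt V (FreeMagma.mul a b) = (freeOp V).bracket (wordElt V a) (wordElt V b) :=
  (wordMul_single V a b).symm

theorem freeOp_ext (V : GrVect K Γ) {M : Type u} [AddCommGroup M] [Module K M]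
    {f g : (freeOp V).X →ₗ[K] M} (h : ∀ w, f (wordElt V w) = g (wordElt V w)) : f = g :=
  Finsupp.lhom_ext' fun w => LinearMap.ext_ring (h w)

variable [DegreeIndex Γ]

/-- The relations of the free Lie algebra: linearity in the generators, antisymmetry, and
the Jacobi identity. -/
inductive LieRel (V : GrVect K Γ) : (freeOp V).X → Prop
  | add (γ : Γ) (x y : V.gr γ) : LieRel V (wordElt V (.of ⟨γ, x + y⟩) -
      wordElt V (.of ⟨γ, x⟩) - wordElt V (.of ⟨γ, y⟩))
  | smul (γ : Γ) (c : K) (x : V.gr γ) : LieRel V (wordElt V (.of ⟨γ, c • x⟩) -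
      c • wordElt V (.of ⟨γ, x⟩))
  | skew (i j : Γ) (x y : (freeOp V).X) (hx : x ∈ (freeOp V).X.gr i) (hy : y ∈ (freeOp V).X.gr j) :
    LieRel V ((freeOp V).bracket x y + koszul K i j • (freeOp V).bracket y x)
  | jacobi (i j k : Γ) (x y z : (freeOp V).X) (hx : x ∈ (freeOp V).X.gr i)
      (hy : y ∈ (freeOp V).X.gr j) (hz : z ∈ (freeOp V).X.gr k) :
    LieRel V ((freeOp V).bracket x ((freeOp V).bracket y z) -
      (freeOp V).bracket ((freeOp V).bracket x y) z -
      koszul K i j • (freeOp V).bracket y ((freeOp V).bracket x z))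

theorem LieRel.homogeneous {V : GrVect K Γ} {s : (freeOp V).X} (hs : LieRel V s) :
    ∃ γ, s ∈ (freeOp V).X.gr γ := by
  cases hs with
  | add γ x y =>
    exact ⟨γ, sub_mem (sub_mem (wordElt_mem V (.of ⟨γ, x + y⟩)) (wordElt_mem V (.of ⟨γ, x⟩)))
      (wordElt_mem V (.of ⟨γ, y⟩))⟩
  | smul γ c x =>
    exact ⟨γ, sub_mem (wordElt_mem V (.of ⟨γ, c • x⟩))
      (Submodule.smul_mem _ _ (wordElt_mem V (.of ⟨γ, x⟩)))⟩
  | skew i j x y hx hy =>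
    refine ⟨i + j, add_mem ((freeOp V).bracket_mem i x hx j y hy) (Submodule.smul_mem _ _ ?_)⟩
    rw [add_comm]
    exact (freeOp V).bracket_mem j y hy i x hx
  | jacobi i j k x y z hx hy hz =>
    refine ⟨i + (j + k), sub_mem (sub_mem ?_ ?_) (Submodule.smul_mem _ _ ?_)⟩
    · exact (freeOp V).bracket_mem _ x hx _ _ ((freeOp V).bracket_mem _ y hy _ z hz)
    · rw [← add_assoc]
      exact (freeOp V).bracket_mem _ _ ((freeOp V).bracket_mem _ x hx _ y hy) _ z hz
    · rw [add_left_comm]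
      exact (freeOp V).bracket_mem _ y hy _ _ ((freeOp V).bracket_mem _ x hx _ z hz)

theorem lieRel_coact (V : GrVect K Γ) : ∀ s ∈ {s | LieRel V s}, ∀ γ,
    (freeOp V).X.coact s γ ∈ (freeOp V).idealSpan {s | LieRel V s} := by
  intro s hs γ
  obtain ⟨δ, hδ⟩ := LieRel.homogeneous hs
  rw [(freeOp V).X.coact_of_mem hδ, Finsupp.single_apply]
  split_ifs
  · exact (freeOp V).subset_idealSpan hs
  · exact zero_mem _

/-- The quotient map onto the free Lie algebra. -/
def freeProj (V : GrVect K Γ) := (freeOp V).proj {s | LieRel V s} (lieRel_coact V)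

/-- The free graded Lie algebra on a graded vector space. -/
abbrev freeLie (V : GrVect K Γ) : GrLie K Γ where
  toGrOp := (freeOp V).quot {s | LieRel V s} (lieRel_coact V)
  skew := by
    rintro i _ ⟨x, hx, rfl⟩ j _ ⟨y, hy, rfl⟩
    rw [eq_neg_iff_add_eq_zero]
    exact GrOp.proj_eq_zero (h := lieRel_coact V) (LieRel.skew i j x y hx hy)
  jacobi := by
    rintro i _ ⟨x, hx, rfl⟩ j _ ⟨y, hy, rfl⟩ k _ ⟨z, hz, rfl⟩
    rw [← sub_eq_zero, ← sub_sub]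
    exact GrOp.proj_eq_zero (h := lieRel_coact V) (LieRel.jacobi i j k x y z hx hy hz)

/-- The inclusion of the component of a given degree in the free Lie algebra. -/
def freeLieι' (V : GrVect K Γ) (γ : Γ) : V.gr γ →ₗ[K] (freeLie V).X where
  toFun x := (freeProj V).hom.lin (wordElt V (.of ⟨γ, x⟩))
  map_add' x y := by
    have h := GrOp.proj_eq_zero (h := lieRel_coact V) (LieRel.add γ x y)
    rw [map_sub, map_sub, sub_sub, sub_eq_zero] at h
    exact h
  map_smul' c x := by
    have h := GrOp.proj_eq_zero (h := lieRel_coact V) (LieRel.smul γ c x)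
    rw [map_sub, map_smul, sub_eq_zero] at h
    exact h

/-- The inclusion of generators in the free Lie algebra. -/
def freeLieι (V : GrVect K Γ) : V ⟶ (freeLie V).X where
  lin := DirectSum.toModule K Γ _ (freeLieι' V) ∘ₗ
    (LinearEquiv.ofBijective (DirectSum.coeLinearMap V.gr) V.isInternal).symm.toLinearMap
  map_mem γ x hx := by
    have : (LinearEquiv.ofBijective (DirectSum.coeLinearMap V.gr) V.isInternal).symm x =
        DirectSum.lof K Γ (fun γ => V.gr γ) γ ⟨x, hx⟩ := by
      rw [LinearEquiv.symm_apply_eq]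
      exact (DirectSum.coeLinearMap_lof V.gr γ ⟨x, hx⟩).symm
    rw [LinearMap.comp_apply, LinearEquiv.coe_coe, this, DirectSum.toModule_lof]
    exact ⟨_, wordElt_mem V (.of ⟨γ, ⟨x, hx⟩⟩), rfl⟩

theorem freeLieι_of_mem (V : GrVect K Γ) {γ : Γ} (x : V.gr γ) :
    (freeLieι V).lin x = (freeProj V).hom.lin (wordElt V (.of ⟨γ, x⟩)) := by
  have : (LinearEquiv.ofBijective (DirectSum.coeLinearMap V.gr) V.isInternal).symm x =
      DirectSum.lof K Γ (fun γ => V.gr γ) γ x := by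
    rw [LinearEquiv.symm_apply_eq]
    exact (DirectSum.coeLinearMap_lof V.gr γ x).symm
  change DirectSum.toModule K Γ _ (freeLieι' V)
    ((LinearEquiv.ofBijective (DirectSum.coeLinearMap V.gr) V.isInternal).symm x) = _
  rw [this, DirectSum.toModule_lof]
  rfl

/-- The evaluation of words in a Lie algebra. -/
def evalWord {V : GrVect K Γ} {g : GrLie K Γ} (f : V ⟶ g.X) : Words V → g.X
  | .of p => f.lin p.2
  | .mul a b => g.bracket (evalWord f a) (evalWord f b)

theorem evalWord_mem {V : GrVect K Γ} {g : GrLie K Γ} (f : V ⟶ g.X) (w : Words V) :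
    evalWord f w ∈ g.X.gr (wordDeg V w) := by
  induction w with
  | of p => exact f.map_mem p.1 p.2 p.2.2
  | mul a b ha hb => exact g.bracket_mem _ _ ha _ _ hb

/-- The evaluation of elements of the free algebra. -/
def evalOp {V : GrVect K Γ} {g : GrLie K Γ} (f : V ⟶ g.X) : (freeOp V).Hom g.toGrOp where
  hom :=
    { lin := Finsupp.linearCombination K (evalWord f)
      map_mem := fun γ x hx => by
        have h : wordSpan V γ ≤ (g.X.gr γ).comap (Finsupp.linearCombination K (evalWord f)) :=
          Submodule.span_le.2 <| by
            rintro _ ⟨w, rfl, rfl⟩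
            change Finsupp.linearCombination K (evalWord f) (Finsupp.single w 1) ∈
              g.X.gr (wordDeg V w)
            rw [Finsupp.linearCombination_single, one_smul]
            exact evalWord_mem f w
        exact h hx }
  map_bracket x y := by
    have h : (wordMul V).compr₂ (Finsupp.linearCombination K (evalWord f)) =
        g.bracket.compl₁₂ (Finsupp.linearCombination K (evalWord f))
          (Finsupp.linearCombination K (evalWord f)) :=
      Finsupp.lhom_ext' fun a => LinearMap.ext_ring <| Finsupp.lhom_ext' fun b =>
        LinearMap.ext_ring <| by
          simp only [LinearMap.comp_apply, Finsupp.lsingle_apply, LinearMap.compr₂_apply,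
            LinearMap.compl₁₂_apply, wordMul_single, Finsupp.linearCombination_single, one_smul]
          rfl
    exact LinearMap.congr_fun₂ h x y

theorem evalOp_wordElt {V : GrVect K Γ} {g : GrLie K Γ} (f : V ⟶ g.X) (w : Words V) :
    (evalOp f).hom.lin (wordElt V w) = evalWord f w := by
  change Finsupp.linearCombination K (evalWord f) (Finsupp.single w 1) = _
  rw [Finsupp.linearCombination_single, one_smul]

theorem evalOp_rel {V : GrVect K Γ} {g : GrLie K Γ} (f : V ⟶ g.X) (s : (freeOp V).X)
    (hs : LieRel V s) : (evalOp f).hom.lin s = 0 := by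
  cases hs with
  | add γ x y =>
    rw [map_sub, map_sub, evalOp_wordElt, evalOp_wordElt, evalOp_wordElt]
    simp [evalWord]
  | smul γ c x =>
    rw [map_sub, map_smul, evalOp_wordElt, evalOp_wordElt]
    simp [evalWord]
  | skew i j x y hx hy =>
    rw [map_add, map_smul, (evalOp f).map_bracket, (evalOp f).map_bracket,
      g.skew i _ ((evalOp f).hom.map_mem i x hx) j _ ((evalOp f).hom.map_mem j y hy),
      neg_add_cancel]
  | jacobi i j k x y z hx hy hz =>
    rw [map_sub, map_sub, map_smul]
    simp only [(evalOp f).map_bracket]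
    rw [g.jacobi i _ ((evalOp f).hom.map_mem i x hx) j _ ((evalOp f).hom.map_mem j y hy) k _
      ((evalOp f).hom.map_mem k z hz), sub_sub, sub_self]

/-- The universal property of the free Lie algebra. -/
def freeLieLift {V : GrVect K Γ} {g : GrLie K Γ} (f : V ⟶ g.X) : freeLie V ⟶ g :=
  GrOp.lift (h := lieRel_coact V) (evalOp f) (evalOp_rel f)

theorem freeLieLift_ι {V : GrVect K Γ} {g : GrLie K Γ} (f : V ⟶ g.X) (x : V) :
    (freeLieLift f).hom.lin ((freeLieι V).lin x) = f.lin x := by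
  have : (freeLieLift f).hom.lin ∘ₗ (freeLieι V).lin = f.lin := V.lin_ext fun γ x hx => by
    rw [LinearMap.comp_apply]
    have h1 := freeLieι_of_mem V ⟨x, hx⟩
    have h2 := evalOp_wordElt f (.of ⟨γ, ⟨x, hx⟩⟩)
    exact (congrArg (freeLieLift f).hom.lin h1).trans h2
  exact LinearMap.congr_fun this x

theorem freeLie_induction {V : GrVect K Γ} {p : (freeLie V).X → Prop}
    (h : ∀ w, p ((freeProj V).hom.lin (wordElt V w))) (h0 : p 0) (hadd : ∀ x y, p x → p y → p (x + y))
    (hsmul : ∀ (c : K) x, p x → p (c • x)) (x : (freeLie V).X) : p x := by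
  obtain ⟨x, rfl⟩ := Submodule.mkQ_surjective _ x
  induction x using Finsupp.induction_linear with
  | zero => rwa [map_zero]
  | add x y hx hy =>
    rw [map_add]
    exact hadd _ _ hx hy
  | single w a =>
    rw [← mul_one a, ← smul_eq_mul, ← Finsupp.smul_single, map_smul]
    exact hsmul _ _ (h w)

theorem freeLie_hom_ext {V : GrVect K Γ} {g : GrLie K Γ} {a b : freeLie V ⟶ g}
    (h : ∀ x, a.hom.lin ((freeLieι V).lin x) = b.hom.lin ((freeLieι V).lin x)) : a = b := by
  apply GrLie.hom_ext
  have hw : ∀ w, a.hom.lin ((freeProj V).hom.lin (wordElt V w)) =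
      b.hom.lin ((freeProj V).hom.lin (wordElt V w)) := by
    intro w
    induction w with
    | of p =>
      have := h p.2
      rwa [freeLieι_of_mem] at this
    | mul x y hx hy =>
      rw [wordElt_mul, (freeProj V).map_bracket]
      refine (a.map_bracket _ _).trans (Eq.trans ?_ (b.map_bracket _ _).symm)
      rw [hx, hy]
  refine LinearMap.ext fun x => ?_
  refine freeLie_induction (p := fun x => a.hom.lin x = b.hom.lin x) hw ?_ ?_ ?_ x
  · rw [map_zero, map_zero]
  · intro x y hx hy
    rw [map_add, map_add, hx, hy]
  · intro c x hx
    rw [map_smul, map_smul, hx]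

end FreeLie

section LieRealisation

open GrVect

variable {K : Type u} [Field K]

/-- The quotient of a Lie algebra by the ideal generated by a set. -/
abbrev GrLie.quot (g : GrLie K (ℕ × ℤ)) (S : Set g.X)
    (h : ∀ s ∈ S, ∀ γ, g.X.coact s γ ∈ g.idealSpan S) : GrLie K (ℕ × ℤ) where
  toGrOp := g.toGrOp.quot S h
  skew := by
    rintro i _ ⟨x, hx, rfl⟩ j _ ⟨y, hy, rfl⟩
    exact congrArg (g.idealSpan S).mkQ (g.skew i x hx j y hy)
  jacobi := by
    rintro i _ ⟨x, hx, rfl⟩ j _ ⟨y, hy, rfl⟩ k _ ⟨z, hz, rfl⟩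
    exact congrArg (g.idealSpan S).mkQ (g.jacobi i x hx j y hy k z hz)

/-- The map `x ⊗ y ↦ [x, y]` to the free Lie algebra on `V` placed in weight one. It sends
`x ∧ y = x ⊗ y - (-1)^{|x||y|} y ⊗ x` to `2 [x, y]`. -/
def lieBracketMap (V : GrVect K ℤ) : V ⊗[K] V →ₗ[K] (freeLie (weightOne V)).X :=
  TensorProduct.lift ((freeLie (weightOne V)).bracket.compl₁₂ (freeLieι (weightOne V)).lin
    (freeLieι (weightOne V)).lin)

theorem lieBracketMap_tmul (V : GrVect K ℤ) (x y : V) :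
    lieBracketMap V (x ⊗ₜ y) = (freeLie (weightOne V)).bracket ((freeLieι (weightOne V)).lin x)
      ((freeLieι (weightOne V)).lin y) := rfl

theorem lieBracketMap_coact (V : GrVect K ℤ) (z : V ⊗[K] V) (γ : ℕ × ℤ) :
    (freeLie (weightOne V)).X.coact (lieBracketMap V z) γ =
      lieBracketMap V ((tensorObj' (weightOne V) (weightOne V)).coact z γ) := by
  refine Hom.coact_lin (V := tensorObj' (weightOne V) (weightOne V))
    ⟨lieBracketMap V, ?_⟩ z γ
  refine tensorGr_le_comap (V := weightOne V) (W := weightOne V) (X := (freeLie (weightOne V)).X)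
    (f := lieBracketMap V) fun i j x hx y hy => ?_
  exact (freeLie (weightOne V)).bracket_mem i _ ((freeLieι (weightOne V)).map_mem i x hx) j _
    ((freeLieι (weightOne V)).map_mem j y hy)

/-- The relations of `L(V, R)`. -/
def lieRelations {m : Mixing} (X : QD K m) : Set (freeLie (weightOne X.V)).X :=
  lieBracketMap X.V '' (X.R : Set (X.V ⊗[K] X.V))

theorem lieRelations_coact {m : Mixing} (X : QD K m) : ∀ s ∈ lieRelations X, ∀ γ,
    (freeLie (weightOne X.V)).X.coact s γ ∈
      (freeLie (weightOne X.V)).idealSpan (lieRelations X) := by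
  rintro _ ⟨z, hz, rfl⟩ γ
  rw [lieBracketMap_coact]
  exact GrOp.subset_idealSpan _ ⟨_, weightOne_homogeneous X.homogeneous z hz γ, rfl⟩

/-- `L(V, R) = Lie(V)/(R)`. -/
abbrev lieObj {m : Mixing} (X : QD K m) : GrLie K (ℕ × ℤ) :=
  (freeLie (weightOne X.V)).quot (lieRelations X) (lieRelations_coact X)

/-- The generators of `L(V, R)`. -/
def lieProj {m : Mixing} (X : QD K m) : freeLie (weightOne X.V) ⟶ lieObj X :=
  GrOp.proj _ (lieRelations X) (lieRelations_coact X)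

theorem freeLie_word_weight_zero (V : GrVect K ℤ) (w : Words (weightOne V))
    (hw : (wordDeg (weightOne V) w).1 = 0) :
    (freeProj (weightOne V)).hom.lin (wordElt (weightOne V) w) = 0 := by
  induction w with
  | of p =>
    rw [← freeLieι_of_mem]
    rcases mem_weightOne p.2.2 with h | ⟨h, -⟩
    · rw [h, map_zero]
    · exact absurd (h.symm.trans hw) one_ne_zero
  | mul a b ha hb =>
    have h : (wordDeg (weightOne V) a).1 + (wordDeg (weightOne V) b).1 = 0 := hw
    rw [wordElt_mul, (freeProj _).map_bracket, ha (by omega), map_zero, LinearMap.zero_apply]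

theorem freeLie_word_finite (V : GrVect K ℤ) [FiniteDimensional K V] (n : ℕ) :
    ∃ E : Submodule K (freeLie (weightOne V)).X, FiniteDimensional K E ∧
      ∀ w : Words (weightOne V), (wordDeg (weightOne V) w).1 = n →
        (freeProj (weightOne V)).hom.lin (wordElt (weightOne V) w) ∈ E := by
  induction n using Nat.strong_induction_on with
  | _ n ih =>
    choose! E hE hE' using ih
    have : ∀ p : Fin n × Fin n, FiniteDimensional K ↥(Submodule.map₂
        (freeLie (weightOne V)).bracket (E p.1) (E p.2)) := fun p =>
      Module.Finite.iff_fg.2 (Submodule.FG.map₂ _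
        (Module.Finite.iff_fg.1 (hE p.1 p.1.2)) (Module.Finite.iff_fg.1 (hE p.2 p.2.2)))
    have h1 : FiniteDimensional K (LinearMap.range (freeLieι (weightOne V)).lin) := by
      have : Module.Finite K (weightOne V).carrier := inferInstanceAs (FiniteDimensional K V)
      exact Module.Finite.range _
    refine ⟨LinearMap.range (freeLieι (weightOne V)).lin ⊔
      ⨆ p : Fin n × Fin n, Submodule.map₂ (freeLie (weightOne V)).bracket (E p.1) (E p.2),
      inferInstance, fun w hw => ?_⟩
    cases w with
    | of p =>
      rw [← freeLieι_of_mem]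
      exact Submodule.mem_sup_left ⟨_, rfl⟩
    | mul a b =>
      have h : (wordDeg (weightOne V) a).1 + (wordDeg (weightOne V) b).1 = n := hw
      rw [wordElt_mul, (freeProj _).map_bracket]
      by_cases ha : (wordDeg (weightOne V) a).1 = 0
      · rw [freeLie_word_weight_zero V a ha, map_zero, LinearMap.zero_apply]
        exact zero_mem _
      by_cases hb : (wordDeg (weightOne V) b).1 = 0
      · rw [freeLie_word_weight_zero V b hb, map_zero]
        exact zero_mem _
      have ha' : (wordDeg (weightOne V) a).1 < n := by omega
      have hb' : (wordDeg (weightOne V) b).1 < n := by omega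
      exact Submodule.mem_sup_right (Submodule.mem_iSup_of_mem
        ((⟨_, ha'⟩, ⟨_, hb'⟩) : Fin n × Fin n) (Submodule.apply_mem_map₂ _
          (hE' _ ha' a rfl) (hE' _ hb' b rfl)))

theorem lieObj_finWeight {m : Mixing} (X : QD K m) : wgLie K (lieObj X) := by
  have := X.finite
  choose E hE hE' using freeLie_word_finite X.V
  have hfin : ∀ n, FiniteDimensional K ↥((E n).map (lieProj X).hom.lin) := fun n => by
    have := hE n
    infer_instance
  refine @finWeight_of_le K _ (lieObj X).X _ hfin fun n z => ?_
  rintro _ ⟨_, ⟨x, hx, rfl⟩, rfl⟩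
  refine ⟨_, ?_, rfl⟩
  have : wordSpan (weightOne X.V) (n, z) ≤ (E n).comap (freeProj (weightOne X.V)).hom.lin :=
    Submodule.span_le.2 <| by
      rintro _ ⟨w, hw, rfl⟩
      exact hE' n w (congrArg Prod.fst hw)
  exact this hx

/-- The map of free Lie algebras induced by a map of generators. -/
def freeLieMap {V W : GrVect K ℤ} (f : V ⟶ W) :
    freeLie (weightOne V) ⟶ freeLie (weightOne W) :=
  freeLieLift (V := weightOne V)
    (show weightOne V ⟶ (freeLie (weightOne W)).X from
      (show weightOne V ⟶ weightOne W from (regrade (fun z => ((1, z) : ℕ × ℤ))).map f) ≫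
        freeLieι (weightOne W))

theorem freeLieMap_ι {V W : GrVect K ℤ} (f : V ⟶ W) (x : V) :
    (freeLieMap f).hom.lin ((freeLieι (weightOne V)).lin x) =
      (freeLieι (weightOne W)).lin (f.lin x) := freeLieLift_ι (V := weightOne V) _ x

theorem freeLieMap_bracketMap {V W : GrVect K ℤ} (f : V ⟶ W) (z : V ⊗[K] V) :
    (freeLieMap f).hom.lin (lieBracketMap V z) = lieBracketMap W (sq f z) := by
  have h : (freeLieMap f).hom.lin ∘ₗ lieBracketMap V = lieBracketMap W ∘ₗ sq f :=
    TensorProduct.ext' fun x y => by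
      refine ((freeLieMap f).map_bracket _ _).trans ?_
      rw [freeLieMap_ι, freeLieMap_ι]
      rfl
  exact LinearMap.congr_fun h z

/-- `L` on morphisms. -/
def lieMap {m : Mixing} {X Y : QD K m} (f : X ⟶ Y) : lieObj X ⟶ lieObj Y :=
  GrOp.lift (h := lieRelations_coact X) (freeLieMap f.hom ≫ lieProj Y :
    freeLie (weightOne X.V) ⟶ lieObj Y) <| by
    rintro _ ⟨z, hz, rfl⟩
    exact (congrArg (lieProj Y).hom.lin (freeLieMap_bracketMap f.hom z)).trans
      (GrOp.proj_eq_zero (h := lieRelations_coact Y) ⟨_, f.map_le hz, rfl⟩)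

theorem lieMap_ι {m : Mixing} {X Y : QD K m} (f : X ⟶ Y) (x : X.V) :
    (lieMap f).hom.lin ((lieProj X).hom.lin ((freeLieι (weightOne X.V)).lin x)) =
      (lieProj Y).hom.lin ((freeLieι (weightOne Y.V)).lin (f.hom.lin x)) :=
  congrArg (lieProj Y).hom.lin (freeLieMap_ι f.hom x)

theorem lie_hom_ext {m : Mixing} {X : QD K m} {g : GrLie K (ℕ × ℤ)} {a b : lieObj X ⟶ g}
    (h : ∀ x : X.V, a.hom.lin ((lieProj X).hom.lin ((freeLieι (weightOne X.V)).lin x)) =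
      b.hom.lin ((lieProj X).hom.lin ((freeLieι (weightOne X.V)).lin x))) : a = b := by
  have h1 : lieProj X ≫ a = lieProj X ≫ b := freeLie_hom_ext h
  refine GrOp.quot_hom_ext (h := lieRelations_coact X) fun x => ?_
  exact LinearMap.congr_fun (congrArg (fun c : freeLie (weightOne X.V) ⟶ g => c.hom.lin) h1) x

/-- The functor `L : (QD⁻, ⊕) ⥤ wg-Lie-alg`. -/
def realL (K : Type u) [Field K] : QDMinus K ⥤ WgLieAlg K where
  obj X := ⟨lieObj X.obj, lieObj_finWeight X.obj⟩
  map f := ObjectProperty.homMk (lieMap f.hom)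
  map_id X := ObjectProperty.hom_ext _ (lie_hom_ext fun x => lieMap_ι (𝟙 X.obj) x)
  map_comp f g := ObjectProperty.hom_ext _ (lie_hom_ext fun x =>
    (lieMap_ι (f.hom ≫ g.hom) x).trans
      ((congrArg (lieMap g.hom).hom.lin (lieMap_ι f.hom x)).trans (lieMap_ι g.hom _)).symm)

end LieRealisation

/-! ### Subcoalgebras -/

section Subcoalgebras

open GrVect

variable {K : Type u} [Field K] {Γ : Type} [DecidableEq Γ]

/-- A subspace as a type. -/
def SubSpace {V : GrVect K Γ} (N : Submodule K V) : Type u := N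

instance {V : GrVect K Γ} (N : Submodule K V) : AddCommGroup (SubSpace N) :=
  inferInstanceAs (AddCommGroup N)

instance {V : GrVect K Γ} (N : Submodule K V) : Module K (SubSpace N) :=
  inferInstanceAs (Module K N)

/-- The inclusion of a subspace. -/
def subLin {V : GrVect K Γ} (N : Submodule K V) : SubSpace N →ₗ[K] V := N.subtype

theorem subLin_injective {V : GrVect K Γ} (N : Submodule K V) : Function.Injective (subLin N) :=
  Submodule.injective_subtype N

theorem subLin_mem {V : GrVect K Γ} {N : Submodule K V} (x : SubSpace N) : subLin N x ∈ N := x.2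

theorem exists_subLin {V : GrVect K Γ} {N : Submodule K V} {x : V} (hx : x ∈ N) :
    ∃ y, subLin N y = x := ⟨⟨x, hx⟩, rfl⟩

/-- A linear projection onto a subspace. -/
theorem exists_retraction {V : GrVect K Γ} (N : Submodule K V) :
    ∃ p : V →ₗ[K] SubSpace N, p ∘ₗ subLin N = LinearMap.id :=
  LinearMap.exists_leftInverse_of_injective _ (LinearMap.ker_eq_bot.2 (subLin_injective N))

/-- A graded subspace as a graded vector space. -/
abbrev GrVect.subObj (V : GrVect K Γ) (N : Submodule K V) (hN : IsHomogeneous V N) :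
    GrVect K Γ where
  carrier := SubSpace N
  gr γ := (V.gr γ).comap (subLin N)
  isInternal := by
    refine isInternal_of _ (Finsupp.lcoeFun ∘ₗ V.coact ∘ₗ subLin N) (subLin N)
      (subLin_injective N) ?_ ?_
    · intro γ x hx
      ext1 δ
      rw [LinearMap.comp_apply, LinearMap.comp_apply, V.coact_of_mem hx]
      simp [Finsupp.single_apply, Pi.single_apply, eq_comm]
    · rw [eq_top_iff]
      intro x _
      choose y hy using fun γ => exists_subLin (hN _ (subLin_mem x) γ)
      have hx : x = ∑ γ ∈ (V.coact (subLin N x)).support, y γ := by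
        apply subLin_injective N
        rw [map_sum]
        conv_lhs => rw [← V.coact_sum (subLin N x), Finsupp.lsum_apply, Finsupp.sum]
        exact Finset.sum_congr rfl fun γ _ => (hy γ).symm
      rw [hx]
      refine Submodule.sum_mem _ fun γ _ => Submodule.mem_iSup_of_mem γ ?_
      rw [Submodule.mem_comap, hy]
      exact V.coact_mem _ γ

/-- The inclusion of a graded subspace. -/
def GrVect.subIncl (V : GrVect K Γ) (N : Submodule K V) (hN : IsHomogeneous V N) :
    V.subObj N hN ⟶ V := ⟨subLin N, fun _ _ hx => hx⟩

theorem ker_homogeneous {V W : GrVect K Γ} (f : V ⟶ W) :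
    IsHomogeneous V (LinearMap.ker f.lin) := by
  intro x hx γ
  rw [LinearMap.mem_ker] at hx ⊢
  rw [← f.coact_lin, hx, map_zero, Finsupp.zero_apply]

/-- Maps of graded spaces with a linear retraction. -/
def SplitInj {V W : GrVect K Γ} (f : V ⟶ W) : Prop :=
  ∃ p : W →ₗ[K] V, p ∘ₗ f.lin = LinearMap.id

theorem SplitInj.injective {V W : GrVect K Γ} {f : V ⟶ W} (h : SplitInj f) :
    Function.Injective f.lin := by
  obtain ⟨p, hp⟩ := h
  exact Function.LeftInverse.injective (g := p) (LinearMap.congr_fun hp)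

theorem SplitInj.cancel {V W U : GrVect K Γ} {f : V ⟶ W} (h : SplitInj f) {a b : U ⟶ V}
    (hab : a ≫ f = b ≫ f) : a = b :=
  GrVect.hom_ext <| LinearMap.ext fun x => h.injective <|
    LinearMap.congr_fun (congrArg Hom.lin hab) x

theorem SplitInj.mem {V W : GrVect K Γ} {f : V ⟶ W} (h : SplitInj f) {γ : Γ} {x : V}
    (hx : f.lin x ∈ W.gr γ) : x ∈ V.gr γ := by
  rw [mem_iff]
  ext δ
  apply h.injective
  rw [← f.coact_lin, W.coact_of_mem hx]
  by_cases hδ : γ = δ <;> simp [hδ]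

theorem splitInj_id (V : GrVect K Γ) : SplitInj (𝟙 V) := ⟨LinearMap.id, rfl⟩

theorem splitInj_subIncl (V : GrVect K Γ) (N : Submodule K V) (hN : IsHomogeneous V N) :
    SplitInj (V.subIncl N hN) := exists_retraction N

variable [AddCommMonoid Γ]

theorem SplitInj.tensor {V V' W W' : GrVect K Γ} {f : V ⟶ W} {g : V' ⟶ W'} (hf : SplitInj f)
    (hg : SplitInj g) : SplitInj (f ⊗ₘ g) := by
  obtain ⟨p, hp⟩ := hf
  obtain ⟨q, hq⟩ := hg
  refine ⟨TensorProduct.map p q, ?_⟩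
  change TensorProduct.map p q ∘ₗ TensorProduct.map f.lin g.lin = _
  rw [← TensorProduct.map_comp, hp, hq, TensorProduct.map_id]

theorem exists_factor {V W U : Type u} [AddCommGroup V] [Module K V] [AddCommGroup W] [Module K W]
    [AddCommGroup U] [Module K U] (f : V →ₗ[K] W) (e : V →ₗ[K] U)
    (h : LinearMap.ker f ≤ LinearMap.ker e) : ∃ g : W →ₗ[K] U, g ∘ₗ f = e := by
  obtain ⟨p, hp⟩ := LinearMap.exists_leftInverse_of_injective
    ((LinearMap.ker f).liftQ f le_rfl) (Submodule.ker_liftQ_eq_bot _ _ _ le_rfl)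
  refine ⟨(LinearMap.ker f).liftQ e h ∘ₗ p, LinearMap.ext fun x => ?_⟩
  have h1 := LinearMap.congr_fun hp ((LinearMap.ker f).mkQ x)
  rw [LinearMap.comp_apply, Submodule.mkQ_apply, Submodule.liftQ_apply] at h1
  rw [LinearMap.comp_apply, LinearMap.comp_apply, h1, LinearMap.id_apply, Submodule.liftQ_apply]

/-- Over a field, `ker (f ⊗ id) ∩ ker (id ⊗ f)` is the tensor square of `ker f`. -/
theorem mem_of_ker {V : Type u} {W : Type u} {C : Type u} [AddCommGroup V] [Module K V]
    [AddCommGroup W] [Module K W] [AddCommGroup C] [Module K C] (f : V →ₗ[K] W) (i : C →ₗ[K] V)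
    (p : V →ₗ[K] C) (hp : p ∘ₗ i = LinearMap.id) (hi : ∀ x, f x = 0 → ∃ y, i y = x)
    (z : V ⊗[K] V) (h1 : TensorProduct.map f LinearMap.id z = 0)
    (h2 : TensorProduct.map LinearMap.id f z = 0) :
    TensorProduct.map i i (TensorProduct.map p p z) = z := by
  obtain ⟨g, hg⟩ := exists_factor f (LinearMap.id - i ∘ₗ p) fun x hx => by
    obtain ⟨y, rfl⟩ := hi x hx
    have := LinearMap.congr_fun hp y
    rw [LinearMap.comp_apply, LinearMap.id_apply] at this
    rw [LinearMap.mem_ker, LinearMap.sub_apply, LinearMap.comp_apply, this, LinearMap.id_apply,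
      sub_self]
  have e1 : TensorProduct.map (i ∘ₗ p) LinearMap.id z = z := by
    have : TensorProduct.map (LinearMap.id - i ∘ₗ p) (LinearMap.id : V →ₗ[K] V) z = 0 := by
      have h := TensorProduct.map_comp g (LinearMap.id : V →ₗ[K] V) f LinearMap.id
      rw [hg, LinearMap.id_comp] at h
      rw [h, LinearMap.comp_apply, h1, map_zero]
    rw [sub_eq_add_neg, TensorProduct.map_add_left, LinearMap.add_apply, TensorProduct.map_id,
      ← neg_one_smul K (i ∘ₗ p), TensorProduct.map_smul_left, LinearMap.smul_apply, neg_one_smul,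
      LinearMap.id_apply, add_neg_eq_zero] at this
    exact this.symm
  have e2 : TensorProduct.map LinearMap.id (i ∘ₗ p) z = z := by
    have : TensorProduct.map (LinearMap.id : V →ₗ[K] V) (LinearMap.id - i ∘ₗ p) z = 0 := by
      have h := TensorProduct.map_comp (LinearMap.id : V →ₗ[K] V) g LinearMap.id f
      rw [hg, LinearMap.id_comp] at h
      rw [h, LinearMap.comp_apply, h2, map_zero]
    rw [sub_eq_add_neg, TensorProduct.map_add_right, LinearMap.add_apply, TensorProduct.map_id,
      ← neg_one_smul K (i ∘ₗ p), TensorProduct.map_smul_right, LinearMap.smul_apply, neg_one_smul,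
      LinearMap.id_apply, add_neg_eq_zero] at this
    exact this.symm
  have h3 : TensorProduct.map i i (TensorProduct.map p p z) =
      TensorProduct.map (i ∘ₗ p) LinearMap.id (TensorProduct.map LinearMap.id (i ∘ₗ p) z) := by
    rw [← LinearMap.comp_apply, ← LinearMap.comp_apply, ← TensorProduct.map_comp,
      ← TensorProduct.map_comp, LinearMap.id_comp, LinearMap.comp_id]
  rw [h3, e2, e1]

section Kernel

open ComonObj

variable (T : Comon (GrVect K Γ)) {Q : GrVect K Γ} (q : T.X ⟶ Q)

/-- `x ↦ ∑ x₁ ⊗ q(x₂) ⊗ x₃`. -/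
def midMap : T.X ⟶ tensorObj T.X (tensorObj Q T.X) := comul ≫ T.X ◁ comul ≫ T.X ◁ (q ▷ T.X)

theorem comul_assoc_inv : (comul : T.X ⟶ _) ≫ T.X ◁ comul ≫ (α_ T.X T.X T.X).inv =
    comul ≫ comul ▷ T.X := by
  rw [comul_assoc_assoc, Iso.hom_inv_id, Category.comp_id]

theorem midMap_left : comul ≫ midMap T q ▷ T.X =
    midMap T q ≫ T.X ◁ (Q ◁ comul) ≫ T.X ◁ (α_ Q T.X T.X).inv ≫ (α_ T.X (tensorObj Q T.X) T.X).inv := by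
  have h1 : T.X ◁ (q ▷ T.X) ≫ T.X ◁ (Q ◁ comul) ≫ T.X ◁ (α_ Q T.X T.X).inv ≫
      (α_ T.X (tensorObj Q T.X) T.X).inv = T.X ◁ (T.X ◁ comul) ≫ T.X ◁ (α_ T.X T.X T.X).inv ≫
      (α_ T.X (tensorObj T.X T.X) T.X).inv ≫ (T.X ◁ (q ▷ T.X)) ▷ T.X := by
    rw [← associator_inv_naturality_middle, ← whiskerLeft_comp_assoc, ← whiskerLeft_comp_assoc,
      ← whiskerLeft_comp_assoc, ← whiskerLeft_comp_assoc, ← whisker_exchange]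
    simp
  have h2 : (comul : T.X ⟶ _) ≫ T.X ◁ comul ≫ T.X ◁ (T.X ◁ comul) ≫ T.X ◁ (α_ T.X T.X T.X).inv ≫
      (α_ T.X (tensorObj T.X T.X) T.X).inv =
      comul ≫ comul ▷ T.X ≫ (T.X ◁ comul) ▷ T.X := by
    rw [← whiskerLeft_comp_assoc, ← whiskerLeft_comp_assoc, Category.assoc, comul_assoc_inv,
      whiskerLeft_comp, Category.assoc, associator_inv_naturality_middle, reassoc_of% (comul_assoc_inv T)]
  rw [midMap, Category.assoc, Category.assoc, h1, reassoc_of% h2]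
  simp only [comp_whiskerRight]

theorem midMap_right : comul ≫ T.X ◁ midMap T q =
    midMap T q ≫ comul ▷ (tensorObj Q T.X) ≫ (α_ T.X T.X (tensorObj Q T.X)).hom := by
  rw [midMap, Category.assoc, Category.assoc, whisker_exchange_assoc, whisker_exchange_assoc]
  have h : (comul : T.X ⟶ _) ≫ T.X ◁ comul = comul ≫ comul ▷ T.X ≫ (α_ T.X T.X T.X).hom :=
    comul_assoc _
  rw [whiskerLeft_comp, reassoc_of% h]
  simp

/-- The subspace `{x | ∑ x₁ ⊗ q(x₂) ⊗ x₃ = 0}`, the largest subcoalgebra contained in the kernel of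
`q`. -/
def kerCoalg : GrVect K Γ := T.X.subObj (LinearMap.ker (midMap T q).lin) (ker_homogeneous (midMap T q))

/-- The inclusion of the largest subcoalgebra in the kernel of `q`. -/
def kerCoalgIncl : kerCoalg T q ⟶ T.X := T.X.subIncl _ (ker_homogeneous (midMap T q))

theorem kerCoalgIncl_split : SplitInj (kerCoalgIncl T q) := splitInj_subIncl _ _ _

theorem kerCoalgIncl_mid : kerCoalgIncl T q ≫ midMap T q = ⟨0, fun _ _ _ => zero_mem _⟩ :=
  GrVect.hom_ext <| LinearMap.ext fun x => subLin_mem x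

theorem exists_kerCoalgIncl {x : T.X} (hx : (midMap T q).lin x = 0) :
    ∃ y, (kerCoalgIncl T q).lin y = x := exists_subLin hx

/-- The restriction of the coproduct. -/
theorem exists_kerCoalgComul :
    ∃ d : kerCoalg T q ⟶ tensorObj (kerCoalg T q) (kerCoalg T q),
      d ≫ (kerCoalgIncl T q ⊗ₘ kerCoalgIncl T q) = kerCoalgIncl T q ≫ comul := by
  obtain ⟨p, hp⟩ := kerCoalgIncl_split T q
  have key : ∀ x, TensorProduct.map (kerCoalgIncl T q).lin (kerCoalgIncl T q).lin
      (TensorProduct.map p p ((comul (X := T.X)).lin ((kerCoalgIncl T q).lin x))) =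
      (comul (X := T.X)).lin ((kerCoalgIncl T q).lin x) := by
    intro x
    have hx : (midMap T q).lin ((kerCoalgIncl T q).lin x) = 0 := subLin_mem x
    refine mem_of_ker (midMap T q).lin (kerCoalgIncl T q).lin p hp
      (fun x hx => exists_kerCoalgIncl T q hx) _ ?_ ?_
    · have h := LinearMap.congr_fun (congrArg Hom.lin (midMap_left T q)) ((kerCoalgIncl T q).lin x)
      refine h.trans ?_
      rw [comp_lin, LinearMap.comp_apply, hx, map_zero]
    · have h := LinearMap.congr_fun (congrArg Hom.lin (midMap_right T q)) ((kerCoalgIncl T q).lin x)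
      refine h.trans ?_
      rw [comp_lin, LinearMap.comp_apply, hx, map_zero]
  exact ⟨⟨TensorProduct.map p p ∘ₗ (comul (X := T.X)).lin ∘ₗ (kerCoalgIncl T q).lin,
    fun γ x hx => ((kerCoalgIncl_split T q).tensor (kerCoalgIncl_split T q)).mem <|
      (congrArg (fun z => z ∈ (tensorObj T.X T.X).gr γ) (key x)).mpr
        ((comul (X := T.X)).map_mem γ _ ((kerCoalgIncl T q).map_mem γ x hx))⟩,
    GrVect.hom_ext <| LinearMap.ext key⟩

/-- The coproduct of the subcoalgebra: the (unique) restriction of the coproduct. -/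
def kerCoalgComul : kerCoalg T q ⟶ tensorObj (kerCoalg T q) (kerCoalg T q) := (exists_kerCoalgComul T q).choose

theorem kerCoalgComul_incl : kerCoalgComul T q ≫ (kerCoalgIncl T q ⊗ₘ kerCoalgIncl T q) =
    kerCoalgIncl T q ≫ comul := (exists_kerCoalgComul T q).choose_spec

theorem kerCoalgComul_incl_left : kerCoalgComul T q ≫ (kerCoalgIncl T q ≫ counit) ▷ kerCoalg T q ≫
    (𝟙 _ ⊗ₘ kerCoalgIncl T q) = (λ_ _).inv ≫ (𝟙 _ ⊗ₘ kerCoalgIncl T q) := by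
  have h : (kerCoalgIncl T q ≫ counit) ▷ kerCoalg T q ≫ (𝟙 _ ⊗ₘ kerCoalgIncl T q) =
      (kerCoalgIncl T q ⊗ₘ kerCoalgIncl T q) ≫ counit ▷ T.X := by
    rw [← tensorHom_id, ← tensorHom_id, tensorHom_comp_tensorHom, tensorHom_comp_tensorHom,
      Category.id_comp, Category.comp_id, Category.comp_id]
  rw [h, ← Category.assoc, kerCoalgComul_incl, Category.assoc, counit_comul, id_tensorHom,
    leftUnitor_inv_naturality]

theorem kerCoalgComul_incl_right : kerCoalgComul T q ≫ kerCoalg T q ◁ (kerCoalgIncl T q ≫ counit) ≫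
    (kerCoalgIncl T q ⊗ₘ 𝟙 _) = (ρ_ _).inv ≫ (kerCoalgIncl T q ⊗ₘ 𝟙 _) := by
  have h : kerCoalg T q ◁ (kerCoalgIncl T q ≫ counit) ≫ (kerCoalgIncl T q ⊗ₘ 𝟙 _) =
      (kerCoalgIncl T q ⊗ₘ kerCoalgIncl T q) ≫ T.X ◁ counit := by
    rw [← id_tensorHom, ← id_tensorHom, tensorHom_comp_tensorHom, tensorHom_comp_tensorHom,
      Category.id_comp, Category.comp_id, Category.comp_id]
  rw [h, ← Category.assoc, kerCoalgComul_incl, Category.assoc, comul_counit, tensorHom_id,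
    rightUnitor_inv_naturality]

theorem kerCoalgComul_incl_assoc : kerCoalgComul T q ≫ kerCoalg T q ◁ kerCoalgComul T q ≫
    (kerCoalgIncl T q ⊗ₘ (kerCoalgIncl T q ⊗ₘ kerCoalgIncl T q)) =
    kerCoalgComul T q ≫ kerCoalgComul T q ▷ kerCoalg T q ≫ (α_ _ _ _).hom ≫
      (kerCoalgIncl T q ⊗ₘ (kerCoalgIncl T q ⊗ₘ kerCoalgIncl T q)) := by
  have h1 : kerCoalg T q ◁ kerCoalgComul T q ≫ (kerCoalgIncl T q ⊗ₘ (kerCoalgIncl T q ⊗ₘ kerCoalgIncl T q)) =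
      (kerCoalgIncl T q ⊗ₘ kerCoalgIncl T q) ≫ T.X ◁ comul := by
    rw [← id_tensorHom, ← id_tensorHom, tensorHom_comp_tensorHom, tensorHom_comp_tensorHom,
      kerCoalgComul_incl, Category.id_comp, Category.comp_id]
  have h2 : kerCoalgComul T q ▷ kerCoalg T q ≫ ((kerCoalgIncl T q ⊗ₘ kerCoalgIncl T q) ⊗ₘ kerCoalgIncl T q) =
      (kerCoalgIncl T q ⊗ₘ kerCoalgIncl T q) ≫ comul ▷ T.X := by
    rw [← tensorHom_id, ← tensorHom_id, tensorHom_comp_tensorHom, tensorHom_comp_tensorHom,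
      kerCoalgComul_incl, Category.id_comp, Category.comp_id]
  rw [h1, ← associator_naturality, reassoc_of% h2, reassoc_of% (kerCoalgComul_incl T q),
    reassoc_of% (kerCoalgComul_incl T q), comul_assoc]

/-- The largest subcoalgebra in the kernel of `q`. -/
def kerCoalgComon : Comon (GrVect K Γ) where
  X := kerCoalg T q
  comon :=
    { counit := kerCoalgIncl T q ≫ counit
      comul := kerCoalgComul T q
      counit_comul := by
        apply ((splitInj_id _).tensor (kerCoalgIncl_split T q)).cancel
        rw [Category.assoc, kerCoalgComul_incl_left]
      comul_counit := by
        apply ((kerCoalgIncl_split T q).tensor (splitInj_id _)).cancel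
        rw [Category.assoc, kerCoalgComul_incl_right]
      comul_assoc := by
        apply ((kerCoalgIncl_split T q).tensor
          ((kerCoalgIncl_split T q).tensor (kerCoalgIncl_split T q))).cancel
        simp only [Category.assoc]
        rw [kerCoalgComul_incl_assoc] }

/-- The inclusion, as a morphism of coalgebras. -/
def kerCoalgHom : kerCoalgComon T q ⟶ T :=
  Comon.Hom.mk' (M := kerCoalgComon T q) (N := T) (kerCoalgIncl T q) rfl (kerCoalgComul_incl T q).symm

theorem midMap_counit : midMap T q ≫ (counit ⊗ₘ (𝟙 Q ⊗ₘ counit)) = q ≫ (ρ_ Q).inv ≫ (λ_ _).inv := by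
  have h1 : T.X ◁ comul ≫ T.X ◁ (q ▷ T.X) ≫ (counit ⊗ₘ (𝟙 Q ⊗ₘ counit)) =
      ((counit : T.X ⟶ _) ⊗ₘ (q ≫ (ρ_ Q).inv)) := by
    rw [← id_tensorHom, ← id_tensorHom, ← tensorHom_id, tensorHom_comp_tensorHom,
      tensorHom_comp_tensorHom, tensorHom_comp_tensorHom]
    simp only [Category.id_comp, Category.comp_id, comul_counit_hom]
  rw [midMap, Category.assoc, Category.assoc, h1, counit_comul_hom, Category.assoc]

/-- The subcoalgebra lies in the kernel of `q`. -/
theorem kerCoalgIncl_ker (x : kerCoalg T q) : q.lin ((kerCoalgIncl T q).lin x) = 0 := by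
  have h : kerCoalgIncl T q ≫ q =
      (kerCoalgIncl T q ≫ midMap T q) ≫ (counit ⊗ₘ (𝟙 Q ⊗ₘ counit)) ≫ (λ_ _).hom ≫ (ρ_ Q).hom := by
    rw [Category.assoc, reassoc_of% (midMap_counit T q)]
    simp
  refine (LinearMap.congr_fun (congrArg Hom.lin h) x).trans ?_
  rw [kerCoalgIncl_mid]
  exact map_zero (Hom.lin (((counit : T.X ⟶ _) ⊗ₘ (𝟙 Q ⊗ₘ (counit : T.X ⟶ _))) ≫
    (λ_ _).hom ≫ (ρ_ Q).hom))

variable {T q}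

/-- A morphism of coalgebras which is killed by `q` factors through the subcoalgebra. -/
theorem exists_kerCoalgLift {S : Comon (GrVect K Γ)} (f : S ⟶ T) (h : ∀ x, q.lin (f.hom.lin x) = 0) :
    ∃ k : S ⟶ kerCoalgComon T q, k ≫ kerCoalgHom T q = f := by
  have h1 : f.hom ≫ comul = comul ≫ (f.hom ⊗ₘ f.hom) := IsComonHom.hom_comul f.hom
  have h2 : f.hom ≫ counit = counit := IsComonHom.hom_counit f.hom
  have h3 : f.hom ≫ midMap T q = (comul : S.X ⟶ _) ≫ S.X ◁ comul ≫ (f.hom ⊗ₘ ((f.hom ≫ q) ⊗ₘ f.hom)) := by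
    rw [midMap, reassoc_of% h1, ← id_tensorHom, ← id_tensorHom, ← id_tensorHom,
      tensorHom_comp_tensorHom, tensorHom_comp_tensorHom, tensorHom_comp_tensorHom]
    congr 2
    rw [reassoc_of% h1, ← tensorHom_id, tensorHom_comp_tensorHom, Category.comp_id]
  have h4 : (f.hom ⊗ₘ ((f.hom ≫ q) ⊗ₘ f.hom)).lin = 0 := by
    have h5 : (f.hom ≫ q).lin = 0 := LinearMap.ext h
    change TensorProduct.map f.hom.lin (TensorProduct.map (f.hom ≫ q).lin f.hom.lin) = 0
    rw [h5, TensorProduct.map_zero_left, TensorProduct.map_zero_right]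
  obtain ⟨p, hp⟩ := kerCoalgIncl_split T q
  have key : ∀ x, (kerCoalgIncl T q).lin (p (f.hom.lin x)) = f.hom.lin x := by
    intro x
    obtain ⟨y, hy⟩ := exists_kerCoalgIncl T q (x := f.hom.lin x) <| by
      refine (LinearMap.congr_fun (congrArg Hom.lin h3) x).trans ?_
      rw [comp_lin, comp_lin, h4, LinearMap.zero_comp, LinearMap.zero_comp, LinearMap.zero_apply]
    rw [← hy]
    exact congrArg _ (LinearMap.congr_fun hp y)
  let k : S.X ⟶ kerCoalg T q := ⟨p ∘ₗ f.hom.lin, fun γ x hx =>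
    (kerCoalgIncl_split T q).mem <| (congrArg (fun z => z ∈ T.X.gr γ) (key x)).mpr
      (f.hom.map_mem γ _ hx)⟩
  have hk : k ≫ kerCoalgIncl T q = f.hom := GrVect.hom_ext (LinearMap.ext key)
  refine ⟨Comon.Hom.mk' (M := S) (N := kerCoalgComon T q) k ?_ ?_, ?_⟩
  · change k ≫ kerCoalgIncl T q ≫ counit = counit
    rw [reassoc_of% hk, h2]
  · apply ((kerCoalgIncl_split T q).tensor (kerCoalgIncl_split T q)).cancel
    change (k ≫ kerCoalgComul T q) ≫ _ = (comul ≫ (k ⊗ₘ k)) ≫ _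
    rw [Category.assoc, Category.assoc, kerCoalgComul_incl, tensorHom_comp_tensorHom, hk,
      reassoc_of% hk, h1]
  · exact Comon.Hom.ext hk

theorem kerCoalgHom_cancel {S : Comon (GrVect K Γ)} {a b : S ⟶ kerCoalgComon T q}
    (h : a ≫ kerCoalgHom T q = b ≫ kerCoalgHom T q) : a = b :=
  Comon.Hom.ext <| (kerCoalgIncl_split T q).cancel (congrArg Comon.Hom.hom h)

variable {T' : Comon (GrVect K Γ)} {Q' : GrVect K Γ} {q' : T'.X ⟶ Q'}

/-- Functoriality of the largest subcoalgebra in the kernel. -/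
theorem exists_kerCoalgMap (f : T ⟶ T') (g : Q ⟶ Q') (h : q ≫ g = f.hom ≫ q') :
    ∃ k : kerCoalgComon T q ⟶ kerCoalgComon T' q', k ≫ kerCoalgHom T' q' = kerCoalgHom T q ≫ f :=
  exists_kerCoalgLift _ fun x => by
    refine (LinearMap.congr_fun (congrArg Hom.lin h) ((kerCoalgIncl T q).lin x)).symm.trans ?_
    exact (congrArg g.lin (kerCoalgIncl_ker T q x)).trans (map_zero _)

/-- The map induced on the largest subcoalgebras in the kernels. -/
def kerCoalgMap (f : T ⟶ T') (h : ∃ g : Q ⟶ Q', q ≫ g = f.hom ≫ q') :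
    kerCoalgComon T q ⟶ kerCoalgComon T' q' := (exists_kerCoalgMap f h.choose h.choose_spec).choose

theorem kerCoalgMap_incl (f : T ⟶ T') (h : ∃ g : Q ⟶ Q', q ≫ g = f.hom ≫ q') :
    kerCoalgMap f h ≫ kerCoalgHom T' q' = kerCoalgHom T q ≫ f :=
  (exists_kerCoalgMap f h.choose h.choose_spec).choose_spec

theorem kerCoalgMap_eq_id (f : T ⟶ T) (h : ∃ g : Q ⟶ Q, q ≫ g = f.hom ≫ q) (hf : f = 𝟙 T) :
    kerCoalgMap f h = 𝟙 (kerCoalgComon T q) := kerCoalgHom_cancel <| by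
  rw [kerCoalgMap_incl, hf, Category.comp_id, Category.id_comp]

theorem kerCoalgMap_eq_comp {T'' : Comon (GrVect K Γ)} {Q'' : GrVect K Γ} {q'' : T''.X ⟶ Q''}
    (f : T ⟶ T') (f' : T' ⟶ T'') (k : T ⟶ T'') (h : ∃ g : Q ⟶ Q', q ≫ g = f.hom ≫ q')
    (h' : ∃ g : Q' ⟶ Q'', q' ≫ g = f'.hom ≫ q'') (h'' : ∃ g : Q ⟶ Q'', q ≫ g = k.hom ≫ q'')
    (hf : k = f ≫ f') : kerCoalgMap k h'' = kerCoalgMap f h ≫ kerCoalgMap f' h' := kerCoalgHom_cancel <| by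
  rw [kerCoalgMap_incl, hf, Category.assoc, kerCoalgMap_incl f' h', ← Category.assoc, ← Category.assoc,
    kerCoalgMap_incl f h]

end Kernel

end Subcoalgebras

/-! ### The tensor coalgebra -/

section TensorCoalgebra

variable {K : Type u} [Field K]

section Ungraded

variable (X : Type u) [AddCommGroup X] [Module K X]

/-- Left multiplication by a generator. -/
def mulGen : X →ₗ[K] TensorAlgebra K X →ₗ[K] TensorAlgebra K X :=
  LinearMap.mul K (TensorAlgebra K X) ∘ₗ TensorAlgebra.ι K

theorem mulGen_apply (v : X) (w : TensorAlgebra K X) :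
    mulGen X v w = TensorAlgebra.ι K v * w := rfl

/-- Linear maps on the tensor algebra are determined recursively. -/
theorem tensorAlg_mem {N : Submodule K (TensorAlgebra K X)} (h1 : 1 ∈ N)
    (h : ∀ v, ∀ w ∈ N, TensorAlgebra.ι K v * w ∈ N) (w : TensorAlgebra K X) : w ∈ N := by
  let S : Subalgebra K (TensorAlgebra K X) :=
    { carrier := {a | ∀ w ∈ N, a * w ∈ N}
      mul_mem' := fun {a b} ha hb w hw => by
        rw [mul_assoc]
        exact ha _ (hb _ hw)
      add_mem' := fun {a b} ha hb w hw => by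
        rw [add_mul]
        exact add_mem (ha _ hw) (hb _ hw)
      algebraMap_mem' := fun r w hw => by
        rw [← Algebra.smul_def]
        exact N.smul_mem r hw }
  have hS : Algebra.adjoin K (Set.range (TensorAlgebra.ι K)) ≤ S :=
    Algebra.adjoin_le (by rintro _ ⟨v, rfl⟩; exact h v)
  rw [TensorAlgebra.adjoin_range_ι] at hS
  have := hS (Algebra.mem_top (x := w)) 1 h1
  rwa [mul_one] at this

theorem tensorAlg_ext {M : Type u} [AddCommGroup M] [Module K M] {f g : TensorAlgebra K X →ₗ[K] M}
    (h1 : f 1 = g 1)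
    (h : ∀ v w, f w = g w → f (TensorAlgebra.ι K v * w) = g (TensorAlgebra.ι K v * w)) :
    f = g :=
  LinearMap.ext fun w => tensorAlg_mem X (N := LinearMap.eqLocus f g) h1 h w

/-- The recursion for the deconcatenation: `(t, w) ↦ (1 ⊗ vw + (v ⊗ 1) t, vw)`. -/
def deconcStep : X →ₗ[K] Module.End K
    ((TensorAlgebra K X ⊗[K] TensorAlgebra K X) × TensorAlgebra K X) where
  toFun v := LinearMap.prod
    (TensorProduct.mk K _ _ 1 ∘ₗ mulGen X v ∘ₗ LinearMap.snd K _ _ +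
      TensorProduct.map (mulGen X v) LinearMap.id ∘ₗ LinearMap.fst K _ _)
    (mulGen X v ∘ₗ LinearMap.snd K _ _)
  map_add' v w := by
    refine LinearMap.ext fun p => Prod.ext ?_ ?_
    · change 1 ⊗ₜ mulGen X (v + w) p.2 + TensorProduct.map (mulGen X (v + w)) LinearMap.id p.1 =
        (1 ⊗ₜ mulGen X v p.2 + TensorProduct.map (mulGen X v) LinearMap.id p.1) +
          (1 ⊗ₜ mulGen X w p.2 + TensorProduct.map (mulGen X w) LinearMap.id p.1)
      rw [map_add, TensorProduct.map_add_left, LinearMap.add_apply, LinearMap.add_apply,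
        TensorProduct.tmul_add]
      abel
    · simp [LinearMap.prod_apply]
  map_smul' c v := by
    refine LinearMap.ext fun p => Prod.ext ?_ ?_
    · simp [LinearMap.prod_apply, TensorProduct.map_smul_left, smul_add]
    · simp [LinearMap.prod_apply]

/-- The deconcatenation coproduct
`Δ(v₁ ⋯ vₙ) = ∑ v₁ ⋯ vᵢ ⊗ vᵢ₊₁ ⋯ vₙ`, i.e. `Δ(1) = 1 ⊗ 1`, `Δ(vw) = 1 ⊗ vw + (v ⊗ 1) Δ(w)`. -/
def deconc : TensorAlgebra K X →ₗ[K] TensorAlgebra K X ⊗[K] TensorAlgebra K X :=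
  LinearMap.fst K _ _ ∘ₗ LinearMap.applyₗ ((1 ⊗ₜ[K] 1, 1) :
    (TensorAlgebra K X ⊗[K] TensorAlgebra K X) × TensorAlgebra K X) ∘ₗ
      (TensorAlgebra.lift K (deconcStep X)).toLinearMap

theorem deconc_aux (w : TensorAlgebra K X) :
    TensorAlgebra.lift K (deconcStep X) w (1 ⊗ₜ[K] 1, 1) = (deconc X w, w) := by
  refine Prod.ext rfl ?_
  have : LinearMap.snd K _ _ ∘ₗ LinearMap.applyₗ ((1 ⊗ₜ[K] 1, 1) :
    (TensorAlgebra K X ⊗[K] TensorAlgebra K X) × TensorAlgebra K X) ∘ₗ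
      (TensorAlgebra.lift K (deconcStep X)).toLinearMap = LinearMap.id := by
    refine tensorAlg_ext X ?_ fun v w h => ?_
    · simp
    · simp only [LinearMap.comp_apply, AlgHom.toLinearMap_apply, LinearMap.applyₗ_apply_apply,
        LinearMap.snd_apply, LinearMap.id_apply, map_mul, Module.End.mul_apply,
        TensorAlgebra.lift_ι_apply] at h ⊢
      exact congrArg (TensorAlgebra.ι K v * ·) h
  exact LinearMap.congr_fun this w

theorem deconc_one : deconc X 1 = (1 ⊗ₜ 1 : TensorAlgebra K X ⊗[K] TensorAlgebra K X) := by
  simp [deconc]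

theorem deconc_mul (v : X) (w : TensorAlgebra K X) :
    deconc X (TensorAlgebra.ι K v * w) = 1 ⊗ₜ (TensorAlgebra.ι K v * w) +
      TensorProduct.map (mulGen X v) LinearMap.id (deconc X w) := by
  have h : deconc X (TensorAlgebra.ι K v * w) = (deconcStep X v
      (TensorAlgebra.lift K (deconcStep X) w (1 ⊗ₜ[K] 1, 1))).1 := by
    simp [deconc]
  rw [h, deconc_aux]
  rfl

theorem deconc_assoc : TensorProduct.map LinearMap.id (deconc X) ∘ₗ deconc X =
    (TensorProduct.assoc K (TensorAlgebra K X) (TensorAlgebra K X)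
      (TensorAlgebra K X)).toLinearMap ∘ₗ
      TensorProduct.map (deconc X) LinearMap.id ∘ₗ deconc (K := K) X := by
  refine tensorAlg_ext X ?_ fun v w h => ?_
  · simp [deconc_one]
  · have e1 : ∀ t : TensorAlgebra K X ⊗[K] TensorAlgebra K X,
        TensorProduct.map LinearMap.id (deconc X) (TensorProduct.map (mulGen X v) LinearMap.id t) =
        TensorProduct.map (mulGen X v) LinearMap.id
          (TensorProduct.map LinearMap.id (deconc X) t) := fun t => by
      rw [← LinearMap.comp_apply, ← LinearMap.comp_apply, ← TensorProduct.map_comp,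
        ← TensorProduct.map_comp]
      rfl
    have e2 : ∀ t : TensorAlgebra K X ⊗[K] TensorAlgebra K X,
        TensorProduct.assoc K (TensorAlgebra K X) (TensorAlgebra K X) (TensorAlgebra K X)
          (TensorProduct.map (deconc X) LinearMap.id
            (TensorProduct.map (mulGen X v) LinearMap.id t)) =
        1 ⊗ₜ TensorProduct.map (mulGen X v) LinearMap.id t +
          TensorProduct.map (mulGen X v) LinearMap.id
            (TensorProduct.assoc K (TensorAlgebra K X) (TensorAlgebra K X) (TensorAlgebra K X)
              (TensorProduct.map (deconc X) LinearMap.id t)) := fun t => by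
      induction t with
      | zero => simp
      | add a b ha hb =>
        simp only [map_add, ha, hb, TensorProduct.tmul_add]
        abel
      | tmul a b =>
        have e3 : ∀ s : TensorAlgebra K X ⊗[K] TensorAlgebra K X,
            TensorProduct.assoc K (TensorAlgebra K X) (TensorAlgebra K X) (TensorAlgebra K X)
              (TensorProduct.map (mulGen X v) LinearMap.id s ⊗ₜ b) =
            TensorProduct.map (mulGen X v) LinearMap.id
              (TensorProduct.assoc K (TensorAlgebra K X) (TensorAlgebra K X) (TensorAlgebra K X)
                (s ⊗ₜ b)) := fun s => by
          induction s with
          | zero => simp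
          | add c d hc hd => simp only [map_add, TensorProduct.add_tmul, hc, hd]
          | tmul c d => simp
        simp only [TensorProduct.map_tmul, LinearMap.id_apply, mulGen_apply, deconc_mul,
          TensorProduct.add_tmul, map_add, TensorProduct.assoc_tmul, e3]
    simp only [LinearMap.comp_apply, LinearEquiv.coe_coe] at h ⊢
    rw [deconc_mul, map_add, map_add, map_add, e1, e2, ← h]
    simp only [TensorProduct.map_tmul, LinearMap.id_apply, deconc_one, deconc_mul,
      TensorProduct.assoc_tmul, TensorProduct.tmul_add, add_assoc]

theorem counit_deconc :
    TensorProduct.map (TensorAlgebra.algebraMapInv (R := K) (M := X)).toLinearMap LinearMap.id ∘ₗ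
      deconc X = TensorProduct.mk K K (TensorAlgebra K X) 1 := by
  refine tensorAlg_ext X ?_ fun v w h => ?_
  · simp [deconc_one]
  · have e : ∀ t : TensorAlgebra K X ⊗[K] TensorAlgebra K X,
        TensorProduct.map (TensorAlgebra.algebraMapInv (R := K) (M := X)).toLinearMap LinearMap.id
          (TensorProduct.map (mulGen X v) LinearMap.id t) = 0 := fun t => by
      induction t with
      | zero => simp
      | add a b ha hb => simp only [map_add, ha, hb, add_zero]
      | tmul a b => simp [mulGen_apply, TensorAlgebra.algebraMapInv]
    rw [LinearMap.comp_apply, deconc_mul, map_add, e, add_zero]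
    simp

theorem deconc_counit :
    TensorProduct.map LinearMap.id (TensorAlgebra.algebraMapInv (R := K) (M := X)).toLinearMap ∘ₗ
      deconc X = (TensorProduct.mk K (TensorAlgebra K X) K).flip 1 := by
  refine tensorAlg_ext X ?_ fun v w h => ?_
  · simp [deconc_one]
  · have e : ∀ t : TensorAlgebra K X ⊗[K] TensorAlgebra K X,
        TensorProduct.map LinearMap.id (TensorAlgebra.algebraMapInv (R := K) (M := X)).toLinearMap
          (TensorProduct.map (mulGen X v) LinearMap.id t) =
        TensorProduct.map (mulGen X v) LinearMap.id (TensorProduct.map LinearMap.id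
          (TensorAlgebra.algebraMapInv (R := K) (M := X)).toLinearMap t) := fun t => by
      rw [← LinearMap.comp_apply, ← LinearMap.comp_apply, ← TensorProduct.map_comp,
        ← TensorProduct.map_comp]
      rfl
    rw [LinearMap.comp_apply] at h
    rw [LinearMap.comp_apply, deconc_mul, map_add, e, h]
    simp [mulGen_apply, TensorAlgebra.algebraMapInv]

theorem ιInv_one : TensorAlgebra.ιInv (1 : TensorAlgebra K X) = 0 := by
  let _ : Module Kᵐᵒᵖ X := Module.compHom _ ((RingHom.id K).fromOpposite mul_comm)
  have : IsCentralScalar K X := ⟨fun r m => rfl⟩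
  change (TensorAlgebra.toTrivSqZeroExt (R := K) (M := X) 1).snd = 0
  rw [map_one, TrivSqZeroExt.snd_one]

theorem ιInv_mul (v : X) (w : TensorAlgebra K X) :
    TensorAlgebra.ιInv (TensorAlgebra.ι K v * w) = TensorAlgebra.algebraMapInv w • v := by
  let _ : Module Kᵐᵒᵖ X := Module.compHom _ ((RingHom.id K).fromOpposite mul_comm)
  have : IsCentralScalar K X := ⟨fun r m => rfl⟩
  change (TensorAlgebra.toTrivSqZeroExt (R := K) (M := X) (TensorAlgebra.ι K v * w)).snd = _
  have h : (TrivSqZeroExt.fstHom K K X).comp (TensorAlgebra.toTrivSqZeroExt (R := K) (M := X)) =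
      TensorAlgebra.algebraMapInv := by
    refine TensorAlgebra.hom_ext (LinearMap.ext fun x => ?_)
    simp [TensorAlgebra.algebraMapInv]
  have h1 : (TensorAlgebra.toTrivSqZeroExt (R := K) (M := X) w).fst =
      TensorAlgebra.algebraMapInv w := AlgHom.congr_fun h w
  rw [map_mul, TensorAlgebra.toTrivSqZeroExt_ι, TrivSqZeroExt.snd_mul, TrivSqZeroExt.fst_inr,
    TrivSqZeroExt.snd_inr, h1, zero_smul, zero_add, op_smul_eq_smul]

end Ungraded

section Graded

open GrVect

variable {Γ : Type} [DecidableEq Γ] [AddCommMonoid Γ] [DegreeIndex Γ]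

/-- The tensor algebra of a graded space, as a graded space. -/
abbrev tensorGrVect (X : GrVect K Γ) : GrVect K Γ where
  carrier := TensorAlgebra K X
  gr := wordGr X (TensorAlgebra.ι K)
  isInternal := wordGr_isInternal X _ TensorAlgebra.adjoin_range_ι (tensorAlgCoact X)
    fun _ _ => tensorAlgCoact_ι X

theorem deconc_word (X : GrVect K Γ) (γ : Γ) (w : TensorAlgebra K X)
    (hw : IsWord X (TensorAlgebra.ι K) γ w) :
    deconc X w ∈ (tensorObj' (tensorGrVect X) (tensorGrVect X)).gr γ := by
  have h1 : (1 : TensorAlgebra K X) ∈ (tensorGrVect X).gr 0 := Submodule.subset_span .one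
  induction hw with
  | one =>
    rw [deconc_one]
    exact tmul_mem (tensorGrVect X) (tensorGrVect X) (add_zero 0) h1 h1
  | @cons i γ x w hx hw ih =>
    rw [deconc_mul]
    refine add_mem (tmul_mem (tensorGrVect X) (tensorGrVect X) (zero_add _) h1
      (Submodule.subset_span (.cons hx hw))) ?_
    have : tensorGr (tensorGrVect X) (tensorGrVect X) γ ≤
        ((tensorObj' (tensorGrVect X) (tensorGrVect X)).gr (i + γ)).comap
          (TensorProduct.map (mulGen X x) LinearMap.id) :=
      tensorGr_le (tensorGrVect X) (tensorGrVect X) fun j k hjk a ha b hb =>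
        tmul_mem (tensorGrVect X) (tensorGrVect X) (by rw [← hjk, add_assoc])
          (wordGr_mul X _ i j _ (ι_mem_wordGr X _ hx) a ha) hb
    exact this ih

theorem algebraMapInv_word (X : GrVect K Γ) (γ : Γ) (w : TensorAlgebra K X)
    (hw : IsWord X (TensorAlgebra.ι K) γ w) :
    γ = 0 ∨ TensorAlgebra.algebraMapInv w = (0 : K) := by
  induction hw with
  | one => exact .inl rfl
  | cons => exact .inr (by simp [TensorAlgebra.algebraMapInv])

/-- The tensor coalgebra `T^c(X)`, with the deconcatenation coproduct. -/
def tensorCoalg (X : GrVect K Γ) : Comon (GrVect K Γ) where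
  X := tensorGrVect X
  comon :=
    { counit :=
        { lin := (TensorAlgebra.algebraMapInv (R := K) (M := X)).toLinearMap
          map_mem := fun γ => by
            have : wordGr X (TensorAlgebra.ι K) γ ≤ ((unitObj K Γ).gr γ).comap
                (TensorAlgebra.algebraMapInv (R := K) (M := X)).toLinearMap :=
              Submodule.span_le.2 fun w hw => by
                change TensorAlgebra.algebraMapInv w ∈ (unitObj K Γ).gr γ
                rcases algebraMapInv_word X γ w hw with rfl | h
                · exact mem_unit_gr_zero _
                · rw [h]
                  exact zero_mem _
            exact fun x hx => this hx }
      comul :=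
        { lin := deconc X
          map_mem := fun γ => by
            have : wordGr X (TensorAlgebra.ι K) γ ≤
                ((tensorObj' (tensorGrVect X) (tensorGrVect X)).gr γ).comap (deconc X) :=
              Submodule.span_le.2 fun w hw => deconc_word X γ w hw
            exact fun x hx => this hx }
      counit_comul := GrVect.hom_ext (counit_deconc X)
      comul_counit := GrVect.hom_ext (deconc_counit X)
      comul_assoc := GrVect.hom_ext (deconc_assoc X) }

/-- The projection of the tensor coalgebra to its generators. -/
def tensorProj (X : GrVect K Γ) : (tensorCoalg X).X ⟶ X where
  lin := TensorAlgebra.ιInv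
  map_mem γ := by
    have : wordGr X (TensorAlgebra.ι K) γ ≤ (X.gr γ).comap TensorAlgebra.ιInv :=
      Submodule.span_le.2 fun w hw => by
        change TensorAlgebra.ιInv w ∈ X.gr γ
        change IsWord X (TensorAlgebra.ι K) γ w at hw
        cases hw with
        | one =>
          rw [ιInv_one]
          exact zero_mem _
        | @cons i γ x w hx hw =>
          rw [ιInv_mul]
          rcases algebraMapInv_word X γ w hw with rfl | h
          · rw [add_zero]
            exact Submodule.smul_mem _ _ hx
          · rw [h, zero_smul]
            exact zero_mem _
    exact fun x hx => this hx

/-- The algebra map `T(f)`. -/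
def tensorMapAlg {X Y : GrVect K Γ} (f : X ⟶ Y) : TensorAlgebra K X →ₐ[K] TensorAlgebra K Y :=
  TensorAlgebra.lift K (TensorAlgebra.ι K ∘ₗ f.lin)

theorem tensorMapAlg_ι {X Y : GrVect K Γ} (f : X ⟶ Y) (x : X) :
    tensorMapAlg f (TensorAlgebra.ι K x) = TensorAlgebra.ι K (f.lin x) :=
  TensorAlgebra.lift_ι_apply _ _

theorem tensorMapAlg_counit {X Y : GrVect K Γ} (f : X ⟶ Y) (w : TensorAlgebra K X) :
    TensorAlgebra.algebraMapInv (tensorMapAlg f w) = (TensorAlgebra.algebraMapInv w : K) := by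
  have : (TensorAlgebra.algebraMapInv (R := K) (M := Y)).comp (tensorMapAlg f) =
      TensorAlgebra.algebraMapInv := by
    refine TensorAlgebra.hom_ext (LinearMap.ext fun x => ?_)
    simp [tensorMapAlg, TensorAlgebra.algebraMapInv]
  exact AlgHom.congr_fun this w

theorem tensorMapAlg_deconc {X Y : GrVect K Γ} (f : X ⟶ Y) :
    deconc Y ∘ₗ (tensorMapAlg f).toLinearMap =
      TensorProduct.map (tensorMapAlg f).toLinearMap (tensorMapAlg f).toLinearMap ∘ₗ
        deconc (K := K) X := by
  refine tensorAlg_ext _ ?_ fun v w h => ?_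
  · simp [deconc_one]
  · have e : ∀ t : TensorAlgebra K X ⊗[K] TensorAlgebra K X,
        TensorProduct.map (mulGen Y (f.lin v)) LinearMap.id
          (TensorProduct.map (tensorMapAlg f).toLinearMap (tensorMapAlg f).toLinearMap t) =
        TensorProduct.map (tensorMapAlg f).toLinearMap (tensorMapAlg f).toLinearMap
          (TensorProduct.map (mulGen X v) LinearMap.id t) := fun t => by
      induction t with
      | zero => simp
      | add a b ha hb => simp only [map_add, ha, hb]
      | tmul a b => simp [mulGen_apply, tensorMapAlg_ι]
    simp only [LinearMap.comp_apply, AlgHom.toLinearMap_apply] at h ⊢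
    rw [map_mul, tensorMapAlg_ι, deconc_mul, deconc_mul, h, e, map_add, TensorProduct.map_tmul]
    simp [tensorMapAlg_ι]

/-- The morphism of coalgebras `T^c(f)`. -/
def tensorCoalgMap {X Y : GrVect K Γ} (f : X ⟶ Y) : tensorCoalg X ⟶ tensorCoalg Y :=
  Comon.Hom.mk' (M := tensorCoalg X) (N := tensorCoalg Y)
    { lin := (tensorMapAlg f).toLinearMap
      map_mem := fun γ => by
        have : wordGr X (TensorAlgebra.ι K) γ ≤
            (wordGr Y (TensorAlgebra.ι K) γ).comap (tensorMapAlg f).toLinearMap :=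
          Submodule.span_le.2 fun w hw => Submodule.subset_span <| by
            change IsWord X (TensorAlgebra.ι K) γ w at hw
            change IsWord Y (TensorAlgebra.ι K) γ (tensorMapAlg f w)
            induction hw with
            | one => rw [map_one]; exact .one
            | cons hx _ ih => rw [map_mul, tensorMapAlg_ι]; exact .cons (f.map_mem _ _ hx) ih
        exact fun x hx => this hx }
    (GrVect.hom_ext (LinearMap.ext (tensorMapAlg_counit f)))
    (GrVect.hom_ext (tensorMapAlg_deconc f))

theorem tensorCoalgMap_id {X : GrVect K Γ} (f : X ⟶ X) (h : ∀ x, f.lin x = x) :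
    tensorCoalgMap f = 𝟙 (tensorCoalg X) :=
  Comon.Hom.ext <| GrVect.hom_ext <| congrArg AlgHom.toLinearMap <|
    TensorAlgebra.hom_ext (f := tensorMapAlg f) (g := AlgHom.id K _) <| LinearMap.ext fun x => by
      simp [tensorMapAlg, h x]

theorem tensorCoalgMap_comp {X Y Z : GrVect K Γ} (f : X ⟶ Y) (g : Y ⟶ Z) (k : X ⟶ Z)
    (h : ∀ x, k.lin x = g.lin (f.lin x)) :
    tensorCoalgMap k = tensorCoalgMap f ≫ tensorCoalgMap g :=
  Comon.Hom.ext <| GrVect.hom_ext <| congrArg AlgHom.toLinearMap <|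
    TensorAlgebra.hom_ext (f := tensorMapAlg k) (g := (tensorMapAlg g).comp (tensorMapAlg f)) <|
      LinearMap.ext fun x => by
        simp [tensorMapAlg, h x]

theorem tensorProj_natural {X Y : GrVect K Γ} (f : X ⟶ Y) :
    (tensorCoalgMap f).hom ≫ tensorProj Y = tensorProj X ≫ f := by
  refine GrVect.hom_ext (tensorAlg_ext _ ?_ fun v w h => ?_)
  · change TensorAlgebra.ιInv (tensorMapAlg f 1) = f.lin (TensorAlgebra.ιInv 1)
    rw [map_one, ιInv_one, ιInv_one, map_zero]
  · change TensorAlgebra.ιInv (tensorMapAlg f (TensorAlgebra.ι K v * w)) =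
      f.lin (TensorAlgebra.ιInv (TensorAlgebra.ι K v * w))
    rw [map_mul, tensorMapAlg_ι, ιInv_mul, ιInv_mul, tensorMapAlg_counit, map_smul]

end Graded

end TensorCoalgebra

/-! ### The realisation functors `A^c` and `S^c` -/

section Corealisation

open GrVect

variable {K : Type u} [Field K]

/-- The quotient map. -/
def quotMap {Γ : Type} [DecidableEq Γ] (V : GrVect K Γ) (N : Submodule K V)
    (hN : IsHomogeneous V N) : V ⟶ V.quotObj N hN := ⟨N.mkQ, fun _ x hx => ⟨x, hx, rfl⟩⟩

/-- The map of quotients. -/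
def quotObjMap {Γ : Type} [DecidableEq Γ] {V W : GrVect K Γ} {N : Submodule K V}
    {P : Submodule K W} (hN : IsHomogeneous V N) (hP : IsHomogeneous W P) (f : V ⟶ W)
    (h : N ≤ P.comap f.lin) : V.quotObj N hN ⟶ W.quotObj P hP where
  lin := N.mapQ P f.lin h
  map_mem := by
    rintro γ _ ⟨x, hx, rfl⟩
    exact ⟨_, f.map_mem γ x hx, rfl⟩

theorem finWeight_subObj {V : GrVect K (ℕ × ℤ)} (h : finWeight K V) (N : Submodule K V)
    (hN : IsHomogeneous V N) : finWeight K (V.subObj N hN) := by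
  have hfin : ∀ n, FiniteDimensional K ↥((weightPart V n).comap (subLin N)) := fun n => by
    have := h n
    exact FiniteDimensional.of_injective
      (((subLin N).domRestrict _).codRestrict (weightPart V n) fun x => x.2)
      fun x y hxy => Subtype.ext (subLin_injective N (congrArg (Subtype.val : weightPart V n → V) hxy))
  exact @finWeight_of_le K _ (V.subObj N hN) (fun n => (weightPart V n).comap (subLin N)) hfin
    fun n z => Submodule.comap_mono (gr_le_weightPart V (n, z))

variable {m : Mixing}

/-- The target `V^{⊗2}/R`, in weight two. -/
abbrev quadQuot (X : QD K m) : GrVect K (ℕ × ℤ) :=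
  (tensorObj' (weightOne X.V) (weightOne X.V)).quotObj X.R (weightOne_homogeneous X.homogeneous)

/-- The projection `T^c(V) ↠ V^{⊗2} ↠ V^{⊗2}/R`. -/
def quadProj (X : QD K m) : (tensorCoalg (weightOne X.V)).X ⟶ quadQuot X :=
  ComonObj.comul ≫ (tensorProj (weightOne X.V) ⊗ₘ tensorProj (weightOne X.V)) ≫ quotMap _ _ _

/-- The map on generators. -/
def weightOneMap {V W : GrVect K ℤ} (f : V ⟶ W) : weightOne V ⟶ weightOne W :=
  (regrade (fun z => ((1, z) : ℕ × ℤ))).map f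

/-- The map of tensor coalgebras. -/
abbrev coalgMap {X Y : QD K m} (f : X ⟶ Y) :
    tensorCoalg (weightOne X.V) ⟶ tensorCoalg (weightOne Y.V) :=
  tensorCoalgMap (weightOneMap f.hom)

theorem quadProj_natural {X Y : QD K m} (f : X ⟶ Y) :
    ∃ g : quadQuot X ⟶ quadQuot Y, quadProj X ≫ g = (coalgMap f).hom ≫ quadProj Y := by
  refine ⟨quotObjMap _ _ (weightOneMap f.hom ⊗ₘ weightOneMap f.hom) f.map_le, ?_⟩
  have h1 : (coalgMap f).hom ≫ ComonObj.comul =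
      ComonObj.comul ≫ ((coalgMap f).hom ⊗ₘ (coalgMap f).hom) :=
    IsComonHom.hom_comul (coalgMap f).hom
  have h2 := tensorProj_natural (weightOneMap f.hom)
  rw [quadProj, quadProj, Category.assoc, Category.assoc, reassoc_of% h1,
    tensorHom_comp_tensorHom_assoc, h2, ← tensorHom_comp_tensorHom, Category.assoc]
  rfl

theorem finWeight_kerCoalg (X : QD K m) {Q : GrVect K (ℕ × ℤ)}
    (q : (tensorCoalg (weightOne X.V)).X ⟶ Q) : finWeight K (kerCoalg _ q) := by
  have := X.finite
  exact finWeight_subObj (wordGr_finWeight X.V _ _) _ (ker_homogeneous (midMap _ q))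

/-- The functor `A^c : (QD, ⊗̲) ⥤ wg-Ass-coalg`: the coalgebra `A^c(V, R)` is the universal
subcoalgebra `C` of `T^c(V)` such that the composite `C ↪ T^c(V) ↠ V^{⊗2}/R` vanishes. -/
def realAc (K : Type u) [Field K] : QDUTensor K ⥤ WgAssCoalg K where
  obj X := ⟨kerCoalgComon _ (quadProj X), finWeight_kerCoalg X _⟩
  map f := ObjectProperty.homMk (kerCoalgMap (coalgMap f) (quadProj_natural f))
  map_id X := ObjectProperty.hom_ext _ <|
    kerCoalgMap_eq_id _ (quadProj_natural (𝟙 X)) (tensorCoalgMap_id _ fun _ => rfl)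
  map_comp f g := ObjectProperty.hom_ext _ <|
    kerCoalgMap_eq_comp _ _ _ (quadProj_natural f) (quadProj_natural g)
      (quadProj_natural (f ≫ g)) (tensorCoalgMap_comp _ _ _ fun _ => rfl)

/-- The map `c ↦ (q(c), Δ(c) - τΔ(c))`. -/
def cocommProj {Γ : Type} [DecidableEq Γ] [AddCommMonoid Γ] [DegreeIndex Γ]
    (T : Comon (GrVect K Γ)) {Q : GrVect K Γ} (q : T.X ⟶ Q) :
    T.X ⟶ sumObj Q (tensorObj' T.X T.X) where
  lin := q.lin.prod ((ComonObj.comul : T.X ⟶ _).lin -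
    ((ComonObj.comul : T.X ⟶ _) ≫ (β_ T.X T.X).hom).lin)
  map_mem γ x hx := ⟨q.map_mem γ x hx, sub_mem ((ComonObj.comul : T.X ⟶ _).map_mem γ x hx)
    (((ComonObj.comul : T.X ⟶ _) ≫ (β_ T.X T.X).hom).map_mem γ x hx)⟩

theorem cocommProj_isCocomm {Γ : Type} [DecidableEq Γ] [AddCommMonoid Γ] [DegreeIndex Γ]
    (T : Comon (GrVect K Γ)) {Q : GrVect K Γ} (q : T.X ⟶ Q) :
    isCocomm _ (kerCoalgComon T (cocommProj T q)) := by
  have h : kerCoalgIncl T (cocommProj T q) ≫ ComonObj.comul ≫ (β_ T.X T.X).hom =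
      kerCoalgIncl T (cocommProj T q) ≫ ComonObj.comul :=
    GrVect.hom_ext <| LinearMap.ext fun x =>
      (sub_eq_zero.1 (congrArg Prod.snd (kerCoalgIncl_ker T (cocommProj T q) x))).symm
  constructor
  apply ((kerCoalgIncl_split T (cocommProj T q)).tensor (kerCoalgIncl_split T (cocommProj T q))).cancel
  change (kerCoalgComul T (cocommProj T q) ≫ (β_ _ _).hom) ≫ _ = kerCoalgComul T (cocommProj T q) ≫ _
  rw [Category.assoc, ← BraidedCategory.braiding_naturality, reassoc_of% (kerCoalgComul_incl T _),
    h, kerCoalgComul_incl]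

theorem cocommProj_natural {Γ : Type} [DecidableEq Γ] [AddCommMonoid Γ] [DegreeIndex Γ]
    {T T' : Comon (GrVect K Γ)} {Q Q' : GrVect K Γ} {q : T.X ⟶ Q} {q' : T'.X ⟶ Q'} (f : T ⟶ T')
    (h : ∃ g : Q ⟶ Q', q ≫ g = f.hom ≫ q') :
    ∃ g : sumObj Q (tensorObj' T.X T.X) ⟶ sumObj Q' (tensorObj' T'.X T'.X),
      cocommProj T q ≫ g = f.hom ≫ cocommProj T' q' := by
  obtain ⟨g, hg⟩ := h
  have h1 : f.hom ≫ ComonObj.comul = ComonObj.comul ≫ (f.hom ⊗ₘ f.hom) :=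
    IsComonHom.hom_comul f.hom
  have h2 : (ComonObj.comul ≫ (β_ T.X T.X).hom) ≫ (f.hom ⊗ₘ f.hom) =
      f.hom ≫ ComonObj.comul ≫ (β_ T'.X T'.X).hom := by
    rw [Category.assoc, ← BraidedCategory.braiding_naturality, reassoc_of% h1]
  refine ⟨sumHom g (f.hom ⊗ₘ f.hom), GrVect.hom_ext <| LinearMap.ext fun x => Prod.ext ?_ ?_⟩
  · exact LinearMap.congr_fun (congrArg Hom.lin hg) x
  · refine (map_sub (f.hom ⊗ₘ f.hom).lin _ _).trans ?_
    exact congrArg₂ (· - ·) (LinearMap.congr_fun (congrArg Hom.lin h1) x).symm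
      (LinearMap.congr_fun (congrArg Hom.lin h2) x)

/-- The functor `S^c : (QD⁺, ⊗̲) ⥤ wg-Com-coalg`: the coalgebra `S^c(V, R)` is the universal
cocommutative subcoalgebra `C` of `T^c(V)` such that the composite `C ↪ T^c(V) ↠ V^{⊗2}/R`
vanishes. -/
def realSc (K : Type u) [Field K] : QDPlusUTensor K ⥤ WgComCoalg K where
  obj X := ⟨kerCoalgComon _ (cocommProj _ (quadProj X.obj)), finWeight_kerCoalg X.obj _,
    cocommProj_isCocomm _ _⟩
  map f := ObjectProperty.homMk
    (kerCoalgMap (coalgMap f.hom) (cocommProj_natural _ (quadProj_natural f.hom)))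
  map_id X := ObjectProperty.hom_ext _ <|
    kerCoalgMap_eq_id _ (cocommProj_natural _ (quadProj_natural (𝟙 X.obj))) (tensorCoalgMap_id _ fun _ => rfl)
  map_comp f g := ObjectProperty.hom_ext _ <|
    kerCoalgMap_eq_comp _ _ _ (cocommProj_natural _ (quadProj_natural f.hom))
      (cocommProj_natural _ (quadProj_natural g.hom))
      (cocommProj_natural _ (quadProj_natural (f.hom ≫ g.hom))) (tensorCoalgMap_comp _ _ _ fun _ => rfl)

end Corealisation

instance {C : Type*} [Category* C] [MonoidalCategory C] [SymmetricCategory C] :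
    SymmetricCategory Cᵒᵖ where
  symmetry X Y := Quiver.Hom.unop_inj (SymmetricCategory.symmetry X.unop Y.unop)

/-- Strong symmetric monoidal functors. A contravariant functor from `C` to `D` is viewed as a functor
from `Cᵒᵖ`. -/
abbrev StrongSymMonoidal {C D : Type*} [Category* C] [MonoidalCategory C] [SymmetricCategory C]
    [Category* D] [MonoidalCategory D] [SymmetricCategory D] (F : C ⥤ D) : Prop :=
  Nonempty F.Braided

end QuadraticData

end

/-!
The tensor products in this theorem share one feature that makes coherence automatic. In quadratic
data, graded algebras and graded Lie algebras the unit is initial, so that a tensor product `X ⊗ Y`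
receives inclusions of `X` and `Y`, and these are jointly epimorphic (`GeneratedTensor`). All
associators, unitors and braidings are compatible with the inclusions. Hence isomorphisms
`F X ⊗ F Y ≅ F (X ⊗ Y)` that carry inclusions to images of inclusions are automatically natural and
coherent (`braided_of_inclusions`). For coalgebras the unit is terminal and the projections are
jointly monomorphic, and the same criterion applies to opposite functors (`braided_of_op`). Functors
to a full subcategory are compared after the inclusion (`braided_of_comp_fullyFaithful`). What
remains is one isomorphism for each functor.

* Quadratic data. Koszul and linear duality and the lift `𝒮` turn a direct sum of spaces into a
  direct sum, so only the relations have to be compared (`QD.braided_of_sum`). For the linear dual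
  this uses the injectivity of the pairing: a functional that annihilates the mixed symmetric
  tensors has an antisymmetric mixed part (`mixed_part_eq`). If it is also symmetric, its mixed
  part is annihilated by `2`, hence zero (`mixed_part_eq_zero`). This is where `ringChar K ≠ 2` enters
  for the product `∨`.
* `A`, `S` and `U`. The algebra presented by the generators and relations of two presentations
  together with the commutators between them is their tensor product
  (`Presentation.exists_tensorIso`): multiplication `a ⊗ b ↦ ab` is surjective since the generators
  of the second factor can be moved to the right, and the map `s ↦ p(s) ⊗ 1 + 1 ⊗ q(s)` is a left
  inverse of it.
* `L`. The mixed relation between `x` and `y` is sent to `[x, y] - (-1)^{|x||y|} [y, x] = 2 [x, y]`,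
  so in characteristic different from `2` the two summands commute (`lieMap_inl_inr_bracket`) and
  generate a direct sum (`exists_lieSumIso`).
* `A^c` and `S^c`. A map to generators of weight one extends to a morphism to the tensor coalgebra
  (`exists_tensorCoalg_lift`), and a morphism to a subcoalgebra of it is determined by its composite
  to generators (`Cogenerated.hom_ext`). The relations of the product say exactly that the
  two components of the projection to generators cocommute. Cocommutation passes from generators to
  the whole coalgebra (`Cogenerated.cocommute`), and two cocommuting morphisms combine to one into
  the tensor product (`exists_comon_pair`). This gives mutually inverse morphisms
  (`IsCorealisation.exists_iso`).
* Weight-wise duality. Comonoids are monoids of the opposite category, compatibly with tensor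
  products (`comonOp_braided`), and linear duality is lax monoidal. Its structure maps
  `V^* ⊗ W^* ⟶ (V ⊗ W)^*` are injective, and surjective if the weight components of `V` are finite
  dimensional (`dualTensor_surjective`), because a functional of fixed degree involves only finitely
  many of them.
* The inclusions and the functors that forget the weight are obtained from strong monoidal functors
  by passing to monoids, comonoids and full subcategories; on Lie algebras, forgetting the weight
  leaves the direct sum unchanged.
-/

noncomputable section

namespace QuadraticData

/-! ### Monoidal functors and inclusions into tensor products -/

section Criterion

open Limits

universe v₁ v₂ v₃ w₁ w₂ w₃

/-- Monoidal categories whose unit is an initial object. -/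
class InitialUnit (C : Type w₁) [Category.{v₁} C] [MonoidalCategory C] where
  isInitial : IsInitial (𝟙_ C)

section

variable {C : Type w₁} [Category.{v₁} C] [MonoidalCategory C] [InitialUnit C]

/-- The unique morphism out of the unit. -/
def unitTo (X : C) : 𝟙_ C ⟶ X := InitialUnit.isInitial.to X

theorem unit_hom_ext {X : C} (f g : 𝟙_ C ⟶ X) : f = g := InitialUnit.isInitial.hom_ext f g

/-- The inclusion of the first tensor factor. -/
def inclLeft (X Y : C) : X ⟶ X ⊗ Y := (ρ_ X).inv ≫ X ◁ unitTo Y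

/-- The inclusion of the second tensor factor. -/
def inclRight (X Y : C) : Y ⟶ X ⊗ Y := (λ_ Y).inv ≫ unitTo X ▷ Y

theorem inclLeft_whiskerRight {X X' : C} (f : X ⟶ X') (Y : C) :
    inclLeft X Y ≫ f ▷ Y = f ≫ inclLeft X' Y := by
  rw [inclLeft, inclLeft, Category.assoc, whisker_exchange, rightUnitor_inv_naturality_assoc]

theorem inclRight_whiskerRight {X X' : C} (f : X ⟶ X') (Y : C) :
    inclRight X Y ≫ f ▷ Y = inclRight X' Y := by
  rw [inclRight, Category.assoc, ← comp_whiskerRight, unit_hom_ext (unitTo X ≫ f) (unitTo X'),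
    inclRight]

theorem inclLeft_whiskerLeft (X : C) {Y Y' : C} (f : Y ⟶ Y') :
    inclLeft X Y ≫ X ◁ f = inclLeft X Y' := by
  rw [inclLeft, Category.assoc, ← MonoidalCategory.whiskerLeft_comp,
    unit_hom_ext (unitTo Y ≫ f) (unitTo Y'), inclLeft]

theorem inclRight_whiskerLeft (X : C) {Y Y' : C} (f : Y ⟶ Y') :
    inclRight X Y ≫ X ◁ f = f ≫ inclRight X Y' := by
  rw [inclRight, inclRight, Category.assoc, ← whisker_exchange, leftUnitor_inv_naturality_assoc]

theorem inclLeft_inclLeft_assoc (X Y Z : C) :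
    inclLeft X Y ≫ inclLeft (X ⊗ Y) Z ≫ (α_ X Y Z).hom = inclLeft X (Y ⊗ Z) := by
  have h : unitTo (Y ⊗ Z) = unitTo Y ≫ (ρ_ Y).inv ≫ Y ◁ unitTo Z := unit_hom_ext _ _
  simp [inclLeft, h]

theorem inclRight_inclLeft_assoc (X Y Z : C) :
    inclRight X Y ≫ inclLeft (X ⊗ Y) Z ≫ (α_ X Y Z).hom = inclLeft Y Z ≫ inclRight X (Y ⊗ Z) := by
  have h : inclRight X Y ≫ inclLeft (X ⊗ Y) Z = inclLeft Y Z ≫ inclRight X Y ▷ Z :=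
    (inclLeft_whiskerRight _ _).symm
  rw [reassoc_of% h]
  simp [inclRight]

theorem inclRight_assoc (X Y Z : C) :
    inclRight (X ⊗ Y) Z ≫ (α_ X Y Z).hom = inclRight Y Z ≫ inclRight X (Y ⊗ Z) := by
  have h : unitTo (X ⊗ Y) = unitTo Y ≫ (λ_ Y).inv ≫ unitTo X ▷ Y := unit_hom_ext _ _
  simp [inclRight, h]

theorem inclRight_leftUnitor (X : C) : inclRight (𝟙_ C) X ≫ (λ_ X).hom = 𝟙 X := by
  rw [inclRight, unit_hom_ext (unitTo (𝟙_ C)) (𝟙 _)]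
  simp

theorem inclLeft_rightUnitor (X : C) : inclLeft X (𝟙_ C) ≫ (ρ_ X).hom = 𝟙 X := by
  rw [inclLeft, unit_hom_ext (unitTo (𝟙_ C)) (𝟙 _)]
  simp

theorem inclLeft_braiding [BraidedCategory C] (X Y : C) :
    inclLeft X Y ≫ (β_ X Y).hom = inclRight Y X := by
  simp [inclLeft, inclRight]

theorem inclRight_braiding [BraidedCategory C] (X Y : C) :
    inclRight X Y ≫ (β_ X Y).hom = inclLeft Y X := by
  simp [inclLeft, inclRight]

end

/-- Tensor products whose factors jointly generate: a morphism out of `X ⊗ Y` is determined by its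
restrictions to `X` and to `Y`. -/
class GeneratedTensor (C : Type w₁) [Category.{v₁} C] [MonoidalCategory C] [InitialUnit C] :
    Prop where
  hom_ext {X Y Z : C} {f g : X ⊗ Y ⟶ Z} (hl : inclLeft X Y ≫ f = inclLeft X Y ≫ g)
    (hr : inclRight X Y ≫ f = inclRight X Y ≫ g) : f = g

/-- Monoidal categories whose unit is a terminal object. -/
class TerminalUnit (C : Type w₁) [Category.{v₁} C] [MonoidalCategory C] where
  isTerminal : IsTerminal (𝟙_ C)

section

variable {C : Type w₁} [Category.{v₁} C] [MonoidalCategory C]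

section

variable [TerminalUnit C]

/-- The unique morphism to the unit. -/
def toUnit (X : C) : X ⟶ 𝟙_ C := TerminalUnit.isTerminal.from X

theorem hom_unit_ext {X : C} (f g : X ⟶ 𝟙_ C) : f = g := TerminalUnit.isTerminal.hom_ext f g

/-- The projection to the first tensor factor. -/
def projLeft (X Y : C) : X ⊗ Y ⟶ X := X ◁ toUnit Y ≫ (ρ_ X).hom

/-- The projection to the second tensor factor. -/
def projRight (X Y : C) : X ⊗ Y ⟶ Y := toUnit X ▷ Y ≫ (λ_ Y).hom

instance : InitialUnit Cᵒᵖ := ⟨initialOpOfTerminal TerminalUnit.isTerminal⟩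

theorem inclLeft_op (X Y : Cᵒᵖ) : inclLeft X Y = (projLeft X.unop Y.unop).op := by
  rw [inclLeft, unit_hom_ext (unitTo Y) (toUnit Y.unop).op]
  rfl

theorem inclRight_op (X Y : Cᵒᵖ) : inclRight X Y = (projRight X.unop Y.unop).op := by
  rw [inclRight, unit_hom_ext (unitTo X) (toUnit X.unop).op]
  rfl

/-- Tensor products whose factors jointly cogenerate suffice for `GeneratedTensor` of the opposite
category. -/
theorem generatedTensor_op (h : ∀ {X Y Z : C} {f g : Z ⟶ X ⊗ Y},
    f ≫ projLeft X Y = g ≫ projLeft X Y → f ≫ projRight X Y = g ≫ projRight X Y → f = g) :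
    GeneratedTensor Cᵒᵖ where
  hom_ext {X Y Z f g} hl hr := by
    rw [inclLeft_op] at hl
    rw [inclRight_op] at hr
    exact Quiver.Hom.unop_inj (h (congrArg Quiver.Hom.unop hl) (congrArg Quiver.Hom.unop hr))

instance (P : ObjectProperty C) [P.IsMonoidal] : TerminalUnit P.FullSubcategory :=
  ⟨IsTerminal.ofUniqueHom (fun X => ObjectProperty.homMk (toUnit X.obj)) fun _ _ =>
    ObjectProperty.hom_ext _ (hom_unit_ext _ _)⟩

theorem projLeft_hom (P : ObjectProperty C) [P.IsMonoidal] (X Y : P.FullSubcategory) :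
    (projLeft X Y).hom = projLeft X.obj Y.obj := by
  rw [projLeft, projLeft, hom_unit_ext (toUnit Y.obj) (toUnit Y).hom]
  rfl

theorem projRight_hom (P : ObjectProperty C) [P.IsMonoidal] (X Y : P.FullSubcategory) :
    (projRight X Y).hom = projRight X.obj Y.obj := by
  rw [projRight, projRight, hom_unit_ext (toUnit X.obj) (toUnit X).hom]
  rfl

end

variable [InitialUnit C]

instance (P : ObjectProperty C) [P.IsMonoidal] : InitialUnit P.FullSubcategory :=
  ⟨IsInitial.ofUniqueHom (fun X => ObjectProperty.homMk (unitTo X.obj)) fun _ _ =>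
    ObjectProperty.hom_ext _ (unit_hom_ext _ _)⟩

theorem inclLeft_hom (P : ObjectProperty C) [P.IsMonoidal] (X Y : P.FullSubcategory) :
    (inclLeft X Y).hom = inclLeft X.obj Y.obj := by
  rw [inclLeft, inclLeft, unit_hom_ext (unitTo Y.obj) (unitTo Y).hom]
  rfl

theorem inclRight_hom (P : ObjectProperty C) [P.IsMonoidal] (X Y : P.FullSubcategory) :
    (inclRight X Y).hom = inclRight X.obj Y.obj := by
  rw [inclRight, inclRight, unit_hom_ext (unitTo X.obj) (unitTo X).hom]
  rfl

end

variable {C : Type w₁} [Category.{v₁} C] [MonoidalCategory C] [SymmetricCategory C]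
  {D : Type w₂} [Category.{v₂} D] [MonoidalCategory D] [SymmetricCategory D]
  {E : Type w₃} [Category.{v₃} E] [MonoidalCategory E] [SymmetricCategory E]

/-- All coherence conditions of a strong symmetric monoidal functor can be verified on the tensor
factors, where they hold because both sides are images of the same inclusion. -/
theorem braided_of_inclusions [InitialUnit C] [InitialUnit D] [GeneratedTensor D] (F : C ⥤ D)
    (ε : 𝟙_ D ≅ F.obj (𝟙_ C)) (μ : ∀ X Y, F.obj X ⊗ F.obj Y ≅ F.obj (X ⊗ Y))
    (hl : ∀ X Y, inclLeft (F.obj X) (F.obj Y) ≫ (μ X Y).hom = F.map (inclLeft X Y))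
    (hr : ∀ X Y, inclRight (F.obj X) (F.obj Y) ≫ (μ X Y).hom = F.map (inclRight X Y)) :
    Nonempty F.Braided := by
  have hl' := fun X Y {Z} (h : F.obj (X ⊗ Y) ⟶ Z) => (reassoc_of% (hl X Y)) h
  have hr' := fun X Y {Z} (h : F.obj (X ⊗ Y) ⟶ Z) => (reassoc_of% (hr X Y)) h
  let M : F.Monoidal := Functor.CoreMonoidal.toMonoidal
    { εIso := ε
      μIso := μ
      μIso_hom_natural_left := fun f Z => by
        apply GeneratedTensor.hom_ext
        · rw [reassoc_of% @inclLeft_whiskerRight D, hl, hl', ← F.map_comp, ← F.map_comp,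
            inclLeft_whiskerRight]
        · rw [reassoc_of% @inclRight_whiskerRight D, hr, hr', ← F.map_comp, inclRight_whiskerRight]
      μIso_hom_natural_right := fun Z f => by
        apply GeneratedTensor.hom_ext
        · rw [reassoc_of% @inclLeft_whiskerLeft D, hl, hl', ← F.map_comp, inclLeft_whiskerLeft]
        · rw [reassoc_of% @inclRight_whiskerLeft D, hr, hr', ← F.map_comp, ← F.map_comp,
            inclRight_whiskerLeft]
      associativity := fun X Y Z => by
        apply GeneratedTensor.hom_ext
        · apply GeneratedTensor.hom_ext
          · rw [reassoc_of% @inclLeft_whiskerRight D, hl', reassoc_of% @inclLeft_inclLeft_assoc D,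
              reassoc_of% @inclLeft_whiskerLeft D, hl, hl', ← F.map_comp, ← F.map_comp,
              inclLeft_inclLeft_assoc]
          · rw [reassoc_of% @inclLeft_whiskerRight D, hr', reassoc_of% @inclRight_inclLeft_assoc D,
              reassoc_of% @inclRight_whiskerLeft D, hr, hl', hl', ← F.map_comp, ← F.map_comp,
              ← F.map_comp, inclRight_inclLeft_assoc]
        · rw [reassoc_of% @inclRight_whiskerRight D, hr', reassoc_of% @inclRight_assoc D,
            reassoc_of% @inclRight_whiskerLeft D, hr, hr', ← F.map_comp, ← F.map_comp,
            inclRight_assoc]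
      left_unitality := fun X => by
        apply GeneratedTensor.hom_ext
        · exact unit_hom_ext _ _
        · rw [reassoc_of% @inclRight_whiskerRight D, hr', inclRight_leftUnitor, ← F.map_comp,
            inclRight_leftUnitor, F.map_id]
      right_unitality := fun X => by
        apply GeneratedTensor.hom_ext
        · rw [reassoc_of% @inclLeft_whiskerLeft D, hl', inclLeft_rightUnitor, ← F.map_comp,
            inclLeft_rightUnitor, F.map_id]
        · exact unit_hom_ext _ _ }
  refine ⟨{ M with braided := fun X Y => ?_ }⟩
  change (μ X Y).hom ≫ F.map (β_ X Y).hom = (β_ _ _).hom ≫ (μ Y X).hom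
  apply GeneratedTensor.hom_ext
  · rw [hl', reassoc_of% @inclLeft_braiding D, hr, ← F.map_comp, inclLeft_braiding]
  · rw [hr', reassoc_of% @inclRight_braiding D, hl, ← F.map_comp, inclRight_braiding]

theorem braided_comp (F : C ⥤ D) (G : D ⥤ E) (hF : Nonempty F.Braided) (hG : Nonempty G.Braided) :
    Nonempty (F ⋙ G).Braided := by
  obtain ⟨_⟩ := hF
  obtain ⟨_⟩ := hG
  exact ⟨inferInstance⟩

/-- A functor is strong symmetric monoidal if it is so after composition with a fully faithful
one. -/
theorem braided_of_comp_fullyFaithful (F : C ⥤ D) (G : D ⥤ E) [G.Full] [G.Faithful] [G.Braided]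
    (h : Nonempty (F ⋙ G).Braided) : Nonempty F.Braided := by
  obtain ⟨h⟩ := h
  let M : F.Monoidal := Functor.CoreMonoidal.toMonoidal
    { εIso := G.preimageIso ((Functor.Monoidal.εIso G).symm ≪≫ Functor.Monoidal.εIso (F ⋙ G))
      μIso := fun X Y => G.preimageIso ((Functor.Monoidal.μIso G (F.obj X) (F.obj Y)).symm ≪≫
        Functor.Monoidal.μIso (F ⋙ G) X Y)
      μIso_hom_natural_left := fun f Z => by
        apply G.map_injective
        have := Functor.LaxMonoidal.μ_natural_left (F ⋙ G) f Z
        dsimp at this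
        simp [← this, Functor.OplaxMonoidal.δ_natural_left_assoc]
      μIso_hom_natural_right := fun Z f => by
        apply G.map_injective
        have := Functor.LaxMonoidal.μ_natural_right (F ⋙ G) Z f
        dsimp at this
        simp [← this]
      associativity := fun X Y Z => by
        apply G.map_injective
        have := Functor.LaxMonoidal.associativity (F ⋙ G) X Y Z
        dsimp at this
        simp [this, Functor.Monoidal.map_whiskerRight, Functor.Monoidal.map_whiskerLeft]
      left_unitality := fun X => by
        apply G.map_injective
        have := Functor.LaxMonoidal.left_unitality (F ⋙ G) X
        dsimp at this
        have h := Functor.Monoidal.map_leftUnitor G (F.obj X)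
        simp only [this] at h
        rw [h]
        simp [Functor.Monoidal.map_whiskerRight]
      right_unitality := fun X => by
        apply G.map_injective
        have := Functor.LaxMonoidal.right_unitality (F ⋙ G) X
        dsimp at this
        have h := Functor.Monoidal.map_rightUnitor G (F.obj X)
        simp only [this] at h
        rw [h]
        simp [Functor.Monoidal.map_whiskerLeft] }
  refine ⟨{ M with braided := fun X Y => ?_ }⟩
  apply G.map_injective
  have := Functor.LaxBraided.braided (F := F ⋙ G) X Y
  change (G.map (G.preimage _ ≫ _) = G.map (_ ≫ G.preimage _))
  dsimp at this
  simp [this]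

/-- The opposite of a strong monoidal functor. -/
abbrev opMonoidal (F : C ⥤ D) [F.Monoidal] : F.op.Monoidal :=
  Functor.CoreMonoidal.toMonoidal
    { εIso := (Functor.Monoidal.εIso F).symm.op.symm.symm
      μIso := fun X Y => (Functor.Monoidal.μIso F X.unop Y.unop).symm.op.symm.symm
      μIso_hom_natural_left := fun f Z => Quiver.Hom.unop_inj
        (Functor.OplaxMonoidal.δ_natural_left F f.unop Z.unop)
      μIso_hom_natural_right := fun Z f => Quiver.Hom.unop_inj
        (Functor.OplaxMonoidal.δ_natural_right F Z.unop f.unop)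
      associativity := fun X Y Z => Quiver.Hom.unop_inj (by
        change (F.map (α_ _ _ _).inv ≫ Functor.OplaxMonoidal.δ F _ _) ≫
          Functor.OplaxMonoidal.δ F _ _ ▷ _ = (Functor.OplaxMonoidal.δ F _ _ ≫
            _ ◁ Functor.OplaxMonoidal.δ F _ _) ≫ (α_ _ _ _).inv
        simp)
      left_unitality := fun X => Quiver.Hom.unop_inj
        ((Functor.OplaxMonoidal.left_unitality F X.unop).trans (Category.assoc _ _ _).symm)
      right_unitality := fun X => Quiver.Hom.unop_inj
        ((Functor.OplaxMonoidal.right_unitality F X.unop).trans (Category.assoc _ _ _).symm) }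

/-- The opposite of a strong symmetric monoidal functor. -/
abbrev opBraided (F : C ⥤ D) [F.Braided] : F.op.Braided :=
  { opMonoidal F with
    braided := fun X Y => Quiver.Hom.unop_inj <| by
      have := Functor.LaxBraided.braided (F := F) Y.unop X.unop
      change F.map (β_ _ _).hom ≫ Functor.OplaxMonoidal.δ F _ _ =
        Functor.OplaxMonoidal.δ F _ _ ≫ (β_ _ _).hom
      rw [← cancel_epi (Functor.LaxMonoidal.μ F _ _), reassoc_of% this]
      simp }

theorem braided_op (F : C ⥤ D) (h : Nonempty F.Braided) : Nonempty F.op.Braided := by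
  obtain ⟨_⟩ := h
  exact ⟨opBraided F⟩

/-- A functor with a strong symmetric monoidal opposite is strong symmetric monoidal. -/
theorem braided_of_op (F : C ⥤ D) (h : Nonempty F.op.Braided) : Nonempty F.Braided := by
  obtain ⟨h⟩ := braided_op F.op h
  have h₁ : (opOp C).Braided := { braided := fun X Y => by simp }
  have h₂ : (unopUnop D).Braided := { braided := fun X Y => by simp }
  exact braided_comp (opOp C ⋙ F.op.op) (unopUnop D) (braided_comp (opOp C) F.op.op ⟨h₁⟩ ⟨h⟩) ⟨h₂⟩

end Criterion

/-! ### Injectivity of the pairing -/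

/-- No finiteness is needed: expand the second factor in a basis of `W^*`. -/
theorem dualDistrib_injective {K V W : Type*} [Field K] [AddCommGroup V] [Module K V]
    [AddCommGroup W] [Module K W] :
    Function.Injective (TensorProduct.dualDistrib K V W) := by
  refine (injective_iff_map_eq_zero _).2 fun z hz => ?_
  let b := Module.Basis.ofVectorSpace K (Module.Dual K W)
  obtain ⟨c, rfl⟩ := TensorProduct.eq_repr_basis_right b z
  suffices c = 0 by simp [this]
  ext i v
  have hv : c.sum (fun i m => m v • b i) = 0 := by
    ext w
    have := LinearMap.congr_fun hz (v ⊗ₜ w)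
    simpa [Finsupp.sum, LinearMap.sum_apply] using this
  have h := linearIndependent_iff'.1 b.linearIndependent c.support (fun i => c i v) hv i
  by_cases hi : i ∈ c.support
  · exact h hi
  · simp [Finsupp.notMem_support_iff.1 hi]

section QuadFunctorsMonoidal

open GrVect

variable {K : Type u} [Field K]

/-- The pairing differs from the one of the ungraded duals by the sign twist, which is an
involution. -/
theorem GrVect.pairing_injective {Γ : Type} [DecidableEq Γ] [AddCommMonoid Γ] [DegreeIndex Γ]
    (V W : GrVect K Γ) : Function.Injective (pairing V W) := by
  have h₁ : Function.Injective (LinearMap.lcomp K K (signTwist V W)) := fun f g h => by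
    ext1
    ext x y
    have := LinearMap.congr_fun h (signTwist V W (x ⊗ₜ y))
    simpa [signTwist_signTwist] using this
  exact (h₁.comp dualDistrib_injective).comp
    (TensorProduct.map_injective_of_flat_flat _ _ (toFun_injective V) (toFun_injective W))

/-! ### Strong monoidal functors to quadratic data -/

namespace QD

variable {m : Mixing}

instance : InitialUnit (QD K m) :=
  ⟨Limits.IsInitial.ofUniqueHom unitHom fun _ f => hom_ext <| LinearMap.ext fun _ =>
    map_zero f.hom.lin⟩

instance : TerminalUnit (QD K m) :=
  ⟨Limits.IsTerminal.ofUniqueHom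
    (fun X => ⟨⟨0, fun _ _ _ => zero_mem _⟩, fun z _ => by simp [sq]⟩)
    fun _ _ => hom_ext <| LinearMap.ext fun _ => rfl⟩

theorem inclLeft_eq (X Y : QD K m) : inclLeft X Y = inlHom X Y := hom_ext <|
  LinearMap.ext fun _ => Prod.ext rfl (map_zero (unitTo Y).hom.lin)

theorem inclRight_eq (X Y : QD K m) : inclRight X Y = inrHom X Y := hom_ext <|
  LinearMap.ext fun _ => Prod.ext (map_zero (unitTo X).hom.lin) rfl

theorem projLeft_lin (X Y : QD K m) : (projLeft X Y).hom = sumFst X.V Y.V := rfl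

theorem projRight_lin (X Y : QD K m) : (projRight X Y).hom = sumSnd X.V Y.V := rfl

instance : GeneratedTensor (QD K m) where
  hom_ext {X Y Z f g} hl hr := by
    rw [inclLeft_eq] at hl
    rw [inclRight_eq] at hr
    refine hom_ext (LinearMap.ext fun p => ?_)
    have h₁ := LinearMap.congr_fun (congrArg (fun f => f.hom.lin) hl) p.1
    have h₂ := LinearMap.congr_fun (congrArg (fun f => f.hom.lin) hr) p.2
    have hp : p = (inl X.V Y.V).lin p.1 + (inr X.V Y.V).lin p.2 :=
      Prod.ext (add_zero p.1).symm (zero_add p.2).symm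
    rw [hp, map_add, map_add]
    exact congrArg₂ (· + ·) h₁ h₂

/-- A functor `F` to quadratic data is strong symmetric monoidal if the underlying space of
`F (X ⊗ Y)` is the direct sum of those of `F X` and `F Y` and if its relations are those of `F X`
and `F Y` together with the mixed ones. The map `g` is the inverse of the direct sum
decomposition. -/
theorem braided_of_sum {C : Type*} [Category* C] [MonoidalCategory C]
    [SymmetricCategory C] [InitialUnit C] (F : C ⥤ QD K m) [Subsingleton (F.obj (𝟙_ C)).V]
    (g : ∀ X Y, (F.obj (X ⊗ Y)).V ⟶ sumObj (F.obj X).V (F.obj Y).V)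
    (hl : ∀ X Y, (F.map (inclLeft X Y)).hom ≫ g X Y = inl _ _)
    (hr : ∀ X Y, (F.map (inclRight X Y)).hom ≫ g X Y = inr _ _)
    (hg : ∀ X Y z, (F.map (inclLeft X Y)).hom.lin ((g X Y).lin z).1 +
      (F.map (inclRight X Y)).hom.lin ((g X Y).lin z).2 = z)
    (hm : ∀ X Y x y, symLin m _ ((F.map (inclLeft X Y)).hom.lin x ⊗ₜ
      (F.map (inclRight X Y)).hom.lin y) ∈ (F.obj (X ⊗ Y)).R)
    (hR : ∀ X Y, ∀ z ∈ (F.obj (X ⊗ Y)).R, sq (g X Y) z ∈ (prod (F.obj X) (F.obj Y)).R) :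
    Nonempty F.Braided := by
  let d : ∀ X Y, sumObj (F.obj X).V (F.obj Y).V ⟶ (F.obj (X ⊗ Y)).V := fun X Y =>
    { lin := (F.map (inclLeft X Y)).hom.lin.coprod (F.map (inclRight X Y)).hom.lin
      map_mem := fun γ p hp => add_mem ((F.map (inclLeft X Y)).hom.map_mem γ _ hp.1)
        ((F.map (inclRight X Y)).hom.map_mem γ _ hp.2) }
  have hdl : ∀ X Y, inl _ _ ≫ d X Y = (F.map (inclLeft X Y)).hom := fun X Y =>
    GrVect.hom_ext <| LinearMap.ext fun x =>
      (congrArg _ (map_zero (F.map (inclRight X Y)).hom.lin)).trans (add_zero _)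
  have hdr : ∀ X Y, inr _ _ ≫ d X Y = (F.map (inclRight X Y)).hom := fun X Y =>
    GrVect.hom_ext <| LinearMap.ext fun x =>
      (congrArg (· + _) (map_zero (F.map (inclLeft X Y)).hom.lin)).trans (zero_add _)
  let μ : ∀ X Y, F.obj X ⊗ F.obj Y ≅ F.obj (X ⊗ Y) := fun X Y =>
    { hom := ofSum (d X Y) _ _ (hdl X Y) (hdr X Y) (hm X Y)
      inv := ⟨g X Y, hR X Y⟩
      hom_inv_id := hom_ext <| LinearMap.ext fun p => by
        have h₁ := LinearMap.congr_fun (congrArg Hom.lin (hl X Y)) p.1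
        have h₂ := LinearMap.congr_fun (congrArg Hom.lin (hr X Y)) p.2
        refine (map_add (g X Y).lin _ _).trans ((congrArg₂ (· + ·) h₁ h₂).trans ?_)
        exact Prod.ext (add_zero p.1) (zero_add p.2)
      inv_hom_id := hom_ext <| LinearMap.ext fun z => hg X Y z }
  let ε : 𝟙_ (QD K m) ≅ F.obj (𝟙_ C) :=
    { hom := unitTo _
      inv := toUnit _
      hom_inv_id := unit_hom_ext _ _
      inv_hom_id := hom_ext <| LinearMap.ext fun _ => Subsingleton.elim _ _ }
  refine braided_of_inclusions F ε μ (fun X Y => ?_) fun X Y => ?_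
  · rw [inclLeft_eq]
    exact Hom.ext (hdl X Y)
  · rw [inclRight_eq]
    exact Hom.ext (hdr X Y)

end QD

/-! ### The Koszul dual and the lift `𝒮` -/

theorem shiftSq_symLin (V : GrVect K ℤ) (z : V ⊗[K] V) :
    shiftSq V (symLin .minus V z) = symLin .plus (shift V) (shiftSq V z) := by
  refine LinearMap.congr_fun (f := shiftSq V ∘ₗ symLin .minus V)
    (g := symLin .plus (shift V) ∘ₗ shiftSq V) (tensor_ext V V fun i x hx j y hy => ?_) z
  have h1 := swapLin_tmul (shift V) (shift V) (mem_regrade (· + 1) V rfl hx)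
    (mem_regrade (· + 1) V rfl hy)
  have h2 : koszul K (i + 1) (j + 1) = -(koszul K i (1 : ℤ) * koszul K i j * koszul K j (1 : ℤ))
      := by
    rw [koszul_add_left, koszul_add_right, koszul_add_right]
    have : koszul K (1 : ℤ) (1 : ℤ) = -1 := by
      simp [koszul, DegreeIndex.deg]
    rw [this, koszul_comm 1 j]
    ring
  simp only [LinearMap.comp_apply, symLin, LinearMap.add_apply, LinearMap.sub_apply,
    LinearMap.id_apply, map_sub, swapLin_tmul V V hx hy, shiftSq_tmul V hx y, map_smul,
    shiftSq_tmul V hy x, h1, h2]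
  rw [sub_eq_add_neg, ← neg_smul, smul_add, smul_smul, smul_smul]
  congr 2
  have := koszul_mul_self (K := K) i (1 : ℤ)
  linear_combination (koszul K i j * koszul K j (1 : ℤ)) * this

/-- For homogeneous `x`, suspending `x ⊗ y` only changes the sign. -/
theorem shift_tmul (V : GrVect K ℤ) {i : ℤ} {x : V} (hx : x ∈ V.gr i) (y : V) :
    (x ⊗ₜ[K] y : shift V ⊗[K] shift V) = shiftSq V (koszul K i (1 : ℤ) • (x ⊗ₜ y)) := by
  rw [map_smul, shiftSq_tmul V hx, smul_smul, koszul_mul_self, one_smul]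

/-- Suspension commutes with direct sums. -/
def shiftSum (V W : GrVect K ℤ) : shift (sumObj V W) ⟶ sumObj (shift V) (shift W) where
  lin := LinearMap.id (M := V × W)
  map_mem γ p hp := regrade_le (· + 1) (sumObj V W) (N := (sumObj (shift V) (shift W)).gr γ) (by
    rintro γ rfl p hp
    exact ⟨mem_regrade (· + 1) V rfl hp.1, mem_regrade (· + 1) W rfl hp.2⟩) hp

theorem sq_sq {U V W : GrVect K ℤ} (f : U ⟶ V) (g : V ⟶ W) (z : U ⊗[K] U) :
    sq g (sq f z) = sq (f ≫ g) z := by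
  rw [sq, sq, sq, comp_lin, TensorProduct.map_comp, LinearMap.comp_apply]

theorem shiftSq_mixed_mem (X Y : QD K .minus) (x : shift X.V) (y : shift Y.V) :
    symLin .plus (shift (sumObj X.V Y.V)) ((shiftMap (inl X.V Y.V)).lin x ⊗ₜ
      (shiftMap (inr X.V Y.V)).lin y) ∈ (koszulObj .plus (QD.prod X Y)).R := by
  refine X.V.induction (p := fun x => symLin .plus (shift (sumObj X.V Y.V))
    ((shiftMap (inl X.V Y.V)).lin x ⊗ₜ (shiftMap (inr X.V Y.V)).lin y) ∈
      (koszulObj .plus (QD.prod X Y)).R) x (fun i x hx => ?_) ?_ ?_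
  · have h := shift_tmul (sumObj X.V Y.V) ((inl X.V Y.V).map_mem i x hx) ((inr X.V Y.V).lin y)
    refine Set.mem_of_eq_of_mem (congrArg (symLin .plus (shift (sumObj X.V Y.V))) h) ?_
    rw [← shiftSq_symLin, map_smul]
    exact ⟨_, Submodule.smul_mem _ _ (QD.mixed_mem X Y x y), rfl⟩
  · refine Set.mem_of_eq_of_mem ?_ (zero_mem (koszulObj .plus (QD.prod X Y)).R)
    rw [map_zero, TensorProduct.zero_tmul, map_zero]
  · intro a b ha hb
    refine Set.mem_of_eq_of_mem ?_ (add_mem ha hb)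
    rw [map_add, TensorProduct.add_tmul, map_add]

theorem sq_shiftSum_mem (X Y : QD K .minus) :
    (koszulObj .plus (QD.prod X Y)).R ≤
      (QD.prod (koszulObj .plus X) (koszulObj .plus Y)).R.comap (sq (shiftSum X.V Y.V)) := by
  rw [Submodule.map_le_iff_le_comap]
  refine sup_le (sup_le ?_ ?_) ?_
  · rintro _ ⟨z, hz, rfl⟩
    rw [Submodule.mem_comap, Submodule.mem_comap, shiftSq_natural, sq_sq]
    exact QD.inl_mem (koszulObj .plus X) (koszulObj .plus Y) ⟨z, hz, rfl⟩
  · rw [mixed, LinearMap.range_le_iff_comap, eq_top_iff]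
    rintro z -
    refine tensor_induction X.V Y.V (fun i j x hx y hy => ?_) z
    rw [Submodule.mem_comap, Submodule.mem_comap, Submodule.mem_comap, LinearMap.comp_apply,
      shiftSq_symLin, TensorProduct.map_tmul,
      shiftSq_tmul (sumObj X.V Y.V) ((inl X.V Y.V).map_mem i x hx), map_smul, map_smul,
      ← symLin_natural]
    exact Submodule.smul_mem _ _ (QD.mixed_mem (koszulObj .plus X) (koszulObj .plus Y) x y)
  · rintro _ ⟨z, hz, rfl⟩
    rw [Submodule.mem_comap, Submodule.mem_comap, shiftSq_natural, sq_sq]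
    exact QD.inr_mem (koszulObj .plus X) (koszulObj .plus Y) ⟨z, hz, rfl⟩

theorem koszulDual_map_inclLeft (X Y : QDTensor K) :
    ((koszulDual K).map (inclLeft X Y)).hom = shiftMap (inl X.V Y.V) :=
  congrArg (fun f => ((koszulDual K).map f).hom) (QD.inclLeft_eq X Y)

theorem koszulDual_map_inclRight (X Y : QDTensor K) :
    ((koszulDual K).map (inclRight X Y)).hom = shiftMap (inr X.V Y.V) :=
  congrArg (fun f => ((koszulDual K).map f).hom) (QD.inclRight_eq X Y)

variable (K) in
theorem koszulDual_braided : StrongSymMonoidal (koszulDual K) := by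
  have : Subsingleton ((koszulDual K).obj (𝟙_ _)).V := inferInstanceAs (Subsingleton PUnit)
  refine QD.braided_of_sum (koszulDual K) (fun X Y => shiftSum X.V Y.V)
    (fun X Y => ?_) (fun X Y => ?_) (fun X Y z => ?_) (fun X Y x y => ?_)
    (fun X Y => sq_shiftSum_mem X Y)
  · rw [koszulDual_map_inclLeft]
    rfl
  · rw [koszulDual_map_inclRight]
    rfl
  · rw [koszulDual_map_inclLeft, koszulDual_map_inclRight]
    exact Prod.ext (add_zero _) (zero_add _)
  · rw [koszulDual_map_inclLeft, koszulDual_map_inclRight]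
    exact shiftSq_mixed_mem X Y x y

variable (K) in
theorem koszulDualMinus_braided : StrongSymMonoidal (koszulDualMinus K) :=
  braided_of_comp_fullyFaithful _ (isSym K .plus).ι
    (braided_comp (isSkew K .minus).ι (koszulDual K) ⟨inferInstance⟩ (koszulDual_braided K))

/-- Commutators in `V ⊕ W` are sums of commutators in `V`, commutators in `W` and mixed ones. -/
theorem extSquare_sum_le (X Y : QD K .minus) (hX : extSquare X.V ≤ X.R) (hY : extSquare Y.V ≤ Y.R) :
    extSquare (sumObj X.V Y.V) ≤ (QD.prod X Y).R := by
  rw [extSquare, LinearMap.range_le_iff_comap, eq_top_iff]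
  rintro z -
  rw [Submodule.mem_comap]
  induction z with
  | zero => simp
  | add a b ha hb =>
    rw [map_add]
    exact add_mem ha hb
  | tmul p q =>
    have hp : ∀ p : sumObj X.V Y.V, (inl X.V Y.V).lin p.1 + (inr X.V Y.V).lin p.2 = p :=
      fun p => Prod.ext (add_zero p.1) (zero_add p.2)
    refine QD.symLin_add_left (hp p) (QD.symLin_add_right (hp q) ?_ ?_)
      (QD.symLin_add_right (hp q) ?_ ?_)
    · exact QD.symLin_mem_of_hom (QD.inlHom X Y) _ _ (hX ⟨_, rfl⟩)
    · exact QD.mixed_mem X Y _ _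
    · exact QD.mixed_mem' X Y _ _
    · exact QD.symLin_mem_of_hom (QD.inrHom X Y) _ _ (hY ⟨_, rfl⟩)

/-- The quadratic datum `𝒮(V, R)`. -/
abbrev calSObj (X : QD K .none) : QD K .minus where
  V := X.V
  finite := X.finite
  R := X.R ⊔ extSquare X.V
  homogeneous := X.homogeneous.sup (range_symLin_homogeneous _ _)

theorem extSquare_le_calSObj (X : QD K .none) : extSquare X.V ≤ (calSObj X).R := le_sup_right

theorem calSObj_prod_le (X Y : QD K .none) :
    (calSObj (QD.prod X Y)).R ≤ (QD.prod (calSObj X) (calSObj Y)).R := by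
  refine sup_le (sup_le (sup_le ?_ ?_) ?_)
    (extSquare_sum_le (calSObj X) (calSObj Y) le_sup_right le_sup_right)
  · rintro _ ⟨z, hz, rfl⟩
    exact QD.inl_mem (calSObj X) (calSObj Y) (Submodule.mem_sup_left hz)
  · rintro _ ⟨z, rfl⟩
    exact zero_mem _
  · rintro _ ⟨z, hz, rfl⟩
    exact QD.inr_mem (calSObj X) (calSObj Y) (Submodule.mem_sup_left hz)

theorem calSObj_prod_mem (X Y : QD K .none) :
    (calSObj (QD.prod X Y)).R ≤
      (QD.prod (calSObj X) (calSObj Y)).R.comap (sq (𝟙 (sumObj X.V Y.V))) := by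
  rw [sq, id_lin, TensorProduct.map_id]
  exact calSObj_prod_le X Y

theorem calS_map_inclLeft (X Y : QDPlusVee K) :
    ((calS K).map (inclLeft X Y)).hom = inl X.obj.V Y.obj.V :=
  congrArg QD.Hom.hom ((inclLeft_hom _ X Y).trans (QD.inclLeft_eq X.obj Y.obj))

theorem calS_map_inclRight (X Y : QDPlusVee K) :
    ((calS K).map (inclRight X Y)).hom = inr X.obj.V Y.obj.V :=
  congrArg QD.Hom.hom ((inclRight_hom _ X Y).trans (QD.inclRight_eq X.obj Y.obj))

variable (K) in
theorem calS_braided : StrongSymMonoidal (calS K) := by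
  have : Subsingleton ((calS K).obj (𝟙_ _)).V := inferInstanceAs (Subsingleton PUnit)
  refine QD.braided_of_sum (calS K) (fun X Y => 𝟙 (sumObj X.obj.V Y.obj.V))
    calS_map_inclLeft calS_map_inclRight (fun X Y z => ?_) (fun X Y x y => ?_)
    (fun X Y => calSObj_prod_mem X.obj Y.obj)
  · rw [calS_map_inclLeft, calS_map_inclRight]
    exact Prod.ext (add_zero _) (zero_add _)
  · exact extSquare_le_calSObj (QD.prod X.obj Y.obj) ⟨_, rfl⟩

/-! ### The linear dual -/

/-- The dual of a direct sum as a direct sum of duals. -/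
def dualSum (V W : GrVect K ℤ) : dualObj (sumObj V W) ⟶ sumObj (dualObj V) (dualObj W) where
  lin := (dualMap (inl V W)).lin.prod (dualMap (inr V W)).lin
  map_mem γ f hf := ⟨(dualMap (inl V W)).map_mem γ f hf, (dualMap (inr V W)).map_mem γ f hf⟩

theorem dualMap_fst_add_snd (V W : GrVect K ℤ) (f : dualObj (sumObj V W)) :
    (dualMap (sumFst V W)).lin ((dualSum V W).lin f).1 +
      (dualMap (sumSnd V W)).lin ((dualSum V W).lin f).2 = f := by
  apply toFun_injective
  rw [map_add]
  ext p
  · exact (congrArg (_ + ·) (map_zero (toFun (sumObj V W) f))).trans (add_zero _)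
  · exact (congrArg (· + _) (map_zero (toFun (sumObj V W) f))).trans (zero_add _)

theorem pairing_symLin (V : GrVect K ℤ) (m : Mixing) (φ : DualSpace V ⊗[K] DualSpace V)
    (z : V ⊗[K] V) : pairing V V (symLin m (dualObj V) φ) z = pairing V V φ (symLin m V z) := by
  have h := LinearMap.congr_fun (pairing_swap V V φ) z
  cases m <;> simp [symLin, h]

/-- The mixed functionals `f ⊗ g - (-1)^{|f||g|} g ⊗ f` annihilate the relations of a product. -/
theorem mixed_mem_perp (X Y : QD K .plus) (f : dualObj X.V) (g : dualObj Y.V) :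
    symLin .minus (dualObj (sumObj X.V Y.V)) ((dualMap (sumFst X.V Y.V)).lin f ⊗ₜ
      (dualMap (sumSnd X.V Y.V)).lin g) ∈ perp (sumObj X.V Y.V) (QD.prod X Y).R := by
  rw [mem_perp]
  intro r hr
  rw [pairing_symLin, ← TensorProduct.map_tmul, pairing_natural, LinearMap.comp_apply]
  suffices h : (QD.prod X Y).R ≤ LinearMap.ker (TensorProduct.map (sumFst X.V Y.V).lin
      (sumSnd X.V Y.V).lin ∘ₗ symLin .minus (sumObj X.V Y.V)) by
    have := h hr
    rw [LinearMap.mem_ker, LinearMap.comp_apply] at this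
    rw [this, map_zero]
  have h₁ : (sumSnd X.V Y.V).lin ∘ₗ (inl X.V Y.V).lin = 0 := LinearMap.ext fun _ => rfl
  have h₂ : (sumFst X.V Y.V).lin ∘ₗ (inr X.V Y.V).lin = 0 := LinearMap.ext fun _ => rfl
  refine sup_le (sup_le ?_ ?_) ?_
  · rintro _ ⟨z, hz, rfl⟩
    rw [LinearMap.mem_ker, LinearMap.comp_apply, symLin_natural, sq, ← LinearMap.comp_apply,
      ← TensorProduct.map_comp, h₁, TensorProduct.map_zero_right, LinearMap.zero_apply]
  · rintro _ ⟨z, rfl⟩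
    have h : ∀ z : sumObj X.V Y.V ⊗[K] sumObj X.V Y.V,
        symLin .minus (sumObj X.V Y.V) (symLin .plus (sumObj X.V Y.V) z) = 0 := fun z => by
      have := LinearMap.congr_fun (swapLin_swapLin (sumObj X.V Y.V) (sumObj X.V Y.V)) z
      simp only [LinearMap.comp_apply, LinearMap.id_apply] at this
      simp [symLin, this, add_comm]
    rw [LinearMap.mem_ker, LinearMap.comp_apply, LinearMap.comp_apply, h, map_zero]
  · rintro _ ⟨z, hz, rfl⟩
    rw [LinearMap.mem_ker, LinearMap.comp_apply, symLin_natural, sq, ← LinearMap.comp_apply,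
      ← TensorProduct.map_comp, h₂, TensorProduct.map_zero_left, LinearMap.zero_apply]

/-- The functionals annihilating the mixed relations are antisymmetric between the summands. -/
theorem mixed_part_eq (X Y : QD K .plus) (φ : DualSpace (sumObj X.V Y.V) ⊗[K]
    DualSpace (sumObj X.V Y.V)) (h : φ ∈ perp (sumObj X.V Y.V) (QD.prod X Y).R) :
    TensorProduct.map (dualMap (inr X.V Y.V)).lin (dualMap (inl X.V Y.V)).lin φ =
      - swapLin (dualObj X.V) (dualObj Y.V)
        (TensorProduct.map (dualMap (inl X.V Y.V)).lin (dualMap (inr X.V Y.V)).lin φ) := by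
  rw [mem_perp] at h
  apply pairing_injective
  rw [map_neg, pairing_swap, pairing_natural, pairing_natural, eq_neg_iff_add_eq_zero]
  refine TensorProduct.ext' fun y x => ?_
  have h₁ := h _ (QD.mixed_mem' X Y x y)
  have h₂ := LinearMap.congr_fun (swapLin_natural (inr X.V Y.V) (inl X.V Y.V)) (y ⊗ₜ x)
  rw [LinearMap.comp_apply, LinearMap.comp_apply, TensorProduct.map_tmul] at h₂
  simp only [symLin, LinearMap.add_apply, LinearMap.id_apply, map_add, h₂] at h₁
  simpa using h₁

theorem sq_sum_decomp (V W : GrVect K ℤ) (z : sumObj V W ⊗[K] sumObj V W) :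
    z = sq (inl V W) (sq (sumFst V W) z) +
      (TensorProduct.map (inl V W).lin (inr V W).lin
        (TensorProduct.map (sumFst V W).lin (sumSnd V W).lin z) +
      TensorProduct.map (inr V W).lin (inl V W).lin
        (TensorProduct.map (sumSnd V W).lin (sumFst V W).lin z)) +
      sq (inr V W) (sq (sumSnd V W) z) := by
  induction z with
  | zero => simp
  | add a b ha hb =>
    conv_lhs => rw [ha, hb]
    simp only [map_add]
    abel
  | tmul p q =>
    have hp : ∀ p : sumObj V W, (inl V W).lin ((sumFst V W).lin p) +
      (inr V W).lin ((sumSnd V W).lin p) = p :=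
      fun p => Prod.ext (add_zero p.1) (zero_add p.2)
    conv_lhs => rw [← hp p, ← hp q]
    simp only [TensorProduct.map_tmul, TensorProduct.add_tmul, TensorProduct.tmul_add]
    abel

/-- The components of a functional that annihilates the relations of a product. -/
theorem sq_dualSum_eq (X Y : QD K .plus) (φ : DualSpace (sumObj X.V Y.V) ⊗[K]
    DualSpace (sumObj X.V Y.V)) (h : φ ∈ perp (sumObj X.V Y.V) (QD.prod X Y).R) :
    sq (dualSum X.V Y.V) φ = sq (inl (dualObj X.V) (dualObj Y.V)) (sq (dualMap (inl X.V Y.V)) φ) +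
      symLin .minus (sumObj (dualObj X.V) (dualObj Y.V))
        (TensorProduct.map (inl (dualObj X.V) (dualObj Y.V)).lin
          (inr (dualObj X.V) (dualObj Y.V)).lin
          (TensorProduct.map (dualMap (inl X.V Y.V)).lin (dualMap (inr X.V Y.V)).lin φ)) +
      sq (inr (dualObj X.V) (dualObj Y.V)) (sq (dualMap (inr X.V Y.V)) φ) := by
  have h₁ := fun z => LinearMap.congr_fun
    (swapLin_natural (inl (dualObj X.V) (dualObj Y.V)) (inr (dualObj X.V) (dualObj Y.V))) z
  simp only [LinearMap.comp_apply] at h₁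
  have hfst : dualSum X.V Y.V ≫ sumFst _ _ = dualMap (inl X.V Y.V) := rfl
  have hsnd : dualSum X.V Y.V ≫ sumSnd _ _ = dualMap (inr X.V Y.V) := rfl
  have hc : ∀ {V V' V'' W W' W'' : GrVect K ℤ} (f : V ⟶ V') (f' : V' ⟶ V'') (g : W ⟶ W')
      (g' : W' ⟶ W'') z, TensorProduct.map f'.lin g'.lin (TensorProduct.map f.lin g.lin z) =
      TensorProduct.map (f ≫ f').lin (g ≫ g').lin z := fun f f' g g' z => by
    rw [comp_lin, comp_lin, TensorProduct.map_comp, LinearMap.comp_apply]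
  have h₂ := mixed_part_eq X Y φ h
  conv_lhs => rw [sq_sum_decomp (dualObj X.V) (dualObj Y.V) (sq (dualSum X.V Y.V) φ)]
  rw [sq_sq _ (sumFst _ _), sq_sq _ (sumSnd _ _), sq.eq_def (dualSum X.V Y.V),
    hc _ (sumFst _ _) _ (sumSnd _ _), hc _ (sumSnd _ _) _ (sumFst _ _), hfst, hsnd, h₂, symLin,
    LinearMap.sub_apply, LinearMap.id_apply, h₁, map_neg, ← sub_eq_add_neg]

/-- The dual of a quadratic datum, `(V^*, R^⊥)`. -/
abbrev dualQD (X : QD K .plus) : QD K .minus where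
  V := dualObj X.V
  finite := by
    have := X.finite
    exact dualObj_finite X.V
  R := perp X.V X.R
  homogeneous := perp_homogeneous _ X.homogeneous

/-- The dual of a quadratic datum, with the orthogonal taken among the symmetric tensors. -/
abbrev dualPlusQD (X : QD K .plus) : QD K .none where
  V := dualObj X.V
  finite := by
    have := X.finite
    exact dualObj_finite X.V
  R := perp X.V X.R ⊓ symSquare (dualObj X.V)
  homogeneous := (perp_homogeneous _ X.homogeneous).inf (range_symLin_homogeneous _ _)

/-- The comparison of the orthogonals of relations for the products with mixed relations. -/
theorem dualQD_prod_le (X Y : QD K .plus) : (dualQD (QD.prod X Y)).R ≤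
    (QD.prod (dualQD X) (dualQD Y)).R.comap (sq (dualSum X.V Y.V)) := by
  intro φ hφ
  rw [Submodule.mem_comap, sq_dualSum_eq X Y φ hφ]
  refine add_mem (add_mem ?_ ?_) ?_
  · exact QD.inl_mem (dualQD X) (dualQD Y)
      (perp_natural _ (QD.inlHom X Y).map_le hφ)
  · exact Submodule.mem_sup_left (Submodule.mem_sup_right ⟨_, rfl⟩)
  · exact QD.inr_mem (dualQD X) (dualQD Y)
      (perp_natural _ (QD.inrHom X Y).map_le hφ)

theorem linearDual_map_inclLeft (X Y : (QDUTensor K)ᵒᵖ) :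
    ((linearDual K).map (inclLeft X Y)).hom = dualMap (sumFst X.unop.V Y.unop.V) :=
  (congrArg (fun f => ((linearDual K).map f).hom) (inclLeft_op X Y)).trans
    (congrArg dualMap (QD.projLeft_lin X.unop Y.unop))

theorem linearDual_map_inclRight (X Y : (QDUTensor K)ᵒᵖ) :
    ((linearDual K).map (inclRight X Y)).hom = dualMap (sumSnd X.unop.V Y.unop.V) :=
  (congrArg (fun f => ((linearDual K).map f).hom) (inclRight_op X Y)).trans
    (congrArg dualMap (QD.projRight_lin X.unop Y.unop))

theorem fst_dualSum (V W : GrVect K ℤ) : dualMap (sumFst V W) ≫ dualSum V W = inl _ _ := by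
  refine GrVect.hom_ext (LinearMap.ext fun f => Prod.ext (toFun_injective _ rfl)
    (toFun_injective _ ?_))
  exact LinearMap.ext fun _ => map_zero (toFun V f)

theorem snd_dualSum (V W : GrVect K ℤ) : dualMap (sumSnd V W) ≫ dualSum V W = inr _ _ := by
  refine GrVect.hom_ext (LinearMap.ext fun f => Prod.ext (toFun_injective _ ?_)
    (toFun_injective _ rfl))
  exact LinearMap.ext fun _ => map_zero (toFun W f)

theorem zeroObj_dual_subsingleton : Subsingleton (DualSpace (zeroObj K ℤ)) :=
  ⟨fun _ _ => toFun_injective _ (LinearMap.ext fun _ => (map_zero _).trans (map_zero _).symm)⟩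

variable (K) in
theorem linearDual_braided : StrongSymMonoidal (linearDual K) := by
  have : Subsingleton ((linearDual K).obj (𝟙_ _)).V := zeroObj_dual_subsingleton
  refine QD.braided_of_sum (linearDual K) (fun X Y => dualSum X.unop.V Y.unop.V)
    (fun X Y => ?_) (fun X Y => ?_) (fun X Y z => ?_) (fun X Y x y => ?_)
    (fun X Y => dualQD_prod_le X.unop Y.unop)
  · rw [linearDual_map_inclLeft]
    exact fst_dualSum _ _
  · rw [linearDual_map_inclRight]
    exact snd_dualSum _ _
  · rw [linearDual_map_inclLeft, linearDual_map_inclRight]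
    exact dualMap_fst_add_snd _ _ z
  · rw [linearDual_map_inclLeft, linearDual_map_inclRight]
    exact mixed_mem_perp X.unop Y.unop x y

variable (K) in
theorem secondKoszulDual_braided : StrongSymMonoidal (secondKoszulDual K) :=
  braided_comp _ _ (braided_op _ (koszulDual_braided K)) (linearDual_braided K)

/-- A symmetric tensor on `V^* ⊕ W^*` has no mixed part if it annihilates the mixed relations. -/
theorem mixed_part_eq_zero (hK : ringChar K ≠ 2) (X Y : QD K .plus)
    (φ : DualSpace (sumObj X.V Y.V) ⊗[K] DualSpace (sumObj X.V Y.V))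
    (h : φ ∈ perp (sumObj X.V Y.V) (QD.prod X Y).R)
    (hs : φ ∈ symSquare (dualObj (sumObj X.V Y.V))) :
    TensorProduct.map (dualMap (inl X.V Y.V)).lin (dualMap (inr X.V Y.V)).lin φ = 0 := by
  have h₁ : swapLin (dualObj (sumObj X.V Y.V)) (dualObj (sumObj X.V Y.V)) φ = φ := by
    obtain ⟨χ, rfl⟩ := hs
    have := LinearMap.congr_fun
      (swapLin_swapLin (dualObj (sumObj X.V Y.V)) (dualObj (sumObj X.V Y.V))) χ
    simp only [LinearMap.comp_apply, LinearMap.id_apply] at this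
    simp [symLin, this, add_comm]
  have h₂ := mixed_part_eq X Y φ h
  have h₃ := LinearMap.congr_fun
    (swapLin_natural (dualMap (inl X.V Y.V)) (dualMap (inr X.V Y.V))) φ
  simp only [LinearMap.comp_apply] at h₃
  rw [h₃, h₁, eq_neg_iff_add_eq_zero, ← two_smul K, smul_eq_zero] at h₂
  -- the mixed part is both equal and opposite to itself under the symmetry
  have h₄ := h₂.resolve_left (Ring.two_ne_zero hK)
  rw [← h₁, ← h₃] at h₄
  have h₅ := LinearMap.congr_fun (swapLin_swapLin (dualObj X.V) (dualObj Y.V))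
    (TensorProduct.map (dualMap (inl X.V Y.V)).lin (dualMap (inr X.V Y.V)).lin φ)
  rw [LinearMap.comp_apply, h₄, map_zero] at h₅
  exact h₅.symm

/-- The orthogonal among the symmetric tensors has no mixed part, as the product `∨` requires. -/
theorem dualPlusQD_prod_le (hK : ringChar K ≠ 2) (X Y : QD K .plus) :
    (dualPlusQD (QD.prod X Y)).R ≤
      (QD.prod (dualPlusQD X) (dualPlusQD Y)).R.comap (sq (dualSum X.V Y.V)) := by
  rintro φ ⟨hφ, hs⟩
  have h := sq_dualSum_eq X Y φ hφ
  rw [mixed_part_eq_zero hK X Y φ hφ hs, map_zero, map_zero, add_zero] at h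
  rw [Submodule.mem_comap, h]
  obtain ⟨χ, rfl⟩ := hs
  refine add_mem ?_ ?_
  · exact QD.inl_mem (dualPlusQD X) (dualPlusQD Y)
      ⟨perp_natural _ (QD.inlHom X Y).map_le hφ, _, symLin_natural .plus _ χ⟩
  · exact QD.inr_mem (dualPlusQD X) (dualPlusQD Y)
      ⟨perp_natural _ (QD.inrHom X Y).map_le hφ, _, symLin_natural .plus _ χ⟩

theorem linearDualPlus_map_inclLeft (X Y : (QDPlusUTensor K)ᵒᵖ) :
    ((linearDualPlus K).map (inclLeft X Y)).hom.hom =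
      dualMap (sumFst X.unop.obj.V Y.unop.obj.V) := by
  rw [inclLeft_op]
  exact congrArg dualMap ((congrArg QD.Hom.hom (projLeft_hom _ X.unop Y.unop)).trans
    (QD.projLeft_lin X.unop.obj Y.unop.obj))

theorem linearDualPlus_map_inclRight (X Y : (QDPlusUTensor K)ᵒᵖ) :
    ((linearDualPlus K).map (inclRight X Y)).hom.hom =
      dualMap (sumSnd X.unop.obj.V Y.unop.obj.V) := by
  rw [inclRight_op]
  exact congrArg dualMap ((congrArg QD.Hom.hom (projRight_hom _ X.unop Y.unop)).trans
    (QD.projRight_lin X.unop.obj Y.unop.obj))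

variable (K) in
theorem linearDualPlus_braided (hK : ringChar K ≠ 2) : StrongSymMonoidal (linearDualPlus K) := by
  refine braided_of_comp_fullyFaithful _ (isSym K .none).ι ?_
  have : Subsingleton ((linearDualPlus K ⋙ (isSym K .none).ι).obj (𝟙_ _)).V :=
    zeroObj_dual_subsingleton
  refine QD.braided_of_sum (linearDualPlus K ⋙ (isSym K .none).ι)
    (fun X Y => dualSum X.unop.obj.V Y.unop.obj.V)
    (fun X Y => ?_) (fun X Y => ?_) (fun X Y z => ?_) (fun X Y x y => zero_mem _)
    (fun X Y => dualPlusQD_prod_le hK X.unop.obj Y.unop.obj)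
  · exact (congrArg (· ≫ dualSum X.unop.obj.V Y.unop.obj.V)
      (linearDualPlus_map_inclLeft X Y)).trans (fst_dualSum _ _)
  · exact (congrArg (· ≫ dualSum X.unop.obj.V Y.unop.obj.V)
      (linearDualPlus_map_inclRight X Y)).trans (snd_dualSum _ _)
  · have h₁ := linearDualPlus_map_inclLeft X Y
    have h₂ := linearDualPlus_map_inclRight X Y
    refine Eq.trans ?_ (dualMap_fst_add_snd _ _ z)
    exact congrArg₂ (fun (f : dualObj X.unop.obj.V ⟶ dualObj (sumObj X.unop.obj.V Y.unop.obj.V))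
      (g : dualObj Y.unop.obj.V ⟶ dualObj (sumObj X.unop.obj.V Y.unop.obj.V)) =>
        f.lin ((dualSum _ _).lin z).1 + g.lin ((dualSum _ _).lin z).2) h₁ h₂

variable (K) in
theorem secondKoszulDualMinus_braided (hK : ringChar K ≠ 2) :
    StrongSymMonoidal (secondKoszulDualMinus K) :=
  braided_comp _ _ (braided_op _ (koszulDualMinus_braided K)) (linearDualPlus_braided K hK)

end QuadFunctorsMonoidal

/-! ### Graded algebras as rings -/

section MonRings

open GrVect

variable {K : Type u} [Field K] {Γ : Type} [DecidableEq Γ] [AddCommMonoid Γ] [DegreeIndex Γ]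

theorem GrVect.isIso_of_bijective {V W : GrVect K Γ} (f : V ⟶ W) (h : Function.Bijective f.lin) :
    IsIso f :=
  (mkIso (LinearEquiv.ofBijective f.lin h) f.map_mem (symm_mem _ f.map_mem)).isIso_hom

/-- The underlying ring of a graded algebra. -/
def MonRing (A : Mon (GrVect K Γ)) : Type u := A.X

instance (A : Mon (GrVect K Γ)) : AddCommGroup (MonRing A) := inferInstanceAs (AddCommGroup A.X)

instance (A : Mon (GrVect K Γ)) : Module K (MonRing A) := inferInstanceAs (Module K A.X)

/-- The multiplication of a graded algebra as a bilinear map. -/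
def MonRing.mulLin (A : Mon (GrVect K Γ)) : MonRing A →ₗ[K] MonRing A →ₗ[K] MonRing A :=
  TensorProduct.curry ((MonObj.mul (X := A.X)).lin : A.X ⊗[K] A.X →ₗ[K] A.X)

instance (A : Mon (GrVect K Γ)) : Ring (MonRing A) where
  __ := (inferInstance : AddCommGroup (MonRing A))
  mul a b := MonRing.mulLin A a b
  one := (MonObj.one (X := A.X)).lin (1 : K)
  zero_mul a := LinearMap.map_zero₂ (MonRing.mulLin A) a
  mul_zero a := (MonRing.mulLin A a).map_zero
  left_distrib a b c := (MonRing.mulLin A a).map_add b c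
  right_distrib a b c := LinearMap.map_add₂ (MonRing.mulLin A) a b c
  mul_assoc a b c := LinearMap.congr_fun (congrArg Hom.lin (MonObj.mul_assoc A.X))
    (((a : A.X) ⊗ₜ[K] (b : A.X)) ⊗ₜ[K] (c : A.X))
  one_mul a := (LinearMap.congr_fun (congrArg Hom.lin (MonObj.one_mul A.X))
    ((1 : K) ⊗ₜ[K] (a : A.X))).trans
    (one_smul K a)
  mul_one a := (LinearMap.congr_fun (congrArg Hom.lin (MonObj.mul_one A.X))
    ((a : A.X) ⊗ₜ[K] (1 : K))).trans
    (one_smul K a)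

instance (A : Mon (GrVect K Γ)) : Algebra K (MonRing A) :=
  Algebra.ofModule (fun c a b => LinearMap.map_smul₂ (MonRing.mulLin A) c a b)
    fun c a b => (MonRing.mulLin A a).map_smul c b

namespace MonRing

/-- The map of rings underlying a morphism of graded algebras. -/
def map {A B : Mon (GrVect K Γ)} (f : A ⟶ B) : MonRing A →ₐ[K] MonRing B :=
  AlgHom.ofLinearMap (f.hom.lin : A.X →ₗ[K] B.X)
    (LinearMap.congr_fun (congrArg Hom.lin (IsMonHom.one_hom f.hom)) (1 : K))
    fun a b => LinearMap.congr_fun (congrArg Hom.lin (IsMonHom.mul_hom f.hom))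
      ((a : A.X) ⊗ₜ[K] (b : A.X))

theorem one_mem (A : Mon (GrVect K Γ)) : (1 : MonRing A) ∈ A.X.gr 0 :=
  (MonObj.one (X := A.X)).map_mem 0 (1 : K) (mem_unit_gr_zero 1)

theorem mul_mem (A : Mon (GrVect K Γ)) {i j : Γ} {a b : MonRing A} (ha : a ∈ A.X.gr i)
    (hb : b ∈ A.X.gr j) : a * b ∈ A.X.gr (i + j) :=
  (MonObj.mul (X := A.X)).map_mem (i + j) _ (tmul_mem A.X A.X rfl ha hb)

theorem tensorμ_tmul (V V' W W' : GrVect K Γ) (x : V) {i : Γ} {x' : V'} (hx' : x' ∈ V'.gr i)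
    {j : Γ} {y : W} (hy : y ∈ W.gr j) (y' : W') :
    (tensorμ V V' W W').lin ((x ⊗ₜ x') ⊗ₜ (y ⊗ₜ y')) =
      koszul K i j • ((x ⊗ₜ[K] y) ⊗ₜ[K] (x' ⊗ₜ[K] y')) := by
  have h : (tensorμ V V' W W').lin ((x ⊗ₜ x') ⊗ₜ (y ⊗ₜ y')) =
      (TensorProduct.assoc K V W (V' ⊗[K] W')).symm (x ⊗ₜ[K] TensorProduct.assoc K W V' W'
        (swapLin V' W (x' ⊗ₜ y) ⊗ₜ[K] y')) := rfl
  rw [h, swapLin_tmul V' W hx' hy, ← TensorProduct.smul_tmul', map_smul, TensorProduct.tmul_smul,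
    map_smul]
  rfl

variable (A B : Mon (GrVect K Γ))

/-- The element `a ⊗ b` of the tensor product of two graded algebras. -/
def tmul (a : MonRing A) (b : MonRing B) : MonRing (A ⊗ B) := (a : A.X) ⊗ₜ[K] (b : B.X)

theorem tmul_mul_tmul {i j : Γ} (a : MonRing A) {b : MonRing B} (hb : b ∈ B.X.gr i)
    {a' : MonRing A} (ha' : a' ∈ A.X.gr j) (b' : MonRing B) :
    tmul A B a b * tmul A B a' b' = koszul K i j • tmul A B (a * a') (b * b') := by
  have h := tensorμ_tmul A.X B.X A.X B.X a hb ha' b'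
  refine (congrArg (TensorProduct.map (MonObj.mul (X := A.X)).lin
    (MonObj.mul (X := B.X)).lin) h).trans ?_
  rw [map_smul]
  rfl

end MonRing

instance : InitialUnit (Mon (GrVect K Γ)) :=
  ⟨Limits.IsInitial.ofUniqueHom (fun A => (Mon.uniqueHomFromTrivial A).default) fun A f =>
    (Mon.uniqueHomFromTrivial A).uniq f⟩

namespace MonRing

variable (A B : Mon (GrVect K Γ))

theorem map_unitTo (c : K) : (unitTo A).hom.lin c = algebraMap K (MonRing A) c := by
  have h := (map (unitTo A)).commutes c
  refine Eq.trans (congrArg (unitTo A).hom.lin ?_) h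
  exact (mul_one c).symm

theorem map_inclLeft (a : MonRing A) : map (inclLeft A B) a = tmul A B a 1 := by
  have h : map (inclLeft A B) a = tmul A B a ((unitTo B).hom.lin (1 : K)) := rfl
  rw [h, map_unitTo, map_one]

theorem map_inclRight (b : MonRing B) : map (inclRight A B) b = tmul A B 1 b := by
  have h : map (inclRight A B) b = tmul A B ((unitTo A).hom.lin (1 : K)) b := rfl
  rw [h, map_unitTo, map_one]

theorem map_inclLeft_mul_map_inclRight (a : MonRing A) (b : MonRing B) :
    map (inclLeft A B) a * map (inclRight A B) b = tmul A B a b := by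
  rw [map_inclLeft, map_inclRight, tmul_mul_tmul A B a (one_mem B) (one_mem A) b,
    koszul_zero_left, one_smul, one_mul, mul_one]

theorem map_inclRight_mul_map_inclLeft {i j : Γ} {a : MonRing A} (ha : a ∈ A.X.gr i)
    {b : MonRing B} (hb : b ∈ B.X.gr j) :
    map (inclRight A B) b * map (inclLeft A B) a =
      koszul K j i • (map (inclLeft A B) a * map (inclRight A B) b) := by
  rw [map_inclLeft_mul_map_inclRight, map_inclLeft, map_inclRight, tmul_mul_tmul A B 1 hb ha 1,
    one_mul, mul_one]

end MonRing

instance : GeneratedTensor (Mon (GrVect K Γ)) where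
  hom_ext {A B C f g} hl hr := by
    refine Mon.Hom.ext (GrVect.hom_ext (TensorProduct.ext' fun a b => ?_))
    have h : ∀ (a : MonRing A) (b : MonRing B),
        MonRing.map f (MonRing.tmul A B a b) = MonRing.map g (MonRing.tmul A B a b) := fun a b => by
      rw [← MonRing.map_inclLeft_mul_map_inclRight, map_mul, map_mul]
      exact congrArg₂ (fun (s t : MonRing C) => s * t)
        (LinearMap.congr_fun (congrArg (fun h => h.hom.lin) hl) a)
        (LinearMap.congr_fun (congrArg (fun h => h.hom.lin) hr) b)
    exact h a b

end MonRings

/-! ### Tensor products of presented algebras -/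

section PresentationProducts

open GrVect

variable {K : Type u} [Field K] {Γ : Type} [DecidableEq Γ] [AddCommMonoid Γ] [DegreeIndex Γ]

namespace Presentation

/-- The presented algebra as the ring underlying a graded algebra. -/
def toMonRing (P : Presentation K Γ) : P.Alg →ₐ[K] MonRing P.mon :=
  AlgHom.ofLinearMap (LinearMap.id : P.Alg →ₗ[K] P.Alg) (map_one (algebraMap K P.Alg))
    fun _ _ => rfl

/-- The algebra map underlying a morphism out of a presented graded algebra. -/
def algMap {P : Presentation K Γ} {T : Mon (GrVect K Γ)} (f : P.mon ⟶ T) : P.Alg →ₐ[K] MonRing T :=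
  (MonRing.map f).comp P.toMonRing

theorem mon_hom_ext {P : Presentation K Γ} {T : Mon (GrVect K Γ)} {f g : P.mon ⟶ T}
    (h : ∀ x, algMap f (P.ι x) = algMap g (P.ι x)) : f = g :=
  Mon.Hom.ext <| GrVect.hom_ext <| congrArg AlgHom.toLinearMap <|
    P.algHom_ext (f := algMap f) (g := algMap g) h

/-- The universal property of a presented graded algebra. -/
def desc (P : Presentation K Γ) {T : Mon (GrVect K Γ)} (f : P.X →ₗ[K] MonRing T)
    (hf : ∀ γ, ∀ x ∈ P.X.gr γ, f x ∈ T.X.gr γ)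
    (h : ∀ s ∈ P.rel, TensorAlgebra.lift K f s = 0) : P.mon ⟶ T :=
  Mon.Hom.mk' (M := P.mon) (⟨(P.lift _ h).toLinearMap, fun γ => by
      refine Submodule.span_le (p := (T.X.gr γ).comap (P.lift _ h).toLinearMap).2 fun w hw => ?_
      change IsWord P.X P.ι γ w at hw
      change P.lift _ h w ∈ T.X.gr γ
      induction hw with
      | one => rw [map_one]; exact MonRing.one_mem T
      | cons hx _ ih =>
        rw [map_mul, lift_ι, TensorAlgebra.lift_ι_apply]
        exact MonRing.mul_mem T (hf _ _ hx) ih⟩ : P.mon.X ⟶ T.X)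
    (GrVect.hom_ext <| LinearMap.ext_ring <| (P.lift _ h).map_one)
    (GrVect.hom_ext <| TensorProduct.ext' fun (x y : P.Alg) => map_mul (P.lift _ h) x y)

theorem algMap_desc_ι (P : Presentation K Γ) {T : Mon (GrVect K Γ)} (f : P.X →ₗ[K] MonRing T)
    (hf : ∀ γ, ∀ x ∈ P.X.gr γ, f x ∈ T.X.gr γ)
    (h : ∀ s ∈ P.rel, TensorAlgebra.lift K f s = 0) (x : P.X) :
    algMap (P.desc f hf h) (P.ι x) = f x :=
  (P.lift_ι _ h x).trans (TensorAlgebra.lift_ι_apply f x)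

/-- A presented algebra without generators is the unit. -/
theorem unitIso (P : Presentation K Γ) [Subsingleton P.X] (h : ∀ s ∈ P.rel, s = 0) :
    Nonempty (𝟙_ (Mon (GrVect K Γ)) ≅ P.mon) :=
  ⟨{ hom := unitTo _
     inv := P.desc 0 (fun _ _ _ => zero_mem _) fun s hs => by rw [h s hs, map_zero]
     hom_inv_id := unit_hom_ext _ _
     inv_hom_id := mon_hom_ext fun x => by
      have hx : P.ι x = 0 := (congrArg P.ι (Subsingleton.elim x 0)).trans (map_zero P.ι)
      rw [hx]
      exact (map_zero (algMap _)).trans (map_zero (algMap _)).symm }⟩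

/-- The words in the generators span a presented algebra. -/
theorem span_words (P : Presentation K Γ) :
    Submodule.span K {w | ∃ γ, IsWord P.X P.ι γ w} = ⊤ := by
  rw [eq_top_iff]
  rintro z -
  refine P.mon.X.induction (p := fun z => z ∈ Submodule.span K {w | ∃ γ, IsWord P.X P.ι γ w}) z
    (fun γ z hz => ?_) (zero_mem _) fun _ _ => add_mem
  have h : wordGr P.X P.ι γ ≤ Submodule.span K {w | ∃ γ, IsWord P.X P.ι γ w} :=
    Submodule.span_mono fun w hw => ⟨γ, hw⟩
  exact h hz

/-- An element that supercommutes with the generators supercommutes with every word. -/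
theorem word_comm {X : GrVect K Γ} {B B' : Type u} [Ring B] [Algebra K B] [Ring B'] [Algebra K B']
    {ι : X →ₗ[K] B} (f : B →ₐ[K] B') {j : Γ} {b : B'}
    (h : ∀ i, ∀ x ∈ X.gr i, b * f (ι x) = koszul K j i • (f (ι x) * b)) {γ : Γ} {w : B}
    (hw : IsWord X ι γ w) : b * f w = koszul K j γ • (f w * b) := by
  induction hw with
  | one => rw [koszul_zero_right, one_smul, map_one, mul_one, one_mul]
  | cons hx _ ih =>
    rw [map_mul, ← mul_assoc, h _ _ hx, smul_mul_assoc, mul_assoc, ih, mul_smul_comm, smul_smul,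
      ← koszul_add_right, mul_assoc]

section

variable {P Q S : Presentation K Γ} (i : Hom P S) (j : Hom Q S)

/-- The multiplication map `a ⊗ b ↦ i(a) j(b)`. -/
def mulMap : P.Alg ⊗[K] Q.Alg →ₗ[K] S.Alg :=
  LinearMap.mul' K S.Alg ∘ₗ TensorProduct.map i.algHom.toLinearMap j.algHom.toLinearMap

theorem mulMap_tmul (a : P.Alg) (b : Q.Alg) : mulMap i j (a ⊗ₜ b) = i.algHom a * j.algHom b := rfl

/-- The products `i(a) j(b)` span if the generators of `P` and of `Q` together generate and if they
supercommute. -/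
theorem mulMap_surjective
    (hgen : ∀ s, ∃ x y, s = i.hom.lin x + j.hom.lin y)
    (hcomm : ∀ a, ∀ x ∈ P.X.gr a, ∀ b, ∀ y ∈ Q.X.gr b, S.ι (j.hom.lin y) * S.ι (i.hom.lin x) =
      koszul K b a • (S.ι (i.hom.lin x) * S.ι (j.hom.lin y))) :
    Function.Surjective (mulMap i j) := by
  have hP : ∀ x w, w ∈ LinearMap.range (mulMap i j) →
      S.ι (i.hom.lin x) * w ∈ LinearMap.range (mulMap i j) := by
    rintro x _ ⟨w, rfl⟩
    induction w with
    | zero => simp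
    | add a b ha hb =>
      rw [map_add, mul_add]
      exact add_mem ha hb
    | tmul a b =>
      refine ⟨(P.ι x * a) ⊗ₜ b, ?_⟩
      rw [mulMap_tmul, mulMap_tmul, map_mul, i.algHom_ι, mul_assoc]
  have hQ : ∀ y w, w ∈ LinearMap.range (mulMap i j) →
      S.ι (j.hom.lin y) * w ∈ LinearMap.range (mulMap i j) := by
    rintro y _ ⟨w, rfl⟩
    refine Q.X.induction (p := fun y => S.ι (j.hom.lin y) * mulMap i j w ∈
      LinearMap.range (mulMap i j)) y (fun b y hy => ?_) ?_ ?_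
    · suffices h : ∀ v z, S.ι (j.hom.lin y) * (i.algHom v * j.algHom z) ∈
          LinearMap.range (mulMap i j) by
        induction w with
        | zero => simp
        | add a b ha hb =>
          rw [map_add, mul_add]
          exact add_mem ha hb
        | tmul v z => exact h v z
      intro v z
      have hv : v ∈ Submodule.span K {w | ∃ γ, IsWord P.X P.ι γ w} := by
        rw [span_words]
        trivial
      induction hv using Submodule.span_induction with
      | zero => simp
      | add v v' _ _ h h' =>
        rw [map_add, add_mul, mul_add]
        exact add_mem h h'
      | smul c v _ h =>
        rw [map_smul, smul_mul_assoc, mul_smul_comm]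
        exact Submodule.smul_mem _ c h
      | mem v hv =>
        obtain ⟨a, hv⟩ := hv
        have h := word_comm i.algHom (j := b) (b := S.ι (j.hom.lin y)) (fun a x hx => by
          rw [i.algHom_ι, hcomm a x hx b y hy]) hv
        refine ⟨koszul K b a • (v ⊗ₜ (Q.ι y * z)), ?_⟩
        rw [map_smul, mulMap_tmul, ← mul_assoc, h, smul_mul_assoc, map_mul, j.algHom_ι, mul_assoc]
    · rw [map_zero, map_zero, zero_mul]
      exact zero_mem _
    · intro y y' h h'
      rw [map_add, map_add, add_mul]
      exact add_mem h h'
  have hword : ∀ γ w, IsWord S.X S.ι γ w → w ∈ LinearMap.range (mulMap i j) := by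
    intro γ w hw
    induction hw with
    | one => exact ⟨1 ⊗ₜ 1, by rw [mulMap_tmul, map_one, map_one, mul_one]⟩
    | @cons _ _ s w _ _ ih =>
      obtain ⟨x, y, rfl⟩ := hgen s
      rw [map_add, add_mul]
      exact add_mem (hP x w ih) (hQ y w ih)
  intro z
  refine S.mon.X.induction (p := fun z => z ∈ LinearMap.range (mulMap i j)) z
    (fun γ z hz => ?_) (zero_mem _) fun _ _ => add_mem
  exact Submodule.span_le.2 (fun w hw => hword γ w hw) hz

variable (p : S.X ⟶ P.X) (q : S.X ⟶ Q.X)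

/-- The map `s ↦ p(s) ⊗ 1 + 1 ⊗ q(s)` on generators. It extends to the inverse of the multiplication
map. -/
def splitGen : S.X →ₗ[K] MonRing (P.mon ⊗ Q.mon) :=
  (algMap (inclLeft P.mon Q.mon)).toLinearMap ∘ₗ P.ι ∘ₗ p.lin +
    (algMap (inclRight P.mon Q.mon)).toLinearMap ∘ₗ Q.ι ∘ₗ q.lin

theorem splitGen_apply (s : S.X) : splitGen p q s =
    algMap (inclLeft P.mon Q.mon) (P.ι (p.lin s)) +
      algMap (inclRight P.mon Q.mon) (Q.ι (q.lin s)) := rfl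

theorem algMap_inclRight_mul_algMap_inclLeft {a b : Γ} {x : P.X} (hx : x ∈ P.X.gr a) {y : Q.X}
    (hy : y ∈ Q.X.gr b) :
    algMap (inclRight P.mon Q.mon) (Q.ι y) * algMap (inclLeft P.mon Q.mon) (P.ι x) =
      koszul K b a • (algMap (inclLeft P.mon Q.mon) (P.ι x) *
        algMap (inclRight P.mon Q.mon) (Q.ι y)) :=
  MonRing.map_inclRight_mul_map_inclLeft P.mon Q.mon (a := P.toMonRing (P.ι x))
    (b := Q.toMonRing (Q.ι y)) (ι_mem_wordGr P.X P.ι hx) (ι_mem_wordGr Q.X Q.ι hy)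

/-- The algebra presented by the generators of `P` and `Q`, their relations and the
supercommutation relations between them is the tensor product of the two presented algebras. -/
theorem exists_tensorIso
    (hgen : ∀ s, i.hom.lin (p.lin s) + j.hom.lin (q.lin s) = s)
    (hpi : ∀ x, p.lin (i.hom.lin x) = x) (hqi : ∀ x, q.lin (i.hom.lin x) = 0)
    (hpj : ∀ y, p.lin (j.hom.lin y) = 0) (hqj : ∀ y, q.lin (j.hom.lin y) = y)
    (hcomm : ∀ a, ∀ x ∈ P.X.gr a, ∀ b, ∀ y ∈ Q.X.gr b, S.ι (j.hom.lin y) * S.ι (i.hom.lin x) =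
      koszul K b a • (S.ι (i.hom.lin x) * S.ι (j.hom.lin y)))
    (hrel : ∀ s ∈ S.rel, TensorAlgebra.lift K (splitGen p q) s = 0) :
    ∃ e : P.mon ⊗ Q.mon ≅ S.mon, inclLeft P.mon Q.mon ≫ e.hom = i.mon ∧
      inclRight P.mon Q.mon ≫ e.hom = j.mon := by
  have hmem : ∀ γ, ∀ s ∈ S.X.gr γ, splitGen p q s ∈ (P.mon ⊗ Q.mon).X.gr γ := fun γ s hs =>
    add_mem ((inclLeft P.mon Q.mon).hom.map_mem γ _
        (ι_mem_wordGr P.X P.ι (p.map_mem γ s hs)))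
      ((inclRight P.mon Q.mon).hom.map_mem γ _ (ι_mem_wordGr Q.X Q.ι (q.map_mem γ s hs)))
  let δ : S.mon ⟶ P.mon ⊗ Q.mon := S.desc (splitGen p q) hmem hrel
  have hδ : ∀ s, algMap δ (S.ι s) = splitGen p q s := S.algMap_desc_ι _ hmem hrel
  have hl : (algMap δ).comp i.algHom = algMap (inclLeft P.mon Q.mon) := P.algHom_ext fun x => by
    rw [AlgHom.comp_apply, i.algHom_ι, hδ, splitGen_apply, hpi, hqi, map_zero, map_zero, add_zero]
  have hr : (algMap δ).comp j.algHom = algMap (inclRight P.mon Q.mon) := Q.algHom_ext fun y => by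
    rw [AlgHom.comp_apply, j.algHom_ι, hδ, splitGen_apply, hpj, hqj, map_zero, map_zero, zero_add]
  have hδμ : ∀ z, algMap δ (mulMap i j z) = z := fun z => by
    have hab : ∀ (a : P.Alg) (b : Q.Alg), algMap δ (mulMap i j (a ⊗ₜ b)) =
        MonRing.tmul P.mon Q.mon (P.toMonRing a) (Q.toMonRing b) := fun a b => by
      rw [mulMap_tmul, map_mul, ← MonRing.map_inclLeft_mul_map_inclRight]
      exact congrArg₂ (· * ·) (AlgHom.congr_fun hl a) (AlgHom.congr_fun hr b)
    exact LinearMap.congr_fun (f := (algMap δ).toLinearMap ∘ₗ mulMap i j)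
      (g := (LinearMap.id : P.Alg ⊗[K] Q.Alg →ₗ[K] P.Alg ⊗[K] Q.Alg))
      (TensorProduct.ext' hab) z
  have hμ := mulMap_surjective i j (fun s => ⟨_, _, (hgen s).symm⟩) hcomm
  have hbij : Function.Bijective δ.hom.lin := by
    refine ⟨fun a b hab => ?_, fun z => ⟨mulMap i j z, hδμ z⟩⟩
    obtain ⟨a, rfl⟩ := hμ a
    obtain ⟨b, rfl⟩ := hμ b
    exact congrArg (mulMap i j) ((hδμ a).symm.trans (hab.trans (hδμ b)))
  have : IsIso ((Mon.forget (GrVect K Γ)).map δ) := GrVect.isIso_of_bijective δ.hom hbij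
  have : IsIso δ := isIso_of_reflects_iso δ (Mon.forget (GrVect K Γ))
  refine ⟨(asIso δ).symm, ?_, ?_⟩
  · rw [Iso.symm_hom, asIso_inv, IsIso.comp_inv_eq]
    exact mon_hom_ext fun x => (AlgHom.congr_fun hl (P.ι x)).symm
  · rw [Iso.symm_hom, asIso_inv, IsIso.comp_inv_eq]
    exact mon_hom_ext fun x => (AlgHom.congr_fun hr (Q.ι x)).symm

end

end Presentation

end PresentationProducts

/-! ### The realisation functors `A` and `S` are strong monoidal -/

section RealisationProducts

open GrVect Presentation

variable {K : Type u} [Field K]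

section

variable {V W : GrVect K ℤ} {N : Set (V ⊗[K] V)} {N' : Set (W ⊗[K] W)}
  {N'' : Set (sumObj V W ⊗[K] sumObj V W)}
  (hN : ∀ z ∈ N, ∀ γ, (tensorObj' (weightOne V) (weightOne V)).coact z γ ∈ N)
  (hN' : ∀ z ∈ N', ∀ γ, (tensorObj' (weightOne W) (weightOne W)).coact z γ ∈ N')
  (hN'' : ∀ z ∈ N'', ∀ γ, (tensorObj' (weightOne (sumObj V W))
    (weightOne (sumObj V W))).coact z γ ∈ N'')

theorem swapLin_weightOne_tmul {V : GrVect K ℤ} {a b : ℕ × ℤ} {x y : V}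
    (hx : x ∈ (weightOne V).gr a) (hy : y ∈ (weightOne V).gr b) :
    swapLin V V (x ⊗ₜ y) = koszul K a b • (y ⊗ₜ[K] x) := by
  rw [← swap_weightOne]
  exact swapLin_tmul (weightOne V) (weightOne V) hx hy

/-- A map out of the tensor algebra on a commutator. -/
theorem lift_quad_symLin {V : GrVect K ℤ} {B : Type u} [Ring B] [Algebra K B]
    (f : TensorAlgebra K V →ₐ[K] B) {a b : ℕ × ℤ} {x y : V}
    (hx : x ∈ (weightOne V).gr a) (hy : y ∈ (weightOne V).gr b) :
    f (quad V (symLin .minus V (x ⊗ₜ y))) =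
      f (TensorAlgebra.ι K x) * f (TensorAlgebra.ι K y) -
        koszul K a b • (f (TensorAlgebra.ι K y) * f (TensorAlgebra.ι K x)) := by
  rw [symLin, LinearMap.sub_apply, LinearMap.id_apply, swapLin_weightOne_tmul hx hy, map_sub,
    map_smul, quad_tmul, quad_tmul, map_sub, map_smul, map_mul, map_mul]

theorem inl_weightOne {a : ℕ × ℤ} {x : V} (hx : x ∈ (weightOne V).gr a) :
    (inl V W).lin x ∈ (weightOne (sumObj V W)).gr a := (weightOneMap (inl V W)).map_mem a x hx

theorem inr_weightOne {a : ℕ × ℤ} {y : W} (hy : y ∈ (weightOne W).gr a) :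
    (inr V W).lin y ∈ (weightOne (sumObj V W)).gr a := (weightOneMap (inr V W)).map_mem a y hy

/-- The map `s ↦ p(s) ⊗ 1 + 1 ⊗ q(s)` respects quadratic relations and commutators. -/
theorem quad_rel_split
    (hN : ∀ z ∈ N, ∀ γ, (tensorObj' (weightOne V) (weightOne V)).coact z γ ∈ N)
    (hN' : ∀ z ∈ N', ∀ γ, (tensorObj' (weightOne W) (weightOne W)).coact z γ ∈ N')
    (hN'' : ∀ z ∈ N'', ∀ γ, (tensorObj' (weightOne (sumObj V W))
      (weightOne (sumObj V W))).coact z γ ∈ N'')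
    (z : sumObj V W ⊗[K] sumObj V W)
    (hz : z ∈ Submodule.span K (sq (inl V W) '' N) ⊔ mixed .minus V W ⊔
      Submodule.span K (sq (inr V W) '' N')) :
    TensorAlgebra.lift K (splitGen (P := quadPresentation V N hN)
      (Q := quadPresentation W N' hN') (S := quadPresentation (sumObj V W) N'' hN'')
      (weightOneMap (sumFst V W)) (weightOneMap (sumSnd V W))) (quad (sumObj V W) z) = 0 := by
  let P := quadPresentation V N hN
  let Q := quadPresentation W N' hN'
  let g : sumObj V W →ₗ[K] MonRing (P.mon ⊗ Q.mon) := splitGen (P := P) (Q := Q)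
    (S := quadPresentation (sumObj V W) N'' hN'') (weightOneMap (sumFst V W))
    (weightOneMap (sumSnd V W))
  let L : sumObj V W ⊗[K] sumObj V W →ₗ[K] MonRing (P.mon ⊗ Q.mon) :=
    (TensorAlgebra.lift K g).toLinearMap ∘ₗ quad (sumObj V W)
  let a : TensorAlgebra K V →ₐ[K] MonRing (P.mon ⊗ Q.mon) :=
    (algMap (inclLeft P.mon Q.mon)).comp P.proj
  let b : TensorAlgebra K W →ₐ[K] MonRing (P.mon ⊗ Q.mon) :=
    (algMap (inclRight P.mon Q.mon)).comp Q.proj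
  have hgl : ∀ x, g ((inl V W).lin x) = a (TensorAlgebra.ι K x) := fun x => by
    have h : g ((inl V W).lin x) = a (TensorAlgebra.ι K x) + b (TensorAlgebra.ι K (0 : W)) := rfl
    rw [h, map_zero, map_zero, add_zero]
  have hgr : ∀ y, g ((inr V W).lin y) = b (TensorAlgebra.ι K y) := fun y => by
    have h : g ((inr V W).lin y) = a (TensorAlgebra.ι K (0 : V)) + b (TensorAlgebra.ι K y) := rfl
    rw [h, map_zero, map_zero, zero_add]
  have hL : ∀ x y, L (x ⊗ₜ y) = g x * g y := fun x y => by
    change TensorAlgebra.lift K g (quad (sumObj V W) (x ⊗ₜ y)) = _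
    rw [quad_tmul, map_mul, TensorAlgebra.lift_ι_apply, TensorAlgebra.lift_ι_apply]
  suffices h : Submodule.span K (sq (inl V W) '' N) ⊔ mixed .minus V W ⊔
      Submodule.span K (sq (inr V W) '' N') ≤ LinearMap.ker L from h hz
  refine sup_le (sup_le (Submodule.span_le.2 ?_) ?_) (Submodule.span_le.2 ?_)
  · rintro _ ⟨z, hz, rfl⟩
    have h : L ∘ₗ sq (inl V W) = a.toLinearMap ∘ₗ quad V := TensorProduct.ext' fun x y => by
      rw [LinearMap.comp_apply, TensorProduct.map_tmul, hL, hgl, hgl, ← map_mul,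
        LinearMap.comp_apply, quad_tmul]
      rfl
    have h₁ : P.proj (quad V z) = 0 := P.proj_rel ⟨z, hz, rfl⟩
    exact (LinearMap.congr_fun h z).trans
      ((congrArg (algMap (inclLeft P.mon Q.mon)) h₁).trans (map_zero _))
  · rw [mixed, LinearMap.range_le_iff_comap, eq_top_iff]
    rintro z -
    refine tensor_induction V W (fun i j x hx y hy => ?_) z
    have hx' : x ∈ (weightOne V).gr (1, i) := mem_regrade _ V rfl hx
    have hy' : y ∈ (weightOne W).gr (1, j) := mem_regrade _ W rfl hy
    refine (lift_quad_symLin (TensorAlgebra.lift K g) (inl_weightOne hx')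
      (inr_weightOne hy')).trans ?_
    have h : b (TensorAlgebra.ι K y) * a (TensorAlgebra.ι K x) = koszul K (1, j) (1, i) •
        (a (TensorAlgebra.ι K x) * b (TensorAlgebra.ι K y)) :=
      algMap_inclRight_mul_algMap_inclLeft (P := P) (Q := Q) hx' hy'
    rw [TensorAlgebra.lift_ι_apply, TensorAlgebra.lift_ι_apply, hgl, hgr, h, smul_smul,
      koszul_comm (1, j), koszul_mul_self, one_smul, sub_self]
  · rintro _ ⟨z, hz, rfl⟩
    have h : L ∘ₗ sq (inr V W) = b.toLinearMap ∘ₗ quad W := TensorProduct.ext' fun x y => by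
      rw [LinearMap.comp_apply, TensorProduct.map_tmul, hL, hgr, hgr, ← map_mul,
        LinearMap.comp_apply, quad_tmul]
      rfl
    have h₁ : Q.proj (quad W z) = 0 := Q.proj_rel ⟨z, hz, rfl⟩
    exact (LinearMap.congr_fun h z).trans
      ((congrArg (algMap (inclRight P.mon Q.mon)) h₁).trans (map_zero _))

/-- Quadratic relations on a direct sum, consisting of the relations on the summands and the
commutators between them, present the tensor product. -/
theorem quad_exists_tensorIso (hi : ∀ z ∈ N, sq (inl V W) z ∈ N'')
    (hj : ∀ z ∈ N', sq (inr V W) z ∈ N'')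
    (hm : ∀ x y, symLin .minus (sumObj V W) ((inl V W).lin x ⊗ₜ (inr V W).lin y) ∈ N'')
    (hle : ∀ z ∈ N'', z ∈ Submodule.span K (sq (inl V W) '' N) ⊔ mixed .minus V W ⊔
      Submodule.span K (sq (inr V W) '' N')) :
    ∃ e : (quadPresentation V N hN).mon ⊗ (quadPresentation W N' hN').mon ≅
        (quadPresentation (sumObj V W) N'' hN'').mon,
      inclLeft _ _ ≫ e.hom = (quadPresentationHom hN hN'' (inl V W) hi).mon ∧
      inclRight _ _ ≫ e.hom = (quadPresentationHom hN' hN'' (inr V W) hj).mon := by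
  refine exists_tensorIso (quadPresentationHom hN hN'' (inl V W) hi)
    (quadPresentationHom hN' hN'' (inr V W) hj) (weightOneMap (sumFst V W))
    (weightOneMap (sumSnd V W)) (fun s => Prod.ext (add_zero _) (zero_add _)) (fun _ => rfl)
    (fun _ => rfl) (fun _ => rfl) (fun _ => rfl) (fun a x hx b y hy => ?_) ?_
  · have h₁ := (quadPresentation (sumObj V W) N'' hN'').proj_rel ⟨_, hm x y, rfl⟩
    have h₂ := (lift_quad_symLin (quadPresentation (sumObj V W) N'' hN'').proj (inl_weightOne hx)
      (inr_weightOne hy)).symm.trans h₁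
    have h₃ := congrArg (koszul K b a • ·) (sub_eq_zero.1 h₂)
    simp only [smul_smul, koszul_comm a b, koszul_mul_self, one_smul] at h₃
    exact h₃.symm
  · rintro _ ⟨z, hz, rfl⟩
    exact quad_rel_split hN hN' hN'' z (hle z hz)

end

theorem quadPresentation_unitIso (N : Set (zeroObj K ℤ ⊗[K] zeroObj K ℤ))
    (hN : ∀ z ∈ N, ∀ γ, (tensorObj' (weightOne (zeroObj K ℤ)) (weightOne (zeroObj K ℤ))).coact z γ
      ∈ N) :
    Nonempty (𝟙_ (Mon (GrVect K (ℕ × ℤ))) ≅ (quadPresentation (zeroObj K ℤ) N hN).mon) := by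
  have : Subsingleton (quadPresentation (zeroObj K ℤ) N hN).X :=
    inferInstanceAs (Subsingleton PUnit)
  refine unitIso _ ?_
  rintro _ ⟨z, hz, rfl⟩
  have h : quad (K := K) (zeroObj K ℤ) = 0 := TensorProduct.ext' fun x y => by
    rw [quad_tmul, Subsingleton.elim x 0, map_zero, zero_mul]
    rfl
  exact LinearMap.congr_fun h z

theorem assRelations_sum_le (X Y : QD K .minus) :
    (QD.prod X Y).R ≤ Submodule.span K (sq (inl X.V Y.V) '' X.R) ⊔ mixed .minus X.V Y.V ⊔
      Submodule.span K (sq (inr X.V Y.V) '' Y.R) := by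
  have h : ∀ (X : QD K .minus) {Z : GrVect K ℤ} (f : X.V ⟶ Z),
      Submodule.map (sq f) X.R ≤ Submodule.span K (sq f '' X.R) := fun X Z f => by
    rw [Submodule.map_le_iff_le_comap]
    exact fun z hz => Submodule.subset_span ⟨z, hz, rfl⟩
  exact sup_le_sup (sup_le_sup_right (h X (inl X.V Y.V)) _) (h Y (inr X.V Y.V))

variable (K) in
theorem realA_braided : StrongSymMonoidal (realA K) := by
  refine braided_of_comp_fullyFaithful _ (wgAss K).ι ?_
  have h := fun X Y : QDTensor K => quad_exists_tensorIso
    (weightOne_homogeneous X.homogeneous) (weightOne_homogeneous Y.homogeneous)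
    (weightOne_homogeneous (QD.prod X Y).homogeneous) (fun z hz => QD.inl_mem X Y hz)
    (fun z hz => QD.inr_mem X Y hz) (QD.mixed_mem X Y) (assRelations_sum_le X Y)
  choose e hl hr using h
  obtain ⟨ε⟩ := quadPresentation_unitIso (K := K) (QD.unit K .minus).R
    (weightOne_homogeneous (QD.unit K .minus).homogeneous)
  refine braided_of_inclusions (realA K ⋙ (wgAss K).ι) ε e (fun X Y => ?_) fun X Y => ?_
  · refine (hl X Y).trans ?_
    rw [QD.inclLeft_eq]
    rfl
  · refine (hr X Y).trans ?_
    rw [QD.inclRight_eq]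
    rfl

/-- The relations of `S(V, R)`. -/
abbrev comRelations {m : Mixing} (X : QD K m) : Set (X.V ⊗[K] X.V) :=
  (extSquare X.V : Set (X.V ⊗[K] X.V)) ∪ (X.R : Set (X.V ⊗[K] X.V))

theorem comRelations_coact {m : Mixing} (X : QD K m) : ∀ z ∈ comRelations X, ∀ γ,
    (tensorObj' (weightOne X.V) (weightOne X.V)).coact z γ ∈ comRelations X := fun z hz γ =>
  hz.imp (fun h => weightOne_homogeneous (range_symLin_homogeneous .minus X.V) z h γ)
    (fun h => weightOne_homogeneous X.homogeneous z h γ)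

theorem comRelations_map {m : Mixing} {X Y : QD K m} (f : X ⟶ Y) :
    ∀ z ∈ comRelations X, sq f.hom z ∈ comRelations Y := by
  rintro z (⟨w, rfl⟩ | hz)
  · exact .inl ⟨_, symLin_natural .minus f.hom w⟩
  · exact .inr (f.map_le hz)

theorem comRelations_sum_le (X Y : QD K .none) (z : sumObj X.V Y.V ⊗[K] sumObj X.V Y.V)
    (hz : z ∈ comRelations (QD.prod X Y)) :
    z ∈ Submodule.span K (sq (inl X.V Y.V) '' comRelations X) ⊔ mixed .minus X.V Y.V ⊔
      Submodule.span K (sq (inr X.V Y.V) '' comRelations Y) := by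
  have h : ∀ (X : QD K .none) {Z : GrVect K ℤ} (f : X.V ⟶ Z),
      Submodule.map (sq f) (X.R ⊔ extSquare X.V) ≤
        Submodule.span K (sq f '' comRelations X) := fun X Z f => by
    rw [Submodule.map_le_iff_le_comap]
    exact sup_le (fun z hz => Submodule.subset_span ⟨z, .inr hz, rfl⟩)
      fun z hz => Submodule.subset_span ⟨z, .inl hz, rfl⟩
  refine sup_le_sup (sup_le_sup_right (h X (inl X.V Y.V)) _) (h Y (inr X.V Y.V)) ?_
  apply calSObj_prod_le X Y
  exact hz.elim (fun h => Submodule.mem_sup_right h) fun h => Submodule.mem_sup_left h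

variable (K) in
theorem realS_braided : StrongSymMonoidal (realS K) := by
  refine braided_of_comp_fullyFaithful _ (wgCom K).ι ?_
  have h := fun X Y : QDPlusVee K => quad_exists_tensorIso
    (comRelations_coact X.obj) (comRelations_coact Y.obj)
    (comRelations_coact (QD.prod X.obj Y.obj)) (comRelations_map (QD.inlHom X.obj Y.obj))
    (comRelations_map (QD.inrHom X.obj Y.obj)) (fun x y => .inl ⟨_, rfl⟩)
    (comRelations_sum_le X.obj Y.obj)
  choose e hl hr using h
  obtain ⟨ε⟩ := quadPresentation_unitIso (K := K) _ (comRelations_coact (QD.unit K .none))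
  refine braided_of_inclusions (realS K ⋙ (wgCom K).ι) ε e (fun X Y => ?_) fun X Y => ?_
  · have h : inclLeft X Y = ObjectProperty.homMk (QD.inlHom X.obj Y.obj) :=
      ObjectProperty.hom_ext _ ((inclLeft_hom _ X Y).trans (QD.inclLeft_eq X.obj Y.obj))
    rw [h]
    exact hl X Y
  · have h : inclRight X Y = ObjectProperty.homMk (QD.inrHom X.obj Y.obj) :=
      ObjectProperty.hom_ext _ ((inclRight_hom _ X Y).trans (QD.inclRight_eq X.obj Y.obj))
    rw [h]
    exact hr X Y

end RealisationProducts

/-! ### Direct sums of Lie algebras and the universal enveloping algebra -/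

section LieSums

open GrVect

variable {K : Type u} [Field K] {Γ : Type} [DecidableEq Γ] [AddCommMonoid Γ] [DegreeIndex Γ]

namespace GrLie

/-- The unique morphism out of the zero Lie algebra. -/
def fromUnit (g : GrLie K Γ) : unit K Γ ⟶ g where
  hom := ⟨0, fun γ _ _ => (g.X.gr γ).zero_mem⟩
  map_bracket _ _ := (LinearMap.map_zero₂ g.bracket _).symm

instance : InitialUnit (GrLie K Γ) :=
  ⟨Limits.IsInitial.ofUniqueHom fromUnit fun _ f => hom_ext <| LinearMap.ext fun x =>
    (congrArg f.hom.lin (Subsingleton.elim (α := PUnit) x 0)).trans (map_zero f.hom.lin)⟩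

/-- The inclusion of the first summand. -/
def inlHom (g h : GrLie K Γ) : g ⟶ prod g h where
  hom := inl g.X h.X
  map_bracket _ _ := Prod.ext rfl (map_zero (h.bracket 0)).symm

/-- The inclusion of the second summand. -/
def inrHom (g h : GrLie K Γ) : h ⟶ prod g h where
  hom := inr g.X h.X
  map_bracket _ _ := Prod.ext (map_zero (g.bracket 0)).symm rfl

theorem inclLeft_eq (g h : GrLie K Γ) : inclLeft g h = inlHom g h := by
  rw [inclLeft, unit_hom_ext (unitTo h) (fromUnit h)]
  exact hom_ext (LinearMap.ext fun _ => rfl)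

theorem inclRight_eq (g h : GrLie K Γ) : inclRight g h = inrHom g h := by
  rw [inclRight, unit_hom_ext (unitTo g) (fromUnit g)]
  exact hom_ext (LinearMap.ext fun _ => rfl)

instance : GeneratedTensor (GrLie K Γ) where
  hom_ext {g h k a b} hl hr := by
    rw [inclLeft_eq] at hl
    rw [inclRight_eq] at hr
    refine hom_ext (LinearMap.ext fun x => ?_)
    have h1 : (inlHom g h).hom.lin x.1 + (inrHom g h).hom.lin x.2 = x :=
      Prod.ext (add_zero x.1) (zero_add x.2)
    rw [← h1, map_add, map_add]
    exact congrArg₂ (· + ·) (LinearMap.congr_fun (congrArg (fun f => f.hom.lin) hl) x.1)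
      (LinearMap.congr_fun (congrArg (fun f => f.hom.lin) hr) x.2)

end GrLie

open Presentation

theorem map_commutator_sub {V B : Type u} [AddCommGroup V] [Module K V] [Ring B] [Algebra K B]
    (f : TensorAlgebra K V →ₐ[K] B) (x y z : V) (c : K) :
    f (TensorAlgebra.ι K x * TensorAlgebra.ι K y -
      c • (TensorAlgebra.ι K y * TensorAlgebra.ι K x) - TensorAlgebra.ι K z) =
    f (TensorAlgebra.ι K x) * f (TensorAlgebra.ι K y) -
      c • (f (TensorAlgebra.ι K y) * f (TensorAlgebra.ι K x)) - f (TensorAlgebra.ι K z) := by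
  rw [map_sub, map_sub, map_smul, map_mul, map_mul]

/-- The defining relation of an enveloping algebra. -/
theorem envPresentation_comm (g : LieAlg K) {i j : ℤ} {x y : g.X} (hx : x ∈ g.X.gr i)
    (hy : y ∈ g.X.gr j) :
    (envPresentation g).ι x * (envPresentation g).ι y -
      koszul K i j • ((envPresentation g).ι y * (envPresentation g).ι x) -
        (envPresentation g).ι (g.bracket x y) = 0 :=
  (map_commutator_sub (envPresentation g).proj x y _ _).symm.trans
    ((envPresentation g).proj_rel ⟨i, x, hx, j, y, hy, rfl⟩)

theorem env_exists_tensorIso (g h : LieAlg K) :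
    ∃ e : (envPresentation g).mon ⊗ (envPresentation h).mon ≅ (envPresentation (g.prod h)).mon,
      inclLeft _ _ ≫ e.hom = (envHom (GrLie.inlHom g h)).mon ∧
      inclRight _ _ ≫ e.hom = (envHom (GrLie.inrHom g h)).mon := by
  refine exists_tensorIso (P := envPresentation g) (Q := envPresentation h)
    (S := envPresentation (g.prod h)) (envHom (GrLie.inlHom g h))
    (envHom (GrLie.inrHom g h)) (sumFst g.X h.X) (sumSnd g.X h.X)
    (fun s => Prod.ext (add_zero _) (zero_add _)) (fun _ => rfl)
    (fun _ => rfl) (fun _ => rfl) (fun _ => rfl) (fun a x hx b y hy => ?_) ?_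
  · have h₁ := envPresentation_comm (g.prod h) ((inr g.X h.X).map_mem b y hy)
      ((inl g.X h.X).map_mem a x hx)
    have h₂ : (g.prod h).bracket ((inr g.X h.X).lin y) ((inl g.X h.X).lin x) = 0 :=
      Prod.ext (LinearMap.map_zero₂ g.bracket x) (map_zero (h.bracket y))
    exact sub_eq_zero.1 ((sub_eq_self.2 ((congrArg (envPresentation (g.prod h)).ι h₂).trans
      (map_zero _))).symm.trans h₁)
  · rintro _ ⟨a, x, hx, b, y, hy, rfl⟩
    refine (map_commutator_sub _ x y _ _).trans ?_
    let l : (envPresentation g).Alg →ₐ[K]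
        MonRing ((envPresentation g).mon ⊗ (envPresentation h).mon) := algMap (inclLeft _ _)
    let r : (envPresentation h).Alg →ₐ[K]
        MonRing ((envPresentation g).mon ⊗ (envPresentation h).mon) := algMap (inclRight _ _)
    let u₁ : g.X →ₗ[K] MonRing ((envPresentation g).mon ⊗ (envPresentation h).mon) :=
      l.toLinearMap ∘ₗ (envPresentation g).ι
    let u₂ : h.X →ₗ[K] MonRing ((envPresentation g).mon ⊗ (envPresentation h).mon) :=
      r.toLinearMap ∘ₗ (envPresentation h).ι
    have h₁ : u₁ x.1 * u₁ y.1 - koszul K a b • (u₁ y.1 * u₁ x.1) - u₁ (g.bracket x.1 y.1) = 0 := by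
      have := congrArg l (envPresentation_comm g hx.1 hy.1)
      rwa [map_zero, map_sub, map_sub, map_smul, map_mul, map_mul] at this
    have h₂ : u₂ x.2 * u₂ y.2 - koszul K a b • (u₂ y.2 * u₂ x.2) - u₂ (h.bracket x.2 y.2) = 0 := by
      have := congrArg r (envPresentation_comm h hx.2 hy.2)
      rwa [map_zero, map_sub, map_sub, map_smul, map_mul, map_mul] at this
    have h₃ : u₂ y.2 * u₁ x.1 = koszul K b a • (u₁ x.1 * u₂ y.2) :=
      algMap_inclRight_mul_algMap_inclLeft (P := envPresentation g) (Q := envPresentation h)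
        hx.1 hy.2
    have h₄ : u₂ x.2 * u₁ y.1 = koszul K a b • (u₁ y.1 * u₂ x.2) :=
      algMap_inclRight_mul_algMap_inclLeft (P := envPresentation g) (Q := envPresentation h)
        hy.1 hx.2
    have h₅ : koszul K a b • (u₂ y.2 * u₁ x.1) = u₁ x.1 * u₂ y.2 := by
      rw [h₃, smul_smul, koszul_comm b a, koszul_mul_self, one_smul]
    suffices h₆ : (u₁ x.1 + u₂ x.2) * (u₁ y.1 + u₂ y.2) -
        koszul K a b • ((u₁ y.1 + u₂ y.2) * (u₁ x.1 + u₂ x.2)) -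
          (u₁ (g.bracket x.1 y.1) + u₂ (h.bracket x.2 y.2)) = 0 by
      refine Eq.trans (congrArg₂ (fun s t => s - t) (congrArg₂ (fun s t => s - koszul K a b • t)
        (congrArg₂ (fun s t => s * t) ?_ ?_) (congrArg₂ (fun s t => s * t) ?_ ?_)) ?_) h₆
      all_goals exact TensorAlgebra.lift_ι_apply _ _
    refine Eq.trans ?_ ((congrArg₂ (· + ·) h₁ h₂).trans (add_zero 0))
    simp only [add_mul, mul_add, smul_add, h₅, h₄]
    abel

variable (K) in
theorem env_braided : StrongSymMonoidal (env K) := by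
  have h := fun g h : LieAlg K => env_exists_tensorIso g h
  choose e hl hr using h
  have : Subsingleton (envPresentation (GrLie.unit K ℤ)).X :=
    inferInstanceAs (Subsingleton PUnit)
  have h₀ : ∀ (c : K) (y : (zeroObj K ℤ : GrVect K ℤ)), TensorAlgebra.ι K (0 : zeroObj K ℤ) *
      TensorAlgebra.ι K y - c • (TensorAlgebra.ι K y * TensorAlgebra.ι K (0 : zeroObj K ℤ)) -
        TensorAlgebra.ι K (0 : zeroObj K ℤ) = 0 := fun c y => by simp
  obtain ⟨ε⟩ := unitIso (envPresentation (GrLie.unit K ℤ)) (by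
    rintro _ ⟨i, x, _, j, y, _, rfl⟩
    rw [Subsingleton.elim x 0]
    exact h₀ _ _)
  refine braided_of_inclusions (env K) ε e (fun X Y => ?_) fun X Y => ?_
  · rw [GrLie.inclLeft_eq]
    exact hl X Y
  · rw [GrLie.inclRight_eq]
    exact hr X Y

end LieSums

/-! ### The realisation functor `L` -/

section LieProducts

open GrVect

section

variable {K : Type u} [Field K] {Γ : Type} [DecidableEq Γ] [AddCommMonoid Γ] [DegreeIndex Γ]

/-- An element which commutes with the generators of a Lie algebra commutes with all elements. -/
theorem bracket_eq_zero_of_generators {V : GrVect K Γ} {g : GrLie K Γ} (f : freeLie V ⟶ g) {k : Γ}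
    {t : g.X} (ht : t ∈ g.X.gr k)
    (h : ∀ x, g.bracket (f.hom.lin ((freeLieι V).lin x)) t = 0) (u : (freeLie V).X) :
    g.bracket (f.hom.lin u) t = 0 := by
  refine freeLie_induction (p := fun u => g.bracket (f.hom.lin u) t = 0) (fun w => ?_) ?_ ?_ ?_ u
  · induction w with
    | of p =>
      have := h p.2
      rwa [freeLieι_of_mem] at this
    | mul a b ha hb =>
      have hm : ∀ w, f.hom.lin ((freeProj V).hom.lin (wordElt V w)) ∈ g.X.gr (wordDeg V w) :=
        fun w => f.hom.map_mem _ _ ((freeProj V).hom.map_mem _ _ (wordElt_mem V w))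
      have hj := g.jacobi _ _ (hm a) _ _ (hm b) k t ht
      rw [ha, hb, map_zero, map_zero, smul_zero, add_zero] at hj
      rw [wordElt_mul, (freeProj V).map_bracket]
      exact (congrArg (fun z => g.bracket z t) (f.map_bracket _ _)).trans hj.symm
  · rw [map_zero, LinearMap.map_zero₂]
  · intro x y hx hy
    rw [map_add, LinearMap.map_add₂, hx, hy, add_zero]
  · intro c x hx
    rw [map_smul, LinearMap.map_smul₂, hx, smul_zero]

theorem GrLie.bracket_eq_zero_symm (g : GrLie K Γ) {i j : Γ} {x y : g.X} (hx : x ∈ g.X.gr i)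
    (hy : y ∈ g.X.gr j) (h : g.bracket x y = 0) : g.bracket y x = 0 := by
  rw [g.skew j y hy i x hx, h, smul_zero, neg_zero]

/-- Two Lie algebras with generators that commute with each other in a third one commute. -/
theorem bracket_eq_zero_of_generators₂ {V W : GrVect K Γ} {g : GrLie K Γ} (f : freeLie V ⟶ g)
    (f' : freeLie W ⟶ g)
    (h : ∀ i, ∀ x ∈ V.gr i, ∀ j, ∀ y ∈ W.gr j, g.bracket (f.hom.lin ((freeLieι V).lin x))
      (f'.hom.lin ((freeLieι W).lin y)) = 0) (u : (freeLie V).X) (v : (freeLie W).X) :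
    g.bracket (f.hom.lin u) (f'.hom.lin v) = 0 := by
  have h₁ : ∀ u, ∀ j, ∀ y ∈ W.gr j, g.bracket (f.hom.lin u) (f'.hom.lin ((freeLieι W).lin y)) = 0 :=
    fun u j y hy => bracket_eq_zero_of_generators f
      (f'.hom.map_mem j _ ((freeLieι W).map_mem j y hy))
      (fun x => V.induction (p := fun x => g.bracket (f.hom.lin ((freeLieι V).lin x))
        (f'.hom.lin ((freeLieι W).lin y)) = 0) x (fun i x hx => h i x hx j y hy)
        (by rw [map_zero, map_zero, LinearMap.map_zero₂])
        fun x x' hx hx' => by rw [map_add, map_add, LinearMap.map_add₂, hx, hx', add_zero]) u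
  refine (freeLie V).X.induction (p := fun u => g.bracket (f.hom.lin u) (f'.hom.lin v) = 0) u
    (fun i u hu => ?_) (by rw [map_zero, LinearMap.map_zero₂])
    fun x x' hx hx' => by rw [map_add, LinearMap.map_add₂, hx, hx', add_zero]
  have hfu := f.hom.map_mem i u hu
  have h₂ : ∀ v, g.bracket (f'.hom.lin v) (f.hom.lin u) = 0 :=
    bracket_eq_zero_of_generators f' hfu fun y =>
      W.induction (p := fun y => g.bracket (f'.hom.lin ((freeLieι W).lin y)) (f.hom.lin u) = 0) y
        (fun j y hy => g.bracket_eq_zero_symm hfu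
          (f'.hom.map_mem j _ ((freeLieι W).map_mem j y hy)) (h₁ u j y hy))
        (by rw [map_zero, map_zero, LinearMap.map_zero₂])
        fun x x' hx hx' => by rw [map_add, map_add, LinearMap.map_add₂, hx, hx', add_zero]
  refine (freeLie W).X.induction (p := fun v => g.bracket (f.hom.lin u) (f'.hom.lin v) = 0) v
    (fun j v hv => g.bracket_eq_zero_symm (f'.hom.map_mem j v hv) hfu (h₂ v))
    (by rw [map_zero, map_zero]) fun x x' hx hx' => by rw [map_add, map_add, hx, hx', add_zero]

theorem GrLie.bracket_map_symm {g g' h : GrLie K Γ} (a : g ⟶ h) (b : g' ⟶ h)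
    (hab : ∀ x y, h.bracket (a.hom.lin x) (b.hom.lin y) = 0) (x : g.X) (y : g'.X) :
    h.bracket (b.hom.lin y) (a.hom.lin x) = 0 := by
  refine g.X.induction (p := fun x => h.bracket (b.hom.lin y) (a.hom.lin x) = 0) x
    (fun i x hx => ?_) (by rw [map_zero, map_zero])
    fun x x' hx hx' => by rw [map_add, map_add, hx, hx', add_zero]
  exact g'.X.induction (p := fun y => h.bracket (b.hom.lin y) (a.hom.lin x) = 0) y
    (fun j y hy => h.bracket_eq_zero_symm (a.hom.map_mem i x hx) (b.hom.map_mem j y hy) (hab x y))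
    (by rw [map_zero, LinearMap.map_zero₂])
    fun x x' hx hx' => by rw [map_add, LinearMap.map_add₂, hx, hx', add_zero]

/-- Two Lie algebra morphisms with commuting images define a morphism on the direct sum. -/
def GrLie.coprodHom {g g' h : GrLie K Γ} (a : g ⟶ h) (b : g' ⟶ h)
    (hab : ∀ x y, h.bracket (a.hom.lin x) (b.hom.lin y) = 0) : g.prod g' ⟶ h where
  hom :=
    { lin := a.hom.lin.coprod b.hom.lin
      map_mem := fun γ p hp => add_mem (a.hom.map_mem γ _ hp.1) (b.hom.map_mem γ _ hp.2) }
  map_bracket x y := by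
    change a.hom.lin (g.bracket x.1 y.1) + b.hom.lin (g'.bracket x.2 y.2) =
      h.bracket (a.hom.lin x.1 + b.hom.lin x.2) (a.hom.lin y.1 + b.hom.lin y.2)
    rw [map_add, LinearMap.map_add₂, LinearMap.map_add₂, hab, bracket_map_symm a b hab,
      zero_add, add_zero, a.map_bracket, b.map_bracket]

/-- The morphism to a direct sum with given components. -/
def GrLie.pairHom {g h h' : GrLie K Γ} (a : g ⟶ h) (b : g ⟶ h') : g ⟶ h.prod h' where
  hom := { lin := a.hom.lin.prod b.hom.lin
           map_mem := fun γ x hx => ⟨a.hom.map_mem γ x hx, b.hom.map_mem γ x hx⟩ }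
  map_bracket x y := Prod.ext (a.map_bracket x y) (b.map_bracket x y)

end

variable {K : Type u} [Field K]

/-- The images of `L X` and `L Y` in the Lie algebra of the product commute. The mixed relation of
two generators gives `2 [x, y] = 0`, whence the restriction on the characteristic. -/
theorem lieMap_inl_inr_bracket (hK : ringChar K ≠ 2) (X Y : QD K .minus) (u : (lieObj X).X)
    (v : (lieObj Y).X) : (lieObj (QD.prod X Y)).bracket ((lieMap (QD.inlHom X Y)).hom.lin u)
      ((lieMap (QD.inrHom X Y)).hom.lin v) = 0 := by
  obtain ⟨u, rfl⟩ := Submodule.mkQ_surjective _ u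
  obtain ⟨v, rfl⟩ := Submodule.mkQ_surjective _ v
  refine bracket_eq_zero_of_generators₂ (lieProj X ≫ lieMap (QD.inlHom X Y))
    (lieProj Y ≫ lieMap (QD.inrHom X Y)) (fun i x hx j y hy => ?_) u v
  have hl := lieMap_ι (QD.inlHom X Y) x
  have hr := lieMap_ι (QD.inrHom X Y) y
  refine (congrArg₂ (fun s t => (lieObj (QD.prod X Y)).bracket s t) hl hr).trans ?_
  let S := lieObj (QD.prod X Y)
  let γ : (QD.prod X Y).V → S.X := fun s =>
    (lieProj (QD.prod X Y)).hom.lin ((freeLieι (weightOne (QD.prod X Y).V)).lin s)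
  have hγ : ∀ {i : ℕ × ℤ} {s : (QD.prod X Y).V}, s ∈ (weightOne (QD.prod X Y).V).gr i →
      γ s ∈ S.X.gr i := fun {i s} hs =>
    (lieProj (QD.prod X Y)).hom.map_mem _ _ ((freeLieι (weightOne (QD.prod X Y).V)).map_mem _ _ hs)
  have hx' := hγ (inl_weightOne hx)
  have hy' := hγ (inr_weightOne hy)
  let L : (QD.prod X Y).V ⊗[K] (QD.prod X Y).V →ₗ[K] S.X :=
    (lieProj (QD.prod X Y)).hom.lin ∘ₗ lieBracketMap (QD.prod X Y).V
  have hL : ∀ s t, L (s ⊗ₜ t) = S.bracket (γ s) (γ t) := fun s t =>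
    (lieProj (QD.prod X Y)).map_bracket _ _
  have hm : L (symLin .minus (sumObj X.V Y.V) ((inl X.V Y.V).lin x ⊗ₜ (inr X.V Y.V).lin y)) = 0 :=
    GrOp.proj_eq_zero (h := lieRelations_coact (QD.prod X Y)) ⟨_, QD.mixed_mem X Y x y, rfl⟩
  have hs := swapLin_weightOne_tmul (inl_weightOne (W := Y.V) hx) (inr_weightOne (V := X.V) hy)
  rw [symLin, LinearMap.sub_apply, LinearMap.id_apply, hs, map_sub, map_smul, hL, hL] at hm
  -- by graded skew symmetry both terms of the relation are equal
  have hsk := S.skew i _ hx' j _ hy'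
  rw [← neg_eq_iff_eq_neg] at hsk
  rw [← hsk, sub_neg_eq_add, ← two_smul K] at hm
  exact (smul_eq_zero.1 hm).resolve_left (Ring.two_ne_zero hK)

/-- The Lie algebra of a product is the direct sum: the commuting maps from `L X` and `L Y` extend
to the direct sum, and the two projections provide the inverse. -/
theorem exists_lieSumIso (hK : ringChar K ≠ 2) (X Y : QD K .minus) :
    ∃ e : (lieObj X).prod (lieObj Y) ≅ lieObj (QD.prod X Y),
      GrLie.inlHom _ _ ≫ e.hom = lieMap (QD.inlHom X Y) ∧
      GrLie.inrHom _ _ ≫ e.hom = lieMap (QD.inrHom X Y) := by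
  let p : QD.prod X Y ⟶ X := projLeft X Y
  let q : QD.prod X Y ⟶ Y := projRight X Y
  let ι : ∀ Z : QD K .minus, Z.V →ₗ[K] (lieObj Z).X := fun Z =>
    (lieProj Z).hom.lin ∘ₗ (freeLieι (weightOne Z.V)).lin
  have hι : ∀ {Z Z' : QD K .minus} (f : Z ⟶ Z') (z : Z.V),
      (lieMap f).hom.lin (ι Z z) = ι Z' (f.hom.lin z) := fun f z => lieMap_ι f z
  let e := GrLie.coprodHom (lieMap (QD.inlHom X Y)) (lieMap (QD.inrHom X Y))
    (lieMap_inl_inr_bracket hK X Y)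
  let d := GrLie.pairHom (lieMap p) (lieMap q)
  have hl : GrLie.inlHom _ _ ≫ e = lieMap (QD.inlHom X Y) :=
    GrLie.hom_ext (LinearMap.coprod_inl _ _)
  have hr : GrLie.inrHom _ _ ≫ e = lieMap (QD.inrHom X Y) :=
    GrLie.hom_ext (LinearMap.coprod_inr _ _)
  have hed : e ≫ d = 𝟙 _ := by
    refine GeneratedTensor.hom_ext (X := lieObj X) (Y := lieObj Y) ?_ ?_
    · rw [GrLie.inclLeft_eq, reassoc_of% hl]
      exact lie_hom_ext fun x => Prod.ext
        ((congrArg (lieMap p).hom.lin (hι (QD.inlHom X Y) x)).trans (hι p _))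
        ((congrArg (lieMap q).hom.lin (hι (QD.inlHom X Y) x)).trans
          ((hι q _).trans (map_zero (ι Y))))
    · rw [GrLie.inclRight_eq, reassoc_of% hr]
      exact lie_hom_ext fun y => Prod.ext
        ((congrArg (lieMap p).hom.lin (hι (QD.inrHom X Y) y)).trans
          ((hι p _).trans (map_zero (ι X))))
        ((congrArg (lieMap q).hom.lin (hι (QD.inrHom X Y) y)).trans (hι q _))
  have hde : d ≫ e = 𝟙 _ := lie_hom_ext fun s => by
    have h₁ : (lieMap (QD.inlHom X Y)).hom.lin ((lieMap p).hom.lin (ι _ s)) =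
        ι (QD.prod X Y) ((QD.inlHom X Y).hom.lin (p.hom.lin s)) :=
      (congrArg (lieMap (QD.inlHom X Y)).hom.lin (hι p s)).trans (hι _ _)
    have h₂ : (lieMap (QD.inrHom X Y)).hom.lin ((lieMap q).hom.lin (ι _ s)) =
        ι (QD.prod X Y) ((QD.inrHom X Y).hom.lin (q.hom.lin s)) :=
      (congrArg (lieMap (QD.inrHom X Y)).hom.lin (hι q s)).trans (hι _ _)
    refine (congrArg₂ (· + ·) h₁ h₂).trans ?_
    refine ((ι (QD.prod X Y)).map_add _ _).symm.trans (congrArg (ι (QD.prod X Y)) ?_)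
    exact Prod.ext (add_zero s.1) (zero_add s.2)
  exact ⟨⟨e, d, hed, hde⟩, hl, hr⟩

variable (K) in
theorem realL_braided (hK : ringChar K ≠ 2) : StrongSymMonoidal (realL K) := by
  refine braided_of_comp_fullyFaithful _ (wgLie K).ι ?_
  have h := fun X Y : QDMinus K => exists_lieSumIso hK X.obj Y.obj
  choose e hl hr using h
  let ε : GrLie.unit K (ℕ × ℤ) ≅ lieObj (QD.unit K .minus) :=
    { hom := GrLie.fromUnit _
      inv := ⟨⟨0, fun _ _ _ => trivial⟩, fun _ _ => rfl⟩
      hom_inv_id := GrLie.hom_ext (LinearMap.ext fun _ => rfl)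
      inv_hom_id := lie_hom_ext fun x => by
        have hx : (lieProj (QD.unit K .minus)).hom.lin ((freeLieι (weightOne
            (QD.unit K .minus).V)).lin x) = 0 := by
          have hx : x = 0 := Subsingleton.elim (α := PUnit) _ _
          rw [hx, map_zero, map_zero]
        exact hx.symm }
  refine braided_of_inclusions (realL K ⋙ (wgLie K).ι) ε e (fun X Y => ?_) fun X Y => ?_
  · have h : inclLeft X Y = ObjectProperty.homMk (QD.inlHom X.obj Y.obj) :=
      ObjectProperty.hom_ext _ ((inclLeft_hom _ X Y).trans (QD.inclLeft_eq X.obj Y.obj))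
    rw [h, GrLie.inclLeft_eq]
    exact hl X Y
  · have h : inclRight X Y = ObjectProperty.homMk (QD.inrHom X.obj Y.obj) :=
      ObjectProperty.hom_ext _ ((inclRight_hom _ X Y).trans (QD.inclRight_eq X.obj Y.obj))
    rw [h, GrLie.inclRight_eq]
    exact hr X Y

end LieProducts

/-! ### Coalgebras as algebras in the opposite category -/

section ComonOp

universe v₁ v₂ v₃ w₁ w₂ w₃

variable {C : Type w₁} [Category.{v₁} C] [MonoidalCategory C] [SymmetricCategory C]
  {D : Type w₂} [Category.{v₂} D] [MonoidalCategory D] [SymmetricCategory D]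
  {E : Type w₃} [Category.{v₃} E] [MonoidalCategory E] [SymmetricCategory E]

/-- A lax symmetric monoidal functor is strong on the image of a strong symmetric monoidal functor
as soon as its structure maps are invertible there. -/
theorem braided_comp_lax (F : C ⥤ D) (G : D ⥤ E) (hF : Nonempty F.Braided) [G.LaxBraided]
    (hε : IsIso (Functor.LaxMonoidal.ε G))
    (hμ : ∀ X Y, IsIso (Functor.LaxMonoidal.μ G (F.obj X) (F.obj Y))) :
    Nonempty (F ⋙ G).Braided := by
  obtain ⟨_⟩ := hF
  have h₁ : IsIso (Functor.LaxMonoidal.ε (F ⋙ G)) := by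
    rw [Functor.LaxMonoidal.comp_ε]
    infer_instance
  have h₂ : ∀ X Y, IsIso (Functor.LaxMonoidal.μ (F ⋙ G) X Y) := fun X Y => by
    rw [Functor.LaxMonoidal.comp_μ]
    infer_instance
  let M : (F ⋙ G).Monoidal := Functor.Monoidal.ofLaxMonoidal (F ⋙ G)
  exact ⟨{ M with braided := Functor.LaxBraided.braided (F := F ⋙ G) }⟩

variable (C) in
/-- Comonoids are the monoids of the opposite category. -/
abbrev comonOp : (Comon C)ᵒᵖ ⥤ Mon Cᵒᵖ := (Comon.Comon_EquivMon_OpOp C).functor.leftOp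

instance : (comonOp C).Full := inferInstance
instance : (comonOp C).Faithful := inferInstance

variable (C) in
/-- On underlying objects both tensor products are that of `C`, so all structure maps are
identities. -/
theorem comonOp_braided : Nonempty (comonOp C).Braided := by
  have hα : ∀ X Y Z : C, ((X ◁ 𝟙 (Y ⊗ Z) ≫ (α_ X Y Z).inv ≫ 𝟙 (X ⊗ Y) ▷ Z) ≫ 𝟙 _) ≫
      𝟙 (X ⊗ Y) ▷ Z = (𝟙 _ ≫ X ◁ 𝟙 (Y ⊗ Z)) ≫ (α_ X Y Z).inv := fun X Y Z => by simp
  have hl : ∀ X : C, (λ_ X).inv = (((λ_ X).inv ≫ 𝟙 (𝟙_ C) ▷ X) ≫ 𝟙 _) ≫ 𝟙 (𝟙_ C) ▷ X :=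
    fun X => by simp
  have hr : ∀ X : C, (ρ_ X).inv = (((ρ_ X).inv ≫ X ◁ 𝟙 (𝟙_ C)) ≫ 𝟙 _) ≫ X ◁ 𝟙 (𝟙_ C) :=
    fun X => by simp
  let M : (comonOp C).Monoidal := Functor.CoreMonoidal.toMonoidal
    { εIso := Iso.refl _
      μIso := fun X Y => Iso.refl _
      μIso_hom_natural_left := fun f Z => (Category.comp_id _).trans (Category.id_comp _).symm
      μIso_hom_natural_right := fun Z f => (Category.comp_id _).trans (Category.id_comp _).symm
      associativity := fun X Y Z => Mon.Hom.ext <| Quiver.Hom.unop_inj <|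
        (congrArg (fun k => (k ≫ 𝟙 _) ≫ 𝟙 _ ▷ _)
          (Comon.monoidal_associator_inv_hom C X.unop Y.unop Z.unop)).trans
          (hα X.unop.X Y.unop.X Z.unop.X)
      left_unitality := fun X => Mon.Hom.ext <| Quiver.Hom.unop_inj <| (hl X.unop.X).trans
        (congrArg (fun k => (k ≫ 𝟙 _) ≫ 𝟙 _ ▷ _) (Comon.monoidal_leftUnitor_inv_hom C X.unop)).symm
      right_unitality := fun X => Mon.Hom.ext <| Quiver.Hom.unop_inj <| (hr X.unop.X).trans
        (congrArg (fun k => (k ≫ 𝟙 _) ≫ _ ◁ 𝟙 _)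
          (Comon.monoidal_rightUnitor_inv_hom C X.unop)).symm }
  refine ⟨{ M with braided := fun X Y => ?_ }⟩
  exact (Category.id_comp _).trans (Category.comp_id _).symm

/-- The functor induced on comonoids is dual to the one induced by the opposite functor on
monoids. -/
theorem mapComon_braided (F : C ⥤ D) [F.Braided] : Nonempty F.mapComon.Braided := by
  obtain ⟨_⟩ := comonOp_braided D
  let := opBraided F
  refine braided_of_op _ (braided_of_comp_fullyFaithful _ (comonOp D) ?_)
  have h : F.mapComon.op ⋙ comonOp D = comonOp C ⋙ F.op.mapMon := rfl
  rw [h]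
  exact braided_comp _ _ (comonOp_braided C) ⟨inferInstance⟩

end ComonOp

/-! ### Inclusions and forgetful functors -/

section

variable (K : Type u) [Field K]

theorem lambda_braided : StrongSymMonoidal (lambda K) :=
  ⟨inferInstanceAs (ObjectProperty.ι _).Braided⟩

theorem sigma_braided : StrongSymMonoidal (sigma K) :=
  ⟨inferInstanceAs (ObjectProperty.ι _).Braided⟩

theorem comToAss_braided : StrongSymMonoidal (comToAss K) :=
  ⟨inferInstanceAs (ObjectProperty.ι _).Braided⟩

theorem comCoToAssCo_braided : StrongSymMonoidal (comCoToAssCo K) :=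
  ⟨inferInstanceAs (ObjectProperty.ι _).Braided⟩

theorem wgComToWgAss_braided : StrongSymMonoidal (wgComToWgAss K) :=
  ⟨inferInstanceAs (ObjectProperty.ιOfLE _).Braided⟩

theorem wgComCoToWgAssCo_braided : StrongSymMonoidal (wgComCoToWgAssCo K) :=
  ⟨inferInstanceAs (ObjectProperty.ιOfLE _).Braided⟩

theorem wgAssToAss_braided : StrongSymMonoidal (wgAssToAss K) :=
  ⟨inferInstanceAs ((wgAss K).ι ⋙ (forgetWeight K).mapMon).Braided⟩

theorem wgComToCom_braided : StrongSymMonoidal (wgComToCom K) :=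
  braided_of_comp_fullyFaithful _ (isComm _).ι
    ⟨inferInstanceAs ((wgCom K).ι ⋙ (forgetWeight K).mapMon).Braided⟩

theorem wgAssCoToAssCo_braided : StrongSymMonoidal (wgAssCoToAssCo K) :=
  braided_comp (wgAssCo K).ι _ ⟨inferInstance⟩ (mapComon_braided (forgetWeight K))

theorem wgComCoToComCo_braided : StrongSymMonoidal (wgComCoToComCo K) :=
  braided_of_comp_fullyFaithful _ (isCocomm _).ι
    (braided_comp (wgComCo K).ι _ ⟨inferInstance⟩ (mapComon_braided (forgetWeight K)))

/-- The direct sum and its grading are unchanged by forgetting the weight. -/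
theorem wgLieToLie_braided : StrongSymMonoidal (wgLieToLie K) := by
  have hm : ∀ (V W : GrVect K (ℕ × ℤ)) δ (x : V × W),
      x ∈ (GrVect.sumObj (GrVect.regradeObj Prod.snd V) (GrVect.regradeObj Prod.snd W)).gr δ →
        x ∈ (GrVect.regradeObj (Prod.snd : ℕ × ℤ → ℤ) (GrVect.sumObj V W)).gr δ := by
    intro V W δ x hx
    have h₁ := GrVect.regrade_le (N := ((GrVect.regradeObj (Prod.snd : ℕ × ℤ → ℤ)
      (GrVect.sumObj V W)).gr δ).comap (LinearMap.inl K V W)) Prod.snd V (fun γ hγ x hx =>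
        GrVect.mem_regrade Prod.snd (GrVect.sumObj V W) hγ ((GrVect.inl V W).map_mem γ x hx)) hx.1
    have h₂ := GrVect.regrade_le (N := ((GrVect.regradeObj (Prod.snd : ℕ × ℤ → ℤ)
      (GrVect.sumObj V W)).gr δ).comap (LinearMap.inr K V W)) Prod.snd W (fun γ hγ x hx =>
        GrVect.mem_regrade Prod.snd (GrVect.sumObj V W) hγ ((GrVect.inr V W).map_mem γ x hx)) hx.2
    have h₃ := Submodule.add_mem _ (Submodule.mem_comap.1 h₁) (Submodule.mem_comap.1 h₂)
    rwa [LinearMap.inl_apply, LinearMap.inr_apply, Prod.mk_add_mk, add_zero, zero_add] at h₃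
  let μ : ∀ X Y : WgLieAlg K, ((wgLieToLie K).obj X).prod ((wgLieToLie K).obj Y) ≅
      (wgLieToLie K).obj (X ⊗ Y) := fun X Y =>
    { hom := ⟨⟨LinearMap.id, hm X.obj.X Y.obj.X⟩, fun _ _ => rfl⟩
      inv := ⟨⟨LinearMap.id, GrVect.symm_mem
        (V := GrVect.sumObj (GrVect.regradeObj Prod.snd X.obj.X)
          (GrVect.regradeObj Prod.snd Y.obj.X)) (W := GrVect.regradeObj (Prod.snd : ℕ × ℤ → ℤ)
          (GrVect.sumObj X.obj.X Y.obj.X)) (LinearEquiv.refl K (X.obj.X × Y.obj.X))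
          (hm X.obj.X Y.obj.X)⟩, fun _ _ => rfl⟩
      hom_inv_id := rfl
      inv_hom_id := rfl }
  let ε : GrLie.unit K ℤ ≅ (wgLieToLie K).obj (𝟙_ (WgLieAlg K)) :=
    { hom := GrLie.fromUnit _
      inv := ⟨⟨0, fun _ _ _ => trivial⟩, fun _ _ => rfl⟩
      hom_inv_id := rfl
      inv_hom_id := GrLie.hom_ext (LinearMap.ext fun _ => rfl) }
  refine braided_of_inclusions (wgLieToLie K) ε μ (fun X Y => ?_) fun X Y => ?_
  · rw [GrLie.inclLeft_eq]
    refine Eq.trans ?_ (congrArg (forgetWeightLie K).map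
      ((inclLeft_hom _ X Y).trans (GrLie.inclLeft_eq X.obj Y.obj))).symm
    rfl
  · rw [GrLie.inclRight_eq]
    refine Eq.trans ?_ (congrArg (forgetWeightLie K).map
      ((inclRight_hom _ X Y).trans (GrLie.inclRight_eq X.obj Y.obj))).symm
    rfl

end

/-! ### Weight-wise duality -/

section Duality

open GrVect

variable {K : Type u} [Field K]

/-- The part of a homogeneous functional on `V ⊗ W` that is supported on one finite dimensional
component of `V` lies in `V^* ⊗ W^*`. -/
theorem comp_component_mem_range_pairing {V W : GrVect K (ℕ × ℤ)} {δ i : ℕ × ℤ}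
    {φ : V ⊗[K] W →ₗ[K] K} (hφ : ∀ γ, γ ≠ δ → ∀ z ∈ (tensorObj' V W).gr γ, φ z = 0)
    [FiniteDimensional K (V.gr i)] :
    φ ∘ₗ TensorProduct.map (V.component i) LinearMap.id ∈ LinearMap.range (pairing V W) := by
  let b := Module.finBasis K (V.gr i)
  let r : V →ₗ[K] V.gr i := (V.component i).codRestrict (V.gr i) fun x => V.coact_mem x i
  let j : ℕ × ℤ := (δ.1 - i.1, δ.2 - i.2)
  have hj : ∀ j', j' ≠ j → i + j' ≠ δ := by
    rintro j' hj' rfl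
    exact hj' (Prod.ext (Nat.add_sub_cancel_left _ _).symm (add_sub_cancel_left _ _).symm)
  have hf : ∀ a, b.coord a ∘ₗ r ∈ dualGr V (DegreeIndex.dual i) := fun a k hk x hx => by
    rw [DegreeIndex.dual_dual] at hk
    have h : r x = 0 := Subtype.ext ((V.component_of_mem hx).trans (if_neg hk))
    rw [LinearMap.comp_apply, h, map_zero]
  have hg : ∀ a, φ ∘ₗ TensorProduct.mk K V W (b a) ∈ dualGr W (DegreeIndex.dual j) :=
    fun a k hk y hy => by
      rw [DegreeIndex.dual_dual] at hk
      exact hφ (i + k) (hj k hk) _ (tmul_mem V W rfl (b a).2 hy)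
  let f : Fin (Module.finrank K (V.gr i)) → DualSpace V := fun a => ⟨_, mem_dual V (hf a)⟩
  let g : Fin (Module.finrank K (V.gr i)) → DualSpace W := fun a => ⟨_, mem_dual W (hg a)⟩
  refine ⟨koszul K i j • ∑ a, f a ⊗ₜ g a, tensor_ext V W fun k x hx l y hy => ?_⟩
  have h₁ : pairing V W (koszul K i j • ∑ a, f a ⊗ₜ g a) (x ⊗ₜ y) =
      koszul K i j * ∑ a, koszul K k l * (b.coord a (r x) * φ ((b a : V) ⊗ₜ y)) := by
    rw [map_smul, map_sum, LinearMap.smul_apply, LinearMap.sum_apply, smul_eq_mul]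
    exact congrArg (koszul K i j * ·) (Finset.sum_congr rfl fun a _ =>
      pairing_tmul V W (f a) (g a) hx hy)
  rw [h₁, LinearMap.comp_apply, TensorProduct.map_tmul, LinearMap.id_apply]
  by_cases hk : k = i
  · subst hk
    by_cases hl : l = j
    · rw [← Finset.mul_sum, ← mul_assoc, hl, koszul_mul_self, one_mul]
      have h₂ : ((∑ a, b.coord a (r x) • b a : V.gr k) : V) = V.component k x :=
        congrArg Subtype.val (b.sum_repr (r x))
      rw [← h₂, Submodule.coe_sum, TensorProduct.sum_tmul, map_sum]
      refine Finset.sum_congr rfl fun a _ => ?_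
      rw [Submodule.coe_smul, ← TensorProduct.smul_tmul', map_smul, smul_eq_mul]
    · have h₃ : ∀ z ∈ V.gr k, φ (z ⊗ₜ y) = 0 := fun z hz =>
        hφ (k + l) (hj l hl) _ (tmul_mem V W rfl hz hy)
      rw [h₃ (V.component k x) (V.coact_mem x k), Finset.sum_eq_zero fun a _ => by
        rw [h₃ _ (b a).2, mul_zero, mul_zero], mul_zero]
  · have h₂ : V.component i x = 0 := (V.component_of_mem hx).trans (if_neg hk)
    have h₃ : r x = 0 := Subtype.ext h₂
    rw [h₂, TensorProduct.zero_tmul, map_zero, h₃, Finset.sum_eq_zero fun a _ => by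
      rw [map_zero, zero_mul, mul_zero], mul_zero]

/-- A finite dimensional weight component has only finitely many nonzero degrees. -/
theorem exists_finset_support {V : GrVect K (ℕ × ℤ)} (hV : finWeight K V) (n : ℕ) :
    ∃ T : Finset (ℕ × ℤ), ∀ i, i.1 = n → i ∉ T → ∀ x ∈ V.gr i, x = 0 := by
  obtain ⟨s, hs⟩ := Module.Finite.iff_fg.1 (hV n)
  refine ⟨s.biUnion fun x => (V.coact x).support, fun i hi hT x hx => ?_⟩
  have h : weightPart V n ≤ LinearMap.ker (V.component i) := by
    rw [← hs, Submodule.span_le]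
    intro y hy
    by_contra h
    exact hT (Finset.mem_biUnion.2 ⟨y, hy, Finsupp.mem_support_iff.2 h⟩)
  have hx' : V.component i x = 0 := h (hi ▸ gr_le_weightPart V i hx)
  rwa [V.component_of_mem hx, if_pos rfl] at hx'

/-- All functionals on `V ⊗ W` come from `V^* ⊗ W^*` if the weight components of `V` are finite
dimensional. -/
theorem dualTensor_surjective {V W : GrVect K (ℕ × ℤ)} (hV : finWeight K V) :
    Function.Surjective (dualTensor V W).lin := by
  suffices h : dualSpace (tensorObj' V W) ≤ LinearMap.range (pairing V W) by
    intro φ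
    obtain ⟨z, hz⟩ := h (toFun_mem _ φ)
    exact ⟨z, toFun_injective _ hz⟩
  refine iSup_le fun γ φ hφ => ?_
  let δ : ℕ × ℤ := DegreeIndex.dual γ
  have hfin : ∀ i, FiniteDimensional K (V.gr i) := fun i => by
    have : FiniteDimensional K (weightPart V i.1) := hV i.1
    exact Submodule.finiteDimensional_of_le (gr_le_weightPart V i)
  choose T hT using exists_finset_support hV
  -- weights are nonnegative, so only components of `V` of weight at most that of `δ` contribute
  let S : Finset (ℕ × ℤ) := ((Finset.range (δ.1 + 1)).biUnion T).filter fun i => i.1 ≤ δ.1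
  have h : φ = ∑ i ∈ S, φ ∘ₗ TensorProduct.map (V.component i) LinearMap.id := by
    refine tensor_ext V W fun k x hx l y hy => ?_
    rw [LinearMap.sum_apply]
    simp only [LinearMap.comp_apply, TensorProduct.map_tmul, LinearMap.id_apply,
      V.component_of_mem hx]
    by_cases hk : k ∈ S
    · rw [Finset.sum_eq_single_of_mem k hk fun i _ hi => by
        rw [if_neg (Ne.symm hi), TensorProduct.zero_tmul, map_zero], if_pos rfl]
    · rw [Finset.sum_eq_zero fun i hi => by
        rw [if_neg (fun h : k = i => hk (h ▸ hi)), TensorProduct.zero_tmul, map_zero]]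
      by_cases hk' : k.1 ≤ δ.1
      · have hx0 : x = 0 := hT k.1 k rfl (fun h => hk (Finset.mem_filter.2
          ⟨Finset.mem_biUnion.2 ⟨k.1, Finset.mem_range.2 (by omega), h⟩, hk'⟩)) x hx
        rw [hx0, TensorProduct.zero_tmul, map_zero]
      · refine hφ (k + l) (fun h => hk' ?_) _ (tmul_mem V W rfl hx hy)
        exact (Nat.le_add_right k.1 l.1).trans (congrArg Prod.fst h).le
  rw [h]
  exact Submodule.sum_mem _ fun i _ =>
    comp_component_mem_range_pairing (δ := δ) hφ

theorem dual_ε_isIso : IsIso (Functor.LaxMonoidal.ε (dual (K := K) (Γ := ℕ × ℤ))) := by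
  refine isIso_of_bijective (dualUnit K (ℕ × ℤ)) ⟨fun a b h => ?_, fun f => ?_⟩
  · have h₁ := congrArg (fun f => toFun (unitObj K (ℕ × ℤ)) f (1 : K)) h
    exact (mul_one a).symm.trans (h₁.trans (mul_one b))
  · refine ⟨toFun (unitObj K (ℕ × ℤ)) f (1 : K), toFun_injective _ (LinearMap.ext_ring ?_)⟩
    rw [toFun_dualUnit, mul_one]

theorem dualTensor_isIso {V W : GrVect K (ℕ × ℤ)} (hV : finWeight K V) :
    IsIso (dualTensor V W) :=
  isIso_of_bijective _ ⟨fun _ _ h => pairing_injective V W (congrArg (toFun (tensorObj' V W)) h),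
    dualTensor_surjective hV⟩

/-- Weight-wise duality from coalgebras to algebras is the functor induced on monoids by the lax
monoidal duality of graded spaces, whose structure maps are invertible in the presence of finite
dimensional weight components. -/
theorem dual_mapMon_braided (P : ObjectProperty (Comon (GrVect K (ℕ × ℤ)))) [P.IsMonoidal]
    (hP : P ≤ wgAssCo K) : Nonempty (P.ι.op ⋙ dualAlg K).Braided := by
  have h := braided_comp _ _ (braided_op P.ι ⟨inferInstance⟩) (comonOp_braided _)
  refine braided_comp_lax (P.ι.op ⋙ comonOp _) (dual.mapMon) h ?_ fun X Y => ?_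
  · have : IsIso ((Mon.forget (GrVect K (ℕ × ℤ))).map
      (Functor.LaxMonoidal.ε (dual (K := K) (Γ := ℕ × ℤ)).mapMon)) := dual_ε_isIso
    exact isIso_of_reflects_iso _ (Mon.forget _)
  · have : IsIso ((Mon.forget (GrVect K (ℕ × ℤ))).map
      (Functor.LaxMonoidal.μ (dual (K := K) (Γ := ℕ × ℤ)).mapMon
        ((P.ι.op ⋙ comonOp _).obj X) ((P.ι.op ⋙ comonOp _).obj Y))) :=
      dualTensor_isIso (hP _ X.unop.property)
    exact isIso_of_reflects_iso _ (Mon.forget _)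

variable (K)

theorem dualWgAss_braided : StrongSymMonoidal (dualWgAss K) :=
  braided_of_comp_fullyFaithful _ (wgAss K).ι (dual_mapMon_braided (wgAssCo K) le_rfl)

theorem dualWgCom_braided : StrongSymMonoidal (dualWgCom K) :=
  braided_of_comp_fullyFaithful _ (wgCom K).ι (dual_mapMon_braided (wgComCo K) fun _ h => h.1)

end Duality

/-! ### Tensor products of comonoids -/

section ComonProducts

open ComonObj

universe v w

variable {C : Type w} [Category.{v} C] [MonoidalCategory C]

/-- Coassociativity, with a morphism applied to each of the three factors. -/
theorem comul_tensor_assoc (S : C) [ComonObj S] {X Y Z : C} (x : S ⟶ X) (y : S ⟶ Y) (z : S ⟶ Z) :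
    (comul : S ⟶ _) ≫ ((comul ≫ (x ⊗ₘ y)) ⊗ₘ z) ≫ (α_ X Y Z).hom =
      comul ≫ (x ⊗ₘ (comul ≫ (y ⊗ₘ z))) := by
  have h : (comul : S ⟶ _) ≫ S ◁ comul = comul ≫ comul ▷ S ≫ (α_ S S S).hom := comul_assoc S
  have h₁ : (comul ≫ (x ⊗ₘ y)) ⊗ₘ z = (comul : S ⟶ _) ▷ S ≫ ((x ⊗ₘ y) ⊗ₘ z) := by
    rw [← tensorHom_id, tensorHom_comp_tensorHom, Category.id_comp]
  have h₂ : x ⊗ₘ (comul ≫ (y ⊗ₘ z)) = S ◁ (comul : S ⟶ _) ≫ (x ⊗ₘ (y ⊗ₘ z)) := by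
    rw [← id_tensorHom, tensorHom_comp_tensorHom, Category.id_comp]
  rw [h₁, h₂, Category.assoc, associator_naturality, reassoc_of% h]

theorem comul_tensor_assoc_inv (S : C) [ComonObj S] {X Y Z : C} (x : S ⟶ X) (y : S ⟶ Y)
    (z : S ⟶ Z) : (comul : S ⟶ _) ≫ (x ⊗ₘ (comul ≫ (y ⊗ₘ z))) ≫ (α_ X Y Z).inv =
      comul ≫ ((comul ≫ (x ⊗ₘ y)) ⊗ₘ z) := by
  rw [← Category.assoc, ← comul_tensor_assoc]
  simp

variable [SymmetricCategory C]

instance : TerminalUnit (Comon C) :=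
  ⟨Limits.IsTerminal.ofUniqueHom (fun A => (Comon.uniqueHomToTrivial A).default) fun A f =>
    (Comon.uniqueHomToTrivial A).uniq f⟩

variable (A B : Comon C)

theorem projLeft_comon_hom : (projLeft A B).hom = A.X ◁ (counit : B.X ⟶ 𝟙_ C) ≫ (ρ_ A.X).hom := by
  have h₁ : (A ◁ toUnit B).hom = A.X ◁ (toUnit B).hom := by
    exact Comon.monoidal_whiskerLeft_hom C _ _ _ _
  have h₂ : (ρ_ A).hom.hom = (ρ_ A.X).hom := by
    refine (Comon.monoidal_rightUnitor_hom_hom C A).trans ?_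
    have h : A.X ◁ 𝟙 (𝟙_ C) ≫ (ρ_ A.X).hom = (ρ_ A.X).hom := by simp
    exact h
  exact congrArg₂ (fun (k : A.X ⊗ B.X ⟶ A.X ⊗ 𝟙_ C) (l : A.X ⊗ 𝟙_ C ⟶ A.X) => k ≫ l) h₁ h₂

theorem projRight_comon_hom : (projRight A B).hom = (counit : A.X ⟶ 𝟙_ C) ▷ B.X ≫ (λ_ B.X).hom := by
  have h₁ : (toUnit A ▷ B).hom = (toUnit A).hom ▷ B.X := by
    exact Comon.monoidal_whiskerRight_hom C _ _
  have h₂ : (λ_ B).hom.hom = (λ_ B.X).hom := by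
    refine (Comon.monoidal_leftUnitor_hom_hom C B).trans ?_
    have h : 𝟙 (𝟙_ C) ▷ B.X ≫ (λ_ B.X).hom = (λ_ B.X).hom := by simp
    exact h
  exact congrArg₂ (fun (k : A.X ⊗ B.X ⟶ 𝟙_ C ⊗ B.X) (l : 𝟙_ C ⊗ B.X ⟶ B.X) => k ≫ l) h₁ h₂

theorem comon_comul_eq : (comul : (A ⊗ B).X ⟶ _) =
    ((comul : A.X ⟶ _) ⊗ₘ (comul : B.X ⟶ _)) ≫ tensorμ A.X A.X B.X B.X :=
  Comon.tensorObj_comul A.X B.X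

theorem comul_projLeft_projRight :
    (comul : (A ⊗ B).X ⟶ _) ≫ ((projLeft A B).hom ⊗ₘ (projRight A B).hom) = 𝟙 (A ⊗ B).X := by
  have h : (((comul : A.X ⟶ _) ⊗ₘ (comul : B.X ⟶ _)) ≫ tensorμ A.X A.X B.X B.X) ≫
      ((A.X ◁ (counit : B.X ⟶ 𝟙_ C) ≫ (ρ_ A.X).hom) ⊗ₘ
        ((counit : A.X ⟶ 𝟙_ C) ▷ B.X ≫ (λ_ B.X).hom)) = 𝟙 (A.X ⊗ B.X) := by
    rw [← id_tensorHom, ← tensorHom_id, ← tensorHom_comp_tensorHom, Category.assoc,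
      ← tensorμ_natural_assoc, tensorHom_comp_tensorHom_assoc, id_tensorHom, tensorHom_id,
      comul_counit, counit_comul]
    simp only [tensorμ, braiding_tensorUnit_left]
    monoidal
  rw [projLeft_comon_hom, projRight_comon_hom, comon_comul_eq]
  exact h

theorem comul_projRight_projLeft :
    (comul : (A ⊗ B).X ⟶ _) ≫ ((projRight A B).hom ⊗ₘ (projLeft A B).hom) = (β_ A.X B.X).hom := by
  have h : (((comul : A.X ⟶ _) ⊗ₘ (comul : B.X ⟶ _)) ≫ tensorμ A.X A.X B.X B.X) ≫
      (((counit : A.X ⟶ 𝟙_ C) ▷ B.X ≫ (λ_ B.X).hom) ⊗ₘ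
        (A.X ◁ (counit : B.X ⟶ 𝟙_ C) ≫ (ρ_ A.X).hom)) = (β_ A.X B.X).hom := by
    rw [← id_tensorHom, ← tensorHom_id, ← tensorHom_comp_tensorHom, Category.assoc,
      ← tensorμ_natural_assoc, tensorHom_comp_tensorHom_assoc, id_tensorHom, tensorHom_id,
      comul_counit, counit_comul]
    simp only [tensorμ]
    monoidal
  rw [projLeft_comon_hom, projRight_comon_hom, comon_comul_eq]
  exact h

variable {A B}

/-- A morphism of comonoids to a tensor product is determined by its two components. -/
theorem comon_tensor_hom_ext {Z : Comon C} {f g : Z ⟶ A ⊗ B}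
    (hl : f ≫ projLeft A B = g ≫ projLeft A B) (hr : f ≫ projRight A B = g ≫ projRight A B) :
    f = g := by
  have h : ∀ f : Z ⟶ A ⊗ B, f.hom = (comul : Z.X ⟶ _) ≫
      ((f ≫ projLeft A B).hom ⊗ₘ (f ≫ projRight A B).hom) := fun f => by
    have h₁ : f.hom ≫ comul = comul ≫ (f.hom ⊗ₘ f.hom) := IsComonHom.hom_comul f.hom
    rw [Comon.comp_hom', Comon.comp_hom', ← tensorHom_comp_tensorHom, ← reassoc_of% h₁,
      comul_projLeft_projRight]
    exact (Category.comp_id _).symm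
  exact Comon.ext (by rw [h f, h g, hl, hr])

instance : GeneratedTensor (Comon C)ᵒᵖ := generatedTensor_op comon_tensor_hom_ext

/-- Two morphisms of comonoids whose images cocommute define a morphism to the tensor product, dual
to the product of two commuting algebra maps. -/
theorem exists_comon_pair {S : Comon C} (p : S ⟶ A) (r : S ⟶ B)
    (h : (comul : S.X ⟶ _) ≫ (p.hom ⊗ₘ r.hom) = comul ≫ (r.hom ⊗ₘ p.hom) ≫ (β_ B.X A.X).hom) :
    ∃ k : S ⟶ A ⊗ B, k ≫ projLeft A B = p ∧ k ≫ projRight A B = r := by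
  have hp : p.hom ≫ comul = comul ≫ (p.hom ⊗ₘ p.hom) := IsComonHom.hom_comul p.hom
  have hr : r.hom ≫ comul = comul ≫ (r.hom ⊗ₘ r.hom) := IsComonHom.hom_comul r.hom
  have hp' : p.hom ≫ (counit : A.X ⟶ 𝟙_ C) = counit := IsComonHom.hom_counit p.hom
  have hr' : r.hom ≫ (counit : B.X ⟶ 𝟙_ C) = counit := IsComonHom.hom_counit r.hom
  have h' : (comul : S.X ⟶ _) ≫ (p.hom ⊗ₘ r.hom) ≫ (β_ A.X B.X).hom =
      comul ≫ (r.hom ⊗ₘ p.hom) := by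
    rw [reassoc_of% h, SymmetricCategory.symmetry, Category.comp_id]
  -- compatibility with comultiplications: both sides are iterated comultiplications followed by
  -- `p`, `p`, `r`, `r`, the two middle factors being exchanged by `h'`
  have h₁ : ((comul : S.X ⟶ _) ≫ (p.hom ⊗ₘ r.hom)) ≫
      ((comul : A.X ⟶ _) ⊗ₘ (comul : B.X ⟶ _)) ≫ tensorμ A.X A.X B.X B.X =
      comul ≫ ((comul ≫ (p.hom ⊗ₘ r.hom)) ⊗ₘ (comul ≫ (p.hom ⊗ₘ r.hom))) := by
    have e₁ : ∀ {X Y Z : C} (a : S.X ⟶ X) (b : S.X ⟶ Y) (c : Y ⟶ Z),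
        (a ⊗ₘ b) ≫ X ◁ c = a ⊗ₘ (b ≫ c) := fun a b c => by
      rw [← id_tensorHom, tensorHom_comp_tensorHom, Category.comp_id]
    have e₂ : ∀ {X Y Z : C} (a : S.X ⟶ X) (b : S.X ⟶ Y) (c : X ⟶ Z),
        (a ⊗ₘ b) ≫ c ▷ Y = (a ≫ c) ⊗ₘ b := fun a b c => by
      rw [← tensorHom_id, tensorHom_comp_tensorHom, Category.comp_id]
    rw [Category.assoc, tensorHom_comp_tensorHom_assoc, hp, hr, tensorμ,
      reassoc_of% (comul_tensor_assoc S.X), ← whiskerLeft_comp_assoc, ← whiskerLeft_comp_assoc,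
      reassoc_of% e₁]
    simp only [Category.assoc]
    rw [reassoc_of% (comul_tensor_assoc_inv S.X), reassoc_of% e₂, Category.assoc, h',
      comul_tensor_assoc, comul_tensor_assoc_inv]
  have h₂ : (comul : S.X ⟶ _) ≫ (p.hom ⊗ₘ r.hom) ≫
      A.X ◁ (counit : B.X ⟶ 𝟙_ C) ≫ (ρ_ A.X).hom = p.hom := by
    rw [← id_tensorHom, tensorHom_comp_tensorHom_assoc, hr', Category.comp_id,
      MonoidalCategory.tensorHom_def', Category.assoc, comul_counit_assoc]
    simp
  have h₃ : (comul : S.X ⟶ _) ≫ (p.hom ⊗ₘ r.hom) ≫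
      (counit : A.X ⟶ 𝟙_ C) ▷ B.X ≫ (λ_ B.X).hom = r.hom := by
    rw [← tensorHom_id, tensorHom_comp_tensorHom_assoc, hp', Category.comp_id,
      MonoidalCategory.tensorHom_def, Category.assoc, counit_comul_assoc]
    simp
  have h₄ : ((comul : S.X ⟶ _) ≫ (p.hom ⊗ₘ r.hom)) ≫
      ((counit : A.X ⟶ 𝟙_ C) ⊗ₘ (counit : B.X ⟶ 𝟙_ C)) ≫ (λ_ (𝟙_ C)).hom = counit := by
    have e : (counit : A.X ⟶ 𝟙_ C) ⊗ₘ (counit : B.X ⟶ 𝟙_ C) =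
        counit ▷ B.X ≫ 𝟙_ C ◁ counit := MonoidalCategory.tensorHom_def _ _
    rw [e, Category.assoc, Category.assoc, leftUnitor_naturality, reassoc_of% h₃, hr']
  refine ⟨Comon.Hom.mk' (M := S) (N := A ⊗ B) (comul ≫ (p.hom ⊗ₘ r.hom)) ?_ ?_,
    Comon.ext ?_, Comon.ext ?_⟩
  · exact h₄
  · refine Eq.trans ?_ h₁
    rw [comon_comul_eq]
    rfl
  · rw [Comon.comp_hom', projLeft_comon_hom]
    exact (Category.assoc _ _ _).trans h₂
  · rw [Comon.comp_hom', projRight_comon_hom]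
    exact (Category.assoc _ _ _).trans h₃

end ComonProducts

/-! ### Universal property of the tensor coalgebra -/

section TensorCoalgebraLift

open GrVect ComonObj

variable {K : Type u} [Field K]

theorem tensor_map_sub_right {M N M' N' : Type*} [AddCommGroup M] [Module K M] [AddCommGroup N]
    [Module K N] [AddCommGroup M'] [Module K M'] [AddCommGroup N'] [Module K N'] (f : M →ₗ[K] M')
    (g h : N →ₗ[K] N') (z : M ⊗[K] N) : TensorProduct.map f (g - h) z =
      TensorProduct.map f g z - TensorProduct.map f h z := by
  induction z with
  | zero => simp
  | add a b ha hb =>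
    simp only [map_add, ha, hb]
    abel
  | tmul a b => simp [TensorProduct.tmul_sub]

/-- Since `f` is concentrated in weight one, `f ⊗ H` only depends on `H` in one weight less. -/
theorem map_weightOne_eq_zero {V : GrVect K ℤ} {A B : GrVect K (ℕ × ℤ)} (f : A ⟶ weightOne V)
    {M : Type*} [AddCommGroup M] [Module K M] (H : B →ₗ[K] M) {γ : ℕ × ℤ}
    (h : ∀ δ : ℕ × ℤ, δ.1 + 1 = γ.1 → ∀ x ∈ B.gr δ, H x = 0) {z : A ⊗[K] B}
    (hz : z ∈ (tensorObj' A B).gr γ) : TensorProduct.map f.lin H z = 0 := by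
  have : tensorGr A B γ ≤ LinearMap.ker (TensorProduct.map f.lin H) :=
    tensorGr_le A B fun i j hij x hx y hy => by
      rw [LinearMap.mem_ker, TensorProduct.map_tmul]
      rcases mem_weightOne (f.map_mem i x hx) with h0 | ⟨h1, -⟩
      · rw [h0]
        exact TensorProduct.zero_tmul _ _
      · rw [h j (by rw [← hij, Prod.fst_add, h1, add_comm]) y hy, TensorProduct.tmul_zero]
  exact this hz

/-- Induction on the weight along a map `f` to a space of weight one: in `(f ⊗ H)(Δ s)`, the map `H`
is only applied to elements whose weight is one less than that of `s`. -/
theorem weight_induction {V : GrVect K ℤ} (S : Comon (GrVect K (ℕ × ℤ))) (f : S.X ⟶ weightOne V)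
    {M : Type*} [AddCommGroup M] [Module K M] (H : S.X →ₗ[K] M)
    (h : ∀ s, TensorProduct.map f.lin H ((comul : S.X ⟶ _).lin s) = 0 → H s = 0) : H = 0 := by
  have key : ∀ n : ℕ, ∀ γ : ℕ × ℤ, γ.1 = n → ∀ x ∈ S.X.gr γ, H x = 0 := by
    intro n
    induction n using Nat.strong_induction_on with
    | _ n ih =>
      intro γ hγ x hx
      exact h x (map_weightOne_eq_zero f H (fun δ hδ y hy => ih δ.1 (by omega) δ rfl y hy)
        ((comul : S.X ⟶ _).map_mem γ x hx))
  exact S.X.lin_ext fun γ x hx => key γ.1 γ rfl x hx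

section Ungraded

variable (X : Type u) [AddCommGroup X] [Module K X]

/-- The multiplication `v ⊗ w ↦ vw` of a generator and a word. -/
def genMul : X ⊗[K] TensorAlgebra K X →ₗ[K] TensorAlgebra K X := TensorProduct.lift (mulGen X)

theorem genMul_tmul (v : X) (w : TensorAlgebra K X) :
    genMul X (v ⊗ₜ w) = TensorAlgebra.ι K v * w := rfl

/-- A word is recovered from its first letter and the rest. -/
theorem genMul_deconc (w : TensorAlgebra K X) :
    TensorAlgebra.algebraMapInv w • 1 +
      genMul X (TensorProduct.map TensorAlgebra.ιInv LinearMap.id (deconc X w)) = w := by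
  have : (LinearMap.toSpanSingleton K (TensorAlgebra K X) 1 ∘ₗ
      (TensorAlgebra.algebraMapInv (R := K) (M := X)).toLinearMap) +
      genMul X ∘ₗ TensorProduct.map TensorAlgebra.ιInv LinearMap.id ∘ₗ deconc X =
        LinearMap.id := by
    refine tensorAlg_ext X ?_ fun v w _ => ?_
    · simp [deconc_one, ιInv_one]
    · have e : ∀ t : TensorAlgebra K X ⊗[K] TensorAlgebra K X,
          TensorProduct.map TensorAlgebra.ιInv LinearMap.id
            (TensorProduct.map (mulGen X v) LinearMap.id t) =
          v ⊗ₜ TensorProduct.lid K _ (TensorProduct.map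
            (TensorAlgebra.algebraMapInv (R := K) (M := X)).toLinearMap LinearMap.id t) :=
          fun t => by
        induction t with
        | zero => simp
        | add a b ha hb => simp only [map_add, ha, hb, TensorProduct.tmul_add]
        | tmul a b => simp [mulGen_apply, ιInv_mul, TensorProduct.smul_tmul]
      have h := LinearMap.congr_fun (counit_deconc X) w
      rw [LinearMap.comp_apply] at h
      rw [LinearMap.add_apply, LinearMap.comp_apply, LinearMap.comp_apply, LinearMap.comp_apply,
        deconc_mul, map_add, e, h]
      simp [genMul_tmul, ιInv_one, TensorAlgebra.algebraMapInv]
  exact LinearMap.congr_fun this w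

theorem algebraMapInv_genMul (z : X ⊗[K] TensorAlgebra K X) :
    TensorAlgebra.algebraMapInv (genMul X z) = (0 : K) := by
  induction z with
  | zero => simp
  | add a b ha hb => rw [map_add, map_add, ha, hb, add_zero]
  | tmul v w => simp [genMul_tmul, TensorAlgebra.algebraMapInv]

theorem ιInv_genMul (z : X ⊗[K] TensorAlgebra K X) :
    TensorAlgebra.ιInv (genMul X z) = TensorProduct.rid K X
      (TensorProduct.map LinearMap.id
        (TensorAlgebra.algebraMapInv (R := K) (M := X)).toLinearMap z) := by
  induction z with
  | zero => simp
  | add a b ha hb => simp only [map_add, ha, hb]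
  | tmul v w => simp [genMul_tmul, ιInv_mul]

theorem deconc_genMul (z : X ⊗[K] TensorAlgebra K X) :
    deconc X (genMul X z) = 1 ⊗ₜ genMul X z + TensorProduct.map (genMul X) LinearMap.id
      ((TensorProduct.assoc K _ _ _).symm (TensorProduct.map LinearMap.id (deconc X) z)) := by
  induction z with
  | zero => simp
  | add a b ha hb =>
    simp only [map_add, ha, hb, TensorProduct.tmul_add]
    abel
  | tmul v w =>
    have e : ∀ t : TensorAlgebra K X ⊗[K] TensorAlgebra K X,
        TensorProduct.map (mulGen X v) LinearMap.id t = TensorProduct.map (genMul X) LinearMap.id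
          ((TensorProduct.assoc K _ _ _).symm (v ⊗ₜ t)) := fun t => by
      induction t with
      | zero => simp
      | add a b ha hb => simp only [map_add, ha, hb, TensorProduct.tmul_add]
      | tmul a b => rfl
    rw [genMul_tmul, deconc_mul, e]
    rfl

/-- The maps `deconc ∘ a` and `(a ⊗ a) ∘ d` satisfy the same recursion along `f`. -/
theorem deconc_sub_map {S : Type u} [AddCommGroup S] [Module K S] (d : S →ₗ[K] S ⊗[K] S)
    (c : S →ₗ[K] K)
    (hd : ∀ s, TensorProduct.assoc K S S S (TensorProduct.map d LinearMap.id (d s)) =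
      TensorProduct.map LinearMap.id d (d s))
    (hc' : ∀ s, TensorProduct.map c LinearMap.id (d s) = (1 : K) ⊗ₜ[K] s) (f : S →ₗ[K] X)
    (a : S →ₗ[K] TensorAlgebra K X)
    (ha : ∀ s, a s = c s • 1 + genMul X (TensorProduct.map f a (d s))) (s : S) :
    deconc X (a s) - TensorProduct.map a a (d s) = TensorProduct.map (genMul X) LinearMap.id
      ((TensorProduct.assoc K _ _ _).symm
        (TensorProduct.map f (deconc X ∘ₗ a - TensorProduct.map a a ∘ₗ d) (d s))) := by
  have e₁ : deconc X (a s) = 1 ⊗ₜ a s + TensorProduct.map (genMul X) LinearMap.id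
      ((TensorProduct.assoc K _ _ _).symm (TensorProduct.map f (deconc X ∘ₗ a) (d s))) := by
    rw [← LinearMap.id_comp f, TensorProduct.map_comp, LinearMap.comp_apply]
    conv_lhs => rw [ha s, map_add, map_smul, deconc_one, deconc_genMul, ← add_assoc,
      ← TensorProduct.tmul_smul, ← TensorProduct.tmul_add, ← ha s]
  have e₂ : TensorProduct.map a a (d s) = 1 ⊗ₜ a s + TensorProduct.map (genMul X) LinearMap.id
      ((TensorProduct.assoc K _ _ _).symm
        (TensorProduct.map f (TensorProduct.map a a ∘ₗ d) (d s))) := by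
    have h₁ : ∀ t : S ⊗[K] S, TensorProduct.map a a t =
        TensorProduct.map (LinearMap.toSpanSingleton K (TensorAlgebra K X) 1) a
          (TensorProduct.map c LinearMap.id t) +
        TensorProduct.map (genMul X) LinearMap.id (TensorProduct.map (TensorProduct.map f a) a
          (TensorProduct.map d LinearMap.id t)) := fun t => by
      induction t with
      | zero => simp
      | add x y hx hy =>
        rw [map_add, hx, hy]
        simp only [map_add]
        abel
      | tmul x y =>
        rw [TensorProduct.map_tmul, ha x, TensorProduct.add_tmul]
        rfl
    have h₂ : ∀ u : (S ⊗[K] S) ⊗[K] S, TensorProduct.map (TensorProduct.map f a) a u =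
        (TensorProduct.assoc K _ _ _).symm (TensorProduct.map f (TensorProduct.map a a)
          (TensorProduct.assoc K _ _ _ u)) := fun u => by
      refine LinearMap.congr_fun (f := TensorProduct.map (TensorProduct.map f a) a)
        (g := (TensorProduct.assoc K _ _ _).symm.toLinearMap ∘ₗ
          TensorProduct.map f (TensorProduct.map a a) ∘ₗ
            (TensorProduct.assoc K _ _ _).toLinearMap) ?_ u
      exact TensorProduct.ext_threefold fun _ _ _ => rfl
    rw [h₁, hc', h₂, hd, TensorProduct.map_tmul, LinearMap.toSpanSingleton_apply_one,
      ← LinearMap.comp_apply (TensorProduct.map f _), ← TensorProduct.map_comp, LinearMap.comp_id]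
  rw [e₁, e₂, add_sub_add_left_eq_sub, tensor_map_sub_right, map_sub, map_sub]

/-- The recursion `a = ε + f * a` determines the component of `a` of word length one. -/
theorem ιInv_of_recursion {S : Type u} [AddCommGroup S] [Module K S] (d : S →ₗ[K] S ⊗[K] S)
    (c : S →ₗ[K] K) (hc' : ∀ s, TensorProduct.map LinearMap.id c (d s) = s ⊗ₜ[K] (1 : K))
    (f : S →ₗ[K] X) (a : S →ₗ[K] TensorAlgebra K X)
    (ha : ∀ s, a s = c s • 1 + genMul X (TensorProduct.map f a (d s)))
    (hc : ∀ s, TensorAlgebra.algebraMapInv (a s) = c s) (s : S) :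
    TensorAlgebra.ιInv (a s) = f s := by
  have h₁ : (TensorAlgebra.algebraMapInv (R := K) (M := X)).toLinearMap ∘ₗ a = c :=
    LinearMap.ext hc
  have h₂ : TensorProduct.map LinearMap.id
      (TensorAlgebra.algebraMapInv (R := K) (M := X)).toLinearMap
      (TensorProduct.map f a (d s)) = f s ⊗ₜ[K] (1 : K) := by
    rw [← LinearMap.comp_apply, ← TensorProduct.map_comp, h₁, LinearMap.id_comp,
      ← LinearMap.comp_id f, ← LinearMap.id_comp c, TensorProduct.map_comp, LinearMap.comp_apply,
      hc']
    rfl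
  rw [ha, map_add, map_smul, ιInv_one, smul_zero, zero_add, ιInv_genMul, h₂]
  simp

end Ungraded

theorem genMul_mem {V : GrVect K ℤ} (n : ℕ × ℤ) (z : V ⊗[K] TensorAlgebra K V)
    (hz : z ∈ (tensorObj' (weightOne V) (tensorGrVect (weightOne V))).gr n) :
    genMul V z ∈ (tensorGrVect (weightOne V)).gr n :=
  tensorGr_le_comap (V := weightOne V) (W := tensorGrVect (weightOne V))
    (X := tensorGrVect (weightOne V)) (f := genMul V)
    (fun i j _ hx y hy => wordGr_mul _ _ i j _ (ι_mem_wordGr _ _ hx) y hy) n z hz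

variable {V : GrVect K ℤ} {S : Comon (GrVect K (ℕ × ℤ))} (f : S.X ⟶ weightOne V)

/-- The linear maps `s ↦ ε(s) + ∑ f(s₁) f(s₂) ⋯ f(sₖ)` with `1 ≤ k ≤ n`, by recursion on `n`. -/
def liftAux : ℕ → (S.X →ₗ[K] TensorAlgebra K V)
  | 0 => LinearMap.toSpanSingleton K (TensorAlgebra K V) 1 ∘ₗ (counit : S.X ⟶ 𝟙_ _).lin
  | n + 1 => LinearMap.toSpanSingleton K (TensorAlgebra K V) 1 ∘ₗ (counit : S.X ⟶ 𝟙_ _).lin +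
      genMul V ∘ₗ TensorProduct.map f.lin (liftAux n) ∘ₗ (comul : S.X ⟶ _).lin

theorem counit_smul_mem {γ : ℕ × ℤ} {s : S.X} (hs : s ∈ S.X.gr γ) :
    ((counit : S.X ⟶ 𝟙_ _).lin s : K) • (1 : TensorAlgebra K V) ∈
      (tensorGrVect (weightOne V)).gr γ := by
  rcases mem_unit_gr ((counit : S.X ⟶ 𝟙_ _).map_mem γ s hs) with rfl | h
  · exact Submodule.smul_mem _ _ (Submodule.subset_span .one)
  · rw [h, zero_smul]
    exact zero_mem _

theorem liftAux_mem (n : ℕ) : ∀ γ, ∀ s ∈ S.X.gr γ,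
    liftAux f n s ∈ (tensorGrVect (weightOne V)).gr γ := by
  induction n with
  | zero => exact fun γ s hs => counit_smul_mem hs
  | succ n ih =>
    intro γ s hs
    refine add_mem (counit_smul_mem hs) (genMul_mem γ _ ?_)
    exact (tensorHom' f (⟨liftAux f n, ih⟩ : S.X ⟶ tensorGrVect (weightOne V))).map_mem γ _
      ((comul : S.X ⟶ _).map_mem γ s hs)

/-- In weight at most `n`, words of length greater than `n` do not contribute. -/
theorem liftAux_succ (n : ℕ) : ∀ γ : ℕ × ℤ, γ.1 ≤ n → ∀ s ∈ S.X.gr γ,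
    liftAux f (n + 1) s = liftAux f n s := by
  induction n with
  | zero =>
    intro γ hγ s hs
    have h := map_weightOne_eq_zero f (liftAux f 0) (fun δ hδ => by omega)
      ((comul : S.X ⟶ _).map_mem γ s hs)
    refine (congrArg (fun t => liftAux f 0 s + genMul V t) h).trans ?_
    rw [map_zero, add_zero]
  | succ n ih =>
    intro γ hγ s hs
    have h := map_weightOne_eq_zero f (liftAux f (n + 1) - liftAux f n)
      (fun δ hδ x hx => sub_eq_zero.2 (ih δ (by omega) x hx))
      ((comul : S.X ⟶ _).map_mem γ s hs)
    rw [tensor_map_sub_right, sub_eq_zero] at h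
    exact congrArg (fun t => liftAux f 0 s + genMul V t) h

theorem liftAux_eq {γ : ℕ × ℤ} {s : S.X} (hs : s ∈ S.X.gr γ) {n : ℕ} (hn : γ.1 ≤ n) :
    liftAux f n s = liftAux f γ.1 s := by
  induction n, hn using Nat.le_induction with
  | base => rfl
  | succ n hn ih => rw [liftAux_succ f n γ hn s hs, ih]

/-- The linear map `s ↦ ε(s) + ∑ f(s₁) f(s₂) ⋯ f(sₖ)`, with the sum over all `k ≥ 1`. On an element
of weight `n` the terms with `k > n` vanish, so the `n`-th truncation is used there. -/
def liftLin : S.X →ₗ[K] TensorAlgebra K V :=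
  Finsupp.lsum K (fun γ : ℕ × ℤ => liftAux f γ.1) ∘ₗ S.X.coact

theorem liftLin_apply {γ : ℕ × ℤ} {s : S.X} (hs : s ∈ S.X.gr γ) :
    liftLin f s = liftAux f γ.1 s := by
  simp [liftLin, S.X.coact_of_mem hs]

/-- The recursion satisfied by the lift, from which its compatibility with coproducts follows. -/
theorem liftLin_eq (s : S.X) : liftLin f s = ((counit : S.X ⟶ 𝟙_ _).lin s : K) • 1 +
    genMul V (TensorProduct.map f.lin (liftLin f) ((comul : S.X ⟶ _).lin s)) := by
  have : liftLin f = LinearMap.toSpanSingleton K (TensorAlgebra K V) 1 ∘ₗ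
      (counit : S.X ⟶ 𝟙_ _).lin +
        genMul V ∘ₗ TensorProduct.map f.lin (liftLin f) ∘ₗ (comul : S.X ⟶ _).lin := by
    refine S.X.lin_ext fun γ s hs => ?_
    have h := map_weightOne_eq_zero f (liftAux f γ.1 - liftLin f)
      (fun δ hδ x hx => sub_eq_zero.2 <| by
        rw [liftLin_apply f hx, liftAux_eq f hx (by omega)])
      ((comul : S.X ⟶ _).map_mem γ s hs)
    rw [tensor_map_sub_right, sub_eq_zero] at h
    rw [liftLin_apply f hs, ← liftAux_succ f γ.1 γ le_rfl s hs]
    exact congrArg (fun t => liftAux f 0 s + genMul V t) h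
  exact LinearMap.congr_fun this s

theorem counit_liftLin (s : S.X) :
    TensorAlgebra.algebraMapInv (liftLin f s) = (counit : S.X ⟶ 𝟙_ _).lin s := by
  rw [liftLin_eq, map_add, algebraMapInv_genMul, add_zero, map_smul, map_one]
  exact mul_one _

theorem ιInv_liftLin (s : S.X) : TensorAlgebra.ιInv (liftLin f s) = f.lin s :=
  ιInv_of_recursion V (comul : S.X ⟶ _).lin (counit : S.X ⟶ 𝟙_ _).lin
    (fun s => LinearMap.congr_fun (congrArg Hom.lin (comul_counit S.X)) s) f.lin (liftLin f)
    (liftLin_eq f) (counit_liftLin f) s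

theorem deconc_liftLin (s : S.X) : deconc V (liftLin f s) =
    TensorProduct.map (liftLin f) (liftLin f) ((comul : S.X ⟶ _).lin s) := by
  have h := weight_induction S f
    (deconc V ∘ₗ liftLin f - TensorProduct.map (liftLin f) (liftLin f) ∘ₗ (comul : S.X ⟶ _).lin)
    fun s hs => by
      have h₁ := deconc_sub_map V (comul : S.X ⟶ _).lin (counit : S.X ⟶ 𝟙_ _).lin
        (fun s => (LinearMap.congr_fun (congrArg Hom.lin (comul_assoc S.X)) s).symm)
        (fun s => LinearMap.congr_fun (congrArg Hom.lin (counit_comul S.X)) s) f.lin (liftLin f)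
        (liftLin_eq f) s
      refine h₁.trans ?_
      erw [hs]
      rw [map_zero, map_zero]
  exact sub_eq_zero.1 (LinearMap.congr_fun h s)

/-- A graded map from a coalgebra to `V` in weight one extends to a morphism to the tensor
coalgebra. -/
theorem exists_tensorCoalg_lift : ∃ a : S ⟶ tensorCoalg (weightOne V),
    a.hom ≫ tensorProj (weightOne V) = f := by
  refine ⟨Comon.Hom.mk' (M := S) (N := tensorCoalg (weightOne V)) ⟨liftLin f, fun γ s hs => ?_⟩
    (GrVect.hom_ext (LinearMap.ext (counit_liftLin f)))
    (GrVect.hom_ext (LinearMap.ext (deconc_liftLin f))),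
    GrVect.hom_ext (LinearMap.ext (ιInv_liftLin f))⟩
  have h := liftAux_mem f γ.1 γ s hs
  rw [← liftLin_apply f hs] at h
  exact h

end TensorCoalgebraLift

/-! ### Coalgebras cogenerated in weight one -/

section Cogenerated

open GrVect ComonObj

variable {K : Type u} [Field K]

/-- A coalgebra `C` with a map `π` to a space in weight one is cogenerated by `π` if an element `c`
is recovered linearly from `ε(c)` and `(π ⊗ id)(Δ c)`. The recovery maps are part of the notion so
that it remains useful after tensoring with another space. -/
def Cogenerated {V : GrVect K ℤ} (C : Comon (GrVect K (ℕ × ℤ))) (π : C.X ⟶ weightOne V) : Prop :=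
  ∃ (A : K →ₗ[K] C.X) (B : V ⊗[K] C.X →ₗ[K] C.X),
    A ∘ₗ (counit : C.X ⟶ 𝟙_ _).lin + B ∘ₗ TensorProduct.map π.lin LinearMap.id ∘ₗ
      (comul : C.X ⟶ _).lin = LinearMap.id

/-- Subcoalgebras of the tensor coalgebra are cogenerated in weight one. -/
theorem cogenerated_of_splitInj {V : GrVect K ℤ} {C : Comon (GrVect K (ℕ × ℤ))}
    (e : C ⟶ tensorCoalg (weightOne V)) (he : SplitInj e.hom) :
    Cogenerated C (e.hom ≫ tensorProj (weightOne V)) := by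
  obtain ⟨p, hp⟩ := he
  refine ⟨p ∘ₗ LinearMap.toSpanSingleton K (TensorAlgebra K V) 1,
    p ∘ₗ genMul V ∘ₗ TensorProduct.map LinearMap.id e.hom.lin, LinearMap.ext fun c => ?_⟩
  have h₁ : deconc V (e.hom.lin c) = TensorProduct.map e.hom.lin e.hom.lin
      ((comul : C.X ⟶ _).lin c) :=
    LinearMap.congr_fun (congrArg Hom.lin (IsComonHom.hom_comul e.hom)) c
  have h₂ : TensorAlgebra.algebraMapInv (e.hom.lin c) = (counit : C.X ⟶ 𝟙_ _).lin c :=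
    LinearMap.congr_fun (congrArg Hom.lin (IsComonHom.hom_counit e.hom)) c
  have h₃ : ∀ (a : C.X →ₗ[K] TensorAlgebra K V) (t : C.X ⊗[K] C.X),
      TensorProduct.map TensorAlgebra.ιInv LinearMap.id (TensorProduct.map a a t) =
        TensorProduct.map LinearMap.id a
          (TensorProduct.map (TensorAlgebra.ιInv ∘ₗ a) LinearMap.id t) := fun a t => by
    rw [← LinearMap.comp_apply, ← TensorProduct.map_comp, ← LinearMap.comp_apply,
      ← TensorProduct.map_comp, LinearMap.id_comp, LinearMap.comp_id, LinearMap.id_comp]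
  have h₄ := genMul_deconc V (e.hom.lin c)
  have h₅ : genMul V (TensorProduct.map LinearMap.id e.hom.lin (TensorProduct.map
      (e.hom ≫ tensorProj (weightOne V)).lin LinearMap.id ((comul : C.X ⟶ _).lin c))) =
      genMul V (TensorProduct.map TensorAlgebra.ιInv LinearMap.id (deconc V (e.hom.lin c))) :=
    congrArg (genMul V) ((h₃ e.hom.lin _).symm.trans
      (congrArg (TensorProduct.map TensorAlgebra.ιInv LinearMap.id) h₁.symm))
  rw [h₂, ← h₅] at h₄
  exact ((map_add p _ _).symm.trans (congrArg p h₄)).trans (LinearMap.congr_fun hp c)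

variable {V : GrVect K ℤ} {C : Comon (GrVect K (ℕ × ℤ))} {π : C.X ⟶ weightOne V}

theorem Cogenerated.eq_zero (h : Cogenerated C π) {W : GrVect K (ℕ × ℤ)} {z : C.X ⊗[K] W}
    (h₁ : TensorProduct.map (counit : C.X ⟶ 𝟙_ _).lin LinearMap.id z = 0)
    (h₂ : TensorProduct.map (TensorProduct.map π.lin LinearMap.id ∘ₗ (comul : C.X ⟶ _).lin)
      LinearMap.id z = 0) : z = 0 := by
  obtain ⟨A, B, hAB⟩ := h
  have h₃ : TensorProduct.map A LinearMap.id (TensorProduct.map (counit : C.X ⟶ 𝟙_ _).lin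
      LinearMap.id z) + TensorProduct.map B LinearMap.id (TensorProduct.map
        (TensorProduct.map π.lin LinearMap.id ∘ₗ (comul : C.X ⟶ _).lin) LinearMap.id z) = z := by
    have h₄ : ∀ z : C.X ⊗[K] W, TensorProduct.map A LinearMap.id (TensorProduct.map
        (counit : C.X ⟶ 𝟙_ _).lin LinearMap.id z) + TensorProduct.map B LinearMap.id
          (TensorProduct.map (TensorProduct.map π.lin LinearMap.id ∘ₗ (comul : C.X ⟶ _).lin)
            LinearMap.id z) = TensorProduct.map (A ∘ₗ (counit : C.X ⟶ 𝟙_ _).lin +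
              B ∘ₗ TensorProduct.map π.lin LinearMap.id ∘ₗ (comul : C.X ⟶ _).lin)
                LinearMap.id z := fun z => by
      rw [TensorProduct.map_add_left]
      induction z with
      | zero => simp only [map_zero, add_zero]
      | add a b ha hb =>
        simp only [map_add, ← ha, ← hb]
        abel
      | tmul a b => rfl
    rw [h₄, hAB, TensorProduct.map_id]
    rfl
  rw [← h₃, h₁, h₂, map_zero, map_zero, add_zero]

/-- Two maps to `C ⊗ W` agree if they have the same counit component and satisfy the same recursion
along `f`, by induction on the weight. -/
theorem Cogenerated.eq_of_comp (h : Cogenerated C π) {W : GrVect K (ℕ × ℤ)}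
    {S : Comon (GrVect K (ℕ × ℤ))} (f : S.X ⟶ weightOne V) {a b : S.X ⟶ C.X ⊗ W}
    (hc : a ≫ (counit : C.X ⟶ 𝟙_ _) ▷ W = b ≫ counit ▷ W)
    (ha : a ≫ (comul ≫ π ▷ C.X) ▷ W ≫ (α_ _ _ _).hom = comul ≫ (f ⊗ₘ a))
    (hb : b ≫ (comul ≫ π ▷ C.X) ▷ W ≫ (α_ _ _ _).hom = comul ≫ (f ⊗ₘ b)) : a = b := by
  refine GrVect.hom_ext (sub_eq_zero.1 (weight_induction S f (a.lin - b.lin) fun s hs => ?_))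
  rw [tensor_map_sub_right] at hs
  refine h.eq_zero (W := W) ?_ ?_
  · refine (map_sub (TensorProduct.map (counit : C.X ⟶ 𝟙_ _).lin LinearMap.id) (a.lin s)
      (b.lin s)).trans (sub_eq_zero.2 ?_)
    exact LinearMap.congr_fun (congrArg Hom.lin hc) s
  · refine (map_sub (TensorProduct.map (TensorProduct.map π.lin LinearMap.id ∘ₗ
      (comul : C.X ⟶ _).lin) LinearMap.id) (a.lin s) (b.lin s)).trans (sub_eq_zero.2 ?_)
    apply (TensorProduct.assoc K _ _ _).injective
    have h₁ := LinearMap.congr_fun (congrArg Hom.lin ha) s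
    have h₂ := LinearMap.congr_fun (congrArg Hom.lin hb) s
    exact (h₁.trans (sub_eq_zero.1 hs)).trans h₂.symm

/-- A morphism to a coalgebra cogenerated by `π` is determined by its composite with `π`. -/
theorem Cogenerated.hom_ext (h : Cogenerated C π) {S : Comon (GrVect K (ℕ × ℤ))} {a b : S ⟶ C}
    (hab : a.hom ≫ π = b.hom ≫ π) : a = b := by
  have key : ∀ a : S ⟶ C, (a.hom ≫ (ρ_ C.X).inv) ≫ (comul ≫ π ▷ C.X) ▷ (𝟙_ _) ≫ (α_ _ _ _).hom =
      comul ≫ ((a.hom ≫ π) ⊗ₘ (a.hom ≫ (ρ_ C.X).inv)) := fun a => by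
    have h₁ : a.hom ≫ comul = comul ≫ (a.hom ⊗ₘ a.hom) := IsComonHom.hom_comul a.hom
    rw [Category.assoc, ← rightUnitor_inv_naturality_assoc, Category.assoc, reassoc_of% h₁,
      ← tensorHom_comp_tensorHom]
    simp [MonoidalCategory.tensorHom_def]
  refine Comon.ext ?_
  have h₂ : a.hom ≫ (ρ_ C.X).inv = b.hom ≫ (ρ_ C.X).inv := by
    refine h.eq_of_comp (a.hom ≫ π) ?_ (key a) (hab ▸ key b)
    have h₃ : a.hom ≫ (counit : C.X ⟶ 𝟙_ _) = counit := IsComonHom.hom_counit a.hom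
    have h₄ : b.hom ≫ (counit : C.X ⟶ 𝟙_ _) = counit := IsComonHom.hom_counit b.hom
    rw [Category.assoc, Category.assoc, ← rightUnitor_inv_naturality, reassoc_of% h₃,
      reassoc_of% h₄]
  exact (cancel_mono _).1 h₂

/-- A morphism `p` to a coalgebra cogenerated by `π` cocommutes with `g` as soon as its component
`p ≫ π` does: both sides satisfy the same recursion along `p ≫ π`. -/
theorem Cogenerated.cocommute (h : Cogenerated C π) {W : GrVect K (ℕ × ℤ)}
    {S : Comon (GrVect K (ℕ × ℤ))} (p : S ⟶ C) (g : S.X ⟶ W)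
    (hg : comul ≫ ((p.hom ≫ π) ⊗ₘ g) = comul ≫ (g ⊗ₘ (p.hom ≫ π)) ≫ (β_ _ _).hom) :
    comul ≫ (p.hom ⊗ₘ g) = comul ≫ (g ⊗ₘ p.hom) ≫ (β_ _ _).hom := by
  have hp : p.hom ≫ comul = comul ≫ (p.hom ⊗ₘ p.hom) := IsComonHom.hom_comul p.hom
  have hp' : p.hom ≫ (counit : C.X ⟶ 𝟙_ _) = counit := IsComonHom.hom_counit p.hom
  have hL : p.hom ≫ comul ≫ π ▷ C.X = comul ≫ ((p.hom ≫ π) ⊗ₘ p.hom) := by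
    rw [reassoc_of% hp, ← tensorHom_id, tensorHom_comp_tensorHom, Category.comp_id]
  refine h.eq_of_comp (p.hom ≫ π) ?_ ?_ ?_
  · simp only [Category.assoc]
    rw [← BraidedCategory.braiding_naturality_right,
      ← tensorHom_id, ← id_tensorHom, tensorHom_comp_tensorHom, tensorHom_comp_tensorHom_assoc, hp',
      Category.comp_id, MonoidalCategory.tensorHom_def, MonoidalCategory.tensorHom_def',
      counit_comul_assoc, Category.assoc, comul_counit_assoc]
    simp
  · rw [Category.assoc, ← tensorHom_id, tensorHom_comp_tensorHom_assoc, hL, Category.comp_id,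
      comul_tensor_assoc]
  · rw [Category.assoc, Category.assoc, ← BraidedCategory.braiding_naturality_right_assoc,
      ← id_tensorHom, tensorHom_comp_tensorHom_assoc, hL, Category.comp_id,
      BraidedCategory.braiding_tensor_right_hom]
    simp only [Category.assoc, Iso.inv_hom_id, Category.comp_id]
    rw [reassoc_of% (comul_tensor_assoc_inv S.X), ← tensorHom_id, tensorHom_comp_tensorHom_assoc,
      Category.assoc, ← hg, Category.comp_id, reassoc_of% (comul_tensor_assoc S.X), ← id_tensorHom,
      tensorHom_comp_tensorHom, Category.comp_id, Category.assoc]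

end Cogenerated

/-! ### Coalgebras cogenerated by quadratic data -/

section Corealisations

open GrVect ComonObj

variable {K : Type u} [Field K]

/-- The coalgebra `C` with `π : C ⟶ V` is the coalgebra cogenerated by `V` with quadratic
corelations `R`, among the coalgebras with property `P`. The property is vacuous for `A^c` and
cocommutativity for `S^c`. -/
structure IsCorealisation (P : ObjectProperty (Comon (GrVect K (ℕ × ℤ)))) {m : Mixing} (X : QD K m)
    (C : Comon (GrVect K (ℕ × ℤ))) (π : C.X ⟶ weightOne X.V) : Prop where
  prop : P C
  cogenerated : Cogenerated C π
  rel : ∀ c, (comul ≫ (π ⊗ₘ π)).lin c ∈ X.R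
  lift : ∀ {S : Comon (GrVect K (ℕ × ℤ))}, P S → ∀ f : S.X ⟶ weightOne X.V,
    (∀ s, (comul ≫ (f ⊗ₘ f)).lin s ∈ X.R) → ∃ k : S ⟶ C, k.hom ≫ π = f

variable {m : Mixing}

instance : (⊤ : ObjectProperty (Comon (GrVect K (ℕ × ℤ)))).IsMonoidal where
  prop_unit := trivial
  prop_tensor _ _ _ _ := trivial

/-- The projection of a subcoalgebra of `T^c(V)` to the generators. -/
def kerCoalgProj {V : GrVect K ℤ} {Q : GrVect K (ℕ × ℤ)} (q : (tensorCoalg (weightOne V)).X ⟶ Q) :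
    (kerCoalgComon _ q).X ⟶ weightOne V :=
  (kerCoalgHom _ q).hom ≫ tensorProj (weightOne V)

/-- The condition defining `A^c`, in terms of the component of a morphism in the generators. -/
theorem quadProj_eq_zero_iff (X : QD K m) {S : Comon (GrVect K (ℕ × ℤ))}
    (a : S ⟶ tensorCoalg (weightOne X.V)) (s : S.X) :
    (quadProj X).lin (a.hom.lin s) = 0 ↔ (comul ≫ ((a.hom ≫ tensorProj (weightOne X.V)) ⊗ₘ
      (a.hom ≫ tensorProj (weightOne X.V)))).lin s ∈ X.R := by
  have h : a.hom ≫ comul = comul ≫ (a.hom ⊗ₘ a.hom) := IsComonHom.hom_comul a.hom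
  have h₁ : a.hom ≫ quadProj X = (comul ≫ ((a.hom ≫ tensorProj (weightOne X.V)) ⊗ₘ
      (a.hom ≫ tensorProj (weightOne X.V)))) ≫ quotMap _ _ _ := by
    rw [quadProj, reassoc_of% h, tensorHom_comp_tensorHom_assoc, Category.assoc]
  have h₂ := LinearMap.congr_fun (congrArg Hom.lin h₁) s
  exact (Eq.congr_left h₂).trans (Submodule.Quotient.mk_eq_zero X.R)

theorem realAc_isCorealisation (X : QD K m) :
    IsCorealisation ⊤ X (kerCoalgComon _ (quadProj X)) (kerCoalgProj (quadProj X)) where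
  prop := trivial
  cogenerated := cogenerated_of_splitInj (kerCoalgHom _ _) (kerCoalgIncl_split _ _)
  rel c := (quadProj_eq_zero_iff X (kerCoalgHom _ _) c).1 (kerCoalgIncl_ker _ _ c)
  lift {S} _ f hf := by
    obtain ⟨a, ha⟩ := exists_tensorCoalg_lift f
    obtain ⟨k, hk⟩ := exists_kerCoalgLift (q := quadProj X) a fun s =>
      (quadProj_eq_zero_iff X a s).2 (ha.symm ▸ hf s)
    refine ⟨k, Eq.trans ?_ ha⟩
    rw [← hk, kerCoalgProj, Comon.comp_hom', Category.assoc]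

theorem realSc_isCorealisation (X : QD K m) :
    IsCorealisation (isCocomm _) X (kerCoalgComon _ (cocommProj _ (quadProj X)))
      (kerCoalgProj (cocommProj _ (quadProj X))) where
  prop := cocommProj_isCocomm _ _
  cogenerated := cogenerated_of_splitInj (kerCoalgHom _ _) (kerCoalgIncl_split _ _)
  rel c := (quadProj_eq_zero_iff X (kerCoalgHom _ _) c).1
    (congrArg Prod.fst (kerCoalgIncl_ker _ (cocommProj _ (quadProj X)) c))
  lift {S} hS f hf := by
    obtain ⟨a, ha⟩ := exists_tensorCoalg_lift f
    have h₁ : a.hom ≫ comul = comul ≫ (a.hom ⊗ₘ a.hom) := IsComonHom.hom_comul a.hom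
    have h₂ : (comul : S.X ⟶ _) ≫ (β_ S.X S.X).hom = comul := hS.comul_comm
    have h₃ : a.hom ≫ comul ≫ (β_ _ _).hom = a.hom ≫ comul := by
      rw [reassoc_of% h₁, BraidedCategory.braiding_naturality, reassoc_of% h₂, h₁]
    obtain ⟨k, hk⟩ := exists_kerCoalgLift (q := cocommProj _ (quadProj X)) a fun s =>
      Prod.ext ((quadProj_eq_zero_iff X a s).2 (ha.symm ▸ hf s))
        (sub_eq_zero.2 (LinearMap.congr_fun (congrArg Hom.lin h₃) s).symm)
    refine ⟨k, Eq.trans ?_ ha⟩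
    rw [← hk, kerCoalgProj, Comon.comp_hom', Category.assoc]

theorem swapLin_weightOne (V W : GrVect K ℤ) :
    swapLin (weightOne V) (weightOne W) = swapLin V W :=
  tensor_ext V W fun i x hx j y hy => by
    have hk : koszul K ((1, i) : ℕ × ℤ) (1, j) = koszul K i j := rfl
    have h1 : x ∈ (weightOne V).gr (1, i) := mem_regrade _ V rfl hx
    have h2 : y ∈ (weightOne W).gr (1, j) := mem_regrade _ W rfl hy
    rw [swapLin_tmul V W hx hy, ← hk]
    exact swapLin_tmul (weightOne V) (weightOne W) h1 h2

/-- The relations of `X ⊗ Y` force the components in `V` and `W` to cocommute. -/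
theorem QD.prod_rel_swap (X Y : QD K .plus) {z : sumObj X.V Y.V ⊗[K] sumObj X.V Y.V}
    (hz : z ∈ (QD.prod X Y).R) :
    TensorProduct.map (sumFst X.V Y.V).lin (sumSnd X.V Y.V).lin z = swapLin Y.V X.V
      (TensorProduct.map (sumSnd X.V Y.V).lin (sumFst X.V Y.V).lin z) := by
  have h : (QD.prod X Y).R ≤ LinearMap.eqLocus
      (TensorProduct.map (sumFst X.V Y.V).lin (sumSnd X.V Y.V).lin)
      (swapLin Y.V X.V ∘ₗ TensorProduct.map (sumSnd X.V Y.V).lin (sumFst X.V Y.V).lin) := by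
    have h₀ : ∀ {U U₁ U₂ : GrVect K ℤ} (f : sumObj X.V Y.V ⟶ U₁) (g : sumObj X.V Y.V ⟶ U₂)
        (i : U ⟶ sumObj X.V Y.V) (t : U ⊗[K] U), TensorProduct.map f.lin g.lin (sq i t) =
          TensorProduct.map (f.lin ∘ₗ i.lin) (g.lin ∘ₗ i.lin) t := fun f g i t => by
      rw [TensorProduct.map_comp, LinearMap.comp_apply]
    have h₁ : (sumSnd X.V Y.V).lin ∘ₗ (inl X.V Y.V).lin = 0 := rfl
    have h₂ : (sumFst X.V Y.V).lin ∘ₗ (inr X.V Y.V).lin = 0 := rfl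
    refine sup_le (sup_le ?_ ?_) ?_
    · rintro _ ⟨r, -, rfl⟩
      rw [LinearMap.mem_eqLocus, LinearMap.comp_apply, h₀, h₀, h₁,
        TensorProduct.map_zero_left, TensorProduct.map_zero_right]
      simp
    · rintro _ ⟨t, rfl⟩
      have e₁ : TensorProduct.map (sumFst X.V Y.V).lin (sumSnd X.V Y.V).lin
          (TensorProduct.map (inl X.V Y.V).lin (inr X.V Y.V).lin t) = t := by
        rw [← LinearMap.comp_apply, ← TensorProduct.map_comp]
        exact LinearMap.congr_fun (TensorProduct.map_id) t
      have e₂ : ∀ t, TensorProduct.map (sumSnd X.V Y.V).lin (sumFst X.V Y.V).lin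
          (TensorProduct.map (inl X.V Y.V).lin (inr X.V Y.V).lin t) = 0 := fun t => by
        rw [← LinearMap.comp_apply, ← TensorProduct.map_comp, h₁, TensorProduct.map_zero_left]
        rfl
      have e₃ := LinearMap.congr_fun (swapLin_natural (sumFst X.V Y.V) (sumSnd X.V Y.V))
        (TensorProduct.map (inl X.V Y.V).lin (inr X.V Y.V).lin t)
      have e₄ := LinearMap.congr_fun (swapLin_natural (sumSnd X.V Y.V) (sumFst X.V Y.V))
        (TensorProduct.map (inl X.V Y.V).lin (inr X.V Y.V).lin t)
      rw [LinearMap.comp_apply, LinearMap.comp_apply] at e₃ e₄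
      rw [e₁] at e₃
      rw [e₂, map_zero] at e₄
      rw [LinearMap.mem_eqLocus, LinearMap.comp_apply, LinearMap.comp_apply, symLin,
        LinearMap.add_apply, LinearMap.id_apply, map_add, map_add, e₁, e₂, ← e₃, ← e₄, add_zero,
        zero_add]
      exact (LinearMap.congr_fun (swapLin_swapLin X.V Y.V) t).symm
    · rintro _ ⟨r, -, rfl⟩
      rw [LinearMap.mem_eqLocus, LinearMap.comp_apply, h₀, h₀, h₂,
        TensorProduct.map_zero_left, TensorProduct.map_zero_right]
      simp
  exact h hz

/-- If `a` and `b` satisfy the relations of `X` and `Y` and cocommute, then their sum satisfies the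
relations of `X ⊗ Y`. -/
theorem QD.map_add_mem (X Y : QD K .plus) {U : Type u} [AddCommGroup U] [Module K U]
    (a : U →ₗ[K] X.V) (b : U →ₗ[K] Y.V) (t : U ⊗[K] U) (ha : TensorProduct.map a a t ∈ X.R)
    (hb : TensorProduct.map b b t ∈ Y.R)
    (hab : TensorProduct.map b a t = swapLin X.V Y.V (TensorProduct.map a b t)) :
    TensorProduct.map ((inl X.V Y.V).lin ∘ₗ a + (inr X.V Y.V).lin ∘ₗ b)
      ((inl X.V Y.V).lin ∘ₗ a + (inr X.V Y.V).lin ∘ₗ b) t ∈ (QD.prod X Y).R := by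
  have e := LinearMap.congr_fun (swapLin_natural (inl X.V Y.V) (inr X.V Y.V))
    (TensorProduct.map a b t)
  rw [LinearMap.comp_apply, LinearMap.comp_apply] at e
  have h : TensorProduct.map ((inl X.V Y.V).lin ∘ₗ a + (inr X.V Y.V).lin ∘ₗ b)
      ((inl X.V Y.V).lin ∘ₗ a + (inr X.V Y.V).lin ∘ₗ b) t =
      sq (inl X.V Y.V) (TensorProduct.map a a t) +
      symLin .plus _ (TensorProduct.map (inl X.V Y.V).lin (inr X.V Y.V).lin
        (TensorProduct.map a b t)) + sq (inr X.V Y.V) (TensorProduct.map b b t) := by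
    rw [symLin, LinearMap.add_apply, LinearMap.id_apply, e, ← hab]
    simp only [TensorProduct.map_add_left, TensorProduct.map_add_right, TensorProduct.map_comp,
      LinearMap.add_apply, LinearMap.comp_apply]
    abel
  rw [h]
  exact add_mem (Submodule.mem_sup_left (add_mem (Submodule.mem_sup_left ⟨_, ha, rfl⟩)
    (Submodule.mem_sup_right ⟨_, rfl⟩))) (Submodule.mem_sup_right ⟨_, hb, rfl⟩)

section

variable {P : ObjectProperty (Comon (GrVect K (ℕ × ℤ)))} {X Y : QD K .plus}
  {A B C : Comon (GrVect K (ℕ × ℤ))} {πA : A.X ⟶ weightOne X.V} {πB : B.X ⟶ weightOne Y.V}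
  {πC : C.X ⟶ weightOne (QD.prod X Y).V}

/-- The projections of the coalgebra of a product cocommute, hence combine to a morphism to the
tensor product. -/
theorem IsCorealisation.exists_pair (hA : Cogenerated A πA) (hB : Cogenerated B πB)
    (hC : IsCorealisation P (QD.prod X Y) C πC) (p : C ⟶ A) (r : C ⟶ B)
    (hp : p.hom ≫ πA = πC ≫ weightOneMap (sumFst X.V Y.V))
    (hr : r.hom ≫ πB = πC ≫ weightOneMap (sumSnd X.V Y.V)) :
    ∃ k : C ⟶ A ⊗ B, k ≫ projLeft A B = p ∧ k ≫ projRight A B = r := by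
  refine exists_comon_pair p r (hA.cocommute p r.hom ?_)
  have h : comul ≫ ((p.hom ≫ πA) ⊗ₘ (r.hom ≫ πB)) =
      comul ≫ ((r.hom ≫ πB) ⊗ₘ (p.hom ≫ πA)) ≫ (β_ _ _).hom := by
    rw [hp, hr, ← tensorHom_comp_tensorHom, ← tensorHom_comp_tensorHom]
    refine GrVect.hom_ext (LinearMap.ext fun c => ?_)
    refine (QD.prod_rel_swap X Y (hC.rel c)).trans ?_
    rw [← swapLin_weightOne]
    rfl
  have h₁ := hB.cocommute r (p.hom ≫ πA) <| by
    rw [reassoc_of% h, SymmetricCategory.symmetry, Category.comp_id]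
  rw [reassoc_of% h₁, SymmetricCategory.symmetry, Category.comp_id]

/-- The sum of the projections to generators, on a tensor product of coalgebras. -/
def sumProj (πA : A.X ⟶ weightOne X.V) (πB : B.X ⟶ weightOne Y.V) :
    (A ⊗ B).X ⟶ weightOne (QD.prod X Y).V where
  lin := ((projLeft A B).hom ≫ πA ≫ weightOneMap (inl X.V Y.V)).lin +
    ((projRight A B).hom ≫ πB ≫ weightOneMap (inr X.V Y.V)).lin
  map_mem γ x hx := add_mem
    (((projLeft A B).hom ≫ πA ≫ weightOneMap (inl X.V Y.V)).map_mem γ x hx)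
    (((projRight A B).hom ≫ πB ≫ weightOneMap (inr X.V Y.V)).map_mem γ x hx)

theorem sumProj_fst (πA : A.X ⟶ weightOne X.V) (πB : B.X ⟶ weightOne Y.V) :
    sumProj πA πB ≫ weightOneMap (sumFst X.V Y.V) = (projLeft A B).hom ≫ πA :=
  GrVect.hom_ext (LinearMap.ext fun _ => add_zero _)

theorem sumProj_snd (πA : A.X ⟶ weightOne X.V) (πB : B.X ⟶ weightOne Y.V) :
    sumProj πA πB ≫ weightOneMap (sumSnd X.V Y.V) = (projRight A B).hom ≫ πB :=
  GrVect.hom_ext (LinearMap.ext fun _ => zero_add _)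

/-- In a tensor product of coalgebras the two factors cocommute, so the relations of `X ⊗ Y`
hold. -/
theorem sumProj_rel (hA : ∀ a, (comul ≫ (πA ⊗ₘ πA)).lin a ∈ X.R)
    (hB : ∀ b, (comul ≫ (πB ⊗ₘ πB)).lin b ∈ Y.R) (s : (A ⊗ B).X) :
    (comul ≫ (sumProj πA πB ⊗ₘ sumProj πA πB)).lin s ∈ (QD.prod X Y).R := by
  have e : (comul : (A ⊗ B).X ⟶ _) ≫ (((projRight A B).hom ≫ πB) ⊗ₘ ((projLeft A B).hom ≫ πA)) =
      (comul ≫ (((projLeft A B).hom ≫ πA) ⊗ₘ ((projRight A B).hom ≫ πB))) ≫ (β_ _ _).hom := by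
    rw [← tensorHom_comp_tensorHom, ← tensorHom_comp_tensorHom,
      reassoc_of% (comul_projRight_projLeft A B), reassoc_of% (comul_projLeft_projRight A B)]
    exact (BraidedCategory.braiding_naturality πA πB).symm
  have eA : (comul : (A ⊗ B).X ⟶ _) ≫ (((projLeft A B).hom ≫ πA) ⊗ₘ ((projLeft A B).hom ≫ πA)) =
      (projLeft A B).hom ≫ comul ≫ (πA ⊗ₘ πA) := by
    have h : (projLeft A B).hom ≫ comul = comul ≫ ((projLeft A B).hom ⊗ₘ (projLeft A B).hom) :=
      IsComonHom.hom_comul _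
    rw [reassoc_of% h, tensorHom_comp_tensorHom]
  have eB : (comul : (A ⊗ B).X ⟶ _) ≫ (((projRight A B).hom ≫ πB) ⊗ₘ ((projRight A B).hom ≫ πB)) =
      (projRight A B).hom ≫ comul ≫ (πB ⊗ₘ πB) := by
    have h : (projRight A B).hom ≫ comul = comul ≫ ((projRight A B).hom ⊗ₘ (projRight A B).hom) :=
      IsComonHom.hom_comul _
    rw [reassoc_of% h, tensorHom_comp_tensorHom]
  have hz := LinearMap.congr_fun (congrArg Hom.lin e) s
  have hzA := LinearMap.congr_fun (congrArg Hom.lin eA) s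
  have hzB := LinearMap.congr_fun (congrArg Hom.lin eB) s
  refine QD.map_add_mem X Y ((projLeft A B).hom ≫ πA).lin ((projRight A B).hom ≫ πB).lin
    ((comul : (A ⊗ B).X ⟶ _).lin s) ?_ ?_ ?_
  · exact (congrArg (· ∈ X.R) hzA).mpr (hA _)
  · exact (congrArg (· ∈ Y.R) hzB).mpr (hB _)
  · rw [← swapLin_weightOne]
    exact hz

/-- The coalgebra of a product is the tensor product of coalgebras. The morphism to the tensor
product exists by cocommutation and the one in the other direction by the universal property. -/
theorem IsCorealisation.exists_iso [P.IsMonoidal] (hA : IsCorealisation P X A πA)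
    (hB : IsCorealisation P Y B πB)
    (hC : IsCorealisation P (QD.prod X Y) C πC) (p : C ⟶ A) (r : C ⟶ B)
    (hp : p.hom ≫ πA = πC ≫ weightOneMap (sumFst X.V Y.V))
    (hr : r.hom ≫ πB = πC ≫ weightOneMap (sumSnd X.V Y.V)) :
    ∃ e : A ⊗ B ≅ C, e.hom ≫ p = projLeft A B ∧ e.hom ≫ r = projRight A B := by
  obtain ⟨ν, hν₁, hν₂⟩ := IsCorealisation.exists_pair hA.cogenerated hB.cogenerated hC p r hp hr
  obtain ⟨μ, hμ⟩ := hC.lift (ObjectProperty.prop_tensor hA.prop hB.prop) (sumProj πA πB)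
    (sumProj_rel hA.rel hB.rel)
  have h₁ : μ ≫ p = projLeft A B := hA.cogenerated.hom_ext <| by
    rw [Comon.comp_hom', Category.assoc, hp, reassoc_of% hμ, sumProj_fst]
  have h₂ : μ ≫ r = projRight A B := hB.cogenerated.hom_ext <| by
    rw [Comon.comp_hom', Category.assoc, hr, reassoc_of% hμ, sumProj_snd]
  refine ⟨⟨μ, ν, comon_tensor_hom_ext ?_ ?_, hC.cogenerated.hom_ext ?_⟩, h₁, h₂⟩
  · rw [Category.assoc, hν₁, h₁, Category.id_comp]
  · rw [Category.assoc, hν₂, h₂, Category.id_comp]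
  · rw [Comon.comp_hom', Category.assoc, hμ]
    have h₃ : ν.hom ≫ (projLeft A B).hom ≫ πA = πC ≫ weightOneMap (sumFst X.V Y.V) := by
      rw [← hp, ← hν₁, Comon.comp_hom', Category.assoc]
    have h₄ : ν.hom ≫ (projRight A B).hom ≫ πB = πC ≫ weightOneMap (sumSnd X.V Y.V) := by
      rw [← hr, ← hν₂, Comon.comp_hom', Category.assoc]
    refine GrVect.hom_ext (LinearMap.ext fun c => Prod.ext ?_ ?_)
    · exact (add_zero _).trans (LinearMap.congr_fun (congrArg Hom.lin h₃) c)
    · exact (zero_add _).trans (LinearMap.congr_fun (congrArg Hom.lin h₄) c)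

end

/-- A functor to coalgebras is strong symmetric monoidal if the projections identify `F (X ⊗ Y)`
with `F X ⊗ F Y`. -/
theorem braided_of_projections {D : Type*} [Category* D] [MonoidalCategory D]
    [SymmetricCategory D] [TerminalUnit D] (F : D ⥤ Comon (GrVect K (ℕ × ℤ)))
    (hε : IsIso (toUnit (F.obj (𝟙_ D))))
    (hμ : ∀ X Y, ∃ e : F.obj X ⊗ F.obj Y ≅ F.obj (X ⊗ Y),
      e.hom ≫ F.map (projLeft X Y) = projLeft (F.obj X) (F.obj Y) ∧
      e.hom ≫ F.map (projRight X Y) = projRight (F.obj X) (F.obj Y)) : Nonempty F.Braided := by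
  choose e hl hr using hμ
  refine braided_of_op F (braided_of_inclusions F.op (asIso (toUnit (F.obj (𝟙_ D)))).op
    (fun X Y => (e X.unop Y.unop).symm.op) (fun X Y => ?_) (fun X Y => ?_))
  · rw [inclLeft_op, inclLeft_op]
    exact Quiver.Hom.unop_inj ((Iso.inv_comp_eq _).2 (hl X.unop Y.unop).symm)
  · rw [inclRight_op, inclRight_op]
    exact Quiver.Hom.unop_inj ((Iso.inv_comp_eq _).2 (hr X.unop Y.unop).symm)

/-- The coalgebra cogenerated by the zero space is trivial. -/
theorem IsCorealisation.isIso_toUnit {P : ObjectProperty (Comon (GrVect K (ℕ × ℤ)))} [P.IsMonoidal]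
    {X : QD K m} [Subsingleton X.V] {C : Comon (GrVect K (ℕ × ℤ))} {π : C.X ⟶ weightOne X.V}
    (h : IsCorealisation P X C π) : IsIso (toUnit C) := by
  have hs : Subsingleton (weightOne X.V) := inferInstanceAs (Subsingleton X.V)
  have hz : ∀ {U : GrVect K (ℕ × ℤ)} (f g : U ⟶ weightOne X.V), f = g := fun f g =>
    GrVect.hom_ext (LinearMap.ext fun x => Subsingleton.elim (α := X.V) _ _)
  let f : (𝟙_ (Comon (GrVect K (ℕ × ℤ)))).X ⟶ weightOne X.V := ⟨0, fun _ _ _ => zero_mem _⟩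
  obtain ⟨k, -⟩ := h.lift (S := 𝟙_ _) P.prop_unit f fun s => by
    have h₁ : (f ⊗ₘ f).lin = 0 := TensorProduct.map_zero_left _
    rw [comp_lin, h₁]
    exact zero_mem _
  exact ⟨k, h.cogenerated.hom_ext (hz _ _), hom_unit_ext _ _⟩

variable (K)

theorem realAc_braided : StrongSymMonoidal (realAc K) := by
  refine braided_of_comp_fullyFaithful _ (wgAssCo K).ι (braided_of_projections _ ?_ fun X Y => ?_)
  · have : Subsingleton (𝟙_ (QDUTensor K)).V := inferInstanceAs (Subsingleton PUnit)
    exact (realAc_isCorealisation (𝟙_ (QDUTensor K))).isIso_toUnit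
  · have hn : ∀ {X Y : QDUTensor K} (f : X ⟶ Y), ((realAc K).map f).hom.hom ≫
        kerCoalgProj (quadProj Y) = kerCoalgProj (quadProj X) ≫ weightOneMap f.hom := fun f => by
      have h₁ := congrArg Comon.Hom.hom (kerCoalgMap_incl (coalgMap f) (quadProj_natural f))
      have h₂ := tensorProj_natural (weightOneMap f.hom)
      rw [Comon.comp_hom', Comon.comp_hom'] at h₁
      rw [kerCoalgProj, kerCoalgProj, Category.assoc, ← h₂, ← reassoc_of% h₁]
      rfl
    exact (realAc_isCorealisation X).exists_iso (realAc_isCorealisation Y)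
      (realAc_isCorealisation (X ⊗ Y)) _ _ (hn (projLeft X Y)) (hn (projRight X Y))

theorem realSc_braided : StrongSymMonoidal (realSc K) := by
  refine braided_of_comp_fullyFaithful _ (wgComCo K).ι (braided_of_projections _ ?_ fun X Y => ?_)
  · have : Subsingleton (𝟙_ (QDPlusUTensor K)).obj.V := inferInstanceAs (Subsingleton PUnit)
    exact (realSc_isCorealisation (𝟙_ (QDPlusUTensor K)).obj).isIso_toUnit
  · have hn : ∀ {X Y : QDPlusUTensor K} (f : X ⟶ Y), ((realSc K).map f).hom.hom ≫
        kerCoalgProj (cocommProj _ (quadProj Y.obj)) =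
          kerCoalgProj (cocommProj _ (quadProj X.obj)) ≫ weightOneMap f.hom.hom := fun f => by
      have h₁ := congrArg Comon.Hom.hom (kerCoalgMap_incl (coalgMap f.hom)
        (cocommProj_natural _ (quadProj_natural f.hom)))
      have h₂ := tensorProj_natural (weightOneMap f.hom.hom)
      rw [Comon.comp_hom', Comon.comp_hom'] at h₁
      rw [kerCoalgProj, kerCoalgProj, Category.assoc, ← h₂, ← reassoc_of% h₁]
      rfl
    refine (realSc_isCorealisation X.obj).exists_iso (realSc_isCorealisation Y.obj)
      (realSc_isCorealisation (X ⊗ Y).obj) _ _ ((hn (projLeft X Y)).trans ?_)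
        ((hn (projRight X Y)).trans ?_)
    · rw [projLeft_hom]
      rfl
    · rw [projRight_hom]
      rfl

end Corealisations

end QuadraticData

end

theorem mainTheorem3 (K : Type u) [Field K] (hK : ringChar K ≠ 2) :
    -- the functors between categories of quadratic data
    QuadraticData.StrongSymMonoidal (QuadraticData.koszulDual K) ∧
    QuadraticData.StrongSymMonoidal (QuadraticData.linearDual K) ∧
    QuadraticData.StrongSymMonoidal (QuadraticData.secondKoszulDual K) ∧
    QuadraticData.StrongSymMonoidal (QuadraticData.koszulDualMinus K) ∧
    QuadraticData.StrongSymMonoidal (QuadraticData.linearDualPlus K) ∧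
    QuadraticData.StrongSymMonoidal (QuadraticData.secondKoszulDualMinus K) ∧
    QuadraticData.StrongSymMonoidal (QuadraticData.lambda K) ∧
    QuadraticData.StrongSymMonoidal (QuadraticData.sigma K) ∧
    QuadraticData.StrongSymMonoidal (QuadraticData.calS K) ∧
    -- the realisation functors
    QuadraticData.StrongSymMonoidal (QuadraticData.realA K) ∧
    QuadraticData.StrongSymMonoidal (QuadraticData.realAc K) ∧
    QuadraticData.StrongSymMonoidal (QuadraticData.realL K) ∧
    QuadraticData.StrongSymMonoidal (QuadraticData.realS K) ∧
    QuadraticData.StrongSymMonoidal (QuadraticData.realSc K) ∧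
    -- the weight-wise linear duals
    QuadraticData.StrongSymMonoidal (QuadraticData.dualWgAss K) ∧
    QuadraticData.StrongSymMonoidal (QuadraticData.dualWgCom K) ∧
    -- the inclusions of (co)commutative into (co)associative (co)algebras
    QuadraticData.StrongSymMonoidal (QuadraticData.wgComToWgAss K) ∧
    QuadraticData.StrongSymMonoidal (QuadraticData.wgComCoToWgAssCo K) ∧
    QuadraticData.StrongSymMonoidal (QuadraticData.comToAss K) ∧
    QuadraticData.StrongSymMonoidal (QuadraticData.comCoToAssCo K) ∧
    -- the functors which forget the weight
    QuadraticData.StrongSymMonoidal (QuadraticData.wgAssToAss K) ∧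
    QuadraticData.StrongSymMonoidal (QuadraticData.wgAssCoToAssCo K) ∧
    QuadraticData.StrongSymMonoidal (QuadraticData.wgLieToLie K) ∧
    QuadraticData.StrongSymMonoidal (QuadraticData.wgComToCom K) ∧
    QuadraticData.StrongSymMonoidal (QuadraticData.wgComCoToComCo K) ∧
    -- the universal enveloping algebra
    QuadraticData.StrongSymMonoidal (QuadraticData.env K) := by
  exact ⟨QuadraticData.koszulDual_braided K, QuadraticData.linearDual_braided K,
    QuadraticData.secondKoszulDual_braided K, QuadraticData.koszulDualMinus_braided K,
    QuadraticData.linearDualPlus_braided K hK, QuadraticData.secondKoszulDualMinus_braided K hK,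
    QuadraticData.lambda_braided K, QuadraticData.sigma_braided K, QuadraticData.calS_braided K,
    QuadraticData.realA_braided K, QuadraticData.realAc_braided K,
    QuadraticData.realL_braided K hK, QuadraticData.realS_braided K,
    QuadraticData.realSc_braided K, QuadraticData.dualWgAss_braided K,
    QuadraticData.dualWgCom_braided K, QuadraticData.wgComToWgAss_braided K,
    QuadraticData.wgComCoToWgAssCo_braided K, QuadraticData.comToAss_braided K,
    QuadraticData.comCoToAssCo_braided K, QuadraticData.wgAssToAss_braided K,
    QuadraticData.wgAssCoToAssCo_braided K, QuadraticData.wgLieToLie_braided K,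
    QuadraticData.wgComToCom_braided K, QuadraticData.wgComCoToComCo_braided K,
    QuadraticData.env_braided K⟩
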